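/- Let $\Sigma=\Gamma\backslash\mathbb H^2$ be a connected closed oriented hyperbolic surface (so of genus $\ge 2$), with universal covering $\widetilde\Sigma=\mathbb H^2$ and $\Gamma=\pi_1(\Sigma)\subset \mathrm{PSL}_2(\mathbf R)$ its group of covering transformations, discrete, cocompact and acting freely. Let $\overline M=S\mathbb H^2$ be the unit tangent bundle of $\mathbb H^2$, and $M=\Gamma\backslash\overline M$ that of $\Sigma$, with its geodesic foliation $\mathcal G$ and its weakly stable foliation $\mathcal F$. Call a projective structure on $M$ (a maximal atlas with values in $\mathbb P^3(\mathbf R)$ and coordinate changes locally in $\mathrm{PGL}_4(\mathbf R)$) *foliated* if its charts map plaques (small pieces of leaves) of $\mathcal G$ into projective lines and plaques of $\mathcal F$ into projective planes. A representation $q:\Gamma\to\mathrm{PSL}_2(\mathbf C)$ is *quasi-Fuchsian* if it is faithful and discrete and its limit set in $\mathbb P^1(\mathbf C)$ is a Jordan curve; a *Fuchsian* representation is a faithful and discrete $\Gamma\to\mathrm{PSL}_2(\mathbf R)$. Identify $\mathbf C^2=\mathbf R^4$, so that $\mathrm{PSL}_2(\mathbf C)\subset\mathrm{PSL}_4(\mathbf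 R)$ and the Hopf fibration $\mathbb P^3(\mathbf R)\to\mathbb P^1(\mathbf C)$, which sends a real line to the complex line that it spans, is equivariant. Let $q:\Gamma\to \mathrm{PSL}_2(\mathbf C)$ be quasi-Fuchsian, let $u:\widetilde\Sigma\to\mathbb P^1(\mathbf C)$ be a $q$-equivariant local homeomorphism, and let $u^*\mathbb P^3(\mathbf R)\subset\widetilde\Sigma\times\mathbb P^3(\mathbf R)$ be the pullback of the Hopf fibration, on which $\Gamma$ acts by $\gamma(z,p)=(\gamma z,q(\gamma)p)$. 1. The pullback $u^*\mathbb P^3(\mathbf R)$ has a $\Gamma$-invariant projective structure for which the canonical map $u^*\mathbb P^3(\mathbf R)\to\mathbb P^3(\mathbf R)$ is projective. It descends to a projective structure on $N=\Gamma\backslash u^*\mathbb P^3(\mathbf R)$, and $N$ is homeomorphic to $M$. 2. If, for some homeomorphism $M\to N$, the induced projective structure on $M$ is foliated, then $q$ is conjugate in $\mathrm{PSL}_2(\mathbf C)$ to a Fuchsian representation. Conversely, if $q$ is conjugate to a Fuchsian representation and $u$ is injective (as is the standard map, an identification of $\widetilde\Sigma$ with a component of the complement of the limit set), then there is a $\Gamma$-equivariant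 homeomorphism $\overline M\to u^*\mathbb P^3(\mathbf R)$ such that the projective structure induced on $M$ through the quotient homeomorphism $M\to N$ is foliated. -/

import Mathlib

open Topology Filter
open scoped MatrixGroups UpperHalfPlane LinearAlgebra.Projectivization

noncomputable section

namespace QFProj

/-! ### Projective spaces -/

/-- The quotient topology on the projective space of a topological vector space. -/
instance projectivizationTopology (K V : Type*) [DivisionRing K] [AddCommGroup V] [Module K V]
    [TopologicalSpace V] : TopologicalSpace (ℙ K V) :=
  TopologicalSpace.coinduced (fun v : {v : V // v ≠ 0} => Projectivization.mk K v.1 v.2)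
    inferInstance

/-- `ℂ²`; also used as a model of `ℝ⁴`. -/
abbrev C2 : Type := Fin 2 → ℂ

/-- The complex projective line `ℙ¹(ℂ)`. -/
abbrev CP1 : Type := ℙ ℂ C2

/-- The real projective space `ℙ³(ℝ)`, as the space of real lines in `ℂ² = ℝ⁴`. -/
abbrev RP3 : Type := ℙ ℝ C2

theorem ofReal_smul_C2 (t : ℝ) (v : C2) : t • v = (t : ℂ) • v := by
  ext i; simp

/-- The Hopf fibration `ℙ³(ℝ) → ℙ¹(ℂ)`: it sends a real line of `ℂ²` to the complex line that
it spans. -/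
def hopf : RP3 → CP1 :=
  Projectivization.lift (fun v => Projectivization.mk ℂ v.1 v.2) (by
    intro a b t h
    rw [Projectivization.mk_eq_mk_iff']
    exact ⟨(t : ℂ), by rw [← ofReal_smul_C2, h]⟩)

theorem hopf_mk (v : C2) (hv : v ≠ 0) :
    hopf (Projectivization.mk ℝ v hv) = Projectivization.mk ℂ v hv := rfl

/-- A set of points of `ℙ(E)` lies in a projective line. -/
def InProjectiveLine {E : Type*} [AddCommGroup E] [Module ℝ E] (s : Set (ℙ ℝ E)) : Prop :=
  ∃ W : Submodule ℝ E, Module.finrank ℝ W = 2 ∧ ∀ p ∈ s, p.submodule ≤ W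

/-- A set of points of `ℙ(E)` lies in a projective plane. -/
def InProjectivePlane {E : Type*} [AddCommGroup E] [Module ℝ E] (s : Set (ℙ ℝ E)) : Prop :=
  ∃ W : Submodule ℝ E, Module.finrank ℝ W = 3 ∧ ∀ p ∈ s, p.submodule ≤ W

/-! ### Actions of `PSL₂` -/

/-- An action of `SL₂(R)` on which the centre acts trivially descends to `PSL₂(R)`. -/
@[reducible]
def pslAction {R X : Type*} [CommRing R] [MulAction SL(2, R) X]
    (h : ∀ A ∈ Subgroup.center SL(2, R), ∀ x : X, A • x = x) : MulAction PSL(2, R) X :=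
  MulAction.compHom X (QuotientGroup.lift (Subgroup.center SL(2, R))
    (MulAction.toPermHom SL(2, R) X) (fun A hA => Equiv.ext (h A hA)) :
      PSL(2, R) →* Equiv.Perm X)

theorem center_cases {R : Type*} [CommRing R] [IsDomain R] {A : SL(2, R)}
    (hA : A ∈ Subgroup.center SL(2, R)) : A = 1 ∨ A = -1 := by
  obtain ⟨r, hr, h⟩ := Matrix.SpecialLinearGroup.mem_center_iff.1 hA
  rw [Fintype.card_fin, sq_eq_one_iff] at hr
  rcases hr with rfl | rfl
  · left; ext i j; simp [← h]
  · right; ext i j; rw [← h]; fin_cases i <;> fin_cases j <;> simp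

/-- The action of `PSL₂(ℝ)` on the upper half-plane by homographies. -/
instance pslUpperHalfPlane : MulAction PSL(2, ℝ) ℍ :=
  pslAction (by
    intro A hA z
    rcases center_cases hA with rfl | rfl
    · simp
    · ext; simp [UpperHalfPlane.specialLinearGroup_apply])

/-- The action of `PSL₂(ℂ)` on `ℙ¹(ℂ)`. -/
instance pslCP1 : MulAction PSL(2, ℂ) CP1 :=
  pslAction (by
    intro A hA p
    induction p using Projectivization.ind with | h v hv =>
    rw [Projectivization.smul_mk, Projectivization.mk_eq_mk_iff']
    rcases center_cases hA with rfl | rfl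
    · exact ⟨1, by simp⟩
    · exact ⟨-1, by ext i; fin_cases i <;> simp [Matrix.SpecialLinearGroup.smul_def]⟩)

instance sl2CommReal : SMulCommClass SL(2, ℂ) ℝ C2 where
  smul_comm A t v := by rw [ofReal_smul_C2, ofReal_smul_C2, smul_comm]

/-- The action of `PSL₂(ℂ)` on `ℙ³(ℝ)`, that is, the embedding `PSL₂(ℂ) ⊂ PSL₄(ℝ)` given by the
identification `ℂ² = ℝ⁴`. -/
instance pslRP3 : MulAction PSL(2, ℂ) RP3 :=
  pslAction (by
    intro A hA p
    induction p using Projectivization.ind with | h v hv =>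
    rw [Projectivization.smul_mk, Projectivization.mk_eq_mk_iff']
    rcases center_cases hA with rfl | rfl
    · exact ⟨1, by simp⟩
    · exact ⟨-1, by ext i; fin_cases i <;> simp [Matrix.SpecialLinearGroup.smul_def]⟩)

theorem hopf_smul (g : PSL(2, ℂ)) (p : RP3) : hopf (g • p) = g • hopf p := by
  induction g using QuotientGroup.induction_on with | H A =>
  induction p using Projectivization.ind with | h v hv => rfl

/-- The inclusion `PSL₂(ℝ) ⊂ PSL₂(ℂ)`. -/
def pslComplexify : PSL(2, ℝ) →* PSL(2, ℂ) :=
  QuotientGroup.map _ _ (Matrix.SpecialLinearGroup.map (algebraMap ℝ ℂ)) (by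
    intro A hA
    rw [Subgroup.mem_comap]
    rcases center_cases hA with rfl | rfl
    · rw [map_one]; exact one_mem _
    · refine Matrix.SpecialLinearGroup.mem_center_iff.2 ⟨-1, by simp, ?_⟩
      ext i j; fin_cases i <;> fin_cases j <;> simp)

/-! ### The hyperbolic plane, its unit tangent bundle, and the two foliations -/

/-- The unit tangent bundle `Sℍ` of the hyperbolic plane: pairs of a point `z` of `ℍ` and a
tangent vector `v ∈ ℂ` at `z` with hyperbolic norm `|v| / Im z = 1`. -/
def UnitTangent : Type := {w : ℍ × ℂ // ‖w.2‖ = w.1.im}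

namespace UnitTangent

instance : TopologicalSpace UnitTangent :=
  inferInstanceAs (TopologicalSpace {w : ℍ × ℂ // ‖w.2‖ = w.1.im})

/-- The foot point. -/
def pt (w : UnitTangent) : ℍ := w.1.1

/-- The vector. -/
def vec (w : UnitTangent) : ℂ := w.1.2

@[ext] theorem ext {w w' : UnitTangent} (h : w.pt = w'.pt) (h' : w.vec = w'.vec) : w = w' :=
  Subtype.ext (Prod.ext h h')

/-- `SL₂(ℝ)` acts on `Sℍ` by the derivatives `v ↦ v / (c z + d)²` of homographies. -/
instance slAction : MulAction SL(2, ℝ) UnitTangent where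
  smul A w := ⟨(A • w.pt, w.vec / UpperHalfPlane.denom (A : GL (Fin 2) ℝ) w.pt ^ 2), by
    have h : ‖w.vec‖ = w.pt.im := w.2
    have h2 : (A • w.pt).im = w.pt.im /
        Complex.normSq (UpperHalfPlane.denom (A : GL (Fin 2) ℝ) w.pt) := by
      change ((A : GL (Fin 2) ℝ) • w.pt).im = _
      rw [UpperHalfPlane.im_smul_eq_div_normSq]; simp
    change ‖w.vec / _‖ = (A • w.pt).im
    rw [h2, norm_div, norm_pow, h, Complex.normSq_eq_norm_sq]⟩
  one_smul w := by
    apply UnitTangent.ext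
    · exact one_smul _ w.pt
    · change w.vec / UpperHalfPlane.denom ((1 : SL(2, ℝ)) : GL (Fin 2) ℝ) w.pt ^ 2 = _
      simp
  mul_smul A B w := by
    apply UnitTangent.ext
    · exact mul_smul A B w.pt
    · change w.vec / UpperHalfPlane.denom ((A * B : SL(2, ℝ)) : GL (Fin 2) ℝ) w.pt ^ 2
        = w.vec / UpperHalfPlane.denom (B : GL (Fin 2) ℝ) w.pt ^ 2
          / UpperHalfPlane.denom (A : GL (Fin 2) ℝ) ((B • w.pt : ℍ) : ℂ) ^ 2
      have h := UpperHalfPlane.denom_cocycle (A : GL (Fin 2) ℝ) (B : GL (Fin 2) ℝ)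
        (z := (w.pt : ℂ)) w.pt.im_ne_zero
      have h3 : ((B • w.pt : ℍ) : ℂ) = UpperHalfPlane.num (B : GL (Fin 2) ℝ) w.pt /
          UpperHalfPlane.denom (B : GL (Fin 2) ℝ) w.pt :=
        UpperHalfPlane.coe_smul_of_det_pos (by simp) w.pt
      rw [h3, map_mul, h, div_div, mul_pow, mul_comm]

instance pslActionUnitTangent : MulAction PSL(2, ℝ) UnitTangent :=
  pslAction (by
    intro A hA w
    rcases center_cases hA with rfl | rfl
    · simp
    · apply UnitTangent.ext
      · change (-1 : SL(2, ℝ)) • w.pt = w.pt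
        ext; simp [UpperHalfPlane.specialLinearGroup_apply]
      · change w.vec / UpperHalfPlane.denom ((-1 : SL(2, ℝ)) : GL (Fin 2) ℝ) w.pt ^ 2 = _
        simp [UpperHalfPlane.denom])

/-- The velocity at time `t` of the unit speed geodesic `t ↦ i eᵗ` of `ℍ`. The oriented unit speed
geodesics of `ℍ` are its images under `PSL₂(ℝ)`: their velocities are the `A • axis t`. -/
def axis (t : ℝ) : UnitTangent :=
  ⟨(⟨(Real.exp t : ℂ) * Complex.I, by simpa [-Complex.ofReal_exp] using Real.exp_pos t⟩,
    (Real.exp t : ℂ) * Complex.I), by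
      change ‖(Real.exp t : ℂ) * Complex.I‖ = ((Real.exp t : ℂ) * Complex.I).im
      rw [norm_mul, Complex.norm_I, Complex.norm_real]
      simp [-Complex.ofReal_exp, abs_of_pos (Real.exp_pos t)]⟩

/-- The leaf of the geodesic foliation through `w`: the velocities of the oriented geodesic
defined by `w`. -/
def geodesicLeaf (w : UnitTangent) : Set UnitTangent :=
  {w' | ∃ (A : SL(2, ℝ)) (s t : ℝ), w = A • axis s ∧ w' = A • axis t}

/-- The leaf of the weakly stable foliation through `w`: the vectors whose geodesic is positively
asymptotic to the one defined by `w`, up to a shift of time. -/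
def stableLeaf (w : UnitTangent) : Set UnitTangent :=
  {w' | ∃ (A B : SL(2, ℝ)) (s : ℝ), w = A • axis 0 ∧ w' = B • axis 0 ∧
    Tendsto (fun t : ℝ => dist (A • axis t).pt (B • axis (t + s)).pt) atTop (𝓝 0)}

end UnitTangent

/-- `Γ` is a uniformized closed surface group: `Γ ⊂ PSL₂(ℝ) = Isom⁺(ℍ)` is discrete, acts freely on
`ℍ`, and `Σ = Γ \ ℍ` is compact. Then `Σ` is a connected oriented closed hyperbolic surface, with
universal covering `ℍ` and group of covering transformations `Γ = π₁(Σ)`, and every such surface is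
of this form. -/
structure IsSurfaceGroup (Γ : Subgroup PSL(2, ℝ)) : Prop where
  discrete : DiscreteTopology Γ
  free : ∀ (γ : Γ) (z : ℍ), γ • z = z → γ = 1
  cocompact : CompactSpace (MulAction.orbitRel.Quotient Γ ℍ)

/-- The unit tangent bundle `M = Γ \ Sℍ` of the surface `Σ = Γ \ ℍ`. -/
abbrev SurfaceUnitTangent (Γ : Subgroup PSL(2, ℝ)) : Type :=
  MulAction.orbitRel.Quotient Γ UnitTangent

/-! ### Fuchsian and quasi-Fuchsian representations -/

/-- A Fuchsian representation: faithful and discrete, with values in `PSL₂(ℝ)`. -/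
structure IsFuchsian {G : Type*} [Group G] (ρ : G →* PSL(2, ℝ)) : Prop where
  faithful : Function.Injective ρ
  discrete : DiscreteTopology ρ.range

/-- A representation in `PSL₂(ℂ)` that is conjugate to a Fuchsian one. -/
def IsConjugateToFuchsian {G : Type*} [Group G] (q : G →* PSL(2, ℂ)) : Prop :=
  ∃ ρ : G →* PSL(2, ℝ), IsFuchsian ρ ∧
    ∃ g : PSL(2, ℂ), ∀ γ, q γ = g * pslComplexify (ρ γ) * g⁻¹

/-- The limit set in `ℙ¹(ℂ)` of a subgroup of `PSL₂(ℂ)`: the complement of its set of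
discontinuity. -/
def limitSet (G : Subgroup PSL(2, ℂ)) : Set CP1 :=
  {p | ¬ ∃ U ∈ 𝓝 p, {g : G | (((fun x : CP1 => g • x) '' U) ∩ U).Nonempty}.Finite}

/-- A representation of a closed surface group is quasi-Fuchsian when it is faithful and discrete
and its limit set is a Jordan curve. -/
structure IsQuasiFuchsian {G : Type*} [Group G] (q : G →* PSL(2, ℂ)) : Prop where
  faithful : Function.Injective q
  discrete : DiscreteTopology q.range
  jordan : ∃ c : Circle → CP1, Continuous c ∧ Function.Injective c ∧
    Set.range c = limitSet q.range

/-! ### Projective structures -/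

section Projective

variable {E : Type*} [AddCommGroup E] [Module ℝ E] [TopologicalSpace E]

/-- `f` is locally projective on `s`: near every point of `s` it is the restriction of an element
of `PGL(E)`. -/
def LocallyProjectiveOn (f : ℙ ℝ E → ℙ ℝ E) (s : Set (ℙ ℝ E)) : Prop :=
  ∀ p ∈ s, ∃ g : E ≃ₗ[ℝ] E, ∀ᶠ p' in 𝓝 p, f p' = g • p'

/-- Two charts with values in `ℙ(E)` have locally projective changes of coordinates. -/
def ChartsCompatible {X : Type*} [TopologicalSpace X]
    (φ ψ : OpenPartialHomeomorph X (ℙ ℝ E)) : Prop :=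
  LocallyProjectiveOn (ψ ∘ φ.symm) (φ '' (φ.source ∩ ψ.source)) ∧
    LocallyProjectiveOn (φ ∘ ψ.symm) (ψ '' (φ.source ∩ ψ.source))

variable (E) in
/-- A projective structure on `X` modelled on `ℙ(E)`: a maximal atlas of charts with values in
`ℙ(E)` with locally projective changes of coordinates. -/
structure ProjectiveStructure (X : Type*) [TopologicalSpace X] where
  atlas : Set (OpenPartialHomeomorph X (ℙ ℝ E))
  covers : ∀ x, ∃ φ ∈ atlas, x ∈ φ.source
  compatible : ∀ φ ∈ atlas, ∀ ψ ∈ atlas, ChartsCompatible φ ψ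
  maximal : ∀ φ, (∀ ψ ∈ atlas, ChartsCompatible φ ψ) → φ ∈ atlas

/-- `h` is a projective map between spaces with projective structures. -/
def IsProjectiveMap {X Y : Type*} [TopologicalSpace X] [TopologicalSpace Y]
    (P : ProjectiveStructure E X) (Q : ProjectiveStructure E Y) (h : X → Y) : Prop :=
  Continuous h ∧ ∀ φ ∈ P.atlas, ∀ ψ ∈ Q.atlas,
    LocallyProjectiveOn (ψ ∘ h ∘ φ.symm) (φ '' (φ.source ∩ h ⁻¹' ψ.source))

/-- `dev` is a projective map from `X` to the model space `ℙ(E)` with its standard projective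
structure. -/
def IsDevelopingMap {X : Type*} [TopologicalSpace X]
    (P : ProjectiveStructure E X) (dev : X → ℙ ℝ E) : Prop :=
  Continuous dev ∧ ∀ φ ∈ P.atlas, LocallyProjectiveOn (dev ∘ φ.symm) φ.target

/-- A projective structure on `M = Γ \ Sℍ` is foliated if its charts map the geodesic leaves into
projective lines and the weakly stable leaves into projective planes. A leaf of `M` may return
infinitely often to the domain of a chart, so this is a condition on each local piece
(plaque) of the leaf; the leaves are written on the covering `Sℍ` of `M`. -/
def IsFoliated {Γ : Subgroup PSL(2, ℝ)} (R : ProjectiveStructure E (SurfaceUnitTangent Γ)) :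
    Prop :=
  ∀ φ ∈ R.atlas, ∀ w : UnitTangent,
    (Quotient.mk _ w : SurfaceUnitTangent Γ) ∈ φ.source →
    (∃ V ∈ 𝓝 w, InProjectiveLine
      ((fun w' : UnitTangent => φ (Quotient.mk _ w')) '' (V ∩ w.geodesicLeaf))) ∧
    (∃ V ∈ 𝓝 w, InProjectivePlane
      ((fun w' : UnitTangent => φ (Quotient.mk _ w')) '' (V ∩ w.stableLeaf)))

end Projective

/-! ### The pullback of the Hopf fibration -/

/-- A `q`-equivariant local homeomorphism `u : ℍ → ℙ¹(ℂ)` from the universal covering of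
`Σ = Γ \ ℍ`. -/
structure EquivariantLocalHomeo {Γ : Subgroup PSL(2, ℝ)} (q : Γ →* PSL(2, ℂ)) where
  toFun : ℍ → CP1
  isLocalHomeomorph : IsLocalHomeomorph toFun
  equivariant : ∀ (γ : Γ) (z : ℍ), toFun (γ • z) = q γ • toFun z

/-- The pullback `u^* ℙ³(ℝ) = {(z, p) | u(z) = hopf(p)}` of the Hopf fibration. -/
def HopfPullback {Γ : Subgroup PSL(2, ℝ)} {q : Γ →* PSL(2, ℂ)}
    (u : EquivariantLocalHomeo q) : Type :=
  {x : ℍ × RP3 // u.toFun x.1 = hopf x.2}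

namespace HopfPullback

variable {Γ : Subgroup PSL(2, ℝ)} {q : Γ →* PSL(2, ℂ)} {u : EquivariantLocalHomeo q}

instance : TopologicalSpace (HopfPullback u) :=
  inferInstanceAs (TopologicalSpace {x : ℍ × RP3 // u.toFun x.1 = hopf x.2})

/-- `Γ` acts on the pullback by `γ (z, p) = (γ z, q(γ) p)`. -/
instance : MulAction Γ (HopfPullback u) where
  smul γ x := ⟨(γ • x.1.1, q γ • x.1.2), by
    change u.toFun (γ • x.1.1) = hopf (q γ • x.1.2)
    rw [u.equivariant, x.2, hopf_smul]⟩
  one_smul x := Subtype.ext (Prod.ext (one_smul _ _)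
    (show q 1 • x.1.2 = x.1.2 by rw [map_one, one_smul]))
  mul_smul γ δ x := Subtype.ext (Prod.ext (mul_smul _ _ _)
    (show q (γ * δ) • x.1.2 = q γ • q δ • x.1.2 by rw [map_mul, mul_smul]))

variable (u) in
/-- The canonical map `u^* ℙ³(ℝ) → ℙ³(ℝ)`. -/
def toRP3 (x : HopfPullback u) : RP3 := x.1.2

end HopfPullback

end QFProj

end

open scoped ComplexConjugate

noncomputable section

namespace QFProj

/-! ### The topology of projective spaces -/

/-! The canonical map `toRP3` is the base change of the local homeomorphism `u` along the Hopf
fibration, so it is itself a local homeomorphism, and it is `q`-equivariant. It therefore serves as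
a developing map (`IsDevelopingPair`) both for the pullback and for its quotient `N`.

To identify `N` with `M`, an equivariant homeomorphism `Sℍ → u^* ℙ³(ℝ)` over the identity of `ℍ` is
built. A vector is a frame `A ∈ SL₂(ℝ)` up to sign. An equivariant family of hermitian forms `hform`
gives each real line `p` over `u(z)` an affine coordinate of `ℙ¹(ℂ)` centred at `u(z)`; turning `p`
by `e^{iβ}` in its Hopf fibre turns the coordinate by `e^{2iβ}`. Since `u` is only a topological
local homeomorphism it has no derivative; instead the mean argument of the image of a small circle
about `z` is taken. The image loop has degree `±1` (`IsGoodRadius.degree_eq`), so rotating the frame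
rotates this mean phase bijectively, and the relation "mean phase `1`" is the graph of the
homeomorphism (`IsSurfaceGroup.exists_equivariant_homeomorph`).

Suppose that a structure induced by some homeomorphism `M → N` is foliated. Compared with the bundle
isomorphism, it is a self-homeomorphism of `M`, which lifts to `Sℍ` because `Γ` has trivial centre,
so that the central class of the fibre must be mapped trivially to `Γ`
(`IsSurfaceGroup.exists_lift`). The result is a local homeomorphism `D : Sℍ → ℙ³(ℝ)` that maps
pieces of stable leaves into planes. Each `ε ≠ 1` corresponds to some `γ ≠ 1`, which is hyperbolic
and preserves the stable leaf of its axis. That leaf develops into exactly one plane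
(`exists_plane`), so `q ε` preserves a real hyperplane of `ℂ²` and has real eigenvalues
(`exists_trace_eq_of_comap_eq`). A discrete group with trivial centre modulo `±1` and real
eigenvalues is conjugate to a group of real matrices (`IsRealEigenvalueGroup.exists_conj_real`).

Conversely let `q` be conjugate to a Fuchsian `ρ` and `u` be injective. The image of `u` avoids the
limit set, which lies in the real circle. It also avoids the rest of that circle, because a Jordan
curve does not embed in a circle minus a point. Hence, up to complex conjugation, `u` is an
equivariant map `f` of `ℍ` to a half-plane, and `f` is a homeomorphism `ℍ → ℍ` by cocompactness. It
is a quasi-isometry, so by the Morse lemma (`morse_discrete`) it maps each geodesic close to a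
unique geodesic. Averaging the projection over a fixed period makes the correspondence monotone
along geodesics, which gives an equivariant homeomorphism `D` of `Sℍ` that preserves geodesics and
stable leaves (`CoarseHomeo.exists_homeomorph`). Finally `A ↦ [A (i, 1)]` embeds `Sℍ` in `ℙ³(ℝ)`,
taking geodesics into lines and stable leaves into planes. Composing it with `D` gives the foliated
structure (`IsQuasiFuchsian.exists_isFoliated`). -/

theorem isOpenQuotientMap_mk (K V : Type*) [DivisionRing K] [AddCommGroup V] [Module K V]
    [TopologicalSpace V] [ContinuousConstSMul K V] :
    IsOpenQuotientMap (fun v : {v : V // v ≠ 0} => Projectivization.mk K v.1 v.2) := by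
  have hq : IsQuotientMap (fun v : {v : V // v ≠ 0} => Projectivization.mk K v.1 v.2) :=
    ⟨⟨rfl⟩, fun p => by
      induction p using Projectivization.ind with | h v hv => exact ⟨⟨v, hv⟩, rfl⟩⟩
  refine ⟨hq.surjective, hq.continuous, fun U hU => ?_⟩
  rw [← hq.isOpen_preimage]
  -- The saturation of `U` is the union of its multiples by units, and each scaling is continuous.
  have hs : (fun v : {v : V // v ≠ 0} => Projectivization.mk K v.1 v.2) ⁻¹'
      ((fun v : {v : V // v ≠ 0} => Projectivization.mk K v.1 v.2) '' U) =
      ⋃ a : Kˣ, (fun v : {v : V // v ≠ 0} =>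
        (⟨a • v.1, (smul_ne_zero_iff_ne a).2 v.2⟩ : {v : V // v ≠ 0})) ⁻¹' U := by
    ext v
    simp only [Set.mem_preimage, Set.mem_image, Set.mem_iUnion]
    constructor
    · rintro ⟨w, hw, h⟩
      obtain ⟨a, ha⟩ := (Projectivization.mk_eq_mk_iff K _ _ w.2 v.2).1 h
      exact ⟨a, by convert hw⟩
    · rintro ⟨a, ha⟩
      exact ⟨_, ha, (Projectivization.mk_eq_mk_iff K _ _ _ v.2).2 ⟨a, rfl⟩⟩
  rw [hs]
  exact isOpen_iUnion fun a => hU.preimage (by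
    refine Continuous.subtype_mk ?_ _
    exact (continuous_const_smul (a : K)).comp continuous_subtype_val)

theorem continuous_mk_comp {K V X : Type*} [DivisionRing K] [AddCommGroup V] [Module K V]
    [TopologicalSpace V] [ContinuousConstSMul K V] [TopologicalSpace X] {f : X → V}
    (hf : Continuous f) (h0 : ∀ x, f x ≠ 0) :
    Continuous (fun x => Projectivization.mk K (f x) (h0 x)) :=
  (isOpenQuotientMap_mk K V).continuous.comp (hf.subtype_mk h0)

theorem continuous_projectivization_iff {K V X : Type*} [DivisionRing K] [AddCommGroup V]
    [Module K V] [TopologicalSpace V] [ContinuousConstSMul K V] [TopologicalSpace X]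
    {f : ℙ K V → X} :
    Continuous f ↔ Continuous (fun v : {v : V // v ≠ 0} => f (Projectivization.mk K v.1 v.2)) :=
  (isOpenQuotientMap_mk K V).isQuotientMap.continuous_iff

theorem continuous_hopf : Continuous hopf :=
  continuous_projectivization_iff.2 (isOpenQuotientMap_mk ℂ C2).continuous

theorem continuous_linearEquiv_smul {E : Type*} [AddCommGroup E] [Module ℝ E] [TopologicalSpace E]
    [ContinuousConstSMul ℝ E] (g : E ≃ₗ[ℝ] E) (hg : Continuous g) :
    Continuous (fun p : ℙ ℝ E => g • p) :=
  continuous_projectivization_iff.2 <| continuous_mk_comp (hg.comp continuous_subtype_val)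
    (fun v => (LinearEquiv.map_ne_zero_iff g).2 v.2)

theorem continuous_c2_linearEquiv (g : C2 ≃ₗ[ℝ] C2) : Continuous g :=
  g.toLinearMap.continuous_of_finiteDimensional

instance : ContinuousConstSMul (C2 ≃ₗ[ℝ] C2) RP3 :=
  ⟨fun g => continuous_linearEquiv_smul g (continuous_c2_linearEquiv g)⟩

/-- The real linear automorphism of `ℂ²` defined by a matrix. -/
def slReal (A : SL(2, ℂ)) : C2 ≃ₗ[ℝ] C2 := DistribMulAction.toLinearEquiv ℝ C2 A

theorem continuous_sl_smul_C2 (A : SL(2, ℂ)) : Continuous (fun v : C2 => A • v) :=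
  continuous_c2_linearEquiv (slReal A)

theorem psl_mk_smul_mk_RP3 (A : SL(2, ℂ)) (v : C2) (hv : v ≠ 0) :
    (QuotientGroup.mk A : PSL(2, ℂ)) • (Projectivization.mk ℝ v hv : RP3) =
      Projectivization.mk ℝ (A • v) ((smul_ne_zero_iff_ne A).2 hv) := rfl

theorem psl_mk_smul_mk_CP1 (A : SL(2, ℂ)) (v : C2) (hv : v ≠ 0) :
    (QuotientGroup.mk A : PSL(2, ℂ)) • (Projectivization.mk ℂ v hv : CP1) =
      Projectivization.mk ℂ (A • v) ((smul_ne_zero_iff_ne A).2 hv) := rfl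

instance : ContinuousConstSMul PSL(2, ℂ) RP3 := ⟨fun g => by
  induction g using QuotientGroup.induction_on with | H A =>
  exact continuous_const_smul (slReal A)⟩

instance : ContinuousConstSMul PSL(2, ℂ) CP1 := ⟨fun g => by
  induction g using QuotientGroup.induction_on with | H A =>
  exact continuous_projectivization_iff.2 <| continuous_mk_comp
    ((continuous_sl_smul_C2 A).comp continuous_subtype_val)
    (fun v => (smul_ne_zero_iff_ne A).2 v.2)⟩

/-- The determinant of a pair of vectors of `ℂ²`. -/
def det2 (v w : C2) : ℂ := v 0 * w 1 - v 1 * w 0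

theorem continuous_det2 : Continuous (fun x : C2 × C2 => det2 x.1 x.2) := by
  unfold det2; fun_prop

theorem det2_eq_zero_iff {v w : C2} (hv : v ≠ 0) : det2 v w = 0 ↔ ∃ a : ℂ, a • v = w := by
  constructor
  · intro h
    unfold det2 at h
    by_cases h0 : v 0 = 0
    · have h1 : v 1 ≠ 0 := fun h1 => hv (by ext i; fin_cases i <;> simp [h0, h1])
      refine ⟨w 1 / v 1, ?_⟩
      have : w 0 = 0 := by simpa [h0, h1] using h
      ext i; fin_cases i <;> simp [h0, h1, this]
    · refine ⟨w 0 / v 0, ?_⟩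
      ext i; fin_cases i
      · simp [h0]
      · simp; field_simp; linear_combination -h
  · rintro ⟨a, rfl⟩
    simp [det2]; ring

theorem mk_eq_mk_iff_det2 {v w : C2} (hv : v ≠ 0) (hw : w ≠ 0) :
    (Projectivization.mk ℂ v hv : CP1) = Projectivization.mk ℂ w hw ↔ det2 v w = 0 := by
  rw [eq_comm, Projectivization.mk_eq_mk_iff', det2_eq_zero_iff hv]

theorem det2_smul (A : SL(2, ℂ)) (v w : C2) : det2 (A • v) (A • w) = det2 v w := by
  have h := A.det_coe
  rw [Matrix.det_fin_two] at h
  simp only [det2, Matrix.SpecialLinearGroup.smul_def, Matrix.smul_eq_mulVec, Matrix.mulVec, dotProduct, Fin.sum_univ_two]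
  linear_combination (v 0 * w 1 - v 1 * w 0) * h

/-- The diagonal pulls back to the zero set of `det2`, which is closed, and a product of open
quotient maps is a quotient map. -/
instance : T2Space CP1 := by
  rw [t2_iff_isClosed_diagonal, ← ((isOpenQuotientMap_mk ℂ C2).prodMap
    (isOpenQuotientMap_mk ℂ C2)).isQuotientMap.isClosed_preimage]
  have : Prod.map (fun v : {v : C2 // v ≠ 0} => Projectivization.mk ℂ v.1 v.2)
      (fun v : {v : C2 // v ≠ 0} => Projectivization.mk ℂ v.1 v.2) ⁻¹' Set.diagonal CP1 =
      {x | det2 x.1.1 x.2.1 = 0} := by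
    ext ⟨v, w⟩
    exact mk_eq_mk_iff_det2 v.2 w.2
  rw [this]
  exact isClosed_eq (continuous_det2.comp ((continuous_subtype_val.comp continuous_fst).prodMk
    (continuous_subtype_val.comp continuous_snd))) continuous_const

instance : CompactSpace RP3 := by
  have hc : IsCompact (Metric.sphere (0 : C2) 1) := isCompact_sphere 0 1
  have : CompactSpace (Metric.sphere (0 : C2) 1) := isCompact_iff_compactSpace.1 hc
  have h0 : ∀ v : Metric.sphere (0 : C2) 1, v.1 ≠ 0 := fun v => by
    have := v.2; intro h; simp [h] at this
  refine ⟨?_⟩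
  have hr : Set.range (fun v : Metric.sphere (0 : C2) 1 =>
      (Projectivization.mk ℝ v.1 (h0 v) : RP3)) = Set.univ := by
    refine Set.eq_univ_of_forall fun p => ?_
    induction p using Projectivization.ind with | h v hv =>
    have hn : ‖v‖ ≠ 0 := norm_ne_zero_iff.2 hv
    refine ⟨⟨‖v‖⁻¹ • v, by simp [norm_smul, hn]⟩, ?_⟩
    exact (Projectivization.mk_eq_mk_iff' ..).2 ⟨‖v‖⁻¹, rfl⟩
  rw [← hr]
  exact isCompact_range (continuous_mk_comp continuous_subtype_val h0)

/-! ### Discrete subgroups of `PSL₂` -/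

theorem continuous_pslMk (R : Type*) [CommRing R] [TopologicalSpace R] :
    Continuous (QuotientGroup.mk : SL(2, R) → PSL(2, R)) := continuous_quot_mk

instance : IsTopologicalGroup PSL(2, ℝ) := QuotientGroup.instIsTopologicalGroup _
instance : IsTopologicalGroup PSL(2, ℂ) := QuotientGroup.instIsTopologicalGroup _

instance : IsClosed (Subgroup.center SL(2, ℝ) : Set SL(2, ℝ)) := by
  rw [Subgroup.coe_center, ← Set.centralizer_univ]; exact Set.isClosed_centralizer _

instance : T2Space PSL(2, ℝ) := inferInstanceAs (T2Space (SL(2, ℝ) ⧸ Subgroup.center SL(2, ℝ)))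

theorem psl_mk_smul_upperHalfPlane (A : SL(2, ℝ)) (z : ℍ) :
    (QuotientGroup.mk A : PSL(2, ℝ)) • z = A • z := rfl

instance : IsIsometricSMul PSL(2, ℝ) ℍ := ⟨fun g => by
  induction g using QuotientGroup.induction_on with | H A => exact isometry_smul ℍ A⟩

theorem isCompact_setOf_smul_inter {K L : Set ℍ} (hK : IsCompact K) (hL : IsCompact L) :
    IsCompact {A : SL(2, ℝ) | (((A • ·) '' K) ∩ L).Nonempty} := by
  have hp : IsProperMap (fun x : SL(2, ℝ) × ℍ => (x.1 • x.2, x.2)) :=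
    ProperSMul.isProperMap_smul_pair
  have := ((hp.isCompact_preimage (hL.prod hK)).image continuous_fst)
  convert this using 1
  ext A
  constructor
  · rintro ⟨_, ⟨z, hz, rfl⟩, hz'⟩
    exact ⟨(A, z), ⟨hz', hz⟩, rfl⟩
  · rintro ⟨⟨B, z⟩, ⟨hz', hz⟩, rfl⟩
    exact ⟨_, ⟨z, hz, rfl⟩, hz'⟩

/-- The action of `SL₂(ℝ)` on `ℍ` is proper, so the elements that bring `K` to meet `L` form a
compact set. A discrete subgroup is closed and meets the image of this set in a finite set. -/
theorem finite_setOf_smul_inter (S : Subgroup PSL(2, ℝ)) [hS : DiscreteTopology S] {K L : Set ℍ}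
    (hK : IsCompact K) (hL : IsCompact L) :
    {γ : S | (((γ • ·) '' K) ∩ L).Nonempty}.Finite := by
  have hc : IsClosed (S : Set PSL(2, ℝ)) := Subgroup.isClosed_of_discrete
  have hT := (isCompact_setOf_smul_inter hK hL).image (continuous_pslMk ℝ)
  have hpre : IsCompact ((fun x : S => (x : PSL(2, ℝ))) ⁻¹'
      (QuotientGroup.mk '' {A : SL(2, ℝ) | (((A • ·) '' K) ∩ L).Nonempty})) :=
    hc.isClosedEmbedding_subtypeVal.isCompact_preimage hT
  refine (hpre.finite_of_discrete).subset ?_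
  rintro ⟨g, hg⟩ h
  induction g using QuotientGroup.induction_on with | H A =>
  exact ⟨A, h, rfl⟩

theorem properlyDiscontinuousSMul_of_discrete (S : Subgroup PSL(2, ℝ)) [DiscreteTopology S] :
    ProperlyDiscontinuousSMul S ℍ := ⟨fun hK hL => finite_setOf_smul_inter S hK hL⟩

/-! ### The action of `PSL₂(ℝ)` on the unit tangent bundle -/

namespace UnitTangent

theorem continuous_pt : Continuous pt := continuous_fst.comp continuous_subtype_val

theorem continuous_vec : Continuous vec := continuous_snd.comp continuous_subtype_val

theorem norm_vec (w : UnitTangent) : ‖w.vec‖ = w.pt.im := w.2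

instance : T2Space UnitTangent :=
  inferInstanceAs (T2Space {w : ℍ × ℂ // ‖w.2‖ = w.1.im})

theorem continuous_iff {X : Type*} [TopologicalSpace X] {f : X → UnitTangent} :
    Continuous f ↔ Continuous (fun x => (f x).pt) ∧ Continuous (fun x => (f x).vec) :=
  ⟨fun h => ⟨continuous_pt.comp h, continuous_vec.comp h⟩,
    fun h => Continuous.subtype_mk (h.1.prodMk h.2) fun x => (f x).2⟩

theorem pt_smul (A : SL(2, ℝ)) (w : UnitTangent) : (A • w).pt = A • w.pt := rfl

theorem vec_smul (A : SL(2, ℝ)) (w : UnitTangent) :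
    (A • w).vec = w.vec / ((A 1 0 : ℂ) * w.pt + A 1 1) ^ 2 := rfl

theorem pt_psl_smul (g : PSL(2, ℝ)) (w : UnitTangent) : (g • w).pt = g • w.pt := by
  induction g using QuotientGroup.induction_on with | H A => rfl

theorem psl_mk_smul (A : SL(2, ℝ)) (w : UnitTangent) :
    (QuotientGroup.mk A : PSL(2, ℝ)) • w = A • w := rfl

theorem denom_ne_zero (A : SL(2, ℝ)) (z : ℍ) : (A 1 0 : ℂ) * z + A 1 1 ≠ 0 :=
  UpperHalfPlane.denom_ne_zero (A : GL (Fin 2) ℝ) z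

theorem coe_smul (A : SL(2, ℝ)) (z : ℍ) :
    ((A • z : ℍ) : ℂ) = ((A 0 0 : ℂ) * z + A 0 1) / ((A 1 0 : ℂ) * z + A 1 1) :=
  UpperHalfPlane.coe_specialLinearGroup_apply A z

theorem continuous_entry (R : Type*) [CommRing R] [TopologicalSpace R] (i j : Fin 2) :
    Continuous (fun A : SL(2, R) => A i j) :=
  (continuous_apply_apply i j).comp continuous_subtype_val

instance : ContinuousSMul SL(2, ℝ) UnitTangent := ⟨by
  rw [continuous_iff]
  refine ⟨continuous_fst.smul (continuous_pt.comp continuous_snd), ?_⟩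
  simp only [vec_smul]
  refine Continuous.div (continuous_vec.comp continuous_snd) ?_
    (fun x => pow_ne_zero 2 (denom_ne_zero x.1 x.2.pt))
  refine Continuous.pow (Continuous.add (Continuous.mul ?_ ?_) ?_) 2
  · exact Complex.continuous_ofReal.comp ((continuous_entry ℝ 1 0).comp continuous_fst)
  · exact UpperHalfPlane.continuous_coe.comp (continuous_pt.comp continuous_snd)
  · exact Complex.continuous_ofReal.comp ((continuous_entry ℝ 1 1).comp continuous_fst)⟩

instance : ContinuousConstSMul PSL(2, ℝ) UnitTangent := ⟨fun g => by
  induction g using QuotientGroup.induction_on with | H A => exact continuous_const_smul A⟩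

theorem coe_pt_axis (t : ℝ) : (((axis t).pt : ℍ) : ℂ) = (Real.exp t : ℂ) * Complex.I := rfl

theorem vec_axis (t : ℝ) : (axis t).vec = (Real.exp t : ℂ) * Complex.I := rfl

theorem continuous_axis : Continuous axis := by
  have : Continuous fun t : ℝ => (Real.exp t : ℂ) * Complex.I := by fun_prop
  exact continuous_iff.2 ⟨UpperHalfPlane.isEmbedding_coe.continuous_iff.2 this, this⟩

theorem pt_axis_zero : (axis 0).pt = UpperHalfPlane.I := by
  ext; rw [coe_pt_axis]; simp

/-- The rotation of angle `s` in the fibres of the unit tangent bundle. -/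
def rot (s : ℝ) (w : UnitTangent) : UnitTangent :=
  ⟨(w.pt, Complex.exp (s * Complex.I) * w.vec), by
    rw [norm_mul, Complex.norm_exp_ofReal_mul_I, one_mul, norm_vec]⟩

@[simp] theorem pt_rot (s : ℝ) (w : UnitTangent) : (rot s w).pt = w.pt := rfl

theorem vec_rot (s : ℝ) (w : UnitTangent) :
    (rot s w).vec = Complex.exp (s * Complex.I) * w.vec := rfl

theorem rot_smul (s : ℝ) (g : PSL(2, ℝ)) (w : UnitTangent) : rot s (g • w) = g • rot s w := by
  induction g using QuotientGroup.induction_on with | H A =>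
  refine UnitTangent.ext rfl ?_
  rw [psl_mk_smul, psl_mk_smul, vec_rot, vec_smul, vec_smul, vec_rot, pt_rot, mul_div_assoc]

theorem exists_rot_eq {w w' : UnitTangent} (h : w.pt = w'.pt) : ∃ s : ℝ, w' = rot s w := by
  have h0 : w.vec ≠ 0 := by
    rw [← norm_ne_zero_iff, norm_vec]; exact w.pt.im_ne_zero
  have hn : ‖w'.vec / w.vec‖ = 1 := by
    rw [norm_div, norm_vec, norm_vec, h, div_self w'.pt.im_ne_zero]
  refine ⟨(w'.vec / w.vec).arg, UnitTangent.ext h.symm ?_⟩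
  rw [vec_rot]
  have := Complex.norm_mul_exp_arg_mul_I (w'.vec / w.vec)
  rw [hn, Complex.ofReal_one, one_mul] at this
  rw [this, div_mul_cancel₀ _ h0]

end UnitTangent

/-! ### Unit tangent vectors as frames: matrices of `SL₂(ℝ)` up to sign -/

/-- The rotation matrix of angle `θ`. -/
def rotSL (θ : ℝ) : SL(2, ℝ) :=
  ⟨!![Real.cos θ, Real.sin θ; -Real.sin θ, Real.cos θ], by
    rw [Matrix.det_fin_two_of]; nlinarith [Real.cos_sq_add_sin_sq θ]⟩

theorem continuous_sl_mk {R X : Type*} [CommRing R] [TopologicalSpace R] [TopologicalSpace X]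
    {f : X → SL(2, R)} (h : ∀ i j, Continuous fun x => f x i j) : Continuous f :=
  continuous_induced_rng.2 (continuous_matrix h)

theorem continuous_rotSL : Continuous rotSL := by
  refine continuous_sl_mk fun i j => ?_
  fin_cases i <;> fin_cases j <;> simp [rotSL] <;> fun_prop

theorem rotSL_smul_I (θ : ℝ) : rotSL θ • UpperHalfPlane.I = UpperHalfPlane.I := by
  ext
  have h := UnitTangent.denom_ne_zero (rotSL θ) UpperHalfPlane.I
  rw [UnitTangent.coe_smul, div_eq_iff h]
  simp only [rotSL, UpperHalfPlane.coe_I, Matrix.cons_val', Matrix.cons_val_zero,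
    Matrix.cons_val_one, Matrix.cons_val_fin_one, Matrix.of_apply]
  push_cast
  linear_combination (Complex.sin θ : ℂ) * Complex.I_sq

open UnitTangent in
-- At `i` the denominator of the homography is `e^{-iθ}`, so its derivative is `e^{2iθ}`. This
-- doubling is why loops of directions are `π`-periodic in `θ` below.
theorem rotSL_smul_axis (θ : ℝ) : rotSL θ • axis 0 = rot (2 * θ) (axis 0) := by
  refine UnitTangent.ext ?_ ?_
  · rw [pt_smul, pt_rot, pt_axis_zero, rotSL_smul_I]
  · have h := UnitTangent.denom_ne_zero (rotSL θ) UpperHalfPlane.I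
    rw [vec_smul, vec_rot, pt_axis_zero, div_eq_iff (pow_ne_zero 2 h), vec_axis]
    have h2 : ((rotSL θ) 1 0 : ℂ) * UpperHalfPlane.I + (rotSL θ) 1 1 =
        Complex.exp (-(θ * Complex.I)) := by
      rw [← neg_mul, ← Complex.ofReal_neg, Complex.exp_mul_I]
      simp [rotSL]; ring
    rw [h2, ← Complex.exp_nat_mul]
    have : Complex.exp (↑(2 * θ) * Complex.I) * (↑(Real.exp 0) * Complex.I) *
      Complex.exp (↑2 * -(↑θ * Complex.I)) = (↑(Real.exp 0) * Complex.I) *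
      Complex.exp (↑(2 * θ) * Complex.I + ↑2 * -(↑θ * Complex.I)) := by
      rw [Complex.exp_add]; ring
    rw [Nat.cast_ofNat, this]
    push_cast
    ring_nf
    simp

open UnitTangent in
theorem exists_smul_axis (w : UnitTangent) : ∃ A : SL(2, ℝ), w = A • axis 0 := by
  obtain ⟨s, hs⟩ := exists_rot_eq (w := w.pt.toSL2R • axis 0) (w' := w) (by
    rw [pt_smul, pt_axis_zero, UpperHalfPlane.toSL2R_smul_I])
  refine ⟨w.pt.toSL2R * rotSL (s / 2), ?_⟩
  rw [mul_smul, rotSL_smul_axis, ← psl_mk_smul, ← rot_smul, psl_mk_smul,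
    mul_div_cancel₀ s two_ne_zero]
  exact hs

open UnitTangent in
-- The stabilizer of `axis 0` is `{1, -1}`: derivative `1` at `i` means `(c i + d)² = 1`, so `c = 0`
-- and `d = ±1`, and fixing `i` gives `a = d` and `b = -c`.
theorem smul_axis_eq_iff {A B : SL(2, ℝ)} : A • axis 0 = B • axis 0 ↔ B = A ∨ B = -A := by
  have key : ∀ C : SL(2, ℝ), C • axis 0 = axis 0 → C = 1 ∨ C = -1 := by
    intro C h
    have h1 : C • UpperHalfPlane.I = UpperHalfPlane.I := by
      rw [← pt_axis_zero, ← pt_smul, h]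
    have h2 := congrArg vec h
    rw [vec_smul, vec_axis, pt_axis_zero,
      div_eq_iff (pow_ne_zero 2 (UnitTangent.denom_ne_zero C _))] at h2
    have h3 := congrArg UpperHalfPlane.coe h1
    rw [UnitTangent.coe_smul, div_eq_iff (UnitTangent.denom_ne_zero C _)] at h3
    have h4 : ((C 1 0 : ℂ) * Complex.I + C 1 1) ^ 2 = 1 := by
      have : (Complex.exp 0) * Complex.I ≠ 0 := by simp
      have h2' : (Real.exp 0 : ℂ) * Complex.I * (((C 1 0 : ℂ) * Complex.I + C 1 1) ^ 2) =
        (Real.exp 0 : ℂ) * Complex.I * 1 := by rw [mul_one]; exact h2.symm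
      exact mul_left_cancel₀ (by simp) h2'
    rw [UpperHalfPlane.coe_I] at h3
    have h5 := congrArg Complex.re h3
    have h6 := congrArg Complex.im h3
    simp at h5 h6
    rcases sq_eq_one_iff.1 h4 with h | h
    · have h7 := congrArg Complex.re h
      have h8 := congrArg Complex.im h
      simp at h7 h8
      left; ext i j; fin_cases i <;> fin_cases j <;> simp [h5, h6, h7, h8]
    · have h7 := congrArg Complex.re h
      have h8 := congrArg Complex.im h
      simp at h7 h8
      right; ext i j; fin_cases i <;> fin_cases j <;> simp [h5, h6, h7, h8]
  constructor
  · intro h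
    rcases key (A⁻¹ * B) (by rw [mul_smul, ← h, inv_smul_smul]) with h | h
    · left; rw [inv_mul_eq_one] at h; exact h.symm
    · right; rw [inv_mul_eq_iff_eq_mul] at h; rw [h]; simp
  · rintro (rfl | rfl)
    · rfl
    · rw [← psl_mk_smul, ← psl_mk_smul]
      congr 1
      refine QuotientGroup.eq.2 (Matrix.SpecialLinearGroup.mem_center_iff.2 ⟨-1, by simp, ?_⟩)
      ext i j; fin_cases i <;> fin_cases j <;> simp

open UnitTangent in
-- The orbit map followed by the foot point is proper, so the orbit map is proper, hence closed,
-- hence a quotient map. It is open because its fibres are the pairs `{A, -A}`. Closed relations on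
-- vectors can thus be checked on frames.
theorem isOpenQuotientMap_smul_axis :
    IsOpenQuotientMap (fun A : SL(2, ℝ) => A • axis 0) := by
  have hc : Continuous (fun A : SL(2, ℝ) => A • axis 0) := continuous_id.smul continuous_const
  have hp : IsProperMap (fun A : SL(2, ℝ) => A • axis 0) := by
    refine isProperMap_of_comp_of_t2 hc continuous_pt ?_
    convert UpperHalfPlane.isProperMap_smul_I using 2 with A
    simp [pt_smul, pt_axis_zero]
  have hs : Function.Surjective (fun A : SL(2, ℝ) => A • axis 0) := fun w =>
    (exists_smul_axis w).imp fun A h => h.symm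
  have hq := hp.isClosedMap.isQuotientMap hc hs
  refine ⟨hs, hc, fun U hU => ?_⟩
  rw [← hq.isOpen_preimage]
  have : (fun A : SL(2, ℝ) => A • axis 0) ⁻¹' ((fun A : SL(2, ℝ) => A • axis 0) '' U) =
      U ∪ (fun A => -1 * A) ⁻¹' U := by
    ext A
    simp only [Set.mem_preimage, Set.mem_image, Set.mem_union, neg_one_mul]
    constructor
    · rintro ⟨B, hB, h⟩
      rcases smul_axis_eq_iff.1 h with rfl | rfl
      · exact Or.inl hB
      · right; simpa using hB
    · rintro (h | h)
      · exact ⟨A, h, rfl⟩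
      · exact ⟨-A, h, smul_axis_eq_iff.2 (Or.inr (by simp))⟩
  rw [this]
  exact hU.union (hU.preimage (continuous_const.mul continuous_id))

open UnitTangent in
theorem isCompact_pt_preimage {K : Set ℍ} (hK : IsCompact K) : IsCompact (pt ⁻¹' K) := by
  have h := (UpperHalfPlane.isProperMap_smul_I.isCompact_preimage hK).image
    isOpenQuotientMap_smul_axis.continuous
  convert h using 1
  ext w
  obtain ⟨A, rfl⟩ := exists_smul_axis w
  constructor
  · intro hw; refine ⟨A, ?_, rfl⟩
    simpa [pt_smul, pt_axis_zero] using hw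
  · rintro ⟨B, hB, h⟩
    rw [← h]
    simpa [pt_smul, pt_axis_zero] using hB

/-! ### Covering, compactness and displacement properties of surface groups -/

section SurfaceGroup

variable {Γ : Subgroup PSL(2, ℝ)}

instance : ContinuousConstSMul Γ ℍ :=
  ⟨fun γ => continuous_const_smul (γ : PSL(2, ℝ))⟩

instance : ContinuousConstSMul Γ UnitTangent :=
  ⟨fun γ => continuous_const_smul (γ : PSL(2, ℝ))⟩

theorem IsSurfaceGroup.exists_nhds_disjoint (hΓ : IsSurfaceGroup Γ) (z : ℍ) :
    ∃ U ∈ 𝓝 z, ∀ γ : Γ, ((γ • ·) '' U ∩ U).Nonempty → γ = 1 := by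
  have := hΓ.discrete
  have := properlyDiscontinuousSMul_of_discrete Γ
  obtain ⟨U, hU, h⟩ := ProperlyDiscontinuousSMul.exists_nhds_image_smul_eq_self Γ z
  exact ⟨U, hU, fun γ hγ => hΓ.free γ z (h γ hγ)⟩

/-- The quotient map of a space with an equivariant map to `ℍ` is a covering. -/
theorem IsSurfaceGroup.isQuotientCoveringMap (hΓ : IsSurfaceGroup Γ) {X : Type*}
    [TopologicalSpace X] [MulAction Γ X] [ContinuousConstSMul Γ X] {f : X → ℍ} (hf : Continuous f)
    (hfγ : ∀ (γ : Γ) x, f (γ • x) = γ • f x) :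
    IsQuotientCoveringMap (Quotient.mk (MulAction.orbitRel Γ X)) Γ where
  toIsQuotientMap := isQuotientMap_quotient_mk'
  apply_eq_iff_mem_orbit := Quotient.eq''
  disjoint x := by
    obtain ⟨U, hU, h⟩ := hΓ.exists_nhds_disjoint (f x)
    refine ⟨f ⁻¹' U, hf.continuousAt hU, fun γ hγ => h γ ?_⟩
    obtain ⟨_, ⟨y, hy, rfl⟩, hy'⟩ := hγ
    exact ⟨_, ⟨f y, hy, rfl⟩, by simpa [hfγ] using hy'⟩

/-- A closed ball whose translates cover `ℍ`. -/
theorem IsSurfaceGroup.exists_radius (hΓ : IsSurfaceGroup Γ) :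
    ∃ R : ℝ, ∀ z : ℍ, ∃ γ : Γ, dist (γ • z) UpperHalfPlane.I ≤ R := by
  have := hΓ.cocompact
  have hq : IsOpenQuotientMap (Quotient.mk (MulAction.orbitRel Γ ℍ)) :=
    (hΓ.isQuotientCoveringMap continuous_id fun _ _ => rfl).isOpenQuotientMap
  obtain ⟨n, hn⟩ := (isCompact_univ (X := MulAction.orbitRel.Quotient Γ ℍ)).elim_directed_cover
    (fun n : ℕ => Quotient.mk (MulAction.orbitRel Γ ℍ) '' Metric.ball UpperHalfPlane.I n)
    (fun n => hq.isOpenMap _ Metric.isOpen_ball)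
    (fun x _ => by
      obtain ⟨z, rfl⟩ := hq.surjective x
      obtain ⟨n, hn⟩ := exists_nat_gt (dist z UpperHalfPlane.I)
      exact Set.mem_iUnion.2 ⟨n, z, hn, rfl⟩)
    (directed_of_isDirected_le fun m n h => Set.image_mono (Metric.ball_subset_ball (by exact_mod_cast h)))
  refine ⟨n, fun z => ?_⟩
  obtain ⟨z', hz', h⟩ := hn (Set.mem_univ (Quotient.mk _ z))
  obtain ⟨γ, hγ⟩ := Quotient.exact h
  exact ⟨γ, by
    change γ • z = z' at hγ
    rw [hγ]; exact (Metric.mem_ball.1 hz').le⟩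

/-- The displacement of the nontrivial elements of a surface group is bounded below. -/
theorem IsSurfaceGroup.exists_le_dist (hΓ : IsSurfaceGroup Γ) :
    ∃ r : ℝ, 0 < r ∧ ∀ (γ : Γ) (z : ℍ), γ ≠ 1 → r ≤ dist z (γ • z) := by
  have := hΓ.discrete
  obtain ⟨R, hR⟩ := hΓ.exists_radius
  have hfin := finite_setOf_smul_inter Γ (isCompact_closedBall UpperHalfPlane.I R)
    (isCompact_closedBall UpperHalfPlane.I (R + 1))
  have key : ∀ γ : Γ, ∃ r : ℝ, 0 < r ∧ (γ ≠ 1 → ∀ z ∈ Metric.closedBall UpperHalfPlane.I R,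
      r ≤ dist z (γ • z)) := by
    intro γ
    by_cases hγ : γ = 1
    · exact ⟨1, one_pos, fun h => (h hγ).elim⟩
    rcases (Metric.closedBall UpperHalfPlane.I R).eq_empty_or_nonempty with he | hne
    · exact ⟨1, one_pos, by simp [he]⟩
    obtain ⟨z, hz, hmin⟩ := (isCompact_closedBall UpperHalfPlane.I R).exists_isMinOn hne
      (f := fun z => dist z (γ • z))
      (continuous_id.dist (continuous_const_smul (γ : PSL(2, ℝ)))).continuousOn
    exact ⟨dist z (γ • z), dist_pos.2 fun h => hγ (hΓ.free γ z h.symm), fun _ w hw => hmin hw⟩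
  choose r hr hr' using key
  obtain ⟨r₀, hr₀, hle⟩ : ∃ r₀ : ℝ, 0 < r₀ ∧ ∀ γ ∈ hfin.toFinset, r₀ ≤ r γ := by
    rcases hfin.toFinset.eq_empty_or_nonempty with he | hne
    · exact ⟨1, one_pos, fun γ hγ => by rw [he] at hγ; exact absurd hγ (Finset.notMem_empty γ)⟩
    · obtain ⟨γ, _, h⟩ := Finset.exists_min_image hfin.toFinset r hne
      exact ⟨r γ, hr γ, h⟩
  -- An element that moves some point of the ball by less than `1` lies in the finite set `hfin`. An
  -- arbitrary point is first brought into the ball by `ε`, which conjugates `γ`.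
  refine ⟨min 1 r₀, lt_min one_pos hr₀, fun γ z hγ => ?_⟩
  obtain ⟨ε, hε⟩ := hR z
  have hconj : dist z (γ • z) = dist (ε • z) ((ε * γ * ε⁻¹) • ε • z) := by
    rw [mul_smul, inv_smul_smul, mul_smul]
    exact (dist_smul (ε : PSL(2, ℝ)) z (γ • z)).symm
  rw [hconj]
  by_contra! hlt
  have h1 : dist (ε • z) ((ε * γ * ε⁻¹) • ε • z) < 1 := hlt.trans_le (min_le_left _ _)
  have hmem : ε * γ * ε⁻¹ ∈ hfin.toFinset := by
    rw [Set.Finite.mem_toFinset]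
    refine ⟨_, ⟨ε • z, hε, rfl⟩, ?_⟩
    rw [Metric.mem_closedBall]
    have := dist_triangle_left ((ε * γ * ε⁻¹) • ε • z) UpperHalfPlane.I (ε • z)
    linarith
  have := hr' (ε * γ * ε⁻¹) (by simpa using hγ) (ε • z) hε
  exact absurd hlt (not_lt.2 (((min_le_right _ _).trans (hle _ hmem)).trans this))

end SurfaceGroup

/-! ### Geodesic flow, horocycles, and hyperbolicity of the elements of a surface group -/

/-- The diagonal matrices, whose right action on `SL₂(ℝ)` is the geodesic flow. -/
def geoSL (t : ℝ) : SL(2, ℝ) :=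
  ⟨!![Real.exp (t / 2), 0; 0, Real.exp (-(t / 2))], by
    rw [Matrix.det_fin_two_of, ← Real.exp_add]; simp⟩

/-- The unipotent upper triangular matrices. -/
def uniSL (x : ℝ) : SL(2, ℝ) := ⟨!![1, x; 0, 1], by simp⟩

theorem coe_geoSL (t : ℝ) : (geoSL t : Matrix (Fin 2) (Fin 2) ℝ) =
    !![Real.exp (t / 2), 0; 0, Real.exp (-(t / 2))] := rfl

theorem coe_uniSL (x : ℝ) : (uniSL x : Matrix (Fin 2) (Fin 2) ℝ) = !![1, x; 0, 1] := rfl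

theorem continuous_geoSL : Continuous geoSL := by
  refine continuous_sl_mk fun i j => ?_
  fin_cases i <;> fin_cases j <;> simp [geoSL] <;> fun_prop

theorem continuous_uniSL : Continuous uniSL := by
  refine continuous_sl_mk fun i j => ?_
  fin_cases i <;> fin_cases j <;> simp [uniSL] <;> fun_prop

theorem geoSL_add (s t : ℝ) : geoSL (s + t) = geoSL s * geoSL t := by
  ext i j
  rw [Matrix.SpecialLinearGroup.coe_mul, coe_geoSL, coe_geoSL, coe_geoSL]
  fin_cases i <;> fin_cases j <;> simp [← Real.exp_add, add_div, add_comm]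

theorem geoSL_mul_uniSL (t x : ℝ) : geoSL t * uniSL x = uniSL (Real.exp t * x) * geoSL t := by
  ext i j
  have he : Real.exp t = Real.exp (t / 2) * Real.exp (t / 2) := by rw [← Real.exp_add, add_halves]
  rw [Matrix.SpecialLinearGroup.coe_mul, Matrix.SpecialLinearGroup.coe_mul, coe_geoSL, coe_uniSL,
    coe_uniSL, he, Real.exp_neg]
  fin_cases i <;> fin_cases j <;> simp
  field_simp

open UnitTangent in
theorem geoSL_smul_axis (s t : ℝ) : geoSL s • axis t = axis (s + t) := by
  have he : Real.exp s = Real.exp (s / 2) * Real.exp (s / 2) := by rw [← Real.exp_add, add_halves]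
  have hd : Complex.exp (-((s : ℂ) / 2)) ≠ 0 := Complex.exp_ne_zero _
  refine UnitTangent.ext ?_ ?_
  · rw [pt_smul]
    ext
    rw [UnitTangent.coe_smul, coe_pt_axis, coe_pt_axis, Real.exp_add, he]
    simp [geoSL]
    rw [Complex.exp_neg]; field_simp
  · rw [vec_smul, vec_axis, vec_axis, Real.exp_add, he]
    simp [geoSL]
    rw [Complex.exp_neg]; field_simp

theorem coe_uniSL_smul (x : ℝ) (z : ℍ) : ((uniSL x • z : ℍ) : ℂ) = z + x := by
  rw [UnitTangent.coe_smul]; simp [uniSL]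

/-- The displacement of a matrix. -/
theorem normSq_eq_dist (A : SL(2, ℝ)) (z : ℍ) :
    Complex.normSq ((A 1 0 : ℂ) * z ^ 2 + ((A 1 1 : ℂ) - A 0 0) * z - A 0 1) =
      2 * z.im ^ 2 * (Real.cosh (dist z (A • z)) - 1) := by
  have hd := UnitTangent.denom_ne_zero A z
  have him : (A • z).im = z.im / Complex.normSq ((A 1 0 : ℂ) * z + A 1 1) := by
    change ((A : GL (Fin 2) ℝ) • z).im = _
    rw [UpperHalfPlane.im_smul_eq_div_normSq]
    simp [UpperHalfPlane.denom]
  have hn : Complex.normSq ((A 1 0 : ℂ) * z + A 1 1) ≠ 0 := by simpa using hd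
  rw [UpperHalfPlane.cosh_dist, him, dist_eq_norm, ← Complex.normSq_eq_norm_sq,
    UnitTangent.coe_smul]
  have : (z : ℂ) - ((A 0 0 : ℂ) * z + A 0 1) / ((A 1 0 : ℂ) * z + A 1 1) =
    ((A 1 0 : ℂ) * z ^ 2 + ((A 1 1 : ℂ) - A 0 0) * z - A 0 1) / ((A 1 0 : ℂ) * z + A 1 1) := by
    rw [eq_div_iff hd, sub_mul, div_mul_cancel₀ _ hd]; ring
  rw [this, map_div₀]
  have := z.im_ne_zero
  field_simp
  ring

/-- By `normSq_eq_dist` the polynomial whose roots are the fixed points is `O(y)` at `x + i y`.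
Letting `y` tend to `0`, it vanishes at every real `x`, so all its coefficients are zero. -/
theorem mk_eq_one_of_dist_le {A : SL(2, ℝ)} {C : ℝ} (h : ∀ z : ℍ, dist z (A • z) ≤ C) :
    (QuotientGroup.mk A : PSL(2, ℝ)) = 1 := by
  have key : ∀ x : ℝ, A 1 0 * x ^ 2 + (A 1 1 - A 0 0) * x - A 0 1 = 0 := by
    intro x
    have hcont : Continuous fun y : ℝ => 2 * y ^ 2 * (Real.cosh C - 1) -
        Complex.normSq ((A 1 0 : ℂ) * (x + y * Complex.I) ^ 2 +
          ((A 1 1 : ℂ) - A 0 0) * (x + y * Complex.I) - A 0 1) := by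
      have := Complex.continuous_normSq
      fun_prop
    have hle : ∀ y : ℝ, 0 < y → 0 ≤ 2 * y ^ 2 * (Real.cosh C - 1) -
        Complex.normSq ((A 1 0 : ℂ) * (x + y * Complex.I) ^ 2 +
          ((A 1 1 : ℂ) - A 0 0) * (x + y * Complex.I) - A 0 1) := by
      intro y hy
      have hz := normSq_eq_dist A ⟨x + y * Complex.I, by simpa using hy⟩
      rw [sub_nonneg]
      refine hz.le.trans ?_
      have : (UpperHalfPlane.mk (x + y * Complex.I) (by simpa using hy)).im = y := by
        simp [UpperHalfPlane.im]
      rw [this]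
      refine mul_le_mul_of_nonneg_left (sub_le_sub_right ?_ _) (by positivity)
      exact Real.cosh_le_cosh.2 (abs_le_abs_of_nonneg dist_nonneg (h _))
    have h0 : 0 ≤ 2 * (0 : ℝ) ^ 2 * (Real.cosh C - 1) -
        Complex.normSq ((A 1 0 : ℂ) * (x + (0 : ℝ) * Complex.I) ^ 2 +
          ((A 1 1 : ℂ) - A 0 0) * (x + (0 : ℝ) * Complex.I) - A 0 1) :=
      ge_of_tendsto (x := 𝓝[>] (0 : ℝ)) (hcont.continuousWithinAt.tendsto)
        (eventually_nhdsWithin_of_forall hle)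
    have h1 : Complex.normSq ((A 1 0 : ℂ) * (x + (0 : ℝ) * Complex.I) ^ 2 +
          ((A 1 1 : ℂ) - A 0 0) * (x + (0 : ℝ) * Complex.I) - A 0 1) = 0 :=
      le_antisymm (by simpa using h0) (Complex.normSq_nonneg _)
    rw [Complex.normSq_eq_zero] at h1
    exact_mod_cast (by simpa using h1 : (A 1 0 : ℂ) * (x : ℂ) ^ 2 + ((A 1 1 : ℂ) - A 0 0) * x - A 0 1 = 0)
  have hb : A 0 1 = 0 := by simpa using key 0
  have h1 := key 1
  have h2 := key (-1)
  rw [hb] at h1 h2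
  have hc : A 1 0 = 0 := by linarith
  have had : A 1 1 = A 0 0 := by linarith
  have hdet := A.det_coe
  rw [Matrix.det_fin_two, hb, had] at hdet
  refine (QuotientGroup.eq_one_iff A).2 (Matrix.SpecialLinearGroup.mem_center_iff.2
    ⟨A 0 0, by simpa [sq] using hdet, ?_⟩)
  ext i j; fin_cases i <;> fin_cases j <;> simp [hb, hc, had]

/-- A central element has the same displacement at `z` and at `γ z`. By cocompactness its
displacement is bounded, and `mk_eq_one_of_dist_le` applies. -/
theorem IsSurfaceGroup.eq_one_of_commute {Γ : Subgroup PSL(2, ℝ)} (hΓ : IsSurfaceGroup Γ) (δ : Γ)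
    (h : ∀ γ : Γ, γ * δ = δ * γ) : δ = 1 := by
  obtain ⟨R, hR⟩ := hΓ.exists_radius
  have hcont : Continuous fun z : ℍ => dist z (δ • z) :=
    continuous_id.dist (continuous_const_smul (δ : PSL(2, ℝ)))
  obtain ⟨C, hC⟩ := (isCompact_closedBall UpperHalfPlane.I R).bddAbove_image hcont.continuousOn
  have hb : ∀ z : ℍ, dist z (δ • z) ≤ C := by
    intro z
    obtain ⟨γ, hγ⟩ := hR z
    have h1 : dist z (δ • z) = dist (γ • z) (δ • γ • z) := by
      rw [← mul_smul δ γ, ← h γ, mul_smul]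
      exact (dist_smul (γ : PSL(2, ℝ)) z (δ • z)).symm
    rw [h1]
    exact hC ⟨γ • z, hγ, rfl⟩
  obtain ⟨g, hg⟩ := δ
  refine Subtype.ext ?_
  induction g using QuotientGroup.induction_on with | H A => exact mk_eq_one_of_dist_le (A := A) hb

/-- The matrix with entries `a`, `b`, `c`, `d`. -/
def slMk {R : Type*} [CommRing R] (a b c d : R) (h : a * d - b * c = 1) : SL(2, R) :=
  ⟨!![a, b; c, d], by rw [Matrix.det_fin_two_of, h]⟩

theorem coe_slMk {R : Type*} [CommRing R] (a b c d : R) (h : a * d - b * c = 1) :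
    (slMk a b c d h : Matrix (Fin 2) (Fin 2) R) = !![a, b; c, d] := rfl

/-- The point `x + i y` of `ℍ`. -/
def hPt (x y : ℝ) (hy : 0 < y) : ℍ := ⟨x + y * Complex.I, by simpa using hy⟩

theorem coe_hPt (x y : ℝ) (hy : 0 < y) : (hPt x y hy : ℂ) = x + y * Complex.I := rfl

theorem im_hPt (x y : ℝ) (hy : 0 < y) : (hPt x y hy).im = y := by
  rw [← UpperHalfPlane.coe_im, coe_hPt]; simp

theorem psl_mk_neg (A : SL(2, ℝ)) : (QuotientGroup.mk (-A) : PSL(2, ℝ)) = QuotientGroup.mk A := by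
  refine QuotientGroup.eq.2 (Matrix.SpecialLinearGroup.mem_center_iff.2 ⟨-1, by simp, ?_⟩)
  ext i j; fin_cases i <;> fin_cases j <;> simp

theorem smul_eq_self_of_quadratic {A : SL(2, ℝ)} {z : ℍ}
    (h : (A 1 0 : ℂ) * z ^ 2 + ((A 1 1 : ℂ) - A 0 0) * z - A 0 1 = 0) : A • z = z := by
  have h1 := normSq_eq_dist A z
  rw [h, map_zero, eq_comm, mul_eq_zero] at h1
  have h2 : Real.cosh (dist z (A • z)) = 1 := by
    rcases h1 with h1 | h1
    · exact absurd h1 (by have := z.im_pos; positivity)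
    · linarith
  by_contra hne
  have := (Real.one_lt_cosh (x := dist z (A • z))).2 (dist_ne_zero.2 (Ne.symm hne))
  linarith

/-- The hypothesis `hx` says that `x` is a critical point of the fixed-point polynomial, which is
therefore real on the vertical line over `x`. -/
theorem quadratic_hPt {a b c d x y : ℝ} (hy : 0 < y) (hx : 2 * c * x = a - d) :
    (c : ℂ) * (hPt x y hy : ℂ) ^ 2 + ((d : ℂ) - a) * hPt x y hy - b =
      ((-(c * x ^ 2) - b - c * y ^ 2 : ℝ) : ℂ) := by
  have hx' : (2 : ℂ) * c * x = a - d := by exact_mod_cast hx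
  rw [coe_hPt]
  push_cast
  linear_combination (x + y * Complex.I) * hx' + c * y ^ 2 * Complex.I_sq

/-- A matrix of trace greater than `2` is conjugate to a diagonal one. -/
theorem exists_conj_geoSL {A : SL(2, ℝ)} (h : 2 < A 0 0 + A 1 1) :
    ∃ (P : SL(2, ℝ)) (t : ℝ), A = P * geoSL t * P⁻¹ := by
  have hdet := A.det_coe
  rw [Matrix.det_fin_two] at hdet
  set a := A 0 0
  set b := A 0 1
  set c := A 1 0
  set d := A 1 1
  have hA : (A : Matrix (Fin 2) (Fin 2) ℝ) = !![a, b; c, d] := Matrix.eta_fin_two _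
  set s := √((a + d) ^ 2 - 4)
  have hs : s ^ 2 = (a + d) ^ 2 - 4 := Real.sq_sqrt (by nlinarith)
  have hs0 : 0 < s := Real.sqrt_pos.2 (by nlinarith)
  set l := (a + d + s) / 2 with hl
  set m := (a + d - s) / 2 with hm
  have hlm : l * m = 1 := by rw [hl, hm]; nlinarith
  have hl0 : 0 < l := by rw [hl]; linarith
  have hlne : l - m ≠ 0 := by rw [hl, hm]; intro h; linarith
  have hsum : l + m = a + d := by rw [hl, hm]; ring
  obtain ⟨t, ht⟩ : ∃ t : ℝ, Real.exp (t / 2) = l :=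
    ⟨2 * Real.log l, by rw [mul_div_cancel_left₀ _ two_ne_zero, Real.exp_log hl0]⟩
  have ht' : Real.exp (-(t / 2)) = m := by
    rw [Real.exp_neg, ht]; exact inv_eq_of_mul_eq_one_right hlm
  suffices ∃ P : SL(2, ℝ), A * P = P * geoSL t from by
    obtain ⟨P, hP⟩ := this
    exact ⟨P, t, by rw [← hP, mul_inv_cancel_right]⟩
  have had : a * d - b * c = l * m := by rw [hlm, hdet]
  -- The columns of `P` are eigenvectors for the eigenvalues `l` and `m`, scaled to determinant `1`.
  -- The eigenvector `(l - d, c)` may vanish when `c = 0`, whence the separate cases.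
  by_cases hc : c = 0
  · have had' : (a - l) * (a - m) = 0 := by
      have : a * d = l * m := by rw [← had, hc]; ring
      linear_combination -a * hsum - this
    have hdd : d = l + m - a := by linarith
    rcases mul_eq_zero.1 had' with h1 | h1
    · have ha : a = l := by linarith
      have hd : d = m := by linarith
      refine ⟨slMk 1 (b / (m - l)) 0 1 (by ring), ?_⟩
      refine Subtype.ext ?_
      have : m - l ≠ 0 := by intro h; exact hlne (by linarith)
      rw [Matrix.SpecialLinearGroup.coe_mul, Matrix.SpecialLinearGroup.coe_mul, hA, coe_slMk,
        coe_geoSL, ht, ht', ha, hd, hc]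
      ext i j; fin_cases i <;> fin_cases j <;> simp
      field_simp; ring
    · have ha : a = m := by linarith
      have hd : d = l := by linarith
      refine ⟨slMk (b / (l - m)) (-1) 1 0 (by ring), ?_⟩
      refine Subtype.ext ?_
      rw [Matrix.SpecialLinearGroup.coe_mul, Matrix.SpecialLinearGroup.coe_mul, hA, coe_slMk,
        coe_geoSL, ht, ht', ha, hd, hc]
      ext i j; fin_cases i <;> fin_cases j <;> simp
      field_simp; ring
  · refine ⟨slMk (l - d) ((m - d) / (c * (l - m))) c (1 / (l - m)) (by field_simp; ring), ?_⟩
    refine Subtype.ext ?_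
    rw [Matrix.SpecialLinearGroup.coe_mul, Matrix.SpecialLinearGroup.coe_mul, hA, coe_slMk,
      coe_geoSL, ht, ht']
    have ha : a = l + m - d := by linarith
    have hb : b * c = (l + m - d) * d - l * m := by rw [← ha]; linarith
    ext i j; fin_cases i <;> fin_cases j <;> simp
    · rw [ha]; linear_combination hb
    · rw [ha]; field_simp; linear_combination hb
    · ring
    · field_simp; ring

/-- An elliptic element would have a fixed point in `ℍ`, against freeness, and a parabolic one would
have arbitrarily small displacement, against `exists_le_dist`. What remains is trace greater than
`2`, after a choice of sign. -/
theorem IsSurfaceGroup.exists_axis {Γ : Subgroup PSL(2, ℝ)} (hΓ : IsSurfaceGroup Γ) (γ : Γ)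
    (hγ : γ ≠ 1) : ∃ (P : SL(2, ℝ)) (t : ℝ),
      (γ : PSL(2, ℝ)) = QuotientGroup.mk (P * geoSL t * P⁻¹) := by
  obtain ⟨r, hr, hdist⟩ := hΓ.exists_le_dist
  obtain ⟨g, hg⟩ := γ
  obtain ⟨A, rfl, hA⟩ : ∃ A : SL(2, ℝ), QuotientGroup.mk A = g ∧ 0 ≤ A 0 0 + A 1 1 := by
    induction g using QuotientGroup.induction_on with | H A =>
    rcases le_total 0 (A 0 0 + A 1 1) with h | h
    · exact ⟨A, rfl, h⟩
    · refine ⟨-A, psl_mk_neg A, ?_⟩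
      simp; linarith
  have hfree : ∀ z : ℍ, A • z ≠ z := fun z hz => hγ (hΓ.free ⟨_, hg⟩ z hz)
  have hdist' : ∀ z : ℍ, 2 * z.im ^ 2 * (Real.cosh r - 1) ≤
      Complex.normSq ((A 1 0 : ℂ) * z ^ 2 + ((A 1 1 : ℂ) - A 0 0) * z - A 0 1) := by
    intro z
    rw [normSq_eq_dist]
    refine mul_le_mul_of_nonneg_left (sub_le_sub_right ?_ _) (by positivity)
    rw [Real.cosh_le_cosh, abs_of_pos hr, abs_of_nonneg dist_nonneg]
    exact hdist ⟨_, hg⟩ z hγ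
  have hcosh : 0 < Real.cosh r - 1 := by
    have := Real.one_lt_cosh.2 hr.ne'; linarith
  have hdet := A.det_coe
  rw [Matrix.det_fin_two] at hdet
  rcases lt_trichotomy 2 (A 0 0 + A 1 1) with h | h | h
  · obtain ⟨P, t, hP⟩ := exists_conj_geoSL h
    exact ⟨P, t, by rw [← hP]⟩
  · exfalso
    by_cases hc : A 1 0 = 0
    · have had : A 1 1 = A 0 0 := by rw [hc] at hdet; nlinarith
      have hsq := Real.sqrt_pos.2 hcosh
      -- For a translation by `b` the polynomial is the constant `-b`, while at this height the
      -- lower bound for its square is `2 (|b| + 1)²`.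
      have hz := hdist' (hPt 0 ((|A 0 1| + 1) / √(Real.cosh r - 1)) (by positivity))
      rw [im_hPt, quadratic_hPt _ (by rw [hc, had]; ring), Complex.normSq_ofReal, hc, div_pow,
        Real.sq_sqrt hcosh.le] at hz
      have h1 : 2 * ((|A 0 1| + 1) ^ 2 / (Real.cosh r - 1)) * (Real.cosh r - 1) =
        2 * (|A 0 1| + 1) ^ 2 := by field_simp
      have := abs_nonneg (A 0 1)
      have h4 := abs_mul_abs_self (A 0 1)
      rw [h1] at hz
      nlinarith
    · have hsq := Real.sqrt_pos.2 hcosh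
      have hc' : 0 < |A 1 0| := abs_pos.2 hc
      -- Above the real fixed point the polynomial is `-c y²`. For this `y` its square is `y² (cosh
      -- r - 1)`, half of the lower bound.
      have hy : 0 < √(Real.cosh r - 1) / |A 1 0| := by positivity
      have hz := hdist' (hPt ((A 0 0 - A 1 1) / (2 * A 1 0)) _ hy)
      have hq : A 1 0 * ((A 0 0 - A 1 1) / (2 * A 1 0)) ^ 2 + A 0 1 = 0 := by
        field_simp
        have h' : A 0 0 = 2 - A 1 1 := by linarith
        rw [h'] at hdet ⊢
        linear_combination -4 * hdet
      have hy2 : A 1 0 ^ 2 * (√(Real.cosh r - 1) / |A 1 0|) ^ 2 = Real.cosh r - 1 := by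
        rw [div_pow, Real.sq_sqrt hcosh.le, sq_abs]; field_simp
      set y := √(Real.cosh r - 1) / |A 1 0|
      rw [im_hPt, quadratic_hPt _ (by field_simp), Complex.normSq_ofReal] at hz
      have h5 : (-(A 1 0 * ((A 0 0 - A 1 1) / (2 * A 1 0)) ^ 2) - A 0 1 - A 1 0 * y ^ 2) =
        -(A 1 0 * y ^ 2) := by linarith
      rw [h5] at hz
      have h6 : -(A 1 0 * y ^ 2) * -(A 1 0 * y ^ 2) = y ^ 2 * (Real.cosh r - 1) := by
        rw [← hy2]; ring
      rw [h6] at hz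
      have : 0 < y ^ 2 * (Real.cosh r - 1) := by positivity
      linarith
  · exfalso
    have hc : A 1 0 ≠ 0 := by
      intro hc; rw [hc] at hdet; nlinarith [sq_nonneg (A 0 0 - A 1 1)]
    have hD : 0 < 4 - (A 0 0 + A 1 1) ^ 2 := by nlinarith
    have hsq := Real.sqrt_pos.2 hD
    have hc' : 0 < |A 1 0| := abs_pos.2 hc
    have hy : 0 < √(4 - (A 0 0 + A 1 1) ^ 2) / (2 * |A 1 0|) := by positivity
    refine hfree (hPt ((A 0 0 - A 1 1) / (2 * A 1 0)) _ hy) (smul_eq_self_of_quadratic ?_)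
    rw [quadratic_hPt _ (by field_simp), Complex.ofReal_eq_zero]
    rw [div_pow (√_), Real.sq_sqrt hD.le, mul_pow 2 |_|, sq_abs]
    field_simp
    linear_combination 4 * hdet

/-! ### Projective structures defined by developing maps -/

section DevelopedStructure

variable {E : Type*} [AddCommGroup E] [Module ℝ E] [TopologicalSpace E]
variable {X Y Z : Type*} [TopologicalSpace X] [TopologicalSpace Y] [TopologicalSpace Z]

/-- The developing map `dev` of the covering `π : Y → X` is well defined on `X` up to locally
projective maps. -/
structure IsDevelopingPair (π : Y → X) (dev : Y → ℙ ℝ E) : Prop where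
  surjective : Function.Surjective π
  isLocalHomeomorph : IsLocalHomeomorph π
  isLocalHomeomorph_dev : IsLocalHomeomorph dev
  deck : ∀ y y', π y = π y' → ∃ g : E ≃ₗ[ℝ] E, ∃ f : Y → Y, ContinuousAt f y ∧ f y = y' ∧
    ∀ᶠ z in 𝓝 y, π (f z) = π z ∧ dev (f z) = g • dev z

/-- The charts of the projective structure defined by a developing map. -/
def IsDevelopedChart (π : Y → X) (dev : Y → ℙ ℝ E) (φ : OpenPartialHomeomorph X (ℙ ℝ E)) : Prop :=
  ∀ y, π y ∈ φ.source → ∃ g : E ≃ₗ[ℝ] E, ∀ᶠ z in 𝓝 y, φ (π z) = g • dev z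

variable {π : Y → X} {dev : Y → ℙ ℝ E}

/-- The chart is a local section of `π` followed by `dev`. At the other points over its domain,
`deck` supplies the projective map by which it differs from `dev`. -/
theorem IsDevelopingPair.exists_chart (h : IsDevelopingPair π dev) (x : X) :
    ∃ φ : OpenPartialHomeomorph X (ℙ ℝ E), IsDevelopedChart π dev φ ∧ x ∈ φ.source := by
  obtain ⟨y, rfl⟩ := h.surjective x
  obtain ⟨e, hy, he⟩ := h.isLocalHomeomorph y
  obtain ⟨d, hd, hd'⟩ := h.isLocalHomeomorph_dev y
  refine ⟨e.symm.trans d, ?_, ?_⟩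
  · intro y' hy'
    rw [OpenPartialHomeomorph.trans_source, OpenPartialHomeomorph.symm_source] at hy'
    obtain ⟨h1, h2⟩ := hy'
    have h3 : π (e.symm (π y')) = π y' := by
      have := e.right_inv h1
      rwa [← he] at this
    obtain ⟨g, f, hf, hfy, hfz⟩ := h.deck y' (e.symm (π y')) h3.symm
    refine ⟨g, ?_⟩
    have hmem : e.symm (π y') ∈ e.source := e.map_target h1
    have hev : ∀ᶠ z in 𝓝 y', f z ∈ e.source :=
      hf.eventually_mem (by rw [hfy]; exact e.open_source.mem_nhds hmem)
    filter_upwards [hev, hfz] with z hz hz'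
    rw [← hz'.2, ← hz'.1, hd', OpenPartialHomeomorph.trans_apply]
    conv_lhs => rw [he]
    rw [e.left_inv hz]
  · rw [OpenPartialHomeomorph.trans_source, OpenPartialHomeomorph.symm_source]
    rw [he]
    refine ⟨e.map_source hy, ?_⟩
    rw [Set.mem_preimage, e.left_inv hy]; exact hd

/-- A property that holds near `y` for `z ↦ (π z, φ (π z))` holds near `φ (π y)`. -/
theorem eventually_chart (h : IsDevelopingPair π dev) {φ : OpenPartialHomeomorph X (ℙ ℝ E)} {y : Y}
    (hy : π y ∈ φ.source) {p : ℙ ℝ E → Prop} (hp : ∀ᶠ z in 𝓝 y, p (φ (π z))) :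
    ∀ᶠ a in 𝓝 (φ (π y)), p a := by
  have h1 : map (fun z => φ (π z)) (𝓝 y) = 𝓝 (φ (π y)) := by
    rw [show (fun z => φ (π z)) = φ ∘ π from rfl, ← Filter.map_map,
      h.isLocalHomeomorph.map_nhds_eq, φ.map_nhds_eq hy]
  rw [← h1]; exact hp

/-- Read in developed charts, `f` is `dev' ∘ F` expressed through `dev`, up to projective maps on
both sides. Compatibility of charts is the case where `F` and `f` are identities. -/
theorem IsDevelopingPair.locallyProjectiveOn {W : Type*} [TopologicalSpace W] {ρ : Z → W}
    {dev' : Z → ℙ ℝ E}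
    (h : IsDevelopingPair π dev) {F : Y → Z} {f : X → W}
    (hF : Continuous F) (hfF : ∀ y, f (π y) = ρ (F y))
    (hdev : ∀ y, ∃ g : E ≃ₗ[ℝ] E, ∀ᶠ z in 𝓝 y, dev' (F z) = g • dev z)
    {φ : OpenPartialHomeomorph X (ℙ ℝ E)} (hφ : IsDevelopedChart π dev φ)
    {ψ : OpenPartialHomeomorph W (ℙ ℝ E)} (hψ : IsDevelopedChart ρ dev' ψ) :
    LocallyProjectiveOn (ψ ∘ f ∘ φ.symm) (φ '' (φ.source ∩ f ⁻¹' ψ.source)) := by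
  rintro _ ⟨x, ⟨hx, hfx⟩, rfl⟩
  obtain ⟨y, rfl⟩ := h.surjective x
  obtain ⟨g, hg⟩ := hφ y hx
  obtain ⟨g', hg'⟩ := hψ (F y) (by rw [← hfF]; exact hfx)
  obtain ⟨g'', hg''⟩ := hdev y
  refine ⟨g' * g'' * g⁻¹, eventually_chart h hx ?_⟩
  have h1 : ∀ᶠ z in 𝓝 y, π z ∈ φ.source :=
    h.isLocalHomeomorph.continuous.continuousAt.eventually_mem (φ.open_source.mem_nhds hx)
  filter_upwards [hg, hF.continuousAt.eventually hg', hg'', h1] with z hz hz' hz'' hz1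
  rw [Function.comp_apply, Function.comp_apply, φ.left_inv hz1, hfF, hz', hz'', hz, mul_smul,
    mul_smul, inv_smul_smul]

theorem IsDevelopingPair.chartsCompatible (h : IsDevelopingPair π dev)
    {φ ψ : OpenPartialHomeomorph X (ℙ ℝ E)} (hφ : IsDevelopedChart π dev φ)
    (hψ : IsDevelopedChart π dev ψ) : ChartsCompatible φ ψ := by
  refine ⟨h.locallyProjectiveOn (F := id) (f := id) continuous_id (fun _ => rfl)
    (fun y => ⟨1, .of_forall fun z => (one_smul _ _).symm⟩) hφ hψ, ?_⟩
  have := h.locallyProjectiveOn (F := id) (f := id) continuous_id (fun _ => rfl)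
    (fun y => ⟨1, .of_forall fun z => (one_smul _ _).symm⟩) hψ hφ
  rwa [Set.inter_comm, Set.preimage_id] at this

/-- The projective structure defined by a developing map. -/
def IsDevelopingPair.projectiveStructure (h : IsDevelopingPair π dev) : ProjectiveStructure E X where
  atlas := {φ | IsDevelopedChart π dev φ}
  covers := h.exists_chart
  compatible _ hφ _ hψ := h.chartsCompatible hφ hψ
  maximal φ hφ y hy := by
    -- Compatibility with one developed chart `ψ` near `π y` suffices: `φ` is locally a projective
    -- map after `ψ`, and `ψ ∘ π` is locally one after `dev`.
    obtain ⟨ψ, hψ, hy'⟩ := h.exists_chart (π y)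
    obtain ⟨g, hg⟩ := (hφ ψ hψ).2 (ψ (π y)) ⟨π y, ⟨hy, hy'⟩, rfl⟩
    obtain ⟨g', hg'⟩ := hψ y hy'
    refine ⟨g * g', ?_⟩
    have h1 : ∀ᶠ z in 𝓝 y, π z ∈ ψ.source :=
      h.isLocalHomeomorph.continuous.continuousAt.eventually_mem (ψ.open_source.mem_nhds hy')
    have h2 : ContinuousAt (fun z => ψ (π z)) y :=
      (ψ.continuousAt hy').comp (h.isLocalHomeomorph.continuous.continuousAt)
    filter_upwards [hg', h1, h2.eventually hg] with z hz hz1 hz2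
    rw [mul_smul, ← hz, ← hz2, Function.comp_apply, ψ.left_inv hz1]

theorem IsDevelopingPair.isProjectiveMap {W : Type*} [TopologicalSpace W] {ρ : Z → W}
    {dev' : Z → ℙ ℝ E}
    (h : IsDevelopingPair π dev) (h' : IsDevelopingPair ρ dev') {F : Y → Z} {f : X → W}
    (hF : Continuous F) (hf : Continuous f) (hfF : ∀ y, f (π y) = ρ (F y))
    (hdev : ∀ y, ∃ g : E ≃ₗ[ℝ] E, ∀ᶠ z in 𝓝 y, dev' (F z) = g • dev z) :
    IsProjectiveMap h.projectiveStructure h'.projectiveStructure f :=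
  ⟨hf, fun _ hφ _ hψ => h.locallyProjectiveOn hF hfF hdev hφ hψ⟩

theorem isDevelopingPair_id {dev : Y → ℙ ℝ E} (h : IsLocalHomeomorph dev) :
    IsDevelopingPair (id : Y → Y) dev where
  surjective := Function.surjective_id
  isLocalHomeomorph := (Homeomorph.refl Y).isLocalHomeomorph
  isLocalHomeomorph_dev := h
  deck _ _ hy := ⟨1, id, continuousAt_id, hy, .of_forall fun _ => ⟨rfl, (one_smul _ _).symm⟩⟩

theorem isDevelopingMap_id {dev : Y → ℙ ℝ E} (h : IsLocalHomeomorph dev) :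
    IsDevelopingMap (isDevelopingPair_id h).projectiveStructure dev := by
  refine ⟨h.continuous, fun φ hφ a ha => ?_⟩
  obtain ⟨g, hg⟩ := hφ (φ.symm a) (φ.map_target ha)
  refine ⟨g⁻¹, ?_⟩
  filter_upwards [φ.open_target.mem_nhds ha, (φ.continuousAt_symm ha).eventually hg] with b hb hb'
  rw [Function.comp_apply, eq_inv_smul_iff, ← hb']
  exact φ.right_inv hb

end DevelopedStructure

/-! ### The developing map of the pullback -/

namespace HopfPullback

variable {Γ : Subgroup PSL(2, ℝ)} {q : Γ →* PSL(2, ℂ)} {u : EquivariantLocalHomeo q}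

/-- The projection of the pullback to `ℍ`. -/
def base (x : HopfPullback u) : ℍ := x.1.1

variable (u) in
/-- The point of the pullback over `z` defined by `p`. -/
def ofPair (z : ℍ) (p : RP3) (h : u.toFun z = hopf p) : HopfPullback u := ⟨(z, p), h⟩

theorem continuous_base : Continuous (base : HopfPullback u → ℍ) :=
  continuous_fst.comp continuous_subtype_val

theorem continuous_toRP3 : Continuous (toRP3 u) :=
  continuous_snd.comp continuous_subtype_val

theorem base_smul (γ : Γ) (x : HopfPullback u) : base (γ • x) = γ • base x := rfl

theorem toRP3_smul (γ : Γ) (x : HopfPullback u) : toRP3 u (γ • x) = q γ • toRP3 u x := rfl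

theorem hopf_toRP3 (x : HopfPullback u) : hopf (toRP3 u x) = u.toFun (base x) := x.2.symm

theorem ext' {x y : HopfPullback u} (h : base x = base y) (h' : toRP3 u x = toRP3 u y) : x = y :=
  Subtype.ext (Prod.ext h h')

theorem continuous_iff {X : Type*} [TopologicalSpace X] {f : X → HopfPullback u} :
    Continuous f ↔ Continuous (fun x => base (f x)) ∧ Continuous (fun x => toRP3 u (f x)) :=
  ⟨fun h => ⟨continuous_base.comp h, continuous_toRP3.comp h⟩,
    fun h => Continuous.subtype_mk (h.1.prodMk h.2) fun x => (f x).2⟩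

instance : ContinuousConstSMul Γ (HopfPullback u) := ⟨fun γ => continuous_iff.2
  ⟨(continuous_const_smul γ).comp continuous_base,
    (continuous_const_smul (q γ)).comp continuous_toRP3⟩⟩

open Classical in
-- Over a local inverse `e.symm` of `u` the inverse is `p ↦ (e.symm (hopf p), p)`. The value `x`
-- outside the target only makes the function total.
theorem isLocalHomeomorph_toRP3 : IsLocalHomeomorph (toRP3 u) := by
  refine IsLocalHomeomorph.mk _ fun x => ?_
  obtain ⟨e, hx, he⟩ := u.isLocalHomeomorph (base x)
  refine ⟨{ toFun := toRP3 u
            invFun := fun p => if h : hopf p ∈ e.target then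
              ofPair u (e.symm (hopf p)) p (by rw [he]; exact e.right_inv h) else x
            source := base ⁻¹' e.source
            target := hopf ⁻¹' e.target
            map_source' := fun y hy => ?_
            map_target' := fun p hp => ?_
            left_inv' := fun y hy => ?_
            right_inv' := fun p hp => ?_
            open_source := e.open_source.preimage continuous_base
            open_target := e.open_target.preimage continuous_hopf
            continuousOn_toFun := continuous_toRP3.continuousOn
            continuousOn_invFun := ?_ }, hx, fun _ _ => rfl⟩
  · rw [Set.mem_preimage, hopf_toRP3, he]; exact e.map_source hy
  · rw [Set.mem_preimage] at hp ⊢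
    rw [dif_pos hp]; exact e.map_target hp
  · have : hopf (toRP3 u y) ∈ e.target := by rw [hopf_toRP3, he]; exact e.map_source hy
    rw [dif_pos this]
    refine ext' ?_ rfl
    change e.symm (hopf (toRP3 u y)) = base y
    rw [hopf_toRP3, he, e.left_inv hy]
  · rw [Set.mem_preimage] at hp
    rw [dif_pos hp]; rfl
  · rw [continuousOn_iff_continuous_domRestrict]
    have : Set.domRestrict (hopf ⁻¹' e.target) (fun p => if h : hopf p ∈ e.target then
        ofPair u (e.symm (hopf p)) p (by rw [he]; exact e.right_inv h) else x) =
        fun p => ofPair u (e.symm (hopf p.1)) p.1 (by rw [he]; exact e.right_inv p.2) := by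
      ext1 p; exact dif_pos p.2
    rw [this, continuous_iff]
    refine ⟨?_, continuous_subtype_val⟩
    exact e.continuousOn_symm.comp_continuous (continuous_hopf.comp continuous_subtype_val)
      fun p => p.2

end HopfPullback

section Quotient

variable {E : Type*} [AddCommGroup E] [Module ℝ E] [TopologicalSpace E]

/-- An equivariant developing map defines a projective structure on the quotient. -/
theorem isDevelopingPair_quotient {G : Type*} [Group G] {Y : Type*} [TopologicalSpace Y]
    [MulAction G Y] (hq : IsQuotientCoveringMap (Quotient.mk (MulAction.orbitRel G Y)) G)
    {dev : Y → ℙ ℝ E} (hdev : IsLocalHomeomorph dev) (r : G → (E ≃ₗ[ℝ] E))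
    (hr : ∀ γ y, dev (γ • y) = r γ • dev y) :
    IsDevelopingPair (Quotient.mk (MulAction.orbitRel G Y)) dev where
  surjective := hq.surjective
  isLocalHomeomorph := hq.isCoveringMap.isLocalHomeomorph
  isLocalHomeomorph_dev := hdev
  deck y y' hy := by
    obtain ⟨γ, hγ⟩ := hq.apply_eq_iff_mem_orbit.1 hy.symm
    have := hq.toContinuousConstSMul
    exact ⟨r γ, (γ • ·), (continuous_const_smul γ).continuousAt, hγ,
      .of_forall fun z => ⟨hq.map_smul γ, hr γ z⟩⟩

end Quotient

/-- A real linear map of `ℂ²` that induces the action of `g` on `ℙ³(ℝ)`. -/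
def pslLift (g : PSL(2, ℂ)) : C2 ≃ₗ[ℝ] C2 := slReal (Quotient.out g)

theorem pslLift_smul (g : PSL(2, ℂ)) (p : RP3) : pslLift g • p = g • p := by
  conv_rhs => rw [← QuotientGroup.out_eq' g]
  rfl

/-! ### Geodesics of the hyperbolic plane -/

/-- The unit speed geodesic defined by a matrix. -/
def gpt (A : SL(2, ℝ)) (t : ℝ) : ℍ := (A • UnitTangent.axis t).pt

/-- The parameter of the orthogonal projection of `z` to the geodesic of `A`. -/
def proj (A : SL(2, ℝ)) (z : ℍ) : ℝ := Real.log ‖((A⁻¹ • z : ℍ) : ℂ)‖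

/-- The distance of `z` to the geodesic of `A`. -/
def gd (A : SL(2, ℝ)) (z : ℍ) : ℝ := dist z (gpt A (proj A z))

theorem gpt_eq (A : SL(2, ℝ)) (t : ℝ) : gpt A t = A • (UnitTangent.axis t).pt := rfl

theorem gpt_mul (A B : SL(2, ℝ)) (t : ℝ) : gpt (A * B) t = A • gpt B t := by
  rw [gpt_eq, gpt_eq, mul_smul]

theorem gpt_mul_geoSL (A : SL(2, ℝ)) (s t : ℝ) : gpt (A * geoSL s) t = gpt A (s + t) := by
  rw [gpt, mul_smul, geoSL_smul_axis, gpt]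

theorem gpt_neg (A : SL(2, ℝ)) (t : ℝ) : gpt (-A) t = gpt A t := by
  rw [gpt_eq, gpt_eq, ← psl_mk_smul_upperHalfPlane, psl_mk_neg, psl_mk_smul_upperHalfPlane]

theorem proj_mul (A B : SL(2, ℝ)) (z : ℍ) : proj (A * B) (A • z) = proj B z := by
  simp only [proj, mul_inv_rev, mul_smul, inv_smul_smul]

theorem gd_mul (A B : SL(2, ℝ)) (z : ℍ) : gd (A * B) (A • z) = gd B z := by
  rw [gd, gd, proj_mul, gpt_mul, dist_smul]

theorem proj_neg (A : SL(2, ℝ)) (z : ℍ) : proj (-A) z = proj A z := by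
  have : (-A)⁻¹ = -A⁻¹ := by simp
  rw [proj, proj, this, ← psl_mk_smul_upperHalfPlane, psl_mk_neg, psl_mk_smul_upperHalfPlane]

theorem gd_neg (A : SL(2, ℝ)) (z : ℍ) : gd (-A) z = gd A z := by
  rw [gd, gd, proj_neg, gpt_neg]

theorem norm_coe_pos (z : ℍ) : 0 < ‖(z : ℂ)‖ := norm_pos_iff.2 z.ne_zero

theorem im_le_norm (z : ℍ) : z.im ≤ ‖(z : ℂ)‖ := by
  rw [← UpperHalfPlane.coe_im]; exact Complex.im_le_norm _

theorem proj_mul_geoSL (A : SL(2, ℝ)) (s : ℝ) (z : ℍ) : proj (A * geoSL s) z = proj A z - s := by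
  have hinv : (geoSL s)⁻¹ = geoSL (-s) := by
    rw [inv_eq_iff_mul_eq_one, ← geoSL_add, add_neg_cancel]
    ext i j; rw [coe_geoSL]; fin_cases i <;> fin_cases j <;> simp
  have h : ((geoSL (-s) • (A⁻¹ • z) : ℍ) : ℂ) = Real.exp (-s) * (A⁻¹ • z : ℍ) := by
    rw [UnitTangent.coe_smul]
    have he : Real.exp (-s) = Real.exp (-s / 2) * Real.exp (-s / 2) := by
      rw [← Real.exp_add, add_halves]
    simp only [coe_geoSL, he]
    have := Complex.exp_ne_zero (-s / 2 : ℂ)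
    simp
    rw [Complex.exp_neg]
    field_simp
  rw [proj, proj, mul_inv_rev, mul_smul, hinv, h, norm_mul, Complex.norm_real,
    Real.norm_of_nonneg (Real.exp_pos _).le, Real.log_mul (Real.exp_pos _).ne' (norm_coe_pos _).ne',
    Real.log_exp]
  ring

theorem continuous_gpt : Continuous (fun x : SL(2, ℝ) × ℝ => gpt x.1 x.2) :=
  UnitTangent.continuous_pt.comp
    (continuous_fst.smul (UnitTangent.continuous_axis.comp continuous_snd))

theorem continuous_proj : Continuous (fun x : SL(2, ℝ) × ℍ => proj x.1 x.2) := by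
  refine Continuous.log ?_ fun x => (norm_coe_pos _).ne'
  exact (UpperHalfPlane.continuous_coe.comp ((continuous_fst.inv).smul continuous_snd)).norm

theorem continuous_gd : Continuous (fun x : SL(2, ℝ) × ℍ => gd x.1 x.2) := by
  have h : Continuous (fun x : SL(2, ℝ) × ℍ => gpt x.1 (proj x.1 x.2)) :=
    continuous_gpt.comp (g := fun y : SL(2, ℝ) × ℝ => gpt y.1 y.2)
      (f := fun x : SL(2, ℝ) × ℍ => (x.1, proj x.1 x.2)) (continuous_fst.prodMk continuous_proj)
  exact continuous_snd.dist h

theorem norm_axis (t : ℝ) : ‖((UnitTangent.axis t).pt : ℂ)‖ = Real.exp t := by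
  rw [UnitTangent.coe_pt_axis, norm_mul, Complex.norm_I, Complex.norm_real, mul_one,
    Real.norm_of_nonneg (Real.exp_pos _).le]

theorem im_axis (t : ℝ) : (UnitTangent.axis t).pt.im = Real.exp t := by
  rw [← UpperHalfPlane.coe_im, UnitTangent.coe_pt_axis]
  simp [-Complex.ofReal_exp]

theorem proj_gpt (A : SL(2, ℝ)) (t : ℝ) : proj A (gpt A t) = t := by
  rw [proj, gpt_eq, inv_smul_smul, norm_axis, Real.log_exp]

/-- The hyperbolic cosine of a distance in terms of the moduli. -/
theorem cosh_log_le (z w : ℍ) : Real.cosh (Real.log ‖(z : ℂ)‖ - Real.log ‖(w : ℂ)‖) - 1 ≤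
    (Real.cosh (dist z w) - 1) * (z.im * w.im / (‖(z : ℂ)‖ * ‖(w : ℂ)‖)) := by
  have hz := norm_coe_pos z
  have hw := norm_coe_pos w
  have h1 := z.im_pos
  have h2 := w.im_pos
  have h3 : Real.cosh (Real.log ‖(z : ℂ)‖ - Real.log ‖(w : ℂ)‖) - 1 =
      (‖(z : ℂ)‖ - ‖(w : ℂ)‖) ^ 2 / (2 * ‖(z : ℂ)‖ * ‖(w : ℂ)‖) := by
    rw [← Real.log_div hz.ne' hw.ne', Real.cosh_log (by positivity)]
    field_simp
    ring
  have h4 : (Real.cosh (dist z w) - 1) * (z.im * w.im / (‖(z : ℂ)‖ * ‖(w : ℂ)‖)) =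
      dist (z : ℂ) w ^ 2 / (2 * ‖(z : ℂ)‖ * ‖(w : ℂ)‖) := by
    rw [UpperHalfPlane.cosh_dist]
    field_simp
    ring
  rw [h3, h4]
  refine div_le_div_of_nonneg_right ?_ (by positivity)
  rw [← sq_abs]
  exact pow_le_pow_left₀ (abs_nonneg _) (by rw [dist_eq_norm]; exact abs_norm_sub_norm_le _ _) 2

theorem cosh_dist_axis (z : ℍ) (t : ℝ) : Real.cosh (dist z (UnitTangent.axis t).pt) =
    (‖(z : ℂ)‖ ^ 2 + Real.exp t ^ 2) / (2 * z.im * Real.exp t) := by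
  have h1 := z.im_pos
  have h2 := Real.exp_pos t
  rw [UpperHalfPlane.cosh_dist, im_axis, dist_eq_norm, UnitTangent.coe_pt_axis,
    ← Complex.normSq_eq_norm_sq, ← Complex.normSq_eq_norm_sq, Complex.normSq_apply,
    Complex.normSq_apply]
  simp only [Complex.sub_re, Complex.sub_im, Complex.mul_re, Complex.mul_im, Complex.ofReal_re,
    Complex.ofReal_im, Complex.I_re, Complex.I_im, UpperHalfPlane.coe_re, UpperHalfPlane.coe_im]
  field_simp
  ring

theorem dist_gpt (A : SL(2, ℝ)) (z : ℍ) (t : ℝ) :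
    dist z (gpt A t) = dist (A⁻¹ • z) (UnitTangent.axis t).pt := by
  rw [gpt_eq, ← dist_smul A (A⁻¹ • z), smul_inv_smul]

theorem cosh_gd (A : SL(2, ℝ)) (z : ℍ) :
    Real.cosh (gd A z) = ‖((A⁻¹ • z : ℍ) : ℂ)‖ / (A⁻¹ • z).im := by
  have h1 := (A⁻¹ • z).im_pos
  have h2 := norm_coe_pos (A⁻¹ • z)
  rw [gd, dist_gpt, cosh_dist_axis, proj, Real.exp_log h2]
  field_simp
  ring

theorem gd_nonneg (A : SL(2, ℝ)) (z : ℍ) : 0 ≤ gd A z := dist_nonneg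

/-- The distance from `z` to `i eᵗ` has hyperbolic cosine `(|z|² + e²ᵗ) / (2 Im z eᵗ)`, which is
least when `eᵗ = |z|`. Hence `proj` gives the nearest point of the geodesic. -/
theorem gd_le_dist (A : SL(2, ℝ)) (z : ℍ) (t : ℝ) : gd A z ≤ dist z (gpt A t) := by
  have h1 := (A⁻¹ • z).im_pos
  have h2 := norm_coe_pos (A⁻¹ • z)
  have h3 := Real.exp_pos t
  rw [← abs_of_nonneg (gd_nonneg A z), ← abs_of_nonneg (dist_nonneg (x := z) (y := gpt A t)),
    ← Real.cosh_le_cosh, cosh_gd, dist_gpt, cosh_dist_axis, div_le_div_iff₀ h1 (by positivity)]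
  nlinarith [sq_nonneg (‖((A⁻¹ • z : ℍ) : ℂ)‖ - Real.exp t), mul_pos h1 h3]

theorem gd_le_dist_add (A : SL(2, ℝ)) (z w : ℍ) : gd A z ≤ dist z w + gd A w :=
  (gd_le_dist A z (proj A w)).trans (dist_triangle _ _ _)

theorem gd_gpt (A : SL(2, ℝ)) (t : ℝ) : gd A (gpt A t) = 0 := by
  rw [gd, proj_gpt, dist_self]

theorem abs_proj_sub_le (A : SL(2, ℝ)) (z w : ℍ) : |proj A z - proj A w| ≤ dist z w := by
  rw [← abs_of_nonneg (dist_nonneg (x := z) (y := w)), ← Real.cosh_le_cosh]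
  have h := cosh_log_le (A⁻¹ • z) (A⁻¹ • w)
  rw [dist_smul] at h
  have h1 : (A⁻¹ • z).im * (A⁻¹ • w).im / (‖((A⁻¹ • z : ℍ) : ℂ)‖ * ‖((A⁻¹ • w : ℍ) : ℂ)‖) ≤ 1 :=
    div_le_one_of_le₀ (mul_le_mul (im_le_norm _) (im_le_norm _) (A⁻¹ • w).im_pos.le
      (norm_nonneg _)) (by positivity)
  have h2 := Real.one_le_cosh (dist z w)
  have h3 := mul_le_mul_of_nonneg_left h1 (sub_nonneg.2 h2)
  simp only [proj]
  linarith

theorem one_add_sq_div_two_le_cosh (x : ℝ) : 1 + x ^ 2 / 2 ≤ Real.cosh x := by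
  have h1 : Real.cosh x = 1 + 2 * Real.sinh (|x| / 2) ^ 2 := by
    have h := Real.cosh_two_mul (|x| / 2)
    rw [mul_div_cancel₀ _ two_ne_zero, Real.cosh_abs, Real.cosh_sq] at h
    linarith
  have h2 : |x| / 2 ≤ Real.sinh (|x| / 2) := Real.self_le_sinh_iff.2 (by positivity)
  have h3 := pow_le_pow_left₀ (by positivity : 0 ≤ |x| / 2) h2 2
  rw [div_pow, sq_abs] at h3
  linarith

/-- The projection to a geodesic contracts far from the geodesic. -/
theorem sq_proj_sub_le (A : SL(2, ℝ)) (z w : ℍ) {L : ℝ} (hL : dist z w ≤ L) :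
    (proj A z - proj A w) ^ 2 ≤ 2 * Real.cosh L / Real.cosh (gd A z) := by
  have h := cosh_log_le (A⁻¹ • z) (A⁻¹ • w)
  rw [dist_smul] at h
  have h1 : (A⁻¹ • w).im / ‖((A⁻¹ • w : ℍ) : ℂ)‖ ≤ 1 := div_le_one_of_le₀ (im_le_norm _) (norm_nonneg _)
  have h0 := (A⁻¹ • w).im_pos
  have h0' := norm_coe_pos (A⁻¹ • w)
  have hz := (A⁻¹ • z).im_pos
  have hz' := norm_coe_pos (A⁻¹ • z)
  have h4 : Real.cosh (dist z w) ≤ Real.cosh L := by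
    rw [Real.cosh_le_cosh]; exact abs_le_abs_of_nonneg dist_nonneg hL
  have h2 := Real.one_le_cosh (dist z w)
  -- The ratio `Im / |·|` at `z` is the inverse of `cosh (gd A z)`. It is the source of the
  -- contraction.
  have h5 : (Real.cosh (dist z w) - 1) * ((A⁻¹ • z).im * (A⁻¹ • w).im /
      (‖((A⁻¹ • z : ℍ) : ℂ)‖ * ‖((A⁻¹ • w : ℍ) : ℂ)‖)) ≤ Real.cosh L * (1 / Real.cosh (gd A z)) := by
    rw [cosh_gd, one_div_div, mul_div_mul_comm]
    refine mul_le_mul (by linarith) ?_ (by positivity) (Real.cosh_pos _).le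
    exact mul_le_of_le_one_right (by positivity) h1
  have h6 := one_add_sq_div_two_le_cosh (proj A z - proj A w)
  rw [mul_one_div] at h5
  rw [mul_div_assoc]
  simp only [proj] at h6 ⊢
  linarith

theorem dist_gpt_gpt (A : SL(2, ℝ)) (s t : ℝ) : dist (gpt A s) (gpt A t) = |s - t| := by
  rw [gpt_eq, gpt_eq, dist_smul, UpperHalfPlane.dist_of_re_eq (by
    rw [← UpperHalfPlane.coe_re, ← UpperHalfPlane.coe_re, UnitTangent.coe_pt_axis,
      UnitTangent.coe_pt_axis]; simp [-Complex.ofReal_exp]), im_axis, im_axis, Real.log_exp,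
      Real.log_exp, Real.dist_eq]

/-- The half turn, which reverses the geodesics. -/
def flip : SL(2, ℝ) := slMk 0 1 (-1) 0 (by ring)

theorem coe_flip_smul (z : ℍ) : ((flip • z : ℍ) : ℂ) = -(z : ℂ)⁻¹ := by
  rw [UnitTangent.coe_smul, flip]
  simp only [coe_slMk]
  simp

theorem coe_flip_inv_smul (z : ℍ) : ((flip⁻¹ • z : ℍ) : ℂ) = -(z : ℂ)⁻¹ := by
  have : flip⁻¹ = -flip := by
    rw [inv_eq_iff_mul_eq_one]
    refine Subtype.ext ?_
    rw [Matrix.SpecialLinearGroup.coe_mul, Matrix.SpecialLinearGroup.coe_neg, flip, coe_slMk]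
    ext i j; fin_cases i <;> fin_cases j <;> simp
  rw [this, ← psl_mk_smul_upperHalfPlane, psl_mk_neg, psl_mk_smul_upperHalfPlane, coe_flip_smul]

theorem gpt_mul_flip (A : SL(2, ℝ)) (t : ℝ) : gpt (A * flip) t = gpt A (-t) := by
  rw [gpt_mul, gpt_eq, gpt_eq]
  congr 1
  ext
  rw [coe_flip_smul, UnitTangent.coe_pt_axis, UnitTangent.coe_pt_axis, Real.exp_neg]
  push_cast
  rw [mul_inv, Complex.inv_I]; ring

theorem proj_mul_flip (A : SL(2, ℝ)) (z : ℍ) : proj (A * flip) z = -proj A z := by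
  rw [proj, proj, mul_inv_rev, mul_smul, coe_flip_inv_smul, norm_neg, norm_inv, Real.log_inv]

theorem gd_mul_flip (A : SL(2, ℝ)) (z : ℍ) : gd (A * flip) z = gd A z := by
  rw [gd, proj_mul_flip, gpt_mul_flip, neg_neg, gd]

/-- Bring `z` to `i` and rotate about `i`. Between the angles `0` and `π / 2` the real part of the
second point passes from `Re v` to `-Re v / |v|²`, so at some angle that point is on the imaginary
axis. -/
theorem exists_gpt_eq (z w : ℍ) : ∃ (A : SL(2, ℝ)) (s t : ℝ), z = gpt A s ∧ w = gpt A t := by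
  have key : ∀ v : ℍ, ∃ θ t, rotSL θ • v = (UnitTangent.axis t).pt := by
    intro v
    have hc : Continuous fun θ : ℝ => ((rotSL θ • v : ℍ) : ℂ).re :=
      Complex.continuous_re.comp (UpperHalfPlane.continuous_coe.comp
        (continuous_rotSL.smul continuous_const))
    have h0 : ((rotSL 0 • v : ℍ) : ℂ).re = (v : ℂ).re := by
      rw [UnitTangent.coe_smul]; simp [rotSL]
    have h1 : ((rotSL (Real.pi / 2) • v : ℍ) : ℂ).re = -((v : ℂ).re / Complex.normSq v) := by
      rw [UnitTangent.coe_smul]; simp [rotSL]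
    have hn : 0 < Complex.normSq v := Complex.normSq_pos.2 v.ne_zero
    obtain ⟨θ, hθ⟩ : ∃ θ, ((rotSL θ • v : ℍ) : ℂ).re = 0 := by
      rcases le_total 0 (v : ℂ).re with h | h
      · exact mem_range_of_exists_le_of_exists_ge hc
          ⟨Real.pi / 2, by rw [h1]; simp; positivity⟩ ⟨0, by rw [h0]; exact h⟩
      · exact mem_range_of_exists_le_of_exists_ge hc ⟨0, by rw [h0]; exact h⟩
          ⟨Real.pi / 2, by rw [h1, ← neg_div]; exact div_nonneg (by linarith) hn.le⟩
    refine ⟨θ, Real.log (rotSL θ • v).im, ?_⟩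
    ext
    rw [UnitTangent.coe_pt_axis, Real.exp_log (rotSL θ • v).im_pos]
    apply Complex.ext
    · rw [hθ]; simp
    · simp
  obtain ⟨θ, t, ht⟩ := key (z.toSL2R⁻¹ • w)
  refine ⟨z.toSL2R * (rotSL θ)⁻¹, 0, t, ?_, ?_⟩
  · rw [gpt_eq, UnitTangent.pt_axis_zero, mul_smul]
    have : (rotSL θ)⁻¹ • UpperHalfPlane.I = UpperHalfPlane.I := by
      rw [inv_smul_eq_iff, rotSL_smul_I]
    rw [this, UpperHalfPlane.toSL2R_smul_I]
  · rw [gpt_eq, ← ht, mul_smul, inv_smul_smul, smul_inv_smul]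

/-! ### Asymptotic rays -/

/-- Two rays at bounded distance, up to parametrization. -/
def Asymp (x y : ℝ → ℍ) : Prop :=
  ∃ (C : ℝ) (τ : ℝ → ℝ), Tendsto τ atTop atTop ∧ ∀ᶠ t in atTop, dist (x t) (y (τ t)) ≤ C

/-- A map that is Lipschitz at large scale. -/
def CoarseLip (L : ℝ) (f : ℍ → ℍ) : Prop := ∀ z w, dist (f z) (f w) ≤ L * dist z w + L

theorem Asymp.trans {x y z : ℝ → ℍ} (h : Asymp x y) (h' : Asymp y z) : Asymp x z := by
  obtain ⟨C, τ, hτ, hC⟩ := h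
  obtain ⟨C', τ', hτ', hC'⟩ := h'
  refine ⟨C + C', τ' ∘ τ, hτ'.comp hτ, ?_⟩
  filter_upwards [hC, hτ.eventually hC'] with t h1 h2
  exact (dist_triangle _ _ _).trans (add_le_add h1 h2)

theorem Asymp.map {x y : ℝ → ℍ} (h : Asymp x y) {L : ℝ} (hL : 0 ≤ L) {f : ℍ → ℍ}
    (hf : CoarseLip L f) : Asymp (f ∘ x) (f ∘ y) := by
  obtain ⟨C, τ, hτ, hC⟩ := h
  refine ⟨L * C + L, τ, hτ, hC.mono fun t ht => (hf _ _).trans ?_⟩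
  gcongr

theorem Asymp.tendsto_proj {x : ℝ → ℍ} {B : SL(2, ℝ)} (h : Asymp x (gpt B)) :
    Tendsto (fun t => proj B (x t)) atTop atTop := by
  obtain ⟨C, τ, hτ, hC⟩ := h
  refine tendsto_atTop_mono' atTop (hC.mono fun t ht => ?_) (tendsto_atTop_add_const_right _ (-C) hτ)
  have := abs_proj_sub_le B (x t) (gpt B (τ t))
  rw [proj_gpt] at this
  have := (abs_le.1 (this.trans ht)).1
  linarith

/-- The projection of `x` to the geodesic is continuous and tends to infinity, so every large time
`s` is attained at some `σ s`, where `x` is close to its projection. The times `σ s` tend to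
infinity because the projection is bounded on compact intervals. -/
theorem Asymp.symm {x : ℝ → ℍ} (hx : Continuous x) {B : SL(2, ℝ)} (h : Asymp x (gpt B)) :
    Asymp (gpt B) x := by
  have hp := h.tendsto_proj
  obtain ⟨C, τ, hτ, hC⟩ := h
  have hcont : Continuous fun t => proj B (x t) :=
    continuous_proj.comp (g := fun y : SL(2, ℝ) × ℍ => proj y.1 y.2) (f := fun t => (B, x t))
      (continuous_const.prodMk hx)
  obtain ⟨t₀, ht₀⟩ := eventually_atTop.1 hC
  have hex : ∀ s : ℝ, proj B (x t₀) ≤ s → ∃ t, t₀ ≤ t ∧ proj B (x t) = s := by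
    intro s hs
    obtain ⟨t₁, h1, h2⟩ := ((hp.eventually_ge_atTop s).and (eventually_ge_atTop t₀)).exists
    obtain ⟨t, ht, hts⟩ := intermediate_value_Icc h2 hcont.continuousOn ⟨hs, h1⟩
    exact ⟨t, ht.1, hts⟩
  choose! σ hσ hσ' using hex
  refine ⟨C, σ, ?_, ?_⟩
  · rw [tendsto_atTop]
    intro M
    obtain ⟨m, hm⟩ := (isCompact_Icc (a := t₀) (b := M)).bddAbove_image hcont.continuousOn
    filter_upwards [eventually_gt_atTop m, eventually_ge_atTop (proj B (x t₀))] with s hs hs'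
    by_contra! hlt
    have := hm ⟨σ s, ⟨hσ s hs', hlt.le⟩, rfl⟩
    simp only [hσ' s hs'] at this
    linarith
  · filter_upwards [eventually_ge_atTop (proj B (x t₀))] with s hs
    have h1 := (gd_le_dist B (x (σ s)) (τ (σ s))).trans (ht₀ _ (hσ s hs))
    rw [gd, hσ' s hs] at h1
    rwa [dist_comm]

/-- Seen from the frame `B`, the geodesic of `A` must end at `∞`. If the coefficient were not zero,
the points `M (i eᵗ)` would stay bounded for `t ≥ 0`, whereas `proj B` tends to infinity. -/
theorem Asymp.lower_left_eq_zero {A B : SL(2, ℝ)} (h : Asymp (gpt A) (gpt B)) :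
    (B⁻¹ * A) 1 0 = 0 := by
  by_contra hc
  have h1 := h.tendsto_proj
  set M := B⁻¹ * A with hM
  have h2 : ∀ t, proj B (gpt A t) = Real.log ‖((gpt M t : ℍ) : ℂ)‖ := fun t => by
    rw [proj, hM, gpt_mul]
  have hb : ∀ t, 0 ≤ t → ‖((gpt M t : ℍ) : ℂ)‖ ≤ (|M 0 0| + |M 0 1|) / |M 1 0| := by
    intro t ht
    have he : 1 ≤ Real.exp t := Real.one_le_exp ht
    have hc' : 0 < |M 1 0| := abs_pos.2 hc
    have hd := UnitTangent.denom_ne_zero M (UnitTangent.axis t).pt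
    rw [gpt_eq, UnitTangent.coe_smul, norm_div, div_le_div_iff₀ (norm_pos_iff.2 hd) hc',
      UnitTangent.coe_pt_axis]
    have h3 : |M 1 0| * Real.exp t ≤ ‖(M 1 0 : ℂ) * (Real.exp t * Complex.I) + M 1 1‖ := by
      refine le_trans (le_of_eq ?_) (Complex.abs_im_le_norm _)
      simp [-Complex.ofReal_exp, abs_mul]
    have h4 : ‖(M 0 0 : ℂ) * (Real.exp t * Complex.I) + M 0 1‖ ≤ |M 0 0| * Real.exp t + |M 0 1| := by
      refine (norm_add_le _ _).trans (le_of_eq ?_)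
      simp [-Complex.ofReal_exp]
    have h5 := abs_nonneg (M 0 0)
    have h6 := abs_nonneg (M 0 1)
    calc _ ≤ (|M 0 0| * Real.exp t + |M 0 1|) * |M 1 0| := by gcongr
      _ ≤ (|M 0 0| + |M 0 1|) * (|M 1 0| * Real.exp t) := by nlinarith [mul_nonneg h6 hc'.le]
      _ ≤ _ := by gcongr
  obtain ⟨t, ht, ht0⟩ := ((h1.eventually_gt_atTop (Real.log ((|M 0 0| + |M 0 1|) / |M 1 0|))).and
    (eventually_ge_atTop 0)).exists
  rw [h2] at ht
  exact absurd ht (not_lt.2 (Real.log_le_log (norm_coe_pos _) (hb t ht0)))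

theorem eq_geoSL_of_diagonal {M : SL(2, ℝ)} (hc : M 1 0 = 0) (hb : M 0 1 = 0) :
    ∃ t, M = geoSL t ∨ M = -geoSL t := by
  have hdet := M.det_coe
  rw [Matrix.det_fin_two, hb, zero_mul, sub_zero] at hdet
  have hne : M 0 0 ≠ 0 := left_ne_zero_of_mul_eq_one hdet
  have hd : M 1 1 = (M 0 0)⁻¹ := eq_inv_of_mul_eq_one_right hdet
  obtain ⟨a, ha⟩ : ∃ a, a = M 0 0 := ⟨_, rfl⟩
  have hM : (M : Matrix (Fin 2) (Fin 2) ℝ) = !![a, 0; 0, a⁻¹] := by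
    ext i j; fin_cases i <;> fin_cases j <;> simp [hb, hc, hd, ha]
  rw [← ha] at hne
  rcases lt_or_gt_of_ne hne with h | h
  · refine ⟨2 * Real.log (-a), Or.inr (Subtype.ext ?_)⟩
    rw [Matrix.SpecialLinearGroup.coe_neg, coe_geoSL, hM, mul_div_cancel_left₀ _ two_ne_zero,
      Real.exp_neg, Real.exp_log (by linarith)]
    ext i j; fin_cases i <;> fin_cases j <;> simp [inv_neg]
  · refine ⟨2 * Real.log a, Or.inl (Subtype.ext ?_)⟩
    rw [coe_geoSL, hM, mul_div_cancel_left₀ _ two_ne_zero, Real.exp_neg, Real.exp_log h]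

/-- Two geodesics that are asymptotic at both ends are equal. -/
theorem eq_mul_geoSL_of_asymp {A B : SL(2, ℝ)} (h : Asymp (gpt A) (gpt B))
    (h' : Asymp (gpt (A * flip)) (gpt (B * flip))) :
    ∃ t, A = B * geoSL t ∨ A = -(B * geoSL t) := by
  have hc := h.lower_left_eq_zero
  have hb := h'.lower_left_eq_zero
  have hb' : (B⁻¹ * A) 0 1 = 0 := by
    have h1 : (B * flip)⁻¹ * (A * flip) = flip⁻¹ * (B⁻¹ * A) * flip := by group
    have h2 : flip⁻¹ = -flip := by
      rw [inv_eq_iff_mul_eq_one]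
      refine Subtype.ext ?_
      rw [Matrix.SpecialLinearGroup.coe_mul, Matrix.SpecialLinearGroup.coe_neg, flip, coe_slMk]
      ext i j; fin_cases i <;> fin_cases j <;> simp
    rw [h1, h2, Matrix.SpecialLinearGroup.coe_mul, Matrix.SpecialLinearGroup.coe_mul (-flip),
      Matrix.SpecialLinearGroup.coe_neg, flip, coe_slMk,
      Matrix.eta_fin_two ((B⁻¹ * A : SL(2, ℝ)) : Matrix (Fin 2) (Fin 2) ℝ)] at hb
    simpa using hb
  obtain ⟨t, ht | ht⟩ := eq_geoSL_of_diagonal hc hb'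
  · exact ⟨t, Or.inl (by rw [← ht, mul_inv_cancel_left])⟩
  · exact ⟨t, Or.inr (by rw [← mul_neg, ← ht, mul_inv_cancel_left])⟩

/-! ### Quasi-geodesics stay close to geodesics -/

/-- The bound in the Morse lemma. -/
def morseDist (L : ℝ) : ℝ := 8 * L ^ 2 * Real.cosh (2 * L)

/-- The bound in the Morse lemma. -/
def morseBound (L : ℝ) : ℝ := morseDist L + (4 * L * morseDist L + 2 * L) * (2 * L)

/-- Consider the longest excursion `[a, b]` around `i` whose interior points are farther than `D`
from the geodesic. There each step moves the projection by at most `1 / (2 L)`, so that `dist (x a)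
(x b) ≤ 2 D + m / (2 L)` for an excursion of `m` steps. The lower bound `hx'` then gives `m ≤ 4 L D
+ 2 L`, and `x i` is at distance at most `2 L m` from `x a`. -/
theorem morse_discrete {L : ℝ} (hL : 1 ≤ L) {x : ℕ → ℍ} (hx : ∀ k, dist (x k) (x (k + 1)) ≤ 2 * L)
    (hx' : ∀ j k : ℕ, j ≤ k → ((k : ℝ) - j) ≤ L * dist (x j) (x k) + L) {B : SL(2, ℝ)} {n : ℕ}
    (h0 : gd B (x 0) = 0) (hn : gd B (x n) = 0) {i : ℕ} (hi : i ≤ n) :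
    gd B (x i) ≤ morseBound L := by
  set D := morseDist L with hD
  have hLpos : 0 < L := by linarith
  have hD0 : 0 ≤ D := by rw [hD, morseDist]; have := Real.cosh_pos (2 * L); positivity
  have hcoshD : D ≤ Real.cosh D :=
    (Real.self_le_sinh_iff.2 hD0).trans (Real.sinh_lt_cosh D).le
  by_cases hgi : gd B (x i) ≤ D
  · refine hgi.trans ?_
    rw [morseBound, ← hD]
    have : 0 ≤ (4 * L * D + 2 * L) * (2 * L) := by positivity
    linarith
  push Not at hgi
  classical
  set a := Nat.findGreatest (fun k => gd B (x k) ≤ D) i with ha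
  have ha1 : gd B (x a) ≤ D :=
    Nat.findGreatest_spec (P := fun k => gd B (x k) ≤ D) (m := 0) (Nat.zero_le i) (by simpa [h0] using hD0)
  have hai : a < i := by
    refine lt_of_le_of_ne (Nat.findGreatest_le _) fun h => ?_
    rw [h] at ha1; linarith
  have ha2 : ∀ k, a < k → k ≤ i → D < gd B (x k) := fun k hk hki =>
    not_le.1 (Nat.findGreatest_is_greatest hk hki)
  have hexb : ∃ k, i ≤ k ∧ gd B (x k) ≤ D := ⟨n, hi, by rw [hn]; exact hD0⟩
  set b := Nat.find hexb with hb
  obtain ⟨hib, hb1⟩ : i ≤ b ∧ gd B (x b) ≤ D := Nat.find_spec hexb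
  have hb2 : ∀ k, i ≤ k → k < b → D < gd B (x k) := fun k hk hkb => by
    have := Nat.find_min hexb hkb
    push Not at this; exact this hk
  have hstep1 : ∀ z w : ℍ, dist z w ≤ 2 * L → D < gd B z → |proj B z - proj B w| ≤ 1 / (2 * L) := by
    intro z w hzw hz
    have h1 := sq_proj_sub_le B z w hzw
    have h2 : D ≤ Real.cosh (gd B z) := hcoshD.trans (Real.cosh_le_cosh.2 (by
      rw [abs_of_nonneg hD0, abs_of_nonneg (gd_nonneg _ _)]; exact hz.le))
    -- The value `8 L² cosh (2 L)` of `morseDist` is chosen for this inequality, with `cosh (gd B z)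
    -- ≥ D`.
    have h3 : 2 * Real.cosh (2 * L) / Real.cosh (gd B z) ≤ (1 / (2 * L)) ^ 2 := by
      rw [div_pow, div_le_div_iff₀ (Real.cosh_pos _) (by positivity)]
      rw [hD, morseDist] at h2
      nlinarith
    exact abs_le_of_sq_le_sq (h1.trans h3) (by positivity)
  have hstep : ∀ l, a ≤ l → l < b → |proj B (x l) - proj B (x (l + 1))| ≤ 1 / (2 * L) := by
    intro l hal hlb
    rcases eq_or_lt_of_le hal with h | h
    -- The point `x a` itself is within `D`, so the first step is estimated from its other end.
    · rw [abs_sub_comm]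
      refine hstep1 _ _ (by rw [dist_comm]; exact hx l) (ha2 _ (by omega) (by omega))
    · refine hstep1 _ _ (hx l) ?_
      rcases le_total l i with h' | h'
      · exact ha2 l h h'
      · exact hb2 l h' hlb
  have hsum : ∀ m, a + m ≤ b → |proj B (x a) - proj B (x (a + m))| ≤ m * (1 / (2 * L)) ∧
      dist (x a) (x (a + m)) ≤ m * (2 * L) := by
    intro m
    induction m with
    | zero => intro _; simp
    | succ m ih =>
      intro hm
      obtain ⟨h1, h2⟩ := ih (by omega)
      refine ⟨(abs_sub_le _ (proj B (x (a + m))) _).trans ?_, (dist_triangle _ (x (a + m)) _).trans ?_⟩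
      · have := hstep (a + m) (by omega) (by omega)
        push_cast; rw [add_mul, one_mul]; exact add_le_add h1 this
      · push_cast; rw [add_mul, one_mul]; exact add_le_add h2 (hx _)
  obtain ⟨m, hm⟩ := Nat.exists_eq_add_of_le (hai.le.trans hib)
  have hS := (hsum m hm.ge).1
  rw [← hm] at hS
  have hdist : dist (x a) (x b) ≤ D + m * (1 / (2 * L)) + D := by
    have h1 := dist_triangle4 (x a) (gpt B (proj B (x a))) (gpt B (proj B (x b))) (x b)
    have h2 : dist (gpt B (proj B (x b))) (x b) = gd B (x b) := dist_comm _ _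
    have h3 : dist (x a) (gpt B (proj B (x a))) = gd B (x a) := rfl
    rw [dist_gpt_gpt, h2, h3] at h1
    linarith
  have hmb : (m : ℝ) ≤ 4 * L * D + 2 * L := by
    have h1 := hx' a b (by omega)
    have h2 : (b : ℝ) - a = m := by rw [hm]; push_cast; ring
    rw [h2] at h1
    have h3 := mul_le_mul_of_nonneg_left hdist hLpos.le
    have h4 : L * (D + m * (1 / (2 * L)) + D) = 2 * L * D + m / 2 := by field_simp; ring
    linarith
  obtain ⟨k, hk⟩ := Nat.exists_eq_add_of_le hai.le
  have hkm : (k : ℝ) ≤ m := by exact_mod_cast (by omega : k ≤ m)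
  have h1 := (hsum k (by omega)).2
  rw [← hk] at h1
  have h2 := gd_le_dist_add B (x i) (x a)
  rw [dist_comm] at h2
  have h3 : (k : ℝ) * (2 * L) ≤ (4 * L * D + 2 * L) * (2 * L) := by
    gcongr; exact hkm.trans hmb
  rw [morseBound, ← hD]
  linarith

/-! ### Closed relations and homeomorphisms -/

/-- A cluster point `y` of `f` at `x` makes `(x, y)` adherent to the graph, so `y = f x`. With
values in a compact set near `x`, a unique cluster point is a limit. -/
theorem continuous_of_isClosed_graph {X Y : Type*} [TopologicalSpace X] [TopologicalSpace Y]
    {f : X → Y} (hcl : IsClosed {p : X × Y | f p.1 = p.2})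
    (hK : ∀ x, ∃ K : Set Y, IsCompact K ∧ ∀ᶠ x' in 𝓝 x, f x' ∈ K) : Continuous f := by
  rw [continuous_iff_continuousAt]
  intro x
  obtain ⟨K, hKc, hK⟩ := hK x
  refine hKc.tendsto_nhds_of_unique_mapClusterPt hK fun y _ hy => ?_
  have h1 : MapClusterPt (x, y) (𝓝 x) (fun x' => (x', f x')) := by
    rw [mapClusterPt_iff_ultrafilter] at hy ⊢
    obtain ⟨U, hU, hUy⟩ := hy
    exact ⟨U, hU, (tendsto_id.mono_left hU).prodMk_nhds hUy⟩
  have h2 : (x, y) ∈ {p : X × Y | f p.1 = p.2} := by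
    rw [← hcl.closure_eq]
    exact mem_closure_iff_clusterPt.2 (ClusterPt.mono h1 (by
      rw [le_principal_iff]; exact mem_map.2 (univ_mem' fun _ => rfl)))
  exact h2.symm

/-- A closed relation that is the graph of a bijection, locally bounded in both directions, is the
graph of a homeomorphism. -/
theorem exists_homeomorph_of_isClosed {X Y : Type*} [TopologicalSpace X] [TopologicalSpace Y]
    {r : X → Y → Prop} (hcl : IsClosed {p : X × Y | r p.1 p.2}) (h1 : ∀ x, ∃! y, r x y)
    (h2 : ∀ y, ∃! x, r x y)
    (k1 : ∀ x, ∃ K, IsCompact K ∧ ∀ᶠ x' in 𝓝 x, ∀ y, r x' y → y ∈ K)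
    (k2 : ∀ y, ∃ K, IsCompact K ∧ ∀ᶠ y' in 𝓝 y, ∀ x, r x y' → x ∈ K) :
    ∃ h : X ≃ₜ Y, ∀ x y, r x y ↔ h x = y := by
  choose f hf hf' using h1
  choose g hg hg' using h2
  have ef : ∀ x y, r x y ↔ f x = y := fun x y =>
    ⟨fun h => (hf' x y h).symm, fun h => h ▸ hf x⟩
  have eg : ∀ x y, r x y ↔ g y = x := fun x y =>
    ⟨fun h => (hg' y x h).symm, fun h => h ▸ hg y⟩
  refine ⟨{ toFun := f, invFun := g, left_inv := fun x => (eg _ _).1 (hf x),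
            right_inv := fun y => (ef _ _).1 (hg y),
            continuous_toFun := ?_, continuous_invFun := ?_ }, ef⟩
  · refine continuous_of_isClosed_graph (by simpa only [ef] using hcl) fun x => ?_
    obtain ⟨K, hK, h⟩ := k1 x
    exact ⟨K, hK, h.mono fun x' hx' => hx' _ (hf x')⟩
  · refine continuous_of_isClosed_graph ?_ fun y => ?_
    · have := hcl.preimage continuous_swap
      simpa only [Set.preimage_ofPred_eq, Prod.fst_swap, Prod.snd_swap, eg] using this
    obtain ⟨K, hK, h⟩ := k2 y
    exact ⟨K, hK, h.mono fun y' hy' => hy' _ (hg y')⟩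

/-! ### Shadows of quasi-geodesics -/

theorem gd_mul_geoSL (A : SL(2, ℝ)) (s : ℝ) (z : ℍ) : gd (A * geoSL s) z = gd A z := by
  rw [gd, proj_mul_geoSL, gpt_mul_geoSL, add_sub_cancel, gd]

/-- A homeomorphism of the hyperbolic plane that is Lipschitz at large scale, together with its
inverse. -/
structure CoarseHomeo (L : ℝ) (f : ℍ ≃ₜ ℍ) : Prop where
  one_le : 1 ≤ L
  lip : CoarseLip L f
  lip_symm : CoarseLip L f.symm

theorem CoarseHomeo.symm {L : ℝ} {f : ℍ ≃ₜ ℍ} (hf : CoarseHomeo L f) : CoarseHomeo L f.symm :=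
  ⟨hf.one_le, hf.lip_symm, hf.lip⟩

/-- The distance at which geodesics shadow quasi-geodesics. -/
def shadowDist (L : ℝ) : ℝ := morseBound L + 2 * L

/-- A time after which quasi-geodesics have progressed. -/
def shadowTime (L : ℝ) : ℝ := L * (2 * shadowDist L + 2)

theorem shadowDist_nonneg {L : ℝ} (hL : 1 ≤ L) : 0 ≤ shadowDist L := by
  have h := (Real.cosh_pos (2 * L)).le
  have : 0 ≤ L := by linarith
  rw [shadowDist, morseBound, morseDist]
  positivity

theorem shadowTime_pos {L : ℝ} (hL : 1 ≤ L) : 0 < shadowTime L := by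
  have := shadowDist_nonneg hL
  rw [shadowTime]; positivity

/-- The geodesic of `B` follows the image by `f` of the geodesic of `A`. -/
structure Shadow (L : ℝ) (f : ℍ ≃ₜ ℍ) (A B : SL(2, ℝ)) : Prop where
  near : ∀ t, gd B (f (gpt A t)) ≤ shadowDist L
  progress : ∀ t, proj B (f (gpt A t)) + 1 ≤ proj B (f (gpt A (t + shadowTime L)))

section

variable {L : ℝ} {f : ℍ ≃ₜ ℍ}

theorem continuous_gpt_comp {X : Type*} [TopologicalSpace X] {A : X → SL(2, ℝ)} {t : X → ℝ}
    (hA : Continuous A) (ht : Continuous t) : Continuous fun x => gpt (A x) (t x) :=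
  continuous_gpt.comp (g := fun y : SL(2, ℝ) × ℝ => gpt y.1 y.2) (f := fun x => (A x, t x))
    (hA.prodMk ht)

theorem continuous_proj_comp {X : Type*} [TopologicalSpace X] {A : X → SL(2, ℝ)} {z : X → ℍ}
    (hA : Continuous A) (hz : Continuous z) : Continuous fun x => proj (A x) (z x) :=
  continuous_proj.comp (g := fun y : SL(2, ℝ) × ℍ => proj y.1 y.2) (f := fun x => (A x, z x))
    (hA.prodMk hz)

theorem continuous_gd_comp {X : Type*} [TopologicalSpace X] {A : X → SL(2, ℝ)} {z : X → ℍ}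
    (hA : Continuous A) (hz : Continuous z) : Continuous fun x => gd (A x) (z x) :=
  continuous_gd.comp (g := fun y : SL(2, ℝ) × ℍ => gd y.1 y.2) (f := fun x => (A x, z x))
    (hA.prodMk hz)

theorem isClosed_shadow (L : ℝ) (f : ℍ ≃ₜ ℍ) :
    IsClosed {x : SL(2, ℝ) × SL(2, ℝ) | Shadow L f x.1 x.2} := by
  have : {x : SL(2, ℝ) × SL(2, ℝ) | Shadow L f x.1 x.2} =
      (⋂ t, {x | gd x.2 (f (gpt x.1 t)) ≤ shadowDist L}) ∩
      ⋂ t, {x | proj x.2 (f (gpt x.1 t)) + 1 ≤ proj x.2 (f (gpt x.1 (t + shadowTime L)))} := by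
    ext x
    simp only [Set.mem_inter_iff, Set.mem_iInter, Set.mem_ofPred_eq]
    exact ⟨fun h => ⟨h.1, h.2⟩, fun h => ⟨h.1, h.2⟩⟩
  rw [this]
  have h1 : ∀ t, Continuous fun x : SL(2, ℝ) × SL(2, ℝ) => f (gpt x.1 t) := fun t =>
    f.continuous.comp (continuous_gpt_comp continuous_fst continuous_const)
  exact (isClosed_iInter fun t =>
      isClosed_le (continuous_gd_comp continuous_snd (h1 t)) continuous_const).inter
    (isClosed_iInter fun t => isClosed_le ((continuous_proj_comp continuous_snd (h1 t)).add continuous_const)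
      (continuous_proj_comp continuous_snd (h1 (t + shadowTime L))))

theorem CoarseHomeo.dist_le (hf : CoarseHomeo L f) (A : SL(2, ℝ)) (s t : ℝ) :
    dist (f (gpt A s)) (f (gpt A t)) ≤ L * |s - t| + L := by
  rw [← dist_gpt_gpt A]; exact hf.lip _ _

theorem CoarseHomeo.le_dist (hf : CoarseHomeo L f) (A : SL(2, ℝ)) (s t : ℝ) :
    |s - t| ≤ L * dist (f (gpt A s)) (f (gpt A t)) + L := by
  have := hf.lip_symm (f (gpt A s)) (f (gpt A t))
  rwa [f.symm_apply_apply, f.symm_apply_apply, dist_gpt_gpt] at this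

/-- `morse_discrete` is applied to the images of the times `-n, -n + 1, ..., n` and to the geodesic
through the two extreme ones. Other times are within `1` of these, which costs `2 L`. Sliding the
frame along its geodesic normalizes the projection at time `0`. -/
theorem CoarseHomeo.exists_near_segment (hf : CoarseHomeo L f) (A : SL(2, ℝ)) (n : ℕ) :
    ∃ B : SL(2, ℝ), proj B (f (gpt A 0)) = 0 ∧
      ∀ t : ℝ, |t| ≤ n → gd B (f (gpt A t)) ≤ shadowDist L := by
  have hL := hf.one_le
  obtain ⟨B, s, t, hs, ht⟩ := exists_gpt_eq (f (gpt A (-n))) (f (gpt A n))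
  have key : ∀ i, i ≤ 2 * n → gd B (f (gpt A (-n + i))) ≤ morseBound L := by
    intro i hi
    refine morse_discrete hL (x := fun k : ℕ => f (gpt A (-n + k))) (fun k => ?_)
      (fun j k hjk => ?_) (n := 2 * n) ?_ ?_ hi
    · refine (hf.dist_le A _ _).trans (le_of_eq ?_)
      have : (-n + k - (-n + (k + 1 : ℕ)) : ℝ) = -1 := by push_cast; ring
      rw [this]; simp; ring
    · have := hf.le_dist A (-n + j) (-n + k)
      rw [abs_sub_comm] at this
      refine le_trans (le_trans (le_of_eq ?_) (le_abs_self _)) this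
      ring
    · simp only [Nat.cast_zero, add_zero]; rw [hs, gd_gpt]
    · have : (-n + (2 * n : ℕ) : ℝ) = n := by push_cast; ring
      simp only [this]; rw [ht, gd_gpt]
  refine ⟨B * geoSL (proj B (f (gpt A 0))), by rw [proj_mul_geoSL, sub_self], fun t ht => ?_⟩
  obtain ⟨h1, h2⟩ := abs_le.1 ht
  rw [gd_mul_geoSL]
  have h3 : (0 : ℝ) ≤ t + n := by linarith
  have h4 := Nat.floor_le h3
  have h5 := (Nat.lt_floor_add_one (t + n)).le
  refine (gd_le_dist_add B _ (f (gpt A (-n + ⌊t + n⌋₊)))).trans ?_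
  have h6 : |t - (-n + ⌊t + n⌋₊)| ≤ 1 := abs_le.2 ⟨by linarith, by linarith⟩
  have h7 := key ⌊t + n⌋₊ (by
    have : (⌊t + n⌋₊ : ℝ) ≤ (2 * n : ℕ) := by push_cast; linarith
    exact_mod_cast this)
  have h8 := hf.dist_le A t (-n + ⌊t + n⌋₊)
  rw [shadowDist]
  nlinarith

/-- The frames of `exists_near_segment` form nested closed sets. The normalized projection and
nearness at time `0` confine them to a compact set, by properness of the action, so that they have a
common point. -/
theorem CoarseHomeo.exists_near (hf : CoarseHomeo L f) (A : SL(2, ℝ)) :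
    ∃ B : SL(2, ℝ), ∀ t, gd B (f (gpt A t)) ≤ shadowDist L := by
  have hcl : ∀ t, IsClosed {B : SL(2, ℝ) | gd B (f (gpt A t)) ≤ shadowDist L} := fun t =>
    isClosed_le (continuous_gd_comp continuous_id continuous_const) continuous_const
  have hcl0 : IsClosed {B : SL(2, ℝ) | proj B (f (gpt A 0)) = 0} :=
    isClosed_eq (continuous_proj_comp continuous_id continuous_const) continuous_const
  have hcl' : ∀ n : ℕ, IsClosed {B : SL(2, ℝ) | proj B (f (gpt A 0)) = 0 ∧
      ∀ t : ℝ, |t| ≤ n → gd B (f (gpt A t)) ≤ shadowDist L} := fun n => by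
    have := hcl0.inter (isClosed_biInter (s := {t : ℝ | |t| ≤ n}) fun t _ => hcl t)
    convert this using 1
    ext B; simp
  have hc : IsCompact {B : SL(2, ℝ) | proj B (f (gpt A 0)) = 0 ∧
      ∀ t : ℝ, |t| ≤ (0 : ℕ) → gd B (f (gpt A t)) ≤ shadowDist L} := by
    refine (UpperHalfPlane.isProperMap_smul_I.isCompact_preimage
      (isCompact_closedBall (f (gpt A 0)) (shadowDist L))).of_isClosed_subset (hcl' 0) ?_
    intro B hB
    have := hB.2 0 (by simp)
    rw [gd, hB.1, dist_comm, gpt_eq B, UnitTangent.pt_axis_zero] at this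
    exact this
  obtain ⟨B, hB⟩ := IsCompact.nonempty_iInter_of_sequence_nonempty_isCompact_isClosed
    (fun n : ℕ => {B : SL(2, ℝ) | proj B (f (gpt A 0)) = 0 ∧
      ∀ t : ℝ, |t| ≤ n → gd B (f (gpt A t)) ≤ shadowDist L})
    (fun n B hB => ⟨hB.1, fun t ht => hB.2 t (ht.trans (by push_cast; linarith))⟩)
    (fun n => hf.exists_near_segment A n) hc hcl'
  refine ⟨B, fun t => ?_⟩
  obtain ⟨n, hn⟩ := exists_nat_ge |t|
  exact (Set.mem_iInter.1 hB n).2 t hn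

/-- After the time `L (2 shadowDist L + 2)` the image has moved by at least `2 shadowDist L + 1`.
The distances to the geodesic account for `2 shadowDist L`, which leaves `1` for the projections. -/
theorem CoarseHomeo.one_le_abs_sub (hf : CoarseHomeo L f) {A B : SL(2, ℝ)}
    (hB : ∀ t, gd B (f (gpt A t)) ≤ shadowDist L) (t : ℝ) :
    1 ≤ |proj B (f (gpt A (t + shadowTime L))) - proj B (f (gpt A t))| := by
  have hL := hf.one_le
  set x := f (gpt A (t + shadowTime L))
  set y := f (gpt A t)
  have h1 := hf.le_dist A (t + shadowTime L) t
  rw [add_sub_cancel_left, abs_of_pos (shadowTime_pos hL)] at h1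
  have h2 := dist_triangle4 x (gpt B (proj B x)) (gpt B (proj B y)) y
  have h3 : dist (gpt B (proj B y)) y = gd B y := dist_comm _ _
  have h4 : dist x (gpt B (proj B x)) = gd B x := rfl
  rw [dist_gpt_gpt, h3, h4] at h2
  have h5 := hB (t + shadowTime L)
  have h6 := hB t
  have h7 : L * (2 * shadowDist L + 2) ≤ L * (dist x y + 1) := by
    rw [← shadowTime]; linarith
  have h8 := le_of_mul_le_mul_left h7 (by linarith)
  linarith

/-- The progress of the projection during `shadowTime L` is continuous in time and never zero, so
its sign is constant. If it is negative, the geodesic is reversed. -/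
theorem CoarseHomeo.exists_shadow (hf : CoarseHomeo L f) (A : SL(2, ℝ)) : ∃ B, Shadow L f A B := by
  obtain ⟨B, hB⟩ := hf.exists_near A
  have hc : Continuous fun t => proj B (f (gpt A (t + shadowTime L))) - proj B (f (gpt A t)) :=
    (continuous_proj_comp continuous_const (f.continuous.comp (continuous_gpt_comp continuous_const
      (continuous_id.add continuous_const)))).sub
        (continuous_proj_comp continuous_const (f.continuous.comp (continuous_gpt_comp continuous_const continuous_id)))
  have h1 := hf.one_le_abs_sub hB
  have hne : ∀ t, proj B (f (gpt A (t + shadowTime L))) - proj B (f (gpt A t)) ≠ 0 := by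
    intro t ht
    have := h1 t
    rw [ht, abs_zero] at this
    linarith
  by_cases h0 : ∀ t, 0 < proj B (f (gpt A (t + shadowTime L))) - proj B (f (gpt A t))
  · refine ⟨B, hB, fun t => ?_⟩
    have := h1 t
    rw [abs_of_pos (h0 t)] at this
    linarith
  · push Not at h0
    obtain ⟨s, hs⟩ := h0
    refine ⟨B * flip, fun t => by rw [gd_mul_flip]; exact hB t, fun t => ?_⟩
    have h2 : proj B (f (gpt A (t + shadowTime L))) - proj B (f (gpt A t)) ≤ 0 := by
      by_contra! h
      obtain ⟨r, hr⟩ := mem_range_of_exists_le_of_exists_ge hc ⟨s, hs⟩ ⟨t, h.le⟩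
      exact hne r hr
    have := h1 t
    rw [abs_of_nonpos h2] at this
    rw [proj_mul_flip, proj_mul_flip]
    linarith

theorem Shadow.flip {A B : SL(2, ℝ)} (h : Shadow L f A B) :
    Shadow L f (A * flip) (B * QFProj.flip) := by
  refine ⟨fun t => ?_, fun t => ?_⟩
  · rw [gd_mul_flip, gpt_mul_flip]; exact h.near _
  · rw [proj_mul_flip, proj_mul_flip, gpt_mul_flip, gpt_mul_flip]
    have := h.progress (-(t + shadowTime L))
    rw [neg_add, neg_add_cancel_right] at this
    rw [neg_add]
    linarith

end

section

variable {L : ℝ} {f : ℍ ≃ₜ ℍ}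

theorem continuous_proj_time (f : ℍ ≃ₜ ℍ) (A B : SL(2, ℝ)) :
    Continuous fun t => proj B (f (gpt A t)) :=
  continuous_proj_comp continuous_const
    (f.continuous.comp (continuous_gpt_comp continuous_const continuous_id))

/-- Progress is at least `1` in each period, and inside a period the projection varies by a bounded
amount. -/
theorem Shadow.tendsto_proj (hf : CoarseHomeo L f) {A B : SL(2, ℝ)} (h : Shadow L f A B) :
    Tendsto (fun t => proj B (f (gpt A t))) atTop atTop := by
  have hT := shadowTime_pos hf.one_le
  set T := shadowTime L with hTdef
  have hnat : ∀ n : ℕ, proj B (f (gpt A 0)) + n ≤ proj B (f (gpt A (n * T))) := by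
    intro n
    induction n with
    | zero => simp
    | succ n ih =>
      have := h.progress (n * T)
      rw [← hTdef] at this
      have h2 : ((n + 1 : ℕ) : ℝ) * T = n * T + T := by push_cast; ring
      rw [h2]; push_cast; linarith
  have hlow : ∀ t, 0 ≤ t → proj B (f (gpt A 0)) + (t / T - 1) - (L * T + L) ≤
      proj B (f (gpt A t)) := by
    intro t ht
    have h1 : 0 ≤ t / T := by positivity
    have h2 := Nat.floor_le h1
    have h3 := (Nat.lt_floor_add_one (t / T)).le
    have h4 := hnat ⌊t / T⌋₊
    have h5 := (abs_proj_sub_le B (f (gpt A (⌊t / T⌋₊ * T))) (f (gpt A t))).trans (hf.dist_le A _ _)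
    have h6 : |⌊t / T⌋₊ * T - t| ≤ T := by
      rw [abs_le]
      rw [le_div_iff₀ hT] at h2
      rw [div_le_iff₀ hT] at h3
      constructor <;> nlinarith
    have h7 := (abs_le.1 h5).2
    have h8 : L * |⌊t / T⌋₊ * T - t| ≤ L * T := by
      have := hf.one_le
      gcongr
    linarith
  refine tendsto_atTop_mono' atTop ((eventually_ge_atTop 0).mono hlow) ?_
  have h1 : Tendsto (fun t : ℝ => t / T) atTop atTop := tendsto_id.atTop_div_const hT
  have h2 := tendsto_atTop_add_const_right atTop (proj B (f (gpt A 0)) - 1 - (L * T + L)) h1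
  refine h2.congr fun t => ?_
  ring

theorem Shadow.asymp (hf : CoarseHomeo L f) {A B : SL(2, ℝ)} (h : Shadow L f A B) :
    Asymp (fun t => f (gpt A t)) (gpt B) :=
  ⟨shadowDist L, _, h.tendsto_proj hf, Eventually.of_forall h.near⟩

theorem continuous_map_gpt (f : ℍ ≃ₜ ℍ) (A : SL(2, ℝ)) : Continuous fun t => f (gpt A t) :=
  f.continuous.comp (continuous_gpt_comp continuous_const continuous_id)

/-- Both geodesics are asymptotic to the same path, at either end. -/
theorem Shadow.eq_or_eq_neg (hf : CoarseHomeo L f) {A B B' : SL(2, ℝ)} (h : Shadow L f A B)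
    (h' : Shadow L f A B') : ∃ t, B' = B * geoSL t ∨ B' = -(B * geoSL t) :=
  eq_mul_geoSL_of_asymp (((h'.asymp hf).symm (continuous_map_gpt f A)).trans (h.asymp hf))
    (((h'.flip.asymp hf).symm (continuous_map_gpt f _)).trans (h.flip.asymp hf))

theorem Shadow.neg_left {A B : SL(2, ℝ)} (h : Shadow L f A B) : Shadow L f (-A) B := by
  constructor <;> simp only [gpt_neg]
  exacts [h.near, h.progress]

theorem Shadow.neg_right {A B : SL(2, ℝ)} (h : Shadow L f A B) : Shadow L f A (-B) := by
  constructor <;> simp only [proj_neg, gd_neg]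
  exacts [h.near, h.progress]

theorem Shadow.mul_geoSL_left {A B : SL(2, ℝ)} (h : Shadow L f A B) (r : ℝ) :
    Shadow L f (A * geoSL r) B := by
  constructor <;> simp only [gpt_mul_geoSL]
  · exact fun t => h.near _
  · intro t; rw [← add_assoc]; exact h.progress _

theorem Shadow.mul_geoSL_right {A B : SL(2, ℝ)} (h : Shadow L f A B) (r : ℝ) :
    Shadow L f A (B * geoSL r) := by
  constructor
  · simp only [gd_mul_geoSL]; exact h.near
  · intro t
    rw [proj_mul_geoSL, proj_mul_geoSL]
    linarith [h.progress t]

/-! ### The orbit equivalence of geodesic flows, by averaging over a period -/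

/-- The integral of the position of the projection during a period of time. -/
def shadowInt (L : ℝ) (f : ℍ ≃ₜ ℍ) (A B : SL(2, ℝ)) : ℝ :=
  ∫ t in (0 : ℝ)..shadowTime L, proj B (f (gpt A t))

theorem shadowInt_neg_left (A B : SL(2, ℝ)) : shadowInt L f (-A) B = shadowInt L f A B := by
  simp only [shadowInt, gpt_neg]

theorem shadowInt_neg_right (A B : SL(2, ℝ)) : shadowInt L f A (-B) = shadowInt L f A B := by
  simp only [shadowInt, proj_neg]

theorem shadowInt_mul_geoSL_right (A B : SL(2, ℝ)) (s : ℝ) :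
    shadowInt L f A (B * geoSL s) = shadowInt L f A B - shadowTime L * s := by
  simp only [shadowInt, proj_mul_geoSL]
  rw [intervalIntegral.integral_sub ((continuous_proj_time f A B).intervalIntegrable _ _)
    (continuous_const.intervalIntegrable _ _)]
  simp

theorem shadowInt_mul_geoSL_left (A B : SL(2, ℝ)) (r : ℝ) :
    shadowInt L f (A * geoSL r) B = ∫ t in r..r + shadowTime L, proj B (f (gpt A t)) := by
  simp only [shadowInt, gpt_mul_geoSL]
  rw [intervalIntegral.integral_comp_add_left (fun t => proj B (f (gpt A t))), add_zero]

theorem continuous_shadowInt (L : ℝ) (f : ℍ ≃ₜ ℍ) :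
    Continuous fun x : SL(2, ℝ) × SL(2, ℝ) => shadowInt L f x.1 x.2 := by
  refine intervalIntegral.continuous_parametric_intervalIntegral_of_continuous'
    (f := fun (x : SL(2, ℝ) × SL(2, ℝ)) t => proj x.2 (f (gpt x.1 t))) ?_ _ _
  exact continuous_proj_comp continuous_fst.snd
    (f.continuous.comp (continuous_gpt_comp continuous_fst.fst continuous_snd))

/-- As a function of the starting time, the integral over a period `T` has derivative `p (t + T) - p
t ≥ 1`, where `p` is the projection. Averaging thus turns coarse progress into strict monotonicity
along the geodesic. -/
theorem Shadow.sub_le_shadowInt {A B : SL(2, ℝ)} (h : Shadow L f A B) {r s : ℝ} (hrs : r ≤ s) :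
    s - r ≤ shadowInt L f (A * geoSL s) B - shadowInt L f (A * geoSL r) B := by
  have hc := continuous_proj_time f A B
  have hc' : Continuous fun t => proj B (f (gpt A (t + shadowTime L))) :=
    hc.comp (continuous_add_const _)
  rw [shadowInt_mul_geoSL_left, shadowInt_mul_geoSL_left,
    intervalIntegral.integral_interval_sub_interval_comm' (hc.intervalIntegrable _ _)
      (hc.intervalIntegrable _ _) (hc.intervalIntegrable _ _),
    ← intervalIntegral.integral_comp_add_right (fun t => proj B (f (gpt A t))),
    ← intervalIntegral.integral_sub (hc'.intervalIntegrable _ _) (hc.intervalIntegrable _ _)]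
  have h1 : (∫ _ in r..s, (1 : ℝ)) = s - r := by simp
  rw [← h1]
  refine intervalIntegral.integral_mono_on hrs (continuous_const.intervalIntegrable _ _)
    ((hc'.sub hc).intervalIntegrable _ _) fun t _ => ?_
  linarith [h.progress t]

theorem Shadow.exists_shadowInt_eq_zero {A B : SL(2, ℝ)} (h : Shadow L f A B) :
    ∃ r, shadowInt L f (A * geoSL r) B = 0 := by
  have hc : Continuous fun r => shadowInt L f (A * geoSL r) B :=
    (continuous_shadowInt L f).comp (f := fun r => (A * geoSL r, B))
      ((continuous_const.mul continuous_geoSL).prodMk continuous_const)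
  set c := shadowInt L f (A * geoSL 0) B
  have h1 := h.sub_le_shadowInt (neg_nonpos.2 (abs_nonneg c))
  have h2 := h.sub_le_shadowInt (abs_nonneg c)
  refine mem_range_of_exists_le_of_exists_ge hc ⟨-|c|, ?_⟩ ⟨|c|, ?_⟩
  · have := le_abs_self c; linarith
  · have := neg_abs_le c; linarith

/-- The relation between unit vectors defined by shadowing. -/
def ShadowRel (L : ℝ) (f : ℍ ≃ₜ ℍ) (w w' : UnitTangent) : Prop :=
  ∃ A B : SL(2, ℝ), w = A • UnitTangent.axis 0 ∧ w' = B • UnitTangent.axis 0 ∧ Shadow L f A B ∧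
    shadowInt L f A B = 0

theorem shadowRel_iff (A B : SL(2, ℝ)) :
    ShadowRel L f (A • UnitTangent.axis 0) (B • UnitTangent.axis 0) ↔
      Shadow L f A B ∧ shadowInt L f A B = 0 := by
  refine ⟨?_, fun h => ⟨A, B, rfl, rfl, h⟩⟩
  rintro ⟨A', B', hA, hB, h1, h2⟩
  rcases smul_axis_eq_iff.1 hA with rfl | rfl <;>
  rcases smul_axis_eq_iff.1 hB with rfl | rfl
  · exact ⟨h1, h2⟩
  · rw [shadowInt_neg_right] at h2
    have := h1.neg_right
    rw [neg_neg] at this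
    exact ⟨this, h2⟩
  · rw [shadowInt_neg_left] at h2
    have := h1.neg_left
    rw [neg_neg] at this
    exact ⟨this, h2⟩
  · rw [shadowInt_neg_left, shadowInt_neg_right] at h2
    have := h1.neg_left.neg_right
    rw [neg_neg, neg_neg] at this
    exact ⟨this, h2⟩

theorem isClosed_shadowRel (L : ℝ) (f : ℍ ≃ₜ ℍ) :
    IsClosed {p : UnitTangent × UnitTangent | ShadowRel L f p.1 p.2} := by
  have hq := isOpenQuotientMap_smul_axis.prodMap
    isOpenQuotientMap_smul_axis
  rw [← hq.isQuotientMap.isClosed_preimage]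
  have : Prod.map (fun A : SL(2, ℝ) => A • UnitTangent.axis 0)
      (fun A : SL(2, ℝ) => A • UnitTangent.axis 0) ⁻¹'
        {p : UnitTangent × UnitTangent | ShadowRel L f p.1 p.2} =
      {x | Shadow L f x.1 x.2} ∩ {x | shadowInt L f x.1 x.2 = 0} := by
    ext ⟨A, B⟩
    exact shadowRel_iff A B
  rw [this]
  exact (isClosed_shadow L f).inter (isClosed_eq (continuous_shadowInt L f) continuous_const)

/-- The shadowing frame `B` is unique up to sign and sliding, and the integral is affine in the
sliding parameter with slope `-shadowTime L`. So one sliding makes it vanish. -/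
theorem CoarseHomeo.existsUnique_right (hf : CoarseHomeo L f) (w : UnitTangent) :
    ∃! w', ShadowRel L f w w' := by
  have hT := shadowTime_pos hf.one_le
  obtain ⟨A, rfl⟩ := exists_smul_axis w
  obtain ⟨B, hB⟩ := hf.exists_shadow A
  refine ⟨(B * geoSL (shadowInt L f A B / shadowTime L)) • UnitTangent.axis 0,
    (shadowRel_iff _ _).2 ⟨hB.mul_geoSL_right _, ?_⟩, fun w' hw' => ?_⟩
  · rw [shadowInt_mul_geoSL_right]; field_simp; ring
  · obtain ⟨B', rfl⟩ := exists_smul_axis w'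
    obtain ⟨h1, h2⟩ := (shadowRel_iff _ _).1 hw'
    rw [smul_axis_eq_iff]
    obtain ⟨t, rfl | rfl⟩ := hB.eq_or_eq_neg hf h1
    · left
      rw [shadowInt_mul_geoSL_right, sub_eq_zero] at h2
      rw [h2, mul_div_cancel_left₀ _ hT.ne']
    · right
      rw [shadowInt_neg_right, shadowInt_mul_geoSL_right, sub_eq_zero] at h2
      rw [h2, mul_div_cancel_left₀ _ hT.ne', neg_neg]

/-- Let the geodesic of `A` shadow the preimage of that of `B`. Its own shadow `B'` is asymptotic to
`B` at both ends, so it is the same oriented geodesic and `B` shadows `A`. On the geodesic of `A`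
strict monotonicity of the integral selects one time, and any other `A'` is asymptotic to `A` at
both ends. -/
theorem CoarseHomeo.existsUnique_left (hf : CoarseHomeo L f) (w' : UnitTangent) :
    ∃! w, ShadowRel L f w w' := by
  obtain ⟨B, rfl⟩ := exists_smul_axis w'
  have hL : 0 ≤ L := zero_le_one.trans hf.one_le
  obtain ⟨A, hA⟩ : ∃ A, Shadow L f A B := by
    obtain ⟨A, hA⟩ := hf.symm.exists_shadow B
    obtain ⟨B', hB'⟩ := hf.exists_shadow A
    have key : ∀ {A B B' : SL(2, ℝ)}, Shadow L f.symm B A → Shadow L f A B' →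
        Asymp (gpt B) (gpt B') := by
      intro A B B' hA hB'
      have := ((hA.asymp hf.symm).map hL hf.lip).trans (hB'.asymp hf)
      simpa only [Function.comp_def, f.apply_symm_apply] using this
    obtain ⟨t, rfl | rfl⟩ := eq_mul_geoSL_of_asymp (key hA hB') (key hA.flip hB'.flip)
    · exact ⟨A, hB'.mul_geoSL_right t⟩
    · exact ⟨A, (hB'.mul_geoSL_right t).neg_right⟩
  obtain ⟨r, hr⟩ := hA.exists_shadowInt_eq_zero
  refine ⟨(A * geoSL r) • UnitTangent.axis 0, (shadowRel_iff _ _).2 ⟨hA.mul_geoSL_left r, hr⟩,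
    fun w hw => ?_⟩
  obtain ⟨A', rfl⟩ := exists_smul_axis w
  obtain ⟨h1, h2⟩ := (shadowRel_iff _ _).1 hw
  have key : ∀ {A A' B : SL(2, ℝ)}, Shadow L f A B → Shadow L f A' B →
      Asymp (gpt A') (gpt A) := by
    intro A A' B hA hA'
    have := ((hA'.asymp hf).trans ((hA.asymp hf).symm (continuous_map_gpt f A))).map hL hf.lip_symm
    simpa only [Function.comp_def, f.symm_apply_apply] using this
  have huniq : ∀ t, shadowInt L f (A * geoSL t) B = 0 → t = r := by
    intro t ht
    rcases le_total t r with h | h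
    · have := hA.sub_le_shadowInt h; linarith
    · have := hA.sub_le_shadowInt h; linarith
  rw [smul_axis_eq_iff]
  obtain ⟨t, rfl | rfl⟩ := eq_mul_geoSL_of_asymp (key hA h1) (key hA.flip h1.flip)
  · rw [huniq t h2]; exact Or.inl rfl
  · rw [shadowInt_neg_left] at h2
    rw [huniq t h2, neg_neg]; exact Or.inr rfl

/-- The projection has mean zero on the period and differs there from its initial value by at most
`L * shadowTime L + L`, which therefore bounds the initial value. This is the local boundedness
needed to get continuity from a closed graph. -/
theorem CoarseHomeo.dist_le_of_shadowRel (hf : CoarseHomeo L f) {w w' : UnitTangent}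
    (h : ShadowRel L f w w') :
    dist (f w.pt) w'.pt ≤ shadowDist L + (L * shadowTime L + L) := by
  obtain ⟨A, B, rfl, rfl, h1, h2⟩ := h
  have hT := shadowTime_pos hf.one_le
  set p := fun t => proj B (f (gpt A t)) with hp
  have hc : Continuous p := continuous_proj_time f A B
  have h3 : ∀ t ∈ Set.uIoc 0 (shadowTime L), ‖p 0 - p t‖ ≤ L * shadowTime L + L := by
    intro t ht
    rw [Set.uIoc_of_le hT.le] at ht
    refine ((abs_proj_sub_le B _ _).trans (hf.dist_le A _ _)).trans ?_
    have := hf.one_le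
    rw [zero_sub, abs_neg, abs_of_pos ht.1]
    gcongr
    exact ht.2
  have h4 := intervalIntegral.norm_integral_le_of_norm_le_const h3
  rw [intervalIntegral.integral_sub (continuous_const.intervalIntegrable _ _)
    (hc.intervalIntegrable _ _)] at h4
  have h5 : ∫ t in (0 : ℝ)..shadowTime L, p t = 0 := h2
  rw [h5, intervalIntegral.integral_const, sub_zero, sub_zero, smul_eq_mul, norm_mul,
    Real.norm_of_nonneg hT.le, abs_of_pos hT, mul_comm] at h4
  have h6 : |p 0| ≤ L * shadowTime L + L := le_of_mul_le_mul_right h4 hT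
  change dist (f (gpt A 0)) (gpt B 0) ≤ _
  refine (dist_triangle _ (gpt B (p 0)) _).trans ?_
  rw [dist_gpt_gpt, sub_zero]
  exact add_le_add (h1.near 0) h6

/-- The orbit equivalence of geodesic flows defined by a homeomorphism that is Lipschitz at large
scale, together with its inverse. -/
theorem CoarseHomeo.exists_homeomorph (hf : CoarseHomeo L f) :
    ∃ H : UnitTangent ≃ₜ UnitTangent, ∀ w w', ShadowRel L f w w' ↔ H w = w' := by
  set C := shadowDist L + (L * shadowTime L + L) with hC
  refine exists_homeomorph_of_isClosed (isClosed_shadowRel L f) hf.existsUnique_right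
    hf.existsUnique_left (fun w => ?_) fun w' => ?_
  · refine ⟨_, isCompact_pt_preimage (isCompact_closedBall (f w.pt) (C + 1)), ?_⟩
    have h1 : ∀ᶠ v in 𝓝 w, dist (f v.pt) (f w.pt) < 1 :=
      ((f.continuous.comp UnitTangent.continuous_pt).tendsto w).eventually
        (Metric.ball_mem_nhds _ one_pos)
    filter_upwards [h1] with v hv w' hw'
    have h2 := hf.dist_le_of_shadowRel hw'
    rw [dist_comm] at h2
    exact (dist_triangle _ (f v.pt) _).trans (add_le_add h2 hv.le)
  · refine ⟨_, isCompact_pt_preimage ((isCompact_closedBall w'.pt (C + 1)).image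
      f.symm.continuous), ?_⟩
    have h1 : ∀ᶠ v in 𝓝 w', dist v.pt w'.pt < 1 :=
      (UnitTangent.continuous_pt.tendsto w').eventually (Metric.ball_mem_nhds _ one_pos)
    filter_upwards [h1] with v hv w hw
    have h2 := hf.dist_le_of_shadowRel hw
    exact ⟨f w.pt, (dist_triangle _ v.pt _).trans (add_le_add h2 hv.le), f.symm_apply_apply _⟩

theorem ShadowRel.smul {w w' : UnitTangent} (h : ShadowRel L f w w') (γ δ : SL(2, ℝ))
    (hf : ∀ z, f (γ • z) = δ • f z) : ShadowRel L f (γ • w) (δ • w') := by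
  obtain ⟨A, B, rfl, rfl, h1, h2⟩ := h
  refine ⟨γ * A, δ * B, (mul_smul _ _ _).symm, (mul_smul _ _ _).symm, ⟨fun t => ?_, fun t => ?_⟩, ?_⟩
  · rw [gpt_mul, hf, gd_mul]; exact h1.near t
  · rw [gpt_mul, gpt_mul, hf, hf, proj_mul, proj_mul]; exact h1.progress t
  · simp only [shadowInt, gpt_mul, hf, proj_mul]; exact h2

/-- The orbit equivalence maps geodesics to geodesics. -/
theorem Shadow.exists_axis (hf : CoarseHomeo L f) {A B : SL(2, ℝ)} (h : Shadow L f A B) (t : ℝ) :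
    ∃ s, ShadowRel L f (A • UnitTangent.axis t) (B • UnitTangent.axis s) := by
  have hT := shadowTime_pos hf.one_le
  have e : ∀ (A : SL(2, ℝ)) t, A • UnitTangent.axis t = (A * geoSL t) • UnitTangent.axis 0 := by
    intro A t; rw [mul_smul, geoSL_smul_axis, add_zero]
  refine ⟨shadowInt L f (A * geoSL t) B / shadowTime L, ?_⟩
  rw [e A, e B, shadowRel_iff]
  refine ⟨(h.mul_geoSL_left t).mul_geoSL_right _, ?_⟩
  rw [shadowInt_mul_geoSL_right]; field_simp; ring

end

/-! ### The leaves in terms of frames -/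

namespace UnitTangent

theorem smul_axis_eq (A : SL(2, ℝ)) (t : ℝ) : A • axis t = (A * geoSL t) • axis 0 := by
  rw [mul_smul, geoSL_smul_axis, add_zero]

theorem neg_smul (A : SL(2, ℝ)) (w : UnitTangent) : (-A) • w = A • w := by
  rw [← psl_mk_smul, psl_mk_neg, psl_mk_smul]

theorem mem_geodesicLeaf_iff (A : SL(2, ℝ)) (w : UnitTangent) :
    w ∈ (A • axis 0).geodesicLeaf ↔ ∃ t, w = A • axis t := by
  refine ⟨?_, fun ⟨t, h⟩ => ⟨A, 0, t, rfl, h⟩⟩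
  rintro ⟨B, s, t, h, rfl⟩
  rw [smul_axis_eq B s, smul_axis_eq_iff] at h
  have hB : B • axis t = (B * geoSL s) • axis (t - s) := by
    rw [mul_smul, geoSL_smul_axis, add_sub_cancel]
  refine ⟨t - s, ?_⟩
  rcases h with h | h
  · rw [hB, h]
  · rw [hB, h, neg_smul]

theorem mem_stableLeaf_iff (A B : SL(2, ℝ)) :
    B • axis 0 ∈ (A • axis 0).stableLeaf ↔
      ∃ s, Tendsto (fun t : ℝ => dist (gpt A t) (gpt B (t + s))) atTop (𝓝 0) := by
  refine ⟨?_, fun ⟨s, h⟩ => ⟨A, B, s, rfl, rfl, h⟩⟩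
  rintro ⟨A', B', s, hA, hB, h⟩
  refine ⟨s, ?_⟩
  change Tendsto (fun t : ℝ => dist (gpt A' t) (gpt B' (t + s))) atTop (𝓝 0) at h
  rcases smul_axis_eq_iff.1 hA with rfl | rfl <;> rcases smul_axis_eq_iff.1 hB with rfl | rfl <;>
    simpa only [gpt_neg] using h

theorem asymp_of_mem_stableLeaf {A B : SL(2, ℝ)} (h : B • axis 0 ∈ (A • axis 0).stableLeaf) :
    Asymp (gpt A) (gpt B) := by
  obtain ⟨s, h⟩ := (mem_stableLeaf_iff A B).1 h
  exact ⟨1, fun t => t + s, tendsto_atTop_add_const_right _ _ tendsto_id,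
    (h.eventually_le_const one_pos)⟩

end UnitTangent

/-- The orbit equivalence maps weakly stable leaves to weakly stable leaves. -/
theorem Shadow.lower_left_eq_zero {L : ℝ} {f : ℍ ≃ₜ ℍ} (hf : CoarseHomeo L f)
    {A A' B B' : SL(2, ℝ)} (h : Shadow L f A B) (h' : Shadow L f A' B')
    (hA : Asymp (gpt A) (gpt A')) : (B⁻¹ * B') 1 0 = 0 := by
  have h1 := ((h'.asymp hf).symm (continuous_map_gpt f A'))
  have h2 := (h.asymp hf).symm (continuous_map_gpt f A)
  have h3 : Asymp (gpt B) (gpt B') :=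
    (h2.trans (hA.map (zero_le_one.trans hf.one_le) hf.lip)).trans (h'.asymp hf)
  have h4 := h3.symm (continuous_gpt_comp continuous_const continuous_id)
  exact h4.lower_left_eq_zero

/-! ### Loops in the circle -/

/-- `ℓ` is a continuous determination of the argument of `c`. -/
structure IsLift (c : ℝ → Circle) (ℓ : ℝ → ℝ) : Prop where
  continuous : Continuous ℓ
  exp : ∀ θ, Circle.exp (ℓ θ) = c θ

theorem exists_isLift {c : ℝ → Circle} (hc : Continuous c) : ∃ ℓ, IsLift c ℓ := by
  obtain ⟨F, ⟨-, hF⟩, -⟩ := Circle.isCoveringMap_exp.existsUnique_continuousMap_lifts ⟨c, hc⟩ 0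
    (c 0 : ℂ).arg (Circle.exp_arg _)
  exact ⟨F, F.continuous, fun θ => congrFun hF θ⟩

theorem eq_const_of_forall_exists_int {h : ℝ → ℝ} (hc : Continuous h)
    (hh : ∀ θ, ∃ m : ℤ, h θ = m * (2 * Real.pi)) : ∃ m : ℤ, ∀ θ, h θ = m * (2 * Real.pi) := by
  choose m hm using hh
  have hm' : ∀ θ, (m θ : ℝ) = h θ / (2 * Real.pi) := fun θ => by
    rw [hm]; field_simp
  have hmc : Continuous m := by
    rw [Int.isClosedEmbedding_coe_real.isEmbedding.continuous_iff]
    have : ((fun n : ℤ => (n : ℝ)) ∘ m) = fun θ => h θ / (2 * Real.pi) := funext hm'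
    rw [this]
    exact hc.div_const _
  refine ⟨m 0, fun θ => ?_⟩
  rw [hm θ, PreconnectedSpace.constant inferInstance hmc (x := θ) (y := 0)]

theorem IsLift.unique {c : ℝ → Circle} {ℓ ℓ' : ℝ → ℝ} (h : IsLift c ℓ) (h' : IsLift c ℓ') :
    ∃ m : ℤ, ∀ θ, ℓ' θ = ℓ θ + m * (2 * Real.pi) := by
  obtain ⟨m, hm⟩ := eq_const_of_forall_exists_int (h'.continuous.sub h.continuous) (fun θ => by
    obtain ⟨m, hm⟩ := Circle.exp_eq_exp.1 ((h'.exp θ).trans (h.exp θ).symm)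
    exact ⟨m, by rw [Pi.sub_apply, hm]; ring⟩)
  exact ⟨m, fun θ => by rw [← hm θ, Pi.sub_apply]; ring⟩

theorem IsLift.exists_degree {c : ℝ → Circle} (hc : Function.Periodic c Real.pi) {ℓ : ℝ → ℝ}
    (h : IsLift c ℓ) : ∃ d : ℤ, ∀ θ, ℓ (θ + Real.pi) = ℓ θ + d * (2 * Real.pi) :=
  h.unique ⟨h.continuous.comp (continuous_add_const _), fun θ => by rw [h.exp, hc]⟩

/-- `d` is the degree of the `π`-periodic loop `c`. -/
def HasDegree (c : ℝ → Circle) (d : ℤ) : Prop :=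
  ∃ ℓ, IsLift c ℓ ∧ ∀ θ, ℓ (θ + Real.pi) = ℓ θ + d * (2 * Real.pi)

theorem HasDegree.unique {c : ℝ → Circle} {d d' : ℤ} (h : HasDegree c d) (h' : HasDegree c d') :
    d = d' := by
  obtain ⟨ℓ, h1, h2⟩ := h
  obtain ⟨ℓ', h3, h4⟩ := h'
  obtain ⟨m, hm⟩ := h1.unique h3
  have := h4 0
  rw [hm, hm, h2] at this
  have h5 : (d : ℝ) * (2 * Real.pi) = d' * (2 * Real.pi) := by linarith
  exact_mod_cast mul_right_cancel₀ (by positivity) h5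

theorem exists_hasDegree {c : ℝ → Circle} (hc : Continuous c) (hp : Function.Periodic c Real.pi) :
    ∃ d, HasDegree c d := by
  obtain ⟨ℓ, hℓ⟩ := exists_isLift hc
  obtain ⟨d, hd⟩ := hℓ.exists_degree hp
  exact ⟨d, ℓ, hℓ, hd⟩

open scoped Classical in
/-- The phase given by the mean of the argument of a loop. -/
def meanPhase (c : ℝ → Circle) : Circle :=
  -- The default value `1` does not occur for continuous loops, by `exists_isLift`.
  if h : ∃ ℓ, IsLift c ℓ then Circle.exp ((∫ θ in (0 : ℝ)..Real.pi, h.choose θ) / Real.pi) else 1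

/-- Two lifts differ by a constant multiple of `2 π`, and so do their means. -/
theorem meanPhase_eq {c : ℝ → Circle} {ℓ : ℝ → ℝ} (h : IsLift c ℓ) :
    meanPhase c = Circle.exp ((∫ θ in (0 : ℝ)..Real.pi, ℓ θ) / Real.pi) := by
  have hex : ∃ ℓ, IsLift c ℓ := ⟨ℓ, h⟩
  rw [meanPhase, dif_pos hex]
  obtain ⟨m, hm⟩ := h.unique hex.choose_spec
  simp only [hm]
  rw [intervalIntegral.integral_add (h.continuous.intervalIntegrable _ _)
    (continuous_const.intervalIntegrable _ _), Circle.exp_eq_exp]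
  refine ⟨m, ?_⟩
  simp
  field_simp

/-- Shifting the interval by `α` replaces its part `[0, α]` by the translate by `π`, where the lift
is larger by `2 π d`. After division by `π` the mean grows by `2 d α`. -/
theorem meanPhase_shift {c : ℝ → Circle} {d : ℤ} (h : HasDegree c d) (α : ℝ) :
    meanPhase (fun θ => c (α + θ)) = Circle.exp (2 * d * α) * meanPhase c := by
  obtain ⟨ℓ, h1, h2⟩ := h
  have h3 : IsLift (fun θ => c (α + θ)) (fun θ => ℓ (α + θ)) :=
    ⟨h1.continuous.comp (continuous_const_add _), fun θ => h1.exp _⟩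
  rw [meanPhase_eq h1, meanPhase_eq h3, ← Circle.exp_add]
  congr 1
  have hi : ∀ a b : ℝ, IntervalIntegrable ℓ MeasureTheory.volume a b := fun a b =>
    h1.continuous.intervalIntegrable _ _
  have h4 : (∫ θ in α..α + Real.pi, ℓ θ) - ∫ θ in (0 : ℝ)..Real.pi, ℓ θ =
      2 * Real.pi * d * α := by
    rw [intervalIntegral.integral_interval_sub_interval_comm' (hi _ _) (hi _ _) (hi _ _)]
    have h5 : ∫ θ in Real.pi..α + Real.pi, ℓ θ = ∫ θ in (0 : ℝ)..α, ℓ (θ + Real.pi) := by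
      rw [intervalIntegral.integral_comp_add_right ℓ, zero_add]
    rw [h5]
    simp only [h2]
    rw [intervalIntegral.integral_add (hi _ _) (continuous_const.intervalIntegrable _ _)]
    simp
    ring
  rw [intervalIntegral.integral_comp_add_left ℓ, add_zero, sub_eq_iff_eq_add.1 h4]
  field_simp

theorem meanPhase_mul_left {c : ℝ → Circle} (hc : Continuous c) (k : Circle) :
    meanPhase (fun θ => k * c θ) = k * meanPhase c := by
  obtain ⟨ℓ, h⟩ := exists_isLift hc
  have h3 : IsLift (fun θ => k * c θ) (fun θ => (k : ℂ).arg + ℓ θ) :=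
    ⟨continuous_const.add h.continuous, fun θ => by rw [Circle.exp_add, Circle.exp_arg, h.exp]⟩
  rw [meanPhase_eq h, meanPhase_eq h3,
    intervalIntegral.integral_add (continuous_const.intervalIntegrable _ _)
      (h.continuous.intervalIntegrable _ _)]
  have : ((∫ _ in (0 : ℝ)..Real.pi, (k : ℂ).arg) + ∫ θ in (0 : ℝ)..Real.pi, ℓ θ) / Real.pi =
      (k : ℂ).arg + (∫ θ in (0 : ℝ)..Real.pi, ℓ θ) / Real.pi := by
    simp; field_simp
  rw [this, Circle.exp_add, Circle.exp_arg]

section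

variable {X : Type*} [TopologicalSpace X] {κ : X → ℝ → Circle}

theorem continuousOn_circle_arg :
    ContinuousOn (fun z : Circle => (z : ℂ).arg) {z | (z : ℂ) ∈ Complex.slitPlane} := fun _ hz =>
  ((Complex.continuousAt_arg hz).comp
    (f := fun z : Circle => (z : ℂ)) continuous_subtype_val.continuousAt).continuousWithinAt

/-- The ratio of the loops at `x` and `x₀` equals `1` for `x = x₀`. Compactness of one period makes
nearness to `1` uniform in `θ`. -/
theorem eventually_small_arg (hκ : Continuous (Function.uncurry κ))
    (hp : ∀ x, Function.Periodic (κ x) Real.pi) (x₀ : X) {ε : ℝ} (hε : 0 < ε) :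
    ∀ᶠ x in 𝓝 x₀, ∀ θ, ((κ x θ / κ x₀ θ : Circle) : ℂ) ∈ Complex.slitPlane ∧
      |((κ x θ / κ x₀ θ : Circle) : ℂ).arg| < ε := by
  have hg : Continuous fun p : X × ℝ => κ p.1 p.2 / κ x₀ p.2 :=
    hκ.div' (hκ.comp (f := fun p : X × ℝ => (x₀, p.2)) (by fun_prop))
  have h1 : ∀ θ ∈ Set.Icc 0 Real.pi, ∀ᶠ p : X × ℝ in 𝓝 (x₀, θ),
      ((κ p.1 p.2 / κ x₀ p.2 : Circle) : ℂ) ∈ Complex.slitPlane ∧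
        |((κ p.1 p.2 / κ x₀ p.2 : Circle) : ℂ).arg| < ε := by
    intro θ _
    have h2 : ContinuousAt (fun p : X × ℝ => ((κ p.1 p.2 / κ x₀ p.2 : Circle) : ℂ)) (x₀, θ) :=
      (continuous_subtype_val.comp hg).continuousAt
    have h3 : ((κ x₀ θ / κ x₀ θ : Circle) : ℂ) = 1 := by rw [div_self']; rfl
    refine (h2.eventually (by
      simp only [h3]; exact Complex.isOpen_slitPlane.mem_nhds Complex.one_mem_slitPlane)).and ?_
    have h4 : ContinuousAt (fun p : X × ℝ => |((κ p.1 p.2 / κ x₀ p.2 : Circle) : ℂ).arg|) (x₀, θ) := by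
      refine (ContinuousAt.comp (g := Complex.arg)
        (f := fun p : X × ℝ => ((κ p.1 p.2 / κ x₀ p.2 : Circle) : ℂ)) ?_ h2).abs
      refine Complex.continuousAt_arg ?_
      simp only [h3]; exact Complex.one_mem_slitPlane
    refine h4.eventually (gt_mem_nhds ?_)
    simp only [h3]; simpa using hε
  refine (isCompact_Icc.eventually_forall_of_forall_eventually (P := fun x θ =>
    ((κ x θ / κ x₀ θ : Circle) : ℂ) ∈ Complex.slitPlane ∧
        |((κ x θ / κ x₀ θ : Circle) : ℂ).arg| < ε) h1).mono fun x hx θ => ?_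
  have hper : Function.Periodic (fun θ => κ x θ / κ x₀ θ) Real.pi := fun θ => by
    simp only [hp x θ, hp x₀ θ]
  obtain ⟨θ', h5, h6⟩ := hper.exists_mem_Ico₀ Real.pi_pos θ
  rw [h6]
  exact hx θ' ⟨h5.1, h5.2.le⟩

theorem isLift_mul_arg (hκ : Continuous (Function.uncurry κ)) {x₀ x : X} {ℓ : ℝ → ℝ}
    (h : IsLift (κ x₀) ℓ) (hx : ∀ θ, ((κ x θ / κ x₀ θ : Circle) : ℂ) ∈ Complex.slitPlane) :
    IsLift (κ x) (fun θ => ℓ θ + ((κ x θ / κ x₀ θ : Circle) : ℂ).arg) := by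
  refine ⟨h.continuous.add ?_, fun θ => ?_⟩
  · refine continuousOn_circle_arg.comp_continuous ?_ hx
    exact (hκ.comp (f := fun θ => (x, θ)) (by fun_prop)).div'
      (hκ.comp (f := fun θ => (x₀, θ)) (by fun_prop))
  · rw [Circle.exp_add, h.exp, Circle.exp_arg, mul_div_cancel]

/-- A lift at `x` is obtained from a lift at `x₀` by adding the principal argument of the ratio,
which is `π`-periodic and does not affect the degree. -/
theorem eventually_hasDegree (hκ : Continuous (Function.uncurry κ))
    (hp : ∀ x, Function.Periodic (κ x) Real.pi) {x₀ : X} {d : ℤ} (hd : HasDegree (κ x₀) d) :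
    ∀ᶠ x in 𝓝 x₀, HasDegree (κ x) d := by
  obtain ⟨ℓ, h1, h2⟩ := hd
  filter_upwards [eventually_small_arg hκ hp x₀ one_pos] with x hx
  refine ⟨_, isLift_mul_arg hκ h1 fun θ => (hx θ).1, fun θ => ?_⟩
  rw [h2, hp x θ, hp x₀ θ]
  ring

theorem hasDegree_of_preconnected [PreconnectedSpace X] (hκ : Continuous (Function.uncurry κ))
    (hp : ∀ x, Function.Periodic (κ x) Real.pi) {x₀ : X} {d : ℤ} (hd : HasDegree (κ x₀) d) (x : X) :
    HasDegree (κ x) d := by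
  have hex : ∀ x, ∃ d, HasDegree (κ x) d := fun x =>
    exists_hasDegree (hκ.comp (f := fun θ => (x, θ)) (by fun_prop)) (hp x)
  choose D hD using hex
  have hl : IsLocallyConstant D := by
    rw [IsLocallyConstant.iff_eventually_eq]
    intro x
    exact (eventually_hasDegree hκ hp (hD x)).mono fun y hy => (hD y).unique hy
  rw [hd.unique (hD x₀), hl.apply_eq_of_preconnectedSpace x₀ x]
  exact hD x

theorem continuous_meanPhase (hκ : Continuous (Function.uncurry κ))
    (hp : ∀ x, Function.Periodic (κ x) Real.pi) : Continuous fun x => meanPhase (κ x) := by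
  rw [continuous_iff_continuousAt]
  intro x₀
  obtain ⟨ℓ, h1⟩ := exists_isLift (hκ.comp (f := fun θ => (x₀, θ)) (by fun_prop))
  change IsLift (κ x₀) ℓ at h1
  set e : X → ℝ := fun x => (∫ θ in (0 : ℝ)..Real.pi, ((κ x θ / κ x₀ θ : Circle) : ℂ).arg) / Real.pi
    with he
  have h2 : ∀ᶠ x in 𝓝 x₀, meanPhase (κ x) = meanPhase (κ x₀) * Circle.exp (e x) := by
    filter_upwards [eventually_small_arg hκ hp x₀ one_pos] with x hx
    have h3 := isLift_mul_arg hκ h1 fun θ => (hx θ).1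
    have h4 := h3.continuous.sub h1.continuous
    have h4 : Continuous fun θ => ((κ x θ / κ x₀ θ : Circle) : ℂ).arg :=
      h4.congr fun θ => by rw [Pi.sub_apply, add_sub_cancel_left]
    rw [meanPhase_eq h1, meanPhase_eq h3, ← Circle.exp_add, he, ← add_div,
      intervalIntegral.integral_add (h1.continuous.intervalIntegrable _ _)
        (h4.intervalIntegrable _ _)]
  have h5 : Tendsto e (𝓝 x₀) (𝓝 0) := by
    rw [Metric.tendsto_nhds]
    intro ε hε
    filter_upwards [eventually_small_arg hκ hp x₀ (half_pos hε)] with x hx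
    have h6 := intervalIntegral.norm_integral_le_of_norm_le_const (a := 0) (b := Real.pi)
      (f := fun θ => ((κ x θ / κ x₀ θ : Circle) : ℂ).arg) (C := ε / 2) fun θ _ => (hx θ).2.le
    rw [sub_zero, abs_of_pos Real.pi_pos] at h6
    rw [dist_zero_right, he, norm_div, Real.norm_of_nonneg Real.pi_pos.le, div_lt_iff₀ Real.pi_pos]
    nlinarith [Real.pi_pos]
  have h7 : e x₀ = 0 := by simp [he]
  refine (ContinuousAt.congr ?_ (EventuallyEq.symm h2))
  refine continuousAt_const.mul (Circle.exp.continuous.continuousAt.comp ?_)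
  rw [ContinuousAt, h7]
  exact h5

end

/-! ### Equivariant hermitian forms -/

theorem eq_or_eq_neg_of_psl_mk_eq {A B : SL(2, ℂ)}
    (h : (QuotientGroup.mk A : PSL(2, ℂ)) = QuotientGroup.mk B) : B = A ∨ B = -A := by
  rcases center_cases (QuotientGroup.eq.1 h) with h | h
  · left; rw [← mul_one A, ← h, mul_inv_cancel_left]
  · right; rw [← mul_one A, ← mul_neg, ← h, mul_inv_cancel_left]

theorem sl_neg_smul_C2 (A : SL(2, ℂ)) (v : C2) : (-A) • v = -(A • v) := by
  ext i; fin_cases i <;> simp [Matrix.SpecialLinearGroup.smul_def]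

/-- The standard hermitian form. -/
def herm (v w : C2) : ℂ := conj (v 0) * w 0 + conj (v 1) * w 1

theorem herm_neg_neg (v w : C2) : herm (-v) (-w) = herm v w := by simp [herm]

theorem herm_smul_smul (a b : ℂ) (v w : C2) : herm (a • v) (b • w) = conj a * b * herm v w := by
  simp [herm]; ring

theorem herm_add (v w w' : C2) : herm v (w + w') = herm v w + herm v w' := by
  simp [herm]; ring

theorem herm_self (v : C2) : herm v v = (Complex.normSq (v 0) + Complex.normSq (v 1) : ℝ) := by
  simp [herm, Complex.normSq_eq_conj_mul_self]

theorem normSq_add_pos {v : C2} (hv : v ≠ 0) : 0 < Complex.normSq (v 0) + Complex.normSq (v 1) := by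
  have h0 := Complex.normSq_nonneg (v 0)
  have h1 := Complex.normSq_nonneg (v 1)
  refine lt_of_le_of_ne (add_nonneg h0 h1) fun h => hv ?_
  have h2 : v 0 = 0 := Complex.normSq_eq_zero.1 (by linarith)
  have h3 : v 1 = 0 := Complex.normSq_eq_zero.1 (by linarith)
  ext i; fin_cases i
  exacts [h2, h3]

/-- The image by `g` of the standard hermitian form. -/
def pslHerm (g : PSL(2, ℂ)) (v w : C2) : ℂ :=
  herm ((Quotient.out g : SL(2, ℂ))⁻¹ • v) ((Quotient.out g : SL(2, ℂ))⁻¹ • w)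

theorem pslHerm_mk (A : SL(2, ℂ)) (v w : C2) :
    pslHerm (QuotientGroup.mk A) v w = herm (A⁻¹ • v) (A⁻¹ • w) := by
  have h : (QuotientGroup.mk A : PSL(2, ℂ)) =
      QuotientGroup.mk (Quotient.out (QuotientGroup.mk A : PSL(2, ℂ)) : SL(2, ℂ)) :=
    (QuotientGroup.out_eq' _).symm
  rw [pslHerm]
  rcases eq_or_eq_neg_of_psl_mk_eq h with h | h
  · rw [h]
  · have h2 : (-A)⁻¹ = -A⁻¹ := by simp
    rw [h, h2, sl_neg_smul_C2, sl_neg_smul_C2, herm_neg_neg]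

theorem pslHerm_mul (A : SL(2, ℂ)) (g : PSL(2, ℂ)) (v w : C2) :
    pslHerm (QuotientGroup.mk A * g) (A • v) (A • w) = pslHerm g v w := by
  induction g using QuotientGroup.induction_on with | H B =>
  rw [← QuotientGroup.mk_mul, pslHerm_mk, pslHerm_mk]
  simp only [mul_inv_rev, mul_smul, inv_smul_smul]

theorem pslHerm_smul_smul (g : PSL(2, ℂ)) (a b : ℂ) (v w : C2) :
    pslHerm g (a • v) (b • w) = conj a * b * pslHerm g v w := by
  rw [pslHerm, smul_comm _ a, smul_comm _ b, herm_smul_smul, pslHerm]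

theorem pslHerm_add (g : PSL(2, ℂ)) (v w w' : C2) :
    pslHerm g v (w + w') = pslHerm g v w + pslHerm g v w' := by
  simp only [pslHerm, smul_add, herm_add]

theorem exists_pslHerm_self (g : PSL(2, ℂ)) {v : C2} (hv : v ≠ 0) :
    ∃ r : ℝ, 0 < r ∧ pslHerm g v v = r :=
  ⟨_, normSq_add_pos ((smul_ne_zero_iff_ne _).2 hv), herm_self _⟩

theorem continuous_pslHerm (g : PSL(2, ℂ)) :
    Continuous fun x : C2 × C2 => pslHerm g x.1 x.2 := by
  have h1 : Continuous fun x : C2 × C2 => (Quotient.out g : SL(2, ℂ))⁻¹ • x.1 :=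
    (continuous_sl_smul_C2 _).comp continuous_fst
  have h2 : Continuous fun x : C2 × C2 => (Quotient.out g : SL(2, ℂ))⁻¹ • x.2 :=
    (continuous_sl_smul_C2 _).comp continuous_snd
  have h3 := fun i => (continuous_apply i).comp h1
  have h4 := fun i => (continuous_apply i).comp h2
  exact ((Complex.continuous_conj.comp (h3 0)).mul (h4 0)).add
    ((Complex.continuous_conj.comp (h3 1)).mul (h4 1))

/-- A cut-off function on the hyperbolic plane. -/
def bump (R : ℝ) (z : ℍ) : ℝ := max 0 (R + 1 - dist z UpperHalfPlane.I)

theorem continuous_bump (R : ℝ) : Continuous (bump R) := by unfold bump; fun_prop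

theorem bump_nonneg (R : ℝ) (z : ℍ) : 0 ≤ bump R z := le_max_left _ _

theorem bump_pos {R : ℝ} {z : ℍ} (h : dist z UpperHalfPlane.I ≤ R) : 0 < bump R z :=
  lt_max_of_lt_right (by linarith)

theorem dist_le_of_bump_ne_zero {R : ℝ} {z : ℍ} (h : bump R z ≠ 0) :
    dist z UpperHalfPlane.I ≤ R + 1 := by
  by_contra! h'
  exact h (max_eq_left (by linarith))

section

variable {Γ : Subgroup PSL(2, ℝ)} (q : Γ →* PSL(2, ℂ)) (R : ℝ)

/-- An equivariant family of hermitian forms. -/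
def hform (z : ℍ) (v w : C2) : ℂ := ∑ᶠ γ : Γ, (bump R (γ⁻¹ • z) : ℂ) * pslHerm (q γ) v w

variable {q R}

theorem IsSurfaceGroup.locallyFinite_bump (hΓ : IsSurfaceGroup Γ) :
    LocallyFinite fun γ : Γ => Function.support fun z : ℍ => bump R (γ⁻¹ • z) := by
  have := hΓ.discrete
  intro z
  refine ⟨Metric.closedBall z 1, Metric.closedBall_mem_nhds z one_pos, ?_⟩
  refine (finite_setOf_smul_inter Γ (isCompact_closedBall UpperHalfPlane.I (R + 1))
    (isCompact_closedBall z 1)).subset ?_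
  rintro γ ⟨w, hw, hwz⟩
  exact ⟨w, ⟨γ⁻¹ • w, dist_le_of_bump_ne_zero hw, smul_inv_smul _ _⟩, hwz⟩

theorem IsSurfaceGroup.finite_support_hform (hΓ : IsSurfaceGroup Γ) (z : ℍ) (v w : C2) :
    (Function.support fun γ : Γ => (bump R (γ⁻¹ • z) : ℂ) * pslHerm (q γ) v w).Finite := by
  refine ((hΓ.locallyFinite_bump (R := R)).point_finite z).subset fun γ hγ => ?_
  intro h
  exact hγ (by simp [h])

theorem hform_smul_smul (z : ℍ) (a b : ℂ) (v w : C2) :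
    hform q R z (a • v) (b • w) = conj a * b * hform q R z v w := by
  rw [hform, hform, ← smul_eq_mul _ (∑ᶠ _, _), smul_finsum]
  refine finsum_congr fun γ => ?_
  rw [pslHerm_smul_smul, smul_eq_mul]; ring

theorem IsSurfaceGroup.hform_add (hΓ : IsSurfaceGroup Γ) (z : ℍ) (v w w' : C2) :
    hform q R z v (w + w') = hform q R z v w + hform q R z v w' := by
  rw [hform, hform, hform, ← finsum_add_distrib (hΓ.finite_support_hform z v w)
    (hΓ.finite_support_hform z v w')]
  exact finsum_congr fun γ => by rw [pslHerm_add, mul_add]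

theorem hform_equivariant {A : SL(2, ℂ)} {δ : Γ} (h : QuotientGroup.mk A = q δ) (z : ℍ) (v w : C2) :
    hform q R (δ • z) (A • v) (A • w) = hform q R z v w := by
  rw [hform, hform, ← finsum_comp_equiv (Equiv.mulLeft δ)]
  refine finsum_congr fun γ => ?_
  rw [Equiv.coe_mulLeft, map_mul, ← h, pslHerm_mul, mul_inv_rev, mul_smul, inv_smul_smul]

/-- The value is a finite sum of nonnegative reals, and a term is positive since the translates of
the ball of radius `R` cover `ℍ`. -/
theorem IsSurfaceGroup.hform_self_ne_zero (hΓ : IsSurfaceGroup Γ)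
    (hR : ∀ z : ℍ, ∃ γ : Γ, dist (γ • z) UpperHalfPlane.I ≤ R) (z : ℍ) {v : C2} (hv : v ≠ 0) :
    hform q R z v v ≠ 0 := by
  choose r hr hr' using fun γ : Γ => exists_pslHerm_self (q γ) hv
  have h1 : hform q R z v v = ((∑ᶠ γ : Γ, bump R (γ⁻¹ • z) * r γ : ℝ) : ℂ) := by
    rw [hform, ← Complex.ofRealHom_eq_coe, ← AddMonoidHom.coe_coe Complex.ofRealHom,
      AddMonoidHom.map_finsum]
    · simp only [hr', AddMonoidHom.coe_coe, Complex.ofRealHom_eq_coe, Complex.ofReal_mul]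
    · refine ((hΓ.locallyFinite_bump (R := R)).point_finite z).subset fun γ hγ h => hγ ?_
      change bump R (γ⁻¹ • z) = 0 at h
      simp [h]
  rw [h1]
  refine Complex.ofReal_ne_zero.2 (ne_of_gt ?_)
  obtain ⟨γ, hγ⟩ := hR z
  refine finsum_pos (fun γ => mul_nonneg (bump_nonneg _ _) (hr γ).le)
    ⟨γ⁻¹, mul_pos (bump_pos (by rwa [inv_inv])) (hr _)⟩ ?_
  refine ((hΓ.locallyFinite_bump (R := R)).point_finite z).subset fun γ hγ h => hγ ?_
  change bump R (γ⁻¹ • z) = 0 at h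
  simp [h]

theorem IsSurfaceGroup.continuous_hform (hΓ : IsSurfaceGroup Γ) :
    Continuous fun x : ℍ × C2 × C2 => hform q R x.1 x.2.1 x.2.2 := by
  refine continuous_finsum (fun γ => ?_) fun x => ?_
  · refine Continuous.mul ?_ ((continuous_pslHerm (q γ)).comp continuous_snd)
    exact Complex.continuous_ofReal.comp ((continuous_bump R).comp
      ((continuous_const_smul γ⁻¹).comp continuous_fst))
  · obtain ⟨U, hU, hf⟩ := hΓ.locallyFinite_bump (R := R) x.1
    refine ⟨Prod.fst ⁻¹' U, continuous_fst.continuousAt.preimage_mem_nhds hU, hf.subset ?_⟩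
    rintro γ ⟨y, hy, hyU⟩
    refine ⟨y.1, fun h => hy ?_, hyU⟩
    change bump R (γ⁻¹ • y.1) = 0 at h
    simp [h]

/-! ### An affine coordinate on the projective line -/

variable (q R) in
/-- Two complex lines are not orthogonal. -/
def NotOrtho (z : ℍ) (p p' : CP1) : Prop := hform q R z p.rep p'.rep ≠ 0

variable (q R) in
/-- The affine coordinate of `p'` in the chart of `ℙ¹(ℂ)` centred at `hopf p` that is defined by the
hermitian form at `z`. -/
def affineCoord (z : ℍ) (p : RP3) (p' : CP1) : ℂ :=
  det2 p.rep p'.rep / hform q R z p.rep p'.rep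

theorem det2_smul_smul (a b : ℂ) (v w : C2) : det2 (a • v) (b • w) = a * b * det2 v w := by
  simp [det2]; ring

theorem det2_add (v w w' : C2) : det2 v (w + w') = det2 v w + det2 v w' := by
  simp [det2]; ring

theorem notOrtho_mk (z : ℍ) {v w : C2} (hv : v ≠ 0) (hw : w ≠ 0) :
    NotOrtho q R z (Projectivization.mk ℂ v hv) (Projectivization.mk ℂ w hw) ↔
      hform q R z v w ≠ 0 := by
  obtain ⟨a, ha⟩ := Projectivization.exists_smul_eq_mk_rep ℂ v hv
  obtain ⟨b, hb⟩ := Projectivization.exists_smul_eq_mk_rep ℂ w hw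
  rw [NotOrtho, ← ha, ← hb, Units.smul_def, Units.smul_def, hform_smul_smul]
  simp

theorem affineCoord_mk (z : ℍ) {v w : C2} (hv : v ≠ 0) (hw : w ≠ 0) :
    affineCoord q R z (Projectivization.mk ℝ v hv) (Projectivization.mk ℂ w hw) =
      det2 v w / hform q R z v w := by
  obtain ⟨a, ha⟩ := Projectivization.exists_smul_eq_mk_rep ℝ v hv
  obtain ⟨b, hb⟩ := Projectivization.exists_smul_eq_mk_rep ℂ w hw
  have h1 : ((a : ℝ) : ℂ) ≠ 0 := Complex.ofReal_ne_zero.2 a.ne_zero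
  rw [affineCoord, ← ha, ← hb, Units.smul_def, Units.smul_def, ofReal_smul_C2, hform_smul_smul,
    det2_smul_smul, Complex.conj_ofReal, mul_div_mul_left _ _ (mul_ne_zero h1 b.ne_zero)]

theorem affineCoord_equivariant (δ : Γ) (z : ℍ) (p : RP3) (p' : CP1) :
    affineCoord q R (δ • z) (q δ • p) (q δ • p') = affineCoord q R z p p' := by
  obtain ⟨A, hA⟩ := QuotientGroup.mk_surjective (q δ)
  induction p using Projectivization.ind with | h v hv =>
  induction p' using Projectivization.ind with | h w hw =>
  rw [← hA, psl_mk_smul_mk_RP3, psl_mk_smul_mk_CP1, affineCoord_mk, affineCoord_mk, det2_smul,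
    hform_equivariant hA]

theorem notOrtho_equivariant (δ : Γ) (z : ℍ) (p p' : CP1) :
    NotOrtho q R (δ • z) (q δ • p) (q δ • p') ↔ NotOrtho q R z p p' := by
  obtain ⟨A, hA⟩ := QuotientGroup.mk_surjective (q δ)
  induction p using Projectivization.ind with | h v hv =>
  induction p' using Projectivization.ind with | h w hw =>
  rw [← hA, psl_mk_smul_mk_CP1, psl_mk_smul_mk_CP1, notOrtho_mk, notOrtho_mk, hform_equivariant hA]

theorem affineCoord_ne_zero {z : ℍ} {p : RP3} {p' : CP1} (h : NotOrtho q R z (hopf p) p')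
    (hne : hopf p ≠ p') : affineCoord q R z p p' ≠ 0 := by
  induction p using Projectivization.ind with | h v hv =>
  induction p' using Projectivization.ind with | h w hw =>
  rw [hopf_mk] at h hne
  rw [affineCoord_mk]
  exact div_ne_zero (fun h0 => hne ((mk_eq_mk_iff_det2 hv hw).2 h0)) ((notOrtho_mk z hv hw).1 h)

theorem affineCoord_hopf (z : ℍ) (p : RP3) : affineCoord q R z p (hopf p) = 0 := by
  induction p using Projectivization.ind with | h v hv =>
  rw [hopf_mk, affineCoord_mk]
  simp [det2, mul_comm]

/-- Equality of the coordinates makes `h(v, x) w - h(v, w) x` a multiple of `v`. It is also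
orthogonal to `v`, so it is zero because the form does not vanish on `v`. -/
theorem IsSurfaceGroup.affineCoord_injective (hΓ : IsSurfaceGroup Γ)
    (hR : ∀ z : ℍ, ∃ γ : Γ, dist (γ • z) UpperHalfPlane.I ≤ R) {z : ℍ} {p : RP3} {p₁ p₂ : CP1}
    (h1 : NotOrtho q R z (hopf p) p₁) (h2 : NotOrtho q R z (hopf p) p₂)
    (h : affineCoord q R z p p₁ = affineCoord q R z p p₂) : p₁ = p₂ := by
  induction p using Projectivization.ind with | h v hv =>
  induction p₁ using Projectivization.ind with | h w hw =>
  induction p₂ using Projectivization.ind with | h x hx =>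
  rw [hopf_mk, notOrtho_mk] at h1 h2
  rw [affineCoord_mk, affineCoord_mk, div_eq_div_iff h1 h2] at h
  have e1 : ∀ (a : ℂ) (y : C2), det2 v (a • y) = a * det2 v y := fun a y => by
    simpa using det2_smul_smul 1 a v y
  have e2 : ∀ (a : ℂ) (y : C2), hform q R z v (a • y) = a * hform q R z v y := fun a y => by
    simpa using hform_smul_smul (q := q) (R := R) z 1 a v y
  have h3 : det2 v (hform q R z v x • w + (-hform q R z v w) • x) = 0 := by
    rw [det2_add, e1, e1]; linear_combination h
  obtain ⟨a, ha⟩ := (det2_eq_zero_iff hv).1 h3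
  have h4 := congrArg (hform q R z v) ha
  rw [hΓ.hform_add, e2, e2, e2, mul_comm (hform q R z v x), neg_mul, add_neg_cancel] at h4
  have ha0 : a = 0 := (mul_eq_zero.1 h4).resolve_right (hΓ.hform_self_ne_zero hR z hv)
  rw [ha0, zero_smul, neg_smul, ← sub_eq_add_neg, eq_comm, sub_eq_zero] at ha
  rw [Projectivization.mk_eq_mk_iff']
  refine ⟨(hform q R z v x)⁻¹ * hform q R z v w, ?_⟩
  rw [mul_smul, ← ha, smul_smul, inv_mul_cancel₀ h2, one_smul]

/-- The inverse of the affine coordinate. -/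
theorem IsSurfaceGroup.exists_affineCoord_inverse (hΓ : IsSurfaceGroup Γ)
    (hR : ∀ z : ℍ, ∃ γ : Γ, dist (γ • z) UpperHalfPlane.I ≤ R) (z : ℍ) (p : RP3) :
    ∃ g : ℂ → CP1, Continuous g ∧ g 0 = hopf p ∧ (∀ x, NotOrtho q R z (hopf p) (g x)) ∧
      ∀ x, affineCoord q R z p (g x) = x := by
  induction p using Projectivization.ind with | h v hv =>
  have hm := hΓ.hform_self_ne_zero (q := q) hR z hv
  set m := hform q R z v v
  have e1 : ∀ (a : ℂ) (y : C2), det2 v (a • y) = a * det2 v y := fun a y => by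
    simpa using det2_smul_smul 1 a v y
  have e2 : ∀ (a : ℂ) (y : C2), hform q R z v (a • y) = a * hform q R z v y := fun a y => by
    simpa using hform_smul_smul (q := q) (R := R) z 1 a v y
  have e3 : det2 v v = 0 := by simp [det2, mul_comm]
  -- With `w` orthogonal to `v`, the line of `v + s w` has coordinate `s * det2 v w / m`; this is
  -- solved for `s` below.
  obtain ⟨w, hw, hw'⟩ : ∃ w, hform q R z v w = 0 ∧ det2 v w ≠ 0 := by
    obtain ⟨w₀, h0⟩ : ∃ w₀, det2 v w₀ ≠ 0 := by
      refine ⟨![-conj (v 1), conj (v 0)], ?_⟩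
      have h := (normSq_add_pos hv).ne'
      have h2 : det2 v ![-conj (v 1), conj (v 0)] =
          (Complex.normSq (v 0) + Complex.normSq (v 1) : ℝ) := by
        simp [det2, Complex.normSq_eq_conj_mul_self]; ring
      rw [h2]; exact Complex.ofReal_ne_zero.2 h
    refine ⟨w₀ + (-(hform q R z v w₀ / m)) • v, ?_, ?_⟩
    · rw [hΓ.hform_add, e2]; change _ + _ * m = 0; field_simp; ring
    · rw [det2_add, e1, e3, mul_zero, add_zero]; exact h0
  have h1 : ∀ x : ℂ, hform q R z v (v + (x * m / det2 v w) • w) = m := fun x => by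
    rw [hΓ.hform_add, e2, hw, mul_zero, add_zero]
  have h2 : ∀ x : ℂ, v + (x * m / det2 v w) • w ≠ 0 := fun x h0 => by
    have := h1 x
    rw [h0, ← zero_smul ℂ (0 : C2), e2, zero_mul] at this
    exact hm this.symm
  refine ⟨fun x => Projectivization.mk ℂ _ (h2 x), continuous_mk_comp (by fun_prop) h2, ?_,
    fun x => ?_, fun x => ?_⟩
  · simp [hopf_mk]
  · rw [hopf_mk, notOrtho_mk, h1]; exact hm
  · rw [affineCoord_mk, h1, det2_add, e1, e3]; field_simp; ring

theorem IsSurfaceGroup.isOpen_notOrtho (hΓ : IsSurfaceGroup Γ) :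
    IsOpen {x : ℍ × CP1 × CP1 | NotOrtho q R x.1 x.2.1 x.2.2} := by
  have hq := (IsOpenQuotientMap.id (X := ℍ)).prodMap
    ((isOpenQuotientMap_mk ℂ C2).prodMap (isOpenQuotientMap_mk ℂ C2))
  rw [← hq.isQuotientMap.isOpen_preimage]
  convert isOpen_ne_fun (((hΓ.continuous_hform (q := q) (R := R)).comp
    (f := fun x : ℍ × {v : C2 // v ≠ 0} × {v : C2 // v ≠ 0} => (x.1, x.2.1.1, x.2.2.1))
    (by fun_prop))) continuous_const using 1
  swap
  · exact 0
  ext x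
  exact notOrtho_mk _ _ _

theorem IsSurfaceGroup.continuousAt_affineCoord (hΓ : IsSurfaceGroup Γ) {z : ℍ} {p : RP3} {p' : CP1}
    (h : NotOrtho q R z (hopf p) p') :
    ContinuousAt (fun x : ℍ × RP3 × CP1 => affineCoord q R x.1 x.2.1 x.2.2) (z, p, p') := by
  have hq := (IsOpenQuotientMap.id (X := ℍ)).prodMap
    ((isOpenQuotientMap_mk ℝ C2).prodMap (isOpenQuotientMap_mk ℂ C2))
  obtain ⟨x, hx⟩ := hq.surjective (z, p, p')
  rw [← hx, ← hq.continuousAt_comp_iff]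
  have hc := (hΓ.continuous_hform (q := q) (R := R)).comp
    (f := fun x : ℍ × {v : C2 // v ≠ 0} × {v : C2 // v ≠ 0} => (x.1, x.2.1.1, x.2.2.1))
    (by fun_prop)
  have hd := continuous_det2.comp
    (f := fun x : ℍ × {v : C2 // v ≠ 0} × {v : C2 // v ≠ 0} => (x.2.1.1, x.2.2.1)) (by fun_prop)
  have : (fun x : ℍ × RP3 × CP1 => affineCoord q R x.1 x.2.1 x.2.2) ∘
      (Prod.map id (Prod.map (fun v : {v : C2 // v ≠ 0} => Projectivization.mk ℝ v.1 v.2)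
        (fun v : {v : C2 // v ≠ 0} => Projectivization.mk ℂ v.1 v.2))) =
      fun x => det2 x.2.1.1 x.2.2.1 / hform q R x.1 x.2.1.1 x.2.2.1 := by
    ext x
    exact affineCoord_mk _ _ _
  rw [this]
  refine hd.continuousAt.div hc.continuousAt ?_
  simp only [Prod.map, Prod.mk.injEq] at hx
  obtain ⟨rfl, rfl, rfl⟩ := hx
  exact (notOrtho_mk _ _ _).1 h

end

/-! ### The degree of small loops -/

/-- The phase of a complex number. -/
def phase (z : ℂ) : Circle := Circle.exp z.arg

theorem coe_phase {z : ℂ} (hz : z ≠ 0) : (phase z : ℂ) = z / ‖z‖ := by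
  have h : (‖z‖ : ℂ) ≠ 0 := by simpa using hz
  rw [eq_div_iff h, mul_comm, phase, Circle.coe_exp, Complex.norm_mul_exp_arg_mul_I]

theorem continuousAt_phase {z : ℂ} (hz : z ≠ 0) : ContinuousAt phase z := by
  have hi : IsInducing (fun c : Circle => (c : ℂ)) := ⟨rfl⟩
  rw [hi.continuousAt_iff]
  have h : (fun z : ℂ => z / ‖z‖) =ᶠ[𝓝 z] fun z => (phase z : ℂ) :=
    (isOpen_ne.eventually_mem hz).mono fun w hw => (coe_phase hw).symm
  refine ContinuousAt.congr ?_ h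
  exact continuousAt_id.div (Complex.continuous_ofReal.comp continuous_norm).continuousAt
    (by simpa using hz)

theorem phase_exp_mul (t : ℝ) {z : ℂ} (hz : z ≠ 0) :
    phase (Complex.exp (t * Complex.I) * z) = Circle.exp t * phase z := by
  refine Subtype.ext ?_
  rw [Circle.coe_mul, coe_phase hz, coe_phase (mul_ne_zero (Complex.exp_ne_zero _) hz), norm_mul,
    Complex.norm_exp_ofReal_mul_I, one_mul, Circle.coe_exp, mul_div_assoc]

theorem phase_exp (x : ℝ) (t : ℝ) : phase (Complex.exp (x + t * Complex.I)) = Circle.exp t := by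
  refine Subtype.ext ?_
  rw [coe_phase (Complex.exp_ne_zero _), Complex.norm_exp, Circle.coe_exp, Complex.exp_add]
  simp only [Complex.add_re, Complex.ofReal_re, Complex.mul_re, Complex.I_re, mul_zero,
    Complex.ofReal_im, Complex.I_im, mul_one, sub_self, add_zero]
  rw [Complex.ofReal_exp, mul_div_cancel_left₀ _ (Complex.exp_ne_zero _)]

theorem norm_mul_phase_ext {z w : ℂ} (hz : z ≠ 0) (hw : w ≠ 0) (hn : ‖z‖ = ‖w‖)
    (hp : phase z = phase w) : z = w := by
  have h1 := congrArg (fun c : Circle => (c : ℂ)) hp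
  rw [coe_phase hz, coe_phase hw, hn] at h1
  exact (div_left_inj' (by simpa using hw)).1 h1

theorem HasDegree.comp_mul {b : ℝ → Circle} {d' : ℤ} (h : HasDegree b d') (d : ℤ) :
    HasDegree (fun θ => b (d * θ)) (d * d') := by
  obtain ⟨ℓ, h1, h2⟩ := h
  refine ⟨fun θ => ℓ (d * θ), ⟨h1.continuous.comp (continuous_const_mul _), fun θ => h1.exp _⟩,
    fun θ => ?_⟩
  have hp : Function.Periodic (fun x => ℓ x - 2 * d' * x) Real.pi := fun x => by
    simp only [h2]; ring
  have h3 := hp.int_mul d (d * θ)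
  push_cast
  rw [mul_add]
  linarith

/-- Polar coordinates with centre the base point of the frame `A`. -/
def polar (A : SL(2, ℝ)) (θ r : ℝ) : ℍ := gpt (A * rotSL θ) r

theorem rotSL_add (α θ : ℝ) : rotSL (α + θ) = rotSL α * rotSL θ := by
  refine Subtype.ext ?_
  rw [Matrix.SpecialLinearGroup.coe_mul]
  simp only [rotSL, Real.cos_add, Real.sin_add]
  ext i j
  fin_cases i <;> fin_cases j <;> simp <;> ring

theorem rotSL_pi : rotSL Real.pi = -1 := by
  ext i j
  fin_cases i <;> fin_cases j <;> simp [rotSL]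

theorem rotSL_add_pi (θ : ℝ) : rotSL (θ + Real.pi) = -rotSL θ := by
  rw [rotSL_add, rotSL_pi, mul_neg, mul_one]

theorem polar_add_pi (A : SL(2, ℝ)) (θ r : ℝ) : polar A (θ + Real.pi) r = polar A θ r := by
  rw [polar, rotSL_add_pi, mul_neg, gpt_neg, polar]

theorem polar_mul_rotSL (A : SL(2, ℝ)) (α θ r : ℝ) :
    polar (A * rotSL α) θ r = polar A (α + θ) r := by
  rw [polar, polar, rotSL_add, mul_assoc]

theorem polar_mul (B A : SL(2, ℝ)) (θ r : ℝ) : polar (B * A) θ r = B • polar A θ r := by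
  rw [polar, polar, mul_assoc, gpt_mul]

theorem continuous_polar : Continuous fun x : SL(2, ℝ) × ℝ × ℝ => polar x.1 x.2.1 x.2.2 :=
  continuous_gpt_comp (continuous_fst.mul (continuous_rotSL.comp continuous_snd.fst))
    continuous_snd.snd

theorem dist_polar (A : SL(2, ℝ)) (θ : ℝ) {r : ℝ} (hr : 0 ≤ r) :
    dist (polar A θ r) (A • UpperHalfPlane.I) = r := by
  have h : A • UpperHalfPlane.I = gpt (A * rotSL θ) 0 := by
    rw [gpt_eq, UnitTangent.pt_axis_zero, mul_smul, rotSL_smul_I]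
  rw [h, polar, dist_gpt_gpt, sub_zero, abs_of_nonneg hr]

/-- The angle of a point of the hyperbolic plane seen from the base point of a frame. -/
def angle (A : SL(2, ℝ)) (w : ℍ) : Circle :=
  phase ((((A⁻¹ • w : ℍ) : ℂ) - Complex.I) / (((A⁻¹ • w : ℍ) : ℂ) + Complex.I))

theorem add_I_ne_zero (w : ℍ) : (w : ℂ) + Complex.I ≠ 0 := fun h => by
  have := congrArg Complex.im h
  simp at this
  linarith [w.im_pos]

theorem sub_I_ne_zero {A : SL(2, ℝ)} {w : ℍ} (hw : w ≠ A • UpperHalfPlane.I) :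
    ((A⁻¹ • w : ℍ) : ℂ) - Complex.I ≠ 0 := fun h => hw <| by
  rw [← inv_smul_eq_iff]
  ext
  rw [UpperHalfPlane.coe_I]
  exact sub_eq_zero.1 h

theorem continuousAt_angle {A : SL(2, ℝ)} {w : ℍ} (hw : w ≠ A • UpperHalfPlane.I) :
    ContinuousAt (angle A) w := by
  have hc : Continuous fun w : ℍ => ((A⁻¹ • w : ℍ) : ℂ) :=
    UpperHalfPlane.continuous_coe.comp (continuous_const_smul _)
  refine ContinuousAt.comp (g := phase) (continuousAt_phase
    (div_ne_zero (sub_I_ne_zero hw) (add_I_ne_zero _))) ?_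
  exact ((hc.sub continuous_const).div (hc.add continuous_const)
    fun w => add_I_ne_zero _).continuousAt

/-- In the Cayley coordinate `(w - i) / (w + i)` the matrix `rotSL θ` is multiplication by
`e^{2iθ}`. -/
theorem angle_polar (A : SL(2, ℝ)) (θ : ℝ) {r : ℝ} (hr : 0 < r) :
    angle A (polar A θ r) = Circle.exp (2 * θ) * angle A (polar A 0 r) := by
  have h0 : polar A 0 r ≠ A • UpperHalfPlane.I := fun h => by
    have := dist_polar A 0 hr.le
    rw [h, dist_self] at this
    exact hr.ne this
  have h1 : polar A θ r = (A * rotSL θ * A⁻¹) • polar A 0 r := by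
    have : rotSL 0 = 1 := by ext i j; fin_cases i <;> fin_cases j <;> simp [rotSL]
    rw [polar, polar, this, mul_one, ← gpt_mul]
    congr 1; group
  rw [h1, angle, angle, ← phase_exp_mul _ (div_ne_zero (sub_I_ne_zero h0) (add_I_ne_zero _))]
  congr 1
  rw [← mul_smul, mul_assoc, inv_mul_cancel_left, mul_smul]
  set w := A⁻¹ • polar A 0 r
  have h2 := UnitTangent.denom_ne_zero (rotSL θ) w
  have h3 := add_I_ne_zero (rotSL θ • w)
  have he : Complex.exp (↑(2 * θ) * Complex.I) =
      (Complex.cos θ + Complex.sin θ * Complex.I) * (Complex.cos θ + Complex.sin θ * Complex.I) := by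
    rw [← Complex.exp_mul_I, ← Complex.exp_add]; push_cast; ring_nf
  have e00 : rotSL θ 0 0 = Real.cos θ := rfl
  have e01 : rotSL θ 0 1 = Real.sin θ := rfl
  have e10 : rotSL θ 1 0 = -Real.sin θ := rfl
  have e11 : rotSL θ 1 1 = Real.cos θ := rfl
  have hcs := Complex.sin_sq_add_cos_sq (θ : ℂ)
  have hI := Complex.I_sq
  have hcoe := UnitTangent.coe_smul (rotSL θ) w
  rw [e10, e11] at h2
  rw [e00, e01, e10, e11, eq_div_iff h2] at hcoe
  push_cast at h2 hcoe
  rw [← mul_div_assoc, div_eq_div_iff h3 (add_I_ne_zero w), he]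
  refine mul_right_cancel₀ h2 ?_
  generalize Complex.cos (θ : ℂ) = c at *
  generalize Complex.sin (θ : ℂ) = s at *
  generalize ((rotSL θ • w : ℍ) : ℂ) = y at *
  generalize (w : ℂ) = x at *
  generalize Complex.I = i at *
  have k1 : (y - i) * (-s * x + c) = (c + s * i) * (x - i) := by
    linear_combination hcoe + s * hI
  have k2 : (y + i) * (-s * x + c) = (c - s * i) * (x + i) := by
    linear_combination hcoe + s * hI
  have k3 : (c + s * i) * (c - s * i) = 1 := by linear_combination hcs - s ^ 2 * hI
  linear_combination (x + i) * k1 - (c + s * i) * (c + s * i) * (x - i) * k2 -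
    (c + s * i) * (x - i) * (x + i) * k3

/-! ### Images by `u` of small circles -/

section

variable {Γ : Subgroup PSL(2, ℝ)} {q : Γ →* PSL(2, ℂ)} {R : ℝ} {u : EquivariantLocalHomeo q}

/-- On the balls of radius `r`, the map `u` is injective and takes its values in an affine chart. -/
structure IsGoodRadius (R : ℝ) (u : EquivariantLocalHomeo q) (r : ℝ) : Prop where
  pos : 0 < r
  injOn : ∀ z x y, dist x z ≤ r → dist y z ≤ r → u.toFun x = u.toFun y → x = y
  notOrtho : ∀ z x, dist x z ≤ r → NotOrtho q R z (u.toFun z) (u.toFun x)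

theorem notOrtho_self (hΓ : IsSurfaceGroup Γ)
    (hR : ∀ z : ℍ, ∃ γ : Γ, dist (γ • z) UpperHalfPlane.I ≤ R) (z : ℍ) (p : CP1) :
    NotOrtho q R z p p :=
  hΓ.hform_self_ne_zero hR z p.rep_nonzero

/-- Both conditions are `Γ`-invariant and hold for pairs of points near the diagonal. A Lebesgue
number for a compact ball that meets every orbit gives a uniform radius. -/
theorem IsSurfaceGroup.exists_isGoodRadius (hΓ : IsSurfaceGroup Γ)
    (hR : ∀ z : ℍ, ∃ γ : Γ, dist (γ • z) UpperHalfPlane.I ≤ R) (u : EquivariantLocalHomeo q) :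
    ∃ r, IsGoodRadius R u r := by
  have hloc : ∀ z : ℍ, ∃ V : Set ℍ, IsOpen V ∧ z ∈ V ∧ ∀ x ∈ V, ∀ y ∈ V,
      (u.toFun x = u.toFun y → x = y) ∧ NotOrtho q R x (u.toFun x) (u.toFun y) := by
    intro z
    obtain ⟨e, hze, he⟩ := u.isLocalHomeomorph z
    have hopen : IsOpen {x : ℍ × ℍ | NotOrtho q R x.1 (u.toFun x.1) (u.toFun x.2)} := by
      have hu := u.isLocalHomeomorph.continuous
      exact (hΓ.isOpen_notOrtho (q := q) (R := R)).preimage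
        (f := fun x : ℍ × ℍ => (x.1, u.toFun x.1, u.toFun x.2)) (by fun_prop)
    have hmem : (z, z) ∈ {x : ℍ × ℍ | NotOrtho q R x.1 (u.toFun x.1) (u.toFun x.2)} := by
      rw [Set.mem_ofPred_eq]; exact notOrtho_self hΓ hR z _
    obtain ⟨U, V, hU, hV, hzU, hzV, hUV⟩ := isOpen_prod_iff.1 hopen z z hmem
    refine ⟨e.source ∩ (U ∩ V), e.open_source.inter (hU.inter hV), ⟨hze, hzU, hzV⟩,
      fun x hx y hy => ⟨fun h => ?_, ?_⟩⟩
    swap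
    · have := hUV (Set.mk_mem_prod hx.2.1 hy.2.2)
      rwa [Set.mem_ofPred_eq] at this
    rw [he] at h
    exact e.injOn hx.1 hy.1 h
  choose V hVo hzV hV using hloc
  obtain ⟨δ, hδ, h⟩ := lebesgue_number_lemma_of_metric (isCompact_closedBall UpperHalfPlane.I R)
    hVo (fun z _ => Set.mem_iUnion.2 ⟨z, hzV z⟩)
  have hiso : ∀ (γ : Γ) (x y : ℍ), dist (γ • x) (γ • y) = dist x y := fun γ x y =>
    dist_smul (γ : PSL(2, ℝ)) x y
  refine ⟨δ / 2, half_pos hδ, fun z x y hx hy hxy => ?_, fun z x hx => ?_⟩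
  · obtain ⟨γ, hγ⟩ := hR z
    obtain ⟨i, hi⟩ := h (γ • z) hγ
    have h1 := (hV i (γ • x) (hi (by rw [Metric.mem_ball, hiso]; linarith)) (γ • y)
      (hi (by rw [Metric.mem_ball, hiso]; linarith))).1
      (by rw [u.equivariant, u.equivariant, hxy])
    exact smul_left_cancel γ h1
  · obtain ⟨γ, hγ⟩ := hR z
    obtain ⟨i, hi⟩ := h (γ • z) hγ
    have h1 := (hV i (γ • z) (hi (Metric.mem_ball_self hδ)) (γ • x)
      (hi (by rw [Metric.mem_ball, hiso]; linarith))).2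
    rwa [u.equivariant, u.equivariant, notOrtho_equivariant] at h1

variable (u) in
/-- Frames together with a point of the fibre of the pullback. -/
abbrev FramePair : Type :=
  {x : SL(2, ℝ) × HopfPullback u // x.1 • UpperHalfPlane.I = x.2.base}

/-- The affine coordinate of the images by `u` of the points of a circle. -/
def loopCoord (R : ℝ) (r : ℝ) (x : FramePair u) (θ : ℝ) : ℂ :=
  affineCoord q R x.1.2.base (x.1.2.toRP3 u) (u.toFun (polar x.1.1 θ r))

/-- The phases of the images by `u` of the points of a circle. -/
def loopPhase (R : ℝ) (r : ℝ) (x : FramePair u) (θ : ℝ) : Circle := phase (loopCoord R r x θ)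

theorem dist_polar_base (x : FramePair u) (θ : ℝ) {r : ℝ} (hr : 0 ≤ r) :
    dist (polar x.1.1 θ r) x.1.2.base = r := by
  rw [← x.2, dist_polar _ _ hr]

theorem IsGoodRadius.notOrtho_polar {r₀ : ℝ} (h : IsGoodRadius R u r₀) (x : FramePair u) (θ : ℝ)
    {r : ℝ} (hr : 0 ≤ r) (hr' : r ≤ r₀) :
    NotOrtho q R x.1.2.base (hopf (x.1.2.toRP3 u)) (u.toFun (polar x.1.1 θ r)) := by
  rw [HopfPullback.hopf_toRP3]
  exact h.notOrtho _ _ (by rw [dist_polar_base x θ hr]; exact hr')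

theorem IsGoodRadius.loopCoord_ne_zero {r₀ : ℝ} (h : IsGoodRadius R u r₀) (x : FramePair u) (θ : ℝ)
    {r : ℝ} (hr : 0 < r) (hr' : r ≤ r₀) : loopCoord R r x θ ≠ 0 := by
  refine affineCoord_ne_zero (h.notOrtho_polar x θ hr.le hr') fun he => ?_
  rw [HopfPullback.hopf_toRP3] at he
  have h1 := h.injOn x.1.2.base _ _ (by rw [dist_self]; exact h.pos.le)
    (by rw [dist_polar_base x θ hr.le]; exact hr') he
  have h2 := dist_polar_base x θ hr.le
  rw [← h1, dist_self] at h2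
  exact hr.ne h2

theorem IsGoodRadius.continuous_loopCoord (hΓ : IsSurfaceGroup Γ) {r₀ : ℝ}
    (h : IsGoodRadius R u r₀) :
    Continuous fun y : (FramePair u × Set.Ioc 0 r₀) × ℝ => loopCoord R y.1.2 y.1.1 y.2 := by
  rw [continuous_iff_continuousAt]
  rintro ⟨⟨x, r, hr⟩, θ⟩
  refine ContinuousAt.comp (g := fun x : ℍ × RP3 × CP1 => affineCoord q R x.1 x.2.1 x.2.2)
    (f := fun y : (FramePair u × Set.Ioc 0 r₀) × ℝ => (y.1.1.1.2.base, y.1.1.1.2.toRP3 u,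
      u.toFun (polar y.1.1.1.1 y.2 y.1.2)))
    (hΓ.continuousAt_affineCoord (h.notOrtho_polar x θ hr.1.le hr.2)) (Continuous.continuousAt ?_)
  have h1 : Continuous fun y : (FramePair u × Set.Ioc 0 r₀) × ℝ => y.1.1.1.2 := by fun_prop
  refine (HopfPullback.continuous_base.comp h1).prodMk
    ((HopfPullback.continuous_toRP3.comp h1).prodMk (u.isLocalHomeomorph.continuous.comp ?_))
  exact continuous_polar.comp (f := fun y : (FramePair u × Set.Ioc 0 r₀) × ℝ =>
    (y.1.1.1.1, y.2, (y.1.2 : ℝ))) (by fun_prop)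

theorem IsGoodRadius.continuous_loopPhase (hΓ : IsSurfaceGroup Γ) {r₀ : ℝ}
    (h : IsGoodRadius R u r₀) :
    Continuous fun y : (FramePair u × Set.Ioc 0 r₀) × ℝ => loopPhase R y.1.2 y.1.1 y.2 := by
  rw [continuous_iff_continuousAt]
  rintro ⟨⟨x, r, hr⟩, θ⟩
  exact ContinuousAt.comp (g := phase)
    (f := fun y : (FramePair u × Set.Ioc 0 r₀) × ℝ => loopCoord R y.1.2 y.1.1 y.2)
    (continuousAt_phase (h.loopCoord_ne_zero x θ hr.1 hr.2))
    (h.continuous_loopCoord hΓ).continuousAt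

theorem loopCoord_periodic (r : ℝ) (x : FramePair u) :
    Function.Periodic (loopCoord R r x) Real.pi := fun θ => by
  rw [loopCoord, polar_add_pi, loopCoord]

theorem loopPhase_periodic (r : ℝ) (x : FramePair u) :
    Function.Periodic (loopPhase R r x) Real.pi := fun θ => by
  rw [loopPhase, loopCoord_periodic, loopPhase]

theorem IsGoodRadius.continuous_loopPhase_right (hΓ : IsSurfaceGroup Γ) {r₀ : ℝ}
    (h : IsGoodRadius R u r₀) {r : ℝ} (hr : r ∈ Set.Ioc 0 r₀) (x : FramePair u) :
    Continuous (loopPhase R r x) :=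
  (h.continuous_loopPhase hΓ).comp (f := fun θ : ℝ => ((x, (⟨r, hr⟩ : Set.Ioc 0 r₀)), θ))
    (by fun_prop)

theorem IsGoodRadius.hasDegree_radius (hΓ : IsSurfaceGroup Γ) {r₀ : ℝ}
    (h : IsGoodRadius R u r₀) {r r' : ℝ} (hr : r ∈ Set.Ioc 0 r₀) (hr' : r' ∈ Set.Ioc 0 r₀)
    (x : FramePair u) {d : ℤ} (hd : HasDegree (loopPhase R r x) d) :
    HasDegree (loopPhase R r' x) d := by
  have hp : PreconnectedSpace (Set.Ioc 0 r₀) := Subtype.preconnectedSpace isPreconnected_Ioc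
  refine hasDegree_of_preconnected (κ := fun s : Set.Ioc 0 r₀ => loopPhase R s x) ?_
    (fun s => loopPhase_periodic s x) (x₀ := ⟨r, hr⟩) hd ⟨r', hr'⟩
  exact (h.continuous_loopPhase hΓ).comp (f := fun y : Set.Ioc 0 r₀ × ℝ => ((x, y.1), y.2))
    (by fun_prop)

/-- Continuous determinations of the logarithm of a loop give a homotopy to a standard loop. -/
theorem exists_homotopy_of_hasDegree {c : ℝ → ℂ} (hc : Continuous c) (h0 : ∀ θ, c θ ≠ 0)
    (hp : Function.Periodic c Real.pi) {d : ℤ} (hd : HasDegree (fun θ => phase (c θ)) d) {ε ρ : ℝ}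
    (hε : ∀ θ, ‖c θ‖ < ε) (hρ : 0 < ρ) (hρε : ρ < ε) :
    ∃ H : unitInterval → ℝ → ℂ, Continuous (Function.uncurry H) ∧ (∀ s θ, H s θ ≠ 0) ∧
      (∀ s θ, ‖H s θ‖ < ε) ∧ (∀ s, Function.Periodic (H s) Real.pi) ∧ (∀ θ, H 0 θ = c θ) ∧
      ∀ θ, H 1 θ = ρ * Complex.exp ((2 * (d * θ) : ℝ) * Complex.I) := by
  obtain ⟨ℓ, h1, h2⟩ := hd
  have hcn : Continuous fun θ => Real.log ‖c θ‖ := hc.norm.log fun θ => norm_ne_zero_iff.2 (h0 θ)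
  have hℓ := h1.continuous
  have hεpos : 0 < ε := hρ.trans hρε
  refine ⟨fun s θ => Complex.exp ((((1 - s) * Real.log ‖c θ‖ + s * Real.log ρ : ℝ) : ℂ) +
    (((1 - s) * ℓ θ + s * (2 * (d * θ)) : ℝ) : ℂ) * Complex.I), ?_, fun s θ => Complex.exp_ne_zero _,
    fun s θ => ?_, fun s θ => ?_, fun θ => ?_, fun θ => ?_⟩
  · have e1 : Continuous fun x : unitInterval × ℝ => Real.log ‖c x.2‖ := hcn.comp continuous_snd
    have e2 : Continuous fun x : unitInterval × ℝ => ℓ x.2 := hℓ.comp continuous_snd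
    unfold Function.uncurry
    fun_prop
  · rw [Complex.norm_exp, ← Real.lt_log_iff_exp_lt hεpos]
    have e1 := Real.log_lt_log (norm_pos_iff.2 (h0 θ)) (hε θ)
    have e2 := Real.log_lt_log hρ hρε
    have e3 := s.2.1
    have e4 := s.2.2
    simp only [Complex.add_re, Complex.ofReal_re, Complex.mul_re, Complex.I_re, mul_zero,
      Complex.ofReal_im, Complex.I_im, mul_one, sub_self, add_zero]
    rcases e3.eq_or_lt with h | h
    · rw [← h]; simpa using e1
    · have : (1 - (s : ℝ)) * Real.log ‖c θ‖ ≤ (1 - s) * Real.log ε :=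
        mul_le_mul_of_nonneg_left e1.le (by linarith)
      have : (s : ℝ) * Real.log ρ < s * Real.log ε := mul_lt_mul_of_pos_left e2 h
      nlinarith
  · simp only [hp θ, h2]
    have : (((1 - s) * (ℓ θ + d * (2 * Real.pi)) + s * (2 * (d * (θ + Real.pi))) : ℝ) : ℂ) *
        Complex.I = (((1 - s) * ℓ θ + s * (2 * (d * θ)) : ℝ) : ℂ) * Complex.I +
          d * (2 * Real.pi * Complex.I) := by push_cast; ring
    rw [this, ← add_assoc, Complex.exp_add, Complex.exp_int_mul_two_pi_mul_I, mul_one]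
  · refine norm_mul_phase_ext (Complex.exp_ne_zero _) (h0 θ) ?_ ?_
    · rw [Complex.norm_exp]
      simp [Real.exp_log (norm_pos_iff.2 (h0 θ))]
    · rw [phase_exp]; simpa using h1.exp θ
  · beta_reduce
    rw [Complex.exp_add, ← Complex.ofReal_exp]
    simp [Real.exp_log hρ]

/-- Small loops have degree `1` or `-1`. -/
theorem IsGoodRadius.degree_eq (hΓ : IsSurfaceGroup Γ)
    (hR : ∀ z : ℍ, ∃ γ : Γ, dist (γ • z) UpperHalfPlane.I ≤ R) {r₀ : ℝ} (h : IsGoodRadius R u r₀)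
    (x : FramePair u) {d : ℤ} (hd : HasDegree (loopPhase R r₀ x) d) : d = 1 ∨ d = -1 := by
  obtain ⟨z, hz⟩ : ∃ z, z = x.1.2.base := ⟨_, rfl⟩
  set A := x.1.1
  have hA : A • UpperHalfPlane.I = z := by rw [hz]; exact x.2
  set p := x.1.2.toRP3 u
  have hp : hopf p = u.toFun z := by rw [hz]; exact HopfPullback.hopf_toRP3 _
  obtain ⟨g, hg, hg0, hgo, hgi⟩ := hΓ.exists_affineCoord_inverse (q := q) hR z p
  obtain ⟨e, hze, he⟩ := u.isLocalHomeomorph z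
  have hev : ∀ y, e y = u.toFun y := fun y => by rw [he]
  have hgz : g 0 = e z := by rw [hg0, hp, hev]
  have htar : g 0 ∈ e.target := by rw [hgz]; exact e.map_source hze
  -- `ψ` is a local inverse of the coordinate map `y ↦ affineCoord q R z p (u y)` near `z`, defined
  -- through a local inverse of `u`.
  set ψ : ℂ → ℍ := fun y => e.symm (g y) with hψ
  have hψ0 : ψ 0 = z := by rw [hψ]; simp only [hgz, e.left_inv hze]
  have hψc : ∀ y, g y ∈ e.target → ContinuousAt ψ y := fun y hy =>
    (e.continuousAt_symm hy).comp hg.continuousAt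
  obtain ⟨ε, hε, hball⟩ := Metric.eventually_nhds_iff_ball.1
    ((hg.continuousAt.eventually (e.open_target.mem_nhds htar)).and
      ((hψc 0 htar).eventually (Metric.closedBall_mem_nhds _ h.pos)))
  simp only [mem_ball_zero_iff, hψ0] at hball
  have hu : ∀ y, ‖y‖ < ε → u.toFun (ψ y) = g y := fun y hy => by
    rw [← hev]; exact e.right_inv (hball y hy).1
  have hcoord : ∀ y, ‖y‖ < ε → affineCoord q R z p (u.toFun (ψ y)) = y := fun y hy => by
    rw [hu y hy, hgi]
  have hψz : ∀ y, ‖y‖ < ε → y ≠ 0 → ψ y ≠ A • UpperHalfPlane.I := by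
    intro y hy hy0 hyz
    have h1 := hcoord y hy
    rw [hyz, hA, ← hp, affineCoord_hopf] at h1
    exact hy0 h1.symm
  -- points close to the centre
  have hcz : ContinuousAt (fun y => affineCoord q R z p (u.toFun y)) z := by
    refine ContinuousAt.comp (g := fun x : ℍ × RP3 × CP1 => affineCoord q R x.1 x.2.1 x.2.2)
      (f := fun y => (z, p, u.toFun y)) (hΓ.continuousAt_affineCoord ?_) ?_
    · rw [hp]; exact notOrtho_self hΓ hR z _
    · exact continuousAt_const.prodMk (continuousAt_const.prodMk
        u.isLocalHomeomorph.continuous.continuousAt)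
  have h0 : affineCoord q R z p (u.toFun z) = 0 := by rw [← hp, affineCoord_hopf]
  obtain ⟨r₁, hr₁, hr₁'⟩ := Metric.eventually_nhds_iff.1 (hcz.eventually
    (Metric.ball_mem_nhds _ hε))
  simp only [h0, dist_zero_right] at hr₁'
  set r := min r₀ (r₁ / 2) with hrdef
  have hr : r ∈ Set.Ioc 0 r₀ := ⟨lt_min h.pos (half_pos hr₁), min_le_left _ _⟩
  have hrr : r < r₁ := (min_le_right _ _).trans_lt (half_lt_self hr₁)
  have hdist : ∀ θ, dist (polar A θ r) z = r := fun θ => by rw [← hA, dist_polar _ _ hr.1.le]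
  have hc : ∀ θ, loopCoord R r x θ = affineCoord q R z p (u.toFun (polar A θ r)) := fun θ => by
    rw [loopCoord, ← hz]
  have hcε : ∀ θ, ‖loopCoord R r x θ‖ < ε := fun θ => by
    rw [hc]; exact hr₁' ((hdist θ).trans_lt hrr)
  have hψp : ∀ θ, ψ (loopCoord R r x θ) = polar A θ r := by
    intro θ
    refine h.injOn z _ _ (hball _ (hcε θ)).2 (by rw [hdist]; exact hr.2) ?_
    rw [hu _ (hcε θ)]
    refine hΓ.affineCoord_injective hR (hgo _) ?_ ((hgi _).trans (hc θ))
    rw [hp]; exact h.notOrtho z _ (by rw [hdist]; exact hr.2)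
  have hd' := h.hasDegree_radius hΓ ⟨h.pos, le_rfl⟩ hr x hd
  have hcc : Continuous (loopCoord R r x) :=
    (h.continuous_loopCoord hΓ).comp (f := fun θ : ℝ => ((x, (⟨r, hr⟩ : Set.Ioc 0 r₀)), θ))
      (by fun_prop)
  obtain ⟨H, hHc, hH0, hHε, hHp, hHs, hHe⟩ := exists_homotopy_of_hasDegree hcc
    (fun θ => h.loopCoord_ne_zero x θ hr.1 hr.2) (loopCoord_periodic r x) hd' hcε (half_pos hε)
    (half_lt_self hε)
  have hang : ∀ y, ‖y‖ < ε → y ≠ 0 → ContinuousAt (fun y => angle A (ψ y)) y := fun y hy hy0 =>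
    ContinuousAt.comp (g := angle A) (continuousAt_angle (hψz y hy hy0)) (hψc y (hball y hy).1)
  -- The homotopy `H` goes from the image loop to `ρ e^{2 i d θ}` in the punctured disc, with `ρ = ε
  -- / 2`. It is carried back to `ℍ` by `ψ` and observed through `angle`: at time `0` it is the
  -- original circle, of degree `1`.
  have hstart : HasDegree (fun θ => angle A (ψ (H 0 θ))) 1 := by
    have h1 : (fun θ => angle A (ψ (H 0 θ))) =
        fun θ => Circle.exp (2 * θ) * angle A (polar A 0 r) := by
      funext θ; rw [hHs, hψp, angle_polar _ _ hr.1]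
    rw [h1]
    refine ⟨fun θ => 2 * θ + (angle A (polar A 0 r) : ℂ).arg, ⟨by fun_prop, fun θ => ?_⟩,
      fun θ => ?_⟩
    · rw [Circle.exp_add, Circle.exp_arg]
    · push_cast; ring
  have hend := hasDegree_of_preconnected (κ := fun s θ => angle A (ψ (H s θ))) (by
      rw [continuous_iff_continuousAt]
      rintro ⟨s, θ⟩
      exact ContinuousAt.comp (g := fun y => angle A (ψ y)) (f := Function.uncurry H)
        (hang _ (hHε s θ) (hH0 s θ)) hHc.continuousAt)
    (fun s θ => by simp only [hHp s θ]) hstart 1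
  have hne : ∀ τ : ℝ, ((ε / 2 : ℝ) : ℂ) * Complex.exp ((2 * τ : ℝ) * Complex.I) ≠ 0 := fun τ =>
    mul_ne_zero (Complex.ofReal_ne_zero.2 (half_pos hε).ne') (Complex.exp_ne_zero _)
  have hnorm : ∀ τ : ℝ, ‖((ε / 2 : ℝ) : ℂ) * Complex.exp ((2 * τ : ℝ) * Complex.I)‖ < ε := by
    intro τ
    rw [norm_mul, Complex.norm_exp_ofReal_mul_I, mul_one, Complex.norm_real,
      Real.norm_of_nonneg (half_pos hε).le]
    exact half_lt_self hε
  -- At time `1` the loop is a fixed loop, of degree `d'`, run at `d` times the speed. So `d * d' =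
  -- 1`.
  obtain ⟨d', hb⟩ := exists_hasDegree (c := fun τ : ℝ =>
      angle A (ψ ((ε / 2 : ℝ) * Complex.exp ((2 * τ : ℝ) * Complex.I)))) (by
      rw [continuous_iff_continuousAt]
      intro τ
      exact ContinuousAt.comp (g := fun y => angle A (ψ y))
        (f := fun τ : ℝ => ((ε / 2 : ℝ) : ℂ) * Complex.exp ((2 * τ : ℝ) * Complex.I))
        (hang _ (hnorm τ) (hne τ)) (by fun_prop))
    (fun τ => by
      have : ((2 * (τ + Real.pi) : ℝ) : ℂ) * Complex.I =
        ((2 * τ : ℝ) : ℂ) * Complex.I + 2 * Real.pi * Complex.I := by push_cast; ring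
      simp only [this, Complex.exp_add, Complex.exp_two_pi_mul_I, mul_one])
  have hb' := hb.comp_mul d
  simp only [hHe] at hend
  exact Int.eq_one_or_neg_one_of_mul_eq_one (hend.unique hb').symm

end

/-! ### The pullback of the Hopf fibration is isomorphic to the unit tangent bundle -/

theorem exists_mk_of_hopf_eq {p p' : RP3} (h : hopf p = hopf p') :
    ∃ (v : C2) (hv : v ≠ 0) (β : ℝ), p = Projectivization.mk ℝ v hv ∧
      p' = Projectivization.mk ℝ (Complex.exp (β * Complex.I) • v)
        (smul_ne_zero (Complex.exp_ne_zero _) hv) := by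
  induction p using Projectivization.ind with | h v hv =>
  induction p' using Projectivization.ind with | h w hw =>
  rw [hopf_mk, hopf_mk, eq_comm, Projectivization.mk_eq_mk_iff'] at h
  obtain ⟨a, rfl⟩ := h
  have ha : a ≠ 0 := left_ne_zero_of_smul hw
  refine ⟨v, hv, a.arg, rfl, ?_⟩
  rw [Projectivization.mk_eq_mk_iff']
  refine ⟨‖a‖, ?_⟩
  rw [ofReal_smul_C2, smul_smul, Complex.norm_mul_exp_arg_mul_I]

theorem mk_exp_smul_eq_of_exp_eq_one {β : ℝ} (h : Circle.exp (2 * β) = 1) {v : C2} (hv : v ≠ 0) :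
    Projectivization.mk ℝ (Complex.exp (β * Complex.I) • v)
      (smul_ne_zero (Complex.exp_ne_zero _) hv) = Projectivization.mk ℝ v hv := by
  have h1 : Complex.exp (β * Complex.I) * Complex.exp (β * Complex.I) = 1 := by
    have := congrArg (fun c : Circle => (c : ℂ)) h
    rw [Circle.coe_exp, Circle.coe_one] at this
    rw [← Complex.exp_add, ← this]
    push_cast; ring_nf
  rw [Projectivization.mk_eq_mk_iff']
  rcases mul_self_eq_one_iff.1 h1 with h2 | h2
  · exact ⟨1, by rw [h2, one_smul, one_smul]⟩
  · exact ⟨-1, by rw [h2, neg_smul, neg_smul, one_smul, one_smul]⟩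

theorem rotSL_cases_of_exp_eq_one {α : ℝ} (h : Circle.exp (2 * α) = 1) :
    rotSL α = 1 ∨ rotSL α = -1 := by
  obtain ⟨n, hn⟩ := Circle.exp_eq_one.1 h
  have hα : α = n * Real.pi := by linarith
  have hs : Real.sin α = 0 := by rw [hα]; exact Real.sin_int_mul_pi n
  have hc : Real.cos α = 1 ∨ Real.cos α = -1 := by
    have := Real.sin_sq_add_cos_sq α
    rw [hs] at this
    exact sq_eq_one_iff.1 (by linarith)
  rcases hc with hc | hc
  · left; ext i j; fin_cases i <;> fin_cases j <;> simp [rotSL, hs, hc]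
  · right; ext i j; fin_cases i <;> fin_cases j <;> simp [rotSL, hs, hc]

theorem rot_smul_axis (A : SL(2, ℝ)) (s : ℝ) : UnitTangent.rot s (A • UnitTangent.axis 0) =
    (A * rotSL (s / 2)) • UnitTangent.axis 0 := by
  rw [mul_smul, rotSL_smul_axis, ← UnitTangent.psl_mk_smul, ← UnitTangent.psl_mk_smul,
    ← UnitTangent.rot_smul, mul_div_cancel₀ s two_ne_zero]

section

variable {Γ : Subgroup PSL(2, ℝ)} {q : Γ →* PSL(2, ℂ)} {R r : ℝ} {u : EquivariantLocalHomeo q}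

theorem HopfPullback.isCompact_base_preimage {K : Set ℍ} (hK : IsCompact K) :
    IsCompact (base ⁻¹' K : Set (HopfPullback u)) := by
  have hcl : IsClosed {x : ℍ × RP3 | u.toFun x.1 = hopf x.2} :=
    isClosed_eq (u.isLocalHomeomorph.continuous.comp continuous_fst)
      (continuous_hopf.comp continuous_snd)
  have := hcl.isClosedEmbedding_subtypeVal.isCompact_preimage (hK.prod isCompact_univ)
  rw [Set.prod_univ] at this
  exact this

theorem HopfPullback.exists_base_eq (z : ℍ) : ∃ x : HopfPullback u, base x = z := by
  refine ⟨ofPair u z (Projectivization.mk ℝ (u.toFun z).rep (u.toFun z).rep_nonzero) ?_, rfl⟩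
  rw [hopf_mk, Projectivization.mk_rep]

theorem loopPhase_rotSL (y : FramePair u) (α : ℝ)
    (h : (y.1.1 * rotSL α) • UpperHalfPlane.I = y.1.2.base) :
    loopPhase R r ⟨(y.1.1 * rotSL α, y.1.2), h⟩ = fun θ => loopPhase R r y (α + θ) := by
  funext θ
  simp only [loopPhase, loopCoord, polar_mul_rotSL]

theorem smul_rotSL_I (y : FramePair u) (α : ℝ) :
    (y.1.1 * rotSL α) • UpperHalfPlane.I = y.1.2.base := by
  rw [mul_smul, rotSL_smul_I, y.2]

variable (R r) in
/-- The mean phase of the images by `u` of the points of a circle. -/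
def framePhase (y : FramePair u) : Circle := meanPhase (loopPhase R r y)

theorem IsGoodRadius.mem_Ioc (h : IsGoodRadius R u r) : r ∈ Set.Ioc 0 r := ⟨h.pos, le_rfl⟩

theorem IsGoodRadius.continuous_framePhase (hΓ : IsSurfaceGroup Γ) (h : IsGoodRadius R u r) :
    Continuous (framePhase (u := u) R r) :=
  continuous_meanPhase (κ := fun y : FramePair u => loopPhase R r y)
    ((h.continuous_loopPhase hΓ).comp
      (f := fun x : FramePair u × ℝ => ((x.1, (⟨r, h.mem_Ioc⟩ : Set.Ioc 0 r)), x.2)) (by fun_prop))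
    (loopPhase_periodic r)

theorem IsGoodRadius.framePhase_rotSL (hΓ : IsSurfaceGroup Γ)
    (hR : ∀ z : ℍ, ∃ γ : Γ, dist (γ • z) UpperHalfPlane.I ≤ R) (h : IsGoodRadius R u r)
    (y : FramePair u) : ∃ d : ℤ, (d = 1 ∨ d = -1) ∧ ∀ α,
      framePhase R r ⟨(y.1.1 * rotSL α, y.1.2), smul_rotSL_I y α⟩ =
        Circle.exp (2 * d * α) * framePhase R r y := by
  obtain ⟨d, hd⟩ := exists_hasDegree (h.continuous_loopPhase_right hΓ h.mem_Ioc y)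
    (loopPhase_periodic r y)
  refine ⟨d, h.degree_eq hΓ hR y hd, fun α => ?_⟩
  rw [framePhase, loopPhase_rotSL, meanPhase_shift hd, framePhase]

/-- The numerator of `affineCoord` is linear in `v` and its denominator antilinear, so multiplying
`v` by `e^{iβ}` multiplies the coordinate by `e^{2iβ}`. -/
theorem IsGoodRadius.framePhase_fibre (hΓ : IsSurfaceGroup Γ) (h : IsGoodRadius R u r)
    {y y' : FramePair u} (hA : y.1.1 = y'.1.1) (hb : y.1.2.base = y'.1.2.base) {v : C2} (hv : v ≠ 0)
    {β : ℝ} (hp : y.1.2.toRP3 u = Projectivization.mk ℝ v hv)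
    (hp' : y'.1.2.toRP3 u = Projectivization.mk ℝ (Complex.exp (β * Complex.I) • v)
        (smul_ne_zero (Complex.exp_ne_zero _) hv)) :
    framePhase R r y' = Circle.exp (2 * β) * framePhase R r y := by
  rw [framePhase, framePhase, ← meanPhase_mul_left (h.continuous_loopPhase_right hΓ h.mem_Ioc y)]
  congr 1
  funext θ
  rw [loopPhase, loopPhase, ← phase_exp_mul _ (h.loopCoord_ne_zero y θ h.pos le_rfl)]
  congr 1
  rw [loopCoord, loopCoord, hp, hp', ← hA, ← hb]
  set p' := u.toFun (polar y.1.1 θ r)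
  induction p' using Projectivization.ind with | h w hw =>
  rw [affineCoord_mk, affineCoord_mk]
  have e1 := det2_smul_smul (Complex.exp (β * Complex.I)) 1 v w
  have e2 := hform_smul_smul (q := q) (R := R) y.1.2.base (Complex.exp (β * Complex.I)) 1 v w
  rw [one_smul] at e1 e2
  rw [e1, e2, ← Complex.exp_conj, mul_one, mul_one, mul_div_mul_comm, ← Complex.exp_sub]
  congr 2
  simp
  ring

variable (R r u) in
/-- The graph of the isomorphism between the unit tangent bundle and the pullback. -/
def BundleRel (w : UnitTangent) (x : HopfPullback u) : Prop :=
  ∃ y : FramePair u, w = y.1.1 • UnitTangent.axis 0 ∧ y.1.2 = x ∧ framePhase R r y = 1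

theorem BundleRel.pt_eq {w : UnitTangent} {x : HopfPullback u} (h : BundleRel R r u w x) :
    w.pt = x.base := by
  obtain ⟨y, rfl, rfl, -⟩ := h
  rw [UnitTangent.pt_smul, UnitTangent.pt_axis_zero, y.2]

/-- `-A` is `A` turned by `π`, which multiplies the phase by `exp (2 π d i) = 1`. The relation on
frames thus descends to vectors. -/
theorem IsGoodRadius.framePhase_eq_one_of_neg (hΓ : IsSurfaceGroup Γ)
    (hR : ∀ z : ℍ, ∃ γ : Γ, dist (γ • z) UpperHalfPlane.I ≤ R) (h : IsGoodRadius R u r)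
    {y y' : FramePair u} (hy : framePhase R r y = 1) (hA : y'.1.1 = -y.1.1)
    (hx : y'.1.2 = y.1.2) : framePhase R r y' = 1 := by
  obtain ⟨d, -, hd⟩ := h.framePhase_rotSL hΓ hR y
  have h1 : y' = ⟨(y.1.1 * rotSL Real.pi, y.1.2), smul_rotSL_I y _⟩ := by
    refine Subtype.ext (Prod.ext ?_ hx)
    change y'.1.1 = y.1.1 * rotSL Real.pi
    rw [hA, rotSL_pi, mul_neg, mul_one]
  have h2 : (2 * d * Real.pi : ℝ) = 2 * Real.pi * d := by ring
  rw [h1, hd, hy, mul_one, h2, Circle.exp_two_pi_mul_int]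

theorem IsGoodRadius.bundleRel_iff (hΓ : IsSurfaceGroup Γ)
    (hR : ∀ z : ℍ, ∃ γ : Γ, dist (γ • z) UpperHalfPlane.I ≤ R) (h : IsGoodRadius R u r)
    (y : FramePair u) : BundleRel R r u (y.1.1 • UnitTangent.axis 0) y.1.2 ↔
      framePhase R r y = 1 := by
  refine ⟨?_, fun hy => ⟨y, rfl, rfl, hy⟩⟩
  rintro ⟨y', hw, hx, hy'⟩
  rcases smul_axis_eq_iff.1 hw with hA | hA
  · have : y = y' := Subtype.ext (Prod.ext hA.symm hx.symm)
    rwa [this]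
  · exact h.framePhase_eq_one_of_neg hΓ hR hy' (by rw [hA, neg_neg]) hx.symm

theorem IsGoodRadius.isClosed_bundleRel (hΓ : IsSurfaceGroup Γ)
    (hR : ∀ z : ℍ, ∃ γ : Γ, dist (γ • z) UpperHalfPlane.I ≤ R) (h : IsGoodRadius R u r) :
    IsClosed {p : UnitTangent × HopfPullback u | BundleRel R r u p.1 p.2} := by
  have hq := isOpenQuotientMap_smul_axis.prodMap (IsOpenQuotientMap.id (X := HopfPullback u))
  rw [← hq.isQuotientMap.isClosed_preimage]
  have hcl : IsClosed {x : SL(2, ℝ) × HopfPullback u | x.1 • UpperHalfPlane.I = x.2.base} :=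
    isClosed_eq (continuous_fst.smul continuous_const)
      (HopfPullback.continuous_base.comp continuous_snd)
  have h1 : IsClosed {y : FramePair u | framePhase R r y = 1} :=
    isClosed_eq (h.continuous_framePhase hΓ) continuous_const
  convert hcl.isClosedEmbedding_subtypeVal.isClosedMap _ h1 using 1
  ext ⟨A, x⟩
  constructor
  · intro hAx
    have h2 : A • UpperHalfPlane.I = x.base := by
      have := BundleRel.pt_eq (w := A • UnitTangent.axis 0) hAx
      rwa [UnitTangent.pt_smul, UnitTangent.pt_axis_zero] at this
    exact ⟨⟨(A, x), h2⟩, (h.bundleRel_iff hΓ hR ⟨(A, x), h2⟩).1 hAx, rfl⟩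
  · rintro ⟨y, hy, hyx⟩
    have := (h.bundleRel_iff hΓ hR y).2 hy
    rw [hyx] at this
    exact this

/-- Moving the point by `β` in its Hopf fibre multiplies the phase by `e^{2iβ}`, and two values of
`β` with the same `e^{2iβ}` define the same real line. So exactly one point of the fibre has phase
`1`. -/
theorem IsGoodRadius.existsUnique_right (hΓ : IsSurfaceGroup Γ)
    (hR : ∀ z : ℍ, ∃ γ : Γ, dist (γ • z) UpperHalfPlane.I ≤ R) (h : IsGoodRadius R u r)
    (w : UnitTangent) : ∃! x, BundleRel R r u w x := by
  obtain ⟨A, rfl⟩ := exists_smul_axis w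
  obtain ⟨x₀, hx₀⟩ := HopfPullback.exists_base_eq (u := u) (A • UpperHalfPlane.I)
  obtain ⟨v, hv, -, hpv, -⟩ := exists_mk_of_hopf_eq (rfl : hopf (x₀.toRP3 u) = hopf (x₀.toRP3 u))
  set y₀ : FramePair u := ⟨(A, x₀), hx₀.symm⟩
  obtain ⟨t, ht⟩ := Circle.exp_surjective (framePhase R r y₀)
  have hne := smul_ne_zero (Complex.exp_ne_zero (((-t / 2 : ℝ) : ℂ) * Complex.I)) hv
  set x : HopfPullback u := HopfPullback.ofPair u (A • UpperHalfPlane.I)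
    (Projectivization.mk ℝ (Complex.exp (((-t / 2 : ℝ) : ℂ) * Complex.I) • v) hne) (by
      rw [← hx₀, ← HopfPullback.hopf_toRP3, hpv, hopf_mk, hopf_mk, eq_comm,
        Projectivization.mk_eq_mk_iff']
      exact ⟨_, rfl⟩)
  refine ⟨x, ⟨⟨(A, x), rfl⟩, rfl, rfl, ?_⟩, fun x' hx' => ?_⟩
  · rw [h.framePhase_fibre hΓ (y := y₀) (y' := ⟨(A, x), rfl⟩) rfl hx₀ hv hpv rfl, ← ht,
      ← Circle.exp_add]
    have : 2 * (-t / 2) + t = 0 := by ring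
    rw [this, Circle.exp_zero]
  · have h1 : framePhase R r ⟨(A, x), rfl⟩ = 1 := by
      rw [h.framePhase_fibre hΓ (y := y₀) (y' := ⟨(A, x), rfl⟩) rfl hx₀ hv hpv rfl, ← ht,
        ← Circle.exp_add]
      have : 2 * (-t / 2) + t = 0 := by ring
      rw [this, Circle.exp_zero]
    have hb : A • UpperHalfPlane.I = x'.base := by
      have := hx'.pt_eq
      rwa [UnitTangent.pt_smul, UnitTangent.pt_axis_zero] at this
    have h2 := (h.bundleRel_iff hΓ hR ⟨(A, x'), hb⟩).1 hx'
    have hbx : x.base = x'.base := hb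
    obtain ⟨v', hv', β, hp, hp'⟩ := exists_mk_of_hopf_eq (p := x.toRP3 u) (p' := x'.toRP3 u) (by
      rw [HopfPullback.hopf_toRP3, HopfPullback.hopf_toRP3, hbx])
    have h3 := h.framePhase_fibre hΓ (y := ⟨(A, x), rfl⟩) (y' := ⟨(A, x'), hb⟩) rfl hbx hv' hp hp'
    rw [h1, h2, mul_one] at h3
    refine HopfPullback.ext' hbx.symm ?_
    rw [hp, hp', mk_exp_smul_eq_of_exp_eq_one h3.symm]

/-- Turning the frame by `α` multiplies the phase by `e^{2idα}`. As `d = ±1`, this vanishing of the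
phase angle fixes `α` modulo `π`, hence the vector. -/
theorem IsGoodRadius.existsUnique_left (hΓ : IsSurfaceGroup Γ)
    (hR : ∀ z : ℍ, ∃ γ : Γ, dist (γ • z) UpperHalfPlane.I ≤ R) (h : IsGoodRadius R u r)
    (x : HopfPullback u) : ∃! w, BundleRel R r u w x := by
  set y₀ : FramePair u := ⟨(x.base.toSL2R, x), UpperHalfPlane.toSL2R_smul_I _⟩
  obtain ⟨t, ht⟩ := Circle.exp_surjective (framePhase R r y₀)
  obtain ⟨d, hd, hrot⟩ := h.framePhase_rotSL hΓ hR y₀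
  have hdd : (d : ℝ) * d = 1 := by rcases hd with rfl | rfl <;> norm_num
  set α := -(d * t) / 2
  set y : FramePair u := ⟨(y₀.1.1 * rotSL α, y₀.1.2), smul_rotSL_I y₀ α⟩
  have hy : framePhase R r y = 1 := by
    rw [hrot, ← ht, ← Circle.exp_add]
    have : 2 * d * α + t = 0 := by
      have : 2 * d * α = -(d * d * t) := by ring
      rw [this, hdd]; ring
    rw [this, Circle.exp_zero]
  refine ⟨y.1.1 • UnitTangent.axis 0, ⟨y, rfl, rfl, hy⟩, ?_⟩
  rintro _ ⟨y', rfl, hx, hy'⟩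
  obtain ⟨d, hd, hrot⟩ := h.framePhase_rotSL hΓ hR y
  obtain ⟨s, hs⟩ := UnitTangent.exists_rot_eq (w := y.1.1 • UnitTangent.axis 0)
    (w' := y'.1.1 • UnitTangent.axis 0) (by
      rw [UnitTangent.pt_smul, UnitTangent.pt_smul, UnitTangent.pt_axis_zero, y.2, y'.2, hx])
  have hs' : y'.1.1 • UnitTangent.axis 0 = (y.1.1 * rotSL (s / 2)) • UnitTangent.axis 0 := by
    rw [hs, rot_smul_axis]
  have h1 := (h.bundleRel_iff hΓ hR
    ⟨(y.1.1 * rotSL (s / 2), y.1.2), smul_rotSL_I y _⟩).1 ⟨y', hs'.symm, hx, hy'⟩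
  rw [hrot, hy, mul_one] at h1
  have h2 : Circle.exp (2 * (s / 2)) = 1 := by
    rcases hd with rfl | rfl
    · simpa using h1
    · rw [← inv_eq_one, ← Circle.exp_neg]
      simpa using h1
  rw [hs']
  rcases rotSL_cases_of_exp_eq_one h2 with h3 | h3
  · rw [h3, mul_one]
  · rw [h3, mul_neg, mul_one, UnitTangent.neg_smul]

theorem BundleRel.smul {w : UnitTangent} {x : HopfPullback u} (h : BundleRel R r u w x) (γ : Γ) :
    BundleRel R r u (γ • w) (γ • x) := by
  obtain ⟨y, rfl, rfl, hy⟩ := h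
  obtain ⟨B, hB⟩ := QuotientGroup.mk_surjective (γ : PSL(2, ℝ))
  have h1 : ∀ z : ℍ, γ • z = B • z := fun z => by
    rw [← psl_mk_smul_upperHalfPlane, hB]; rfl
  have h2 : ∀ w : UnitTangent, γ • w = B • w := fun w => by
    rw [← UnitTangent.psl_mk_smul, hB]; rfl
  have h3 : (B * y.1.1) • UpperHalfPlane.I = (γ • y.1.2).base := by
    rw [mul_smul, y.2, HopfPullback.base_smul, h1]
  refine ⟨⟨(B * y.1.1, γ • y.1.2), h3⟩, by rw [h2, mul_smul], rfl, ?_⟩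
  rw [← hy, framePhase, framePhase]
  congr 1
  funext θ
  rw [loopPhase, loopPhase, loopCoord, loopCoord]
  simp only [polar_mul, HopfPullback.base_smul, HopfPullback.toRP3_smul]
  rw [← h1, u.equivariant, affineCoord_equivariant]

/-- The pullback of the Hopf fibration is equivariantly homeomorphic to the unit tangent bundle. -/
theorem IsSurfaceGroup.exists_equivariant_homeomorph (hΓ : IsSurfaceGroup Γ)
    (u : EquivariantLocalHomeo q) :
    ∃ H : UnitTangent ≃ₜ HopfPullback u, (∀ (γ : Γ) w, H (γ • w) = γ • H w) ∧
      ∀ w, (H w).base = w.pt := by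
  obtain ⟨R, hR⟩ := hΓ.exists_radius
  obtain ⟨r, h⟩ := hΓ.exists_isGoodRadius hR u
  obtain ⟨H, hH⟩ := exists_homeomorph_of_isClosed (h.isClosed_bundleRel hΓ hR)
    (h.existsUnique_right hΓ hR) (h.existsUnique_left hΓ hR)
    (fun w => ⟨HopfPullback.base ⁻¹' Metric.closedBall w.pt 1, HopfPullback.isCompact_base_preimage (isCompact_closedBall w.pt 1), by
      filter_upwards [UnitTangent.continuous_pt.continuousAt.preimage_mem_nhds
        (Metric.closedBall_mem_nhds w.pt one_pos)] with w' hw' x hx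
      change x.base ∈ Metric.closedBall w.pt 1
      rw [← hx.pt_eq]; exact hw'⟩)
    (fun x => ⟨UnitTangent.pt ⁻¹' Metric.closedBall x.base 1, isCompact_pt_preimage (isCompact_closedBall x.base 1), by
      filter_upwards [HopfPullback.continuous_base.continuousAt.preimage_mem_nhds
        (Metric.closedBall_mem_nhds x.base one_pos)] with x' hx' w hw
      change w.pt ∈ Metric.closedBall x.base 1
      rw [hw.pt_eq]; exact hx'⟩)
  exact ⟨H, fun γ w => (hH _ _).1 (((hH _ _).2 rfl).smul γ),
    fun w => ((hH _ _).2 rfl).pt_eq.symm⟩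

end

/-- An equivariant homeomorphism induces a homeomorphism between the quotients. -/
theorem exists_quotient_homeomorph {G X Y : Type*} [Group G] [TopologicalSpace X]
    [TopologicalSpace Y] [MulAction G X] [MulAction G Y] (H : X ≃ₜ Y)
    (hH : ∀ (g : G) x, H (g • x) = g • H x) :
    ∃ h : MulAction.orbitRel.Quotient G X ≃ₜ MulAction.orbitRel.Quotient G Y,
      ∀ x, h (Quotient.mk _ x) = Quotient.mk _ (H x) := by
  have hiff : ∀ x y, MulAction.orbitRel G X x y ↔ MulAction.orbitRel G Y (H x) (H y) := by
    intro x y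
    rw [MulAction.orbitRel_apply, MulAction.orbitRel_apply]
    constructor
    · rintro ⟨g, rfl⟩; exact ⟨g, (hH g y).symm⟩
    · rintro ⟨g, hg⟩; exact ⟨g, H.injective ((hH g y).trans hg)⟩
  refine ⟨{ toEquiv := Quotient.congr H.toEquiv hiff, continuous_toFun := ?_,
            continuous_invFun := ?_ }, fun x => rfl⟩
  · exact Continuous.quotient_map' H.continuous fun x y h => (hiff x y).1 h
  · refine Continuous.quotient_map' H.symm.continuous fun x y h => ?_
    rw [hiff, H.apply_symm_apply, H.apply_symm_apply]; exact h

/-! ### Groups of matrices with real eigenvalues -/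

theorem sl_mul_apply {R : Type*} [CommRing R] (A B : SL(2, R)) (i j : Fin 2) :
    (A * B) i j = A i 0 * B 0 j + A i 1 * B 1 j := by
  rw [Matrix.SpecialLinearGroup.coe_mul, Matrix.mul_apply, Fin.sum_univ_two]

theorem sl_inv_apply {R : Type*} [CommRing R] (A : SL(2, R)) :
    A⁻¹ 0 0 = A 1 1 ∧ A⁻¹ 0 1 = -A 0 1 ∧ A⁻¹ 1 0 = -A 1 0 ∧ A⁻¹ 1 1 = A 0 0 := by
  rw [Matrix.SpecialLinearGroup.SL2_inv_expl]
  refine ⟨rfl, rfl, rfl, rfl⟩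

theorem sl_det {R : Type*} [CommRing R] (A : SL(2, R)) : A 0 0 * A 1 1 - A 0 1 * A 1 0 = 1 := by
  rw [← Matrix.det_fin_two, A.det_coe]

theorem sl_ext {R : Type*} [CommRing R] {A B : SL(2, R)} (h00 : A 0 0 = B 0 0) (h01 : A 0 1 = B 0 1)
    (h10 : A 1 0 = B 1 0) (h11 : A 1 1 = B 1 1) : A = B := by
  ext i j; fin_cases i <;> fin_cases j <;> assumption

/-- A complex matrix with given entries. -/
def slC (a b c d : ℂ) (h : a * d - b * c = 1) : SL(2, ℂ) :=
  ⟨!![a, b; c, d], by rw [Matrix.det_fin_two_of, h]⟩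

/-- A group of matrices with real eigenvalues, discrete modulo the centre, and with no central
elements other than the obvious ones. -/
structure IsRealEigenvalueGroup (G : Subgroup SL(2, ℂ)) : Prop where
  eigenvalue : ∀ A ∈ G, ∃ t : ℝ, t ≠ 0 ∧ A 0 0 + A 1 1 = (t : ℂ) + (t : ℂ)⁻¹
  discrete : ∃ U ∈ 𝓝 (1 : SL(2, ℂ)), ∀ A ∈ G, A ∈ U → A = 1 ∨ A = -1
  centre : ∀ A ∈ G, (∀ B ∈ G, A * B = B * A) → A = 1 ∨ A = -1
  nontrivial : ∃ A ∈ G, A ≠ 1 ∧ A ≠ -1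

theorem trace_conj (g A : SL(2, ℂ)) :
    (g⁻¹ * A * g) 0 0 + (g⁻¹ * A * g) 1 1 = A 0 0 + A 1 1 := by
  obtain ⟨h1, h2, h3, h4⟩ := sl_inv_apply g
  simp only [sl_mul_apply, h1, h2, h3, h4]
  linear_combination (A 0 0 + A 1 1) * sl_det g

theorem IsRealEigenvalueGroup.conj {G : Subgroup SL(2, ℂ)} (hG : IsRealEigenvalueGroup G)
    (g : SL(2, ℂ)) : IsRealEigenvalueGroup (G.map (MulAut.conj g⁻¹).toMonoidHom) := by
  have hm : ∀ A : SL(2, ℂ), (MulAut.conj g⁻¹).toMonoidHom A = g⁻¹ * A * g := fun A => by simp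
  have hone : ∀ A : SL(2, ℂ), A = 1 ∨ A = -1 ↔ g⁻¹ * A * g = 1 ∨ g⁻¹ * A * g = -1 := by
    intro A
    constructor
    · rintro (rfl | rfl) <;> simp
    · rintro (h | h)
      · left
        have : A = g * (g⁻¹ * A * g) * g⁻¹ := by group
        rw [this, h]; simp
      · right
        have : A = g * (g⁻¹ * A * g) * g⁻¹ := by group
        rw [this, h]; simp
  constructor
  · rintro _ ⟨A, hA, rfl⟩
    rw [hm, trace_conj]
    exact hG.eigenvalue A hA
  · obtain ⟨U, hU, h⟩ := hG.discrete
    have hc : Continuous fun A : SL(2, ℂ) => g * A * g⁻¹ := by fun_prop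
    refine ⟨(fun A => g * A * g⁻¹) ⁻¹' U, hc.continuousAt.preimage_mem_nhds (by simpa using hU), ?_⟩
    rintro _ ⟨A, hA, rfl⟩ hAU
    rw [hm] at hAU ⊢
    rw [← hone]
    refine h A hA ?_
    have : g * (g⁻¹ * A * g) * g⁻¹ = A := by group
    rwa [Set.mem_preimage, this] at hAU
  · rintro _ ⟨A, hA, rfl⟩ h
    rw [hm, ← hone]
    refine hG.centre A hA fun B hB => ?_
    have := h _ ⟨B, hB, rfl⟩
    rw [← map_mul, ← map_mul] at this
    exact (MulAut.conj g⁻¹).injective this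
  · obtain ⟨A, hA, h1, h2⟩ := hG.nontrivial
    refine ⟨_, ⟨A, hA, rfl⟩, ?_⟩
    rw [hm, ← not_or, ← hone, not_or]
    exact ⟨h1, h2⟩

theorem exists_conj_upper {A : SL(2, ℂ)} {t : ℂ} (ht : t ≠ 0) (hA : A 0 0 + A 1 1 = t + t⁻¹) :
    ∃ g : SL(2, ℂ), (g⁻¹ * A * g) 1 0 = 0 ∧ (g⁻¹ * A * g) 0 0 = t ∧ (g⁻¹ * A * g) 1 1 = t⁻¹ := by
  have hdet : ((A : Matrix (Fin 2) (Fin 2) ℂ) - t • (1 : Matrix (Fin 2) (Fin 2) ℂ)).det = 0 := by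
    rw [Matrix.det_fin_two]
    simp
    have h1 := sl_det A
    have h2 : t * t⁻¹ = 1 := mul_inv_cancel₀ ht
    linear_combination h1 - t * hA - h2
  obtain ⟨v, hv, h⟩ := Matrix.exists_mulVec_eq_zero_iff.2 hdet
  have e0 := congrFun h 0
  have e1 := congrFun h 1
  simp [Matrix.mulVec, dotProduct, Fin.sum_univ_two] at e0 e1
  obtain ⟨g, hg0, hg1⟩ : ∃ g : SL(2, ℂ), g 0 0 = v 0 ∧ g 1 0 = v 1 := by
    by_cases h0 : v 0 = 0
    · have h1 : v 1 ≠ 0 := fun h1 => hv (by ext i; fin_cases i <;> simp [h0, h1])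
      exact ⟨slC (v 0) (-(v 1)⁻¹) (v 1) 0 (by field_simp; ring), rfl, rfl⟩
    · exact ⟨slC (v 0) 0 (v 1) (v 0)⁻¹ (by field_simp; ring), rfl, rfl⟩
  obtain ⟨h1, h2, h3, h4⟩ := sl_inv_apply g
  have hd := sl_det g
  have k1 : (g⁻¹ * A * g) 0 0 = t := by
    simp only [sl_mul_apply, h1, h2]
    rw [hg0, hg1] at *
    linear_combination g 1 1 * e0 - g 0 1 * e1 + t * hd
  refine ⟨g, ?_, k1, ?_⟩
  · simp only [sl_mul_apply, h3, h4]
    rw [hg0, hg1] at *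
    linear_combination -v 1 * e0 + v 0 * e1
  · have := trace_conj g A
    rw [k1, hA] at this
    linear_combination this

theorem exists_conj_diagonal {A : SL(2, ℂ)} {t : ℂ} (ht : t ≠ 0) (ht' : t ≠ t⁻¹)
    (hA : A 0 0 + A 1 1 = t + t⁻¹) :
    ∃ g : SL(2, ℂ), (g⁻¹ * A * g) 1 0 = 0 ∧ (g⁻¹ * A * g) 0 1 = 0 ∧ (g⁻¹ * A * g) 0 0 = t ∧
      (g⁻¹ * A * g) 1 1 = t⁻¹ := by
  obtain ⟨g, h10, h00, h11⟩ := exists_conj_upper ht hA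
  set B := g⁻¹ * A * g
  have hk : t⁻¹ - t ≠ 0 := sub_ne_zero.2 ht'.symm
  obtain ⟨y, hy⟩ : ∃ y, y * (t⁻¹ - t) = B 0 1 := ⟨_, div_mul_cancel₀ _ hk⟩
  set k := slC 1 y 0 1 (by ring)
  have e : (g * k)⁻¹ * A * (g * k) = k⁻¹ * B * k := by simp only [B]; group
  obtain ⟨h1, h2, h3, h4⟩ := sl_inv_apply k
  have k00 : k 0 0 = 1 := rfl
  have k01 : k 0 1 = y := rfl
  have k10 : k 1 0 = 0 := rfl
  have k11 : k 1 1 = 1 := rfl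
  refine ⟨g * k, ?_, ?_, ?_, ?_⟩ <;> rw [e] <;>
    simp only [sl_mul_apply, h1, h2, h3, h4, k00, k01, k10, k11, h00, h10, h11]
  · ring
  · linear_combination -hy
  · ring
  · ring

/-- The complexification of a real matrix. -/
def slMap : SL(2, ℝ) →* SL(2, ℂ) := Matrix.SpecialLinearGroup.map (algebraMap ℝ ℂ)

theorem slMap_apply (A : SL(2, ℝ)) (i j : Fin 2) : slMap A i j = (A i j : ℂ) := rfl

theorem exists_slMap_eq {A : SL(2, ℂ)} (h : ∀ i j, (A i j).im = 0) : ∃ B, slMap B = A := by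
  have hre : ∀ i j, ((A i j).re : ℂ) = A i j := fun i j =>
    Complex.ext (by simp) (by simp [h i j])
  refine ⟨⟨!![(A 0 0).re, (A 0 1).re; (A 1 0).re, (A 1 1).re], ?_⟩, ?_⟩
  · rw [Matrix.det_fin_two_of]
    have := sl_det A
    rw [← hre 0 0, ← hre 0 1, ← hre 1 0, ← hre 1 1] at this
    exact_mod_cast this
  · exact sl_ext (hre _ _) (hre _ _) (hre _ _) (hre _ _)

/-! ### Conjugation into `SL₂(ℝ)` -/

section

variable {G : Subgroup SL(2, ℂ)}

theorem IsRealEigenvalueGroup.trace_im (hG : IsRealEigenvalueGroup G) {A : SL(2, ℂ)} (hA : A ∈ G) :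
    (A 0 0 + A 1 1).im = 0 := by
  obtain ⟨t, -, h⟩ := hG.eigenvalue A hA
  rw [h, ← Complex.ofReal_inv, ← Complex.ofReal_add, Complex.ofReal_im]

/-- Diagonal coefficients are real when the group contains a real diagonal matrix. -/
theorem IsRealEigenvalueGroup.diag_im (hG : IsRealEigenvalueGroup G) {A : SL(2, ℂ)} (hA : A ∈ G)
    {t : ℝ} (ht : t ≠ t⁻¹) (h00 : A 0 0 = t) (h01 : A 0 1 = 0) (h10 : A 1 0 = 0)
    (h11 : A 1 1 = (t : ℂ)⁻¹) {B : SL(2, ℂ)} (hB : B ∈ G) : (B 0 0).im = 0 ∧ (B 1 1).im = 0 := by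
  -- The traces of `B` and `A B` are `B₀₀ + B₁₁` and `t B₀₀ + t⁻¹ B₁₁`. Both are real, and `t ≠
  -- t⁻¹`.
  have h1 := hG.trace_im hB
  have h2 := hG.trace_im (mul_mem hA hB)
  simp only [sl_mul_apply, h00, h01, h10, h11, ← Complex.ofReal_inv] at h2
  simp at h1 h2
  have h3 : (t - t⁻¹) * (B 0 0).im = 0 := by
    linear_combination h2 - t⁻¹ * h1
  have h4 := (mul_eq_zero.1 h3).resolve_left (sub_ne_zero.2 ht)
  exact ⟨h4, by linarith⟩

theorem continuous_slC_unipotent : Continuous fun x : ℂ => slC 1 x 0 1 (by ring) := by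
  refine continuous_sl_mk fun i j => ?_
  fin_cases i <;> fin_cases j <;> simp [slC] <;> fun_prop

/-- A discrete group that contains a diagonal matrix contains no upper triangular matrix with another
fixed point. -/
theorem IsRealEigenvalueGroup.commute_of_upper (hG : IsRealEigenvalueGroup G) {A : SL(2, ℂ)}
    (hA : A ∈ G) {t : ℝ} (ht0 : t ≠ 0) (ht : |t| < 1) (h00 : A 0 0 = t) (h01 : A 0 1 = 0)
    (h10 : A 1 0 = 0) (h11 : A 1 1 = (t : ℂ)⁻¹) {B : SL(2, ℂ)} (hB : B ∈ G) (hc : B 1 0 = 0) :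
    A * B = B * A := by
  have htc : (t : ℂ) ≠ 0 := Complex.ofReal_ne_zero.2 ht0
  have hti : (t : ℂ) * (t : ℂ)⁻¹ = 1 := mul_inv_cancel₀ htc
  obtain ⟨a1, a2, a3, a4⟩ := sl_inv_apply A
  obtain ⟨b1, b2, b3, b4⟩ := sl_inv_apply B
  have hdet := sl_det B
  rw [hc, mul_zero, sub_zero] at hdet
  set x : ℂ := B 0 0 * B 0 1 * ((t : ℂ) ^ 2 - 1) with hx
  -- The commutator is unipotent with coefficient `x`. Conjugating it by powers of `A` multiplies
  -- `x` by `t^{2n}`, which tends to `0`, so discreteness forces `x = 0`.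
  have hU : A * B * A⁻¹ * B⁻¹ = slC 1 x 0 1 (by ring) := by
    refine sl_ext ?_ ?_ ?_ ?_ <;>
      simp only [sl_mul_apply, a1, a2, a3, a4, b1, b2, b3, b4, h00, h01, h10, h11, hc]
    · change _ = (1 : ℂ); linear_combination hdet + B 0 0 * B 1 1 * hti
    · change _ = x; rw [hx]; field_simp; ring
    · change _ = (0 : ℂ); ring
    · change _ = (1 : ℂ); linear_combination hdet + B 0 0 * B 1 1 * hti
  have hmem : ∀ n : ℕ, slC 1 ((t : ℂ) ^ (2 * n) * x) 0 1 (by ring) ∈ G := by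
    intro n
    induction n with
    | zero =>
      have : A * B * A⁻¹ * B⁻¹ ∈ G :=
        mul_mem (mul_mem (mul_mem hA hB) (inv_mem hA)) (inv_mem hB)
      rw [hU] at this
      convert this using 2
      simp
    | succ n ih =>
      have h := mul_mem (mul_mem hA ih) (inv_mem hA)
      convert h using 1
      refine sl_ext ?_ ?_ ?_ ?_ <;> simp only [sl_mul_apply, a1, a2, a3, a4, h00, h01, h10, h11]
      · change (1 : ℂ) = (t * 1 + 0 * 0) * (t : ℂ)⁻¹ + _ * -0; field_simp; ring
      · change (t : ℂ) ^ (2 * (n + 1)) * x = (t * 1 + 0 * 0) * (-0) + (t * (t ^ (2 * n) * x) + 0 * 1) * t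
        ring
      · change (0 : ℂ) = (0 * 1 + _ * 0) * (t : ℂ)⁻¹ + _ * -0; ring
      · change (1 : ℂ) = (0 * 1 + _ * 0) * -0 + (0 * _ + (t : ℂ)⁻¹ * 1) * t; field_simp; ring
  have hx0 : x = 0 := by
    obtain ⟨U, hUn, hUG⟩ := hG.discrete
    have ht2 : ‖(t : ℂ) ^ 2‖ < 1 := by
      rw [norm_pow, Complex.norm_real, Real.norm_eq_abs]
      exact pow_lt_one₀ (abs_nonneg _) ht two_ne_zero
    have hlim : Tendsto (fun n : ℕ => slC 1 ((t : ℂ) ^ (2 * n) * x) 0 1 (by ring)) atTop (𝓝 1) := by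
      have h1 : Tendsto (fun n : ℕ => (t : ℂ) ^ (2 * n) * x) atTop (𝓝 0) := by
        simp only [pow_mul]
        simpa using (tendsto_pow_atTop_nhds_zero_of_norm_lt_one ht2).mul_const x
      have h2 := (continuous_slC_unipotent.tendsto 0).comp h1
      have h3 : slC 1 0 0 1 (by ring) = 1 := by
        refine sl_ext ?_ ?_ ?_ ?_ <;> simp [slC]
      rwa [h3] at h2
    obtain ⟨n, hn⟩ := (hlim.eventually hUn).exists
    have h3 : (t : ℂ) ^ (2 * n) * x = 0 := by
      rcases hUG _ (hmem n) hn with h | h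
      · have := congrArg (fun M : SL(2, ℂ) => M 0 1) h
        simpa [slC] using this
      · have := congrArg (fun M : SL(2, ℂ) => M 0 1) h
        simpa [slC] using this
    exact (mul_eq_zero.1 h3).resolve_left (pow_ne_zero _ htc)
  have h1 : A * B * A⁻¹ * B⁻¹ = 1 := by
    rw [hU]
    refine sl_ext ?_ ?_ ?_ ?_ <;> simp [slC, hx0]
  rw [mul_inv_eq_one, mul_inv_eq_iff_eq_mul] at h1
  exact h1

set_option linter.unusedSimpArgs false in
/-- A discrete group that contains a diagonal matrix contains no lower triangular matrix with another
fixed point. -/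
theorem IsRealEigenvalueGroup.commute_of_lower (hG : IsRealEigenvalueGroup G) {A : SL(2, ℂ)}
    (hA : A ∈ G) {t : ℝ} (ht0 : t ≠ 0) (ht : |t| < 1) (h00 : A 0 0 = t) (h01 : A 0 1 = 0)
    (h10 : A 1 0 = 0) (h11 : A 1 1 = (t : ℂ)⁻¹) {B : SL(2, ℂ)} (hB : B ∈ G) (hb : B 0 1 = 0) :
    A * B = B * A := by
  set w := slC 0 (-1) 1 0 (by ring)
  obtain ⟨w1, w2, w3, w4⟩ := sl_inv_apply w
  obtain ⟨a1, a2, a3, a4⟩ := sl_inv_apply A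
  have w00 : w 0 0 = 0 := rfl
  have w01 : w 0 1 = -1 := rfl
  have w10 : w 1 0 = 1 := rfl
  have w11 : w 1 1 = 0 := rfl
  -- Conjugation by `w` exchanges the two axes; using `A⁻¹` in place of `A` keeps the small
  -- eigenvalue `t` in the first position.
  have h := (hG.conj w).commute_of_upper (A := w⁻¹ * A⁻¹ * w) (B := w⁻¹ * B * w)
    ⟨A⁻¹, inv_mem hA, by simp⟩ ht0 ht
    (by simp [sl_mul_apply, w1, w2, w3, w4, w00, w01, w10, w11, a1, a2, a3, a4, h00])
    (by simp [sl_mul_apply, w1, w2, w3, w4, w00, w01, w10, w11, a1, a2, a3, a4, h10])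
    (by simp [sl_mul_apply, w1, w2, w3, w4, w00, w01, w10, w11, a1, a2, a3, a4, h01])
    (by simp [sl_mul_apply, w1, w2, w3, w4, w00, w01, w10, w11, a1, a2, a3, a4, h11])
    ⟨B, hB, by simp⟩
    (by simp [sl_mul_apply, w1, w2, w3, w4, w00, w01, w10, w11, hb])
  have e : w⁻¹ * (A⁻¹ * B) * w = w⁻¹ * (B * A⁻¹) * w := by
    calc _ = w⁻¹ * A⁻¹ * w * (w⁻¹ * B * w) := by group
      _ = _ := h
      _ = _ := by group
  have e2 : A⁻¹ * B = B * A⁻¹ := mul_left_cancel (mul_right_cancel e)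
  calc A * B = A * (B * A⁻¹) * A := by group
    _ = B * A := by rw [← e2]; group

/-- All diagonal coefficients in the group are real. As `A` is not central, some `D` has both
off-diagonal coefficients nonzero, and the diagonal of `D B` shows that `D₀₁ B₁₀` and `D₁₀ B₀₁` are
real. Conjugation by `diag (s, s⁻¹)` with `s² = D₀₁` changes the off-diagonal coefficients of `B`
into `D₀₁ B₁₀` and `D₁₀ B₀₁ / (D₀₁ D₁₀)`. -/
theorem IsRealEigenvalueGroup.exists_conj_real_of_diagonal (hG : IsRealEigenvalueGroup G)
    {A : SL(2, ℂ)} (hA : A ∈ G) {t : ℝ} (ht0 : t ≠ 0) (ht : |t| < 1) (h00 : A 0 0 = t)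
    (h01 : A 0 1 = 0) (h10 : A 1 0 = 0) (h11 : A 1 1 = (t : ℂ)⁻¹) :
    ∃ g : SL(2, ℂ), ∀ B ∈ G, ∃ B', slMap B' = g⁻¹ * B * g := by
  have ht1 : t ≠ t⁻¹ := by
    intro h
    have h2 : t * t = 1 := by nth_rw 2 [h]; exact mul_inv_cancel₀ ht0
    have h3 : |t| * |t| = 1 := by rw [abs_mul_abs_self, h2]
    nlinarith [abs_nonneg t]
  have hne : ¬ (A = 1 ∨ A = -1) := by
    have h1 : A 0 0 ≠ A 1 1 := by
      rw [h00, h11]; exact_mod_cast ht1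
    rintro (rfl | rfl) <;> exact h1 (by simp)
  have hd := fun {B : SL(2, ℂ)} (hB : B ∈ G) => hG.diag_im hA ht1 h00 h01 h10 h11 hB
  obtain ⟨B, hB, hBc⟩ : ∃ B ∈ G, B 1 0 ≠ 0 := by
    by_contra! h
    exact hne (hG.centre A hA fun B hB => hG.commute_of_upper hA ht0 ht h00 h01 h10 h11 hB (h B hB))
  obtain ⟨C, hC, hCb⟩ : ∃ B ∈ G, B 0 1 ≠ 0 := by
    by_contra! h
    exact hne (hG.centre A hA fun B hB => hG.commute_of_lower hA ht0 ht h00 h01 h10 h11 hB (h B hB))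
  obtain ⟨D, hD, hDb, hDc⟩ : ∃ D ∈ G, D 0 1 ≠ 0 ∧ D 1 0 ≠ 0 := by
    by_cases hBb : B 0 1 = 0
    · by_cases hCc : C 1 0 = 0
      · refine ⟨B * C, mul_mem hB hC, ?_, ?_⟩
        · rw [sl_mul_apply, hBb, zero_mul, add_zero]
          refine mul_ne_zero (fun h => ?_) hCb
          simpa [h, hBb] using sl_det B
        · rw [sl_mul_apply, hCc, mul_zero, add_zero]
          refine mul_ne_zero hBc (fun h => ?_)
          simpa [h, hCc] using sl_det C
      · exact ⟨C, hC, hCb, hCc⟩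
    · exact ⟨B, hB, hBb, hBc⟩
  obtain ⟨s, hs⟩ := IsAlgClosed.exists_eq_mul_self (D 0 1)
  have hs0 : s ≠ 0 := fun h => hDb (by rw [hs, h, zero_mul])
  set k := slC s 0 0 s⁻¹ (by field_simp; ring)
  obtain ⟨k1, k2, k3, k4⟩ := sl_inv_apply k
  have k00 : k 0 0 = s := rfl
  have k01 : k 0 1 = 0 := rfl
  have k10 : k 1 0 = 0 := rfl
  have k11 : k 1 1 = s⁻¹ := rfl
  obtain ⟨d0, d1⟩ := hd hD
  have hbc : (D 0 1 * D 1 0).im = 0 := by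
    have : D 0 1 * D 1 0 = D 0 0 * D 1 1 - 1 := by linear_combination -sl_det D
    rw [this]; simp [d0, d1]
  refine ⟨k, fun B hB => ?_⟩
  obtain ⟨b0, b1⟩ := hd hB
  obtain ⟨e0, e1⟩ := hd (mul_mem hD hB)
  rw [sl_mul_apply] at e0 e1
  have hc : (D 0 1 * B 1 0).im = 0 := by
    rw [Complex.add_im, Complex.mul_im (D 0 0)] at e0
    simpa [d0, b0] using e0
  have hb : (D 1 0 * B 0 1).im = 0 := by
    rw [Complex.add_im, Complex.mul_im (D 1 1)] at e1
    simpa [d1, b1] using e1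
  refine exists_slMap_eq fun i j => ?_
  fin_cases i <;> fin_cases j <;>
    simp only [Fin.zero_eta, Fin.mk_one, sl_mul_apply, k1, k2, k3, k4, k00, k01, k10, k11]
  · have : (s⁻¹ * B 0 0 + -0 * B 1 0) * s + (s⁻¹ * B 0 1 + -0 * B 1 1) * 0 = B 0 0 := by
      field_simp; ring
    rwa [this]
  · have : (s⁻¹ * B 0 0 + -0 * B 1 0) * 0 + (s⁻¹ * B 0 1 + -0 * B 1 1) * s⁻¹ =
        D 1 0 * B 0 1 / (D 0 1 * D 1 0) := by
      rw [hs]; field_simp; ring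
    rw [this, Complex.div_im, hb, hbc]; simp
  · have : (-0 * B 0 0 + s * B 1 0) * s + (-0 * B 0 1 + s * B 1 1) * 0 = D 0 1 * B 1 0 := by
      rw [hs]; ring
    rwa [this]
  · have : (-0 * B 0 0 + s * B 1 0) * 0 + (-0 * B 0 1 + s * B 1 1) * s⁻¹ = B 1 1 := by
      field_simp; ring
    rwa [this]

/-- Some element of the group has an eigenvalue other than `±1`. -/
theorem IsRealEigenvalueGroup.exists_ne (hG : IsRealEigenvalueGroup G) :
    ∃ A ∈ G, ∃ t : ℝ, t ≠ 0 ∧ |t| < 1 ∧ A 0 0 + A 1 1 = (t : ℂ) + (t : ℂ)⁻¹ := by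
  by_contra! hcon
  have htr : ∀ A ∈ G, A 0 0 + A 1 1 = 2 ∨ A 0 0 + A 1 1 = -2 := by
    intro A hA
    obtain ⟨t, ht0, ht⟩ := hG.eigenvalue A hA
    have h1 : |t| = 1 := by
      rcases lt_trichotomy |t| 1 with h | h | h
      · exact absurd ht (hcon A hA t ht0 h)
      · exact h
      · refine absurd ?_ (hcon A hA t⁻¹ (inv_ne_zero ht0) ?_)
        · rw [ht, Complex.ofReal_inv, inv_inv, add_comm]
        · rw [abs_inv]; exact inv_lt_one_of_one_lt₀ h
    rcases eq_or_eq_neg_of_abs_eq h1 with rfl | rfl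
    · left; rw [ht]; norm_num
    · right; rw [ht]; norm_num
  obtain ⟨A, hA, hA1, hA2⟩ := hG.nontrivial
  obtain ⟨e, he, hAe⟩ : ∃ e : ℂ, e * e = 1 ∧ A 0 0 + A 1 1 = e + e⁻¹ := by
    rcases htr A hA with h | h
    · exact ⟨1, by norm_num, by rw [h]; norm_num⟩
    · exact ⟨-1, by norm_num, by rw [h]; norm_num⟩
  have he0 : e ≠ 0 := by rintro rfl; simp at he
  have hei : e⁻¹ = e := inv_eq_of_mul_eq_one_left he
  obtain ⟨g, g10, g00, g11⟩ := exists_conj_upper he0 hAe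
  -- If all traces are `±2`, a nontrivial `A` is unipotent up to sign. All elements then fix its
  -- fixed point and commute with it, against the condition on the centre.
  have hone : ∀ B ∈ G, (g⁻¹ * B * g) 1 0 = 0 := by
    intro B hB
    have t1 := htr _ hB
    have t2 := htr _ (mul_mem hA hB)
    have t3 := htr _ (mul_mem (mul_mem hA hA) hB)
    have e2 : g⁻¹ * (A * B) * g = (g⁻¹ * A * g) * (g⁻¹ * B * g) := by group
    have e3 : g⁻¹ * (A * A * B) * g = (g⁻¹ * A * g) * (g⁻¹ * A * g) * (g⁻¹ * B * g) := by group
    rw [← trace_conj g] at t1 t2 t3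
    rw [e2] at t2
    rw [e3] at t3
    set A' := g⁻¹ * A * g
    set B' := g⁻¹ * B * g
    rw [hei] at g11
    simp only [sl_mul_apply, g10, g00, g11] at t2 t3
    have hx : A' 0 1 ≠ 0 := by
      intro hx
      have hA' : A' = 1 ∨ A' = -1 := by
        rcases mul_self_eq_one_iff.1 he with h | h
        · left; exact sl_ext (by simp [g00, h]) (by simp [hx]) (by simp [g10]) (by simp [g11, h])
        · right; exact sl_ext (by simp [g00, h]) (by simp [hx]) (by simp [g10]) (by simp [g11, h])
      have hAA : A = g * A' * g⁻¹ := by simp only [A']; group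
      rcases hA' with h | h
      · exact hA1 (by rw [hAA, h]; simp)
      · exact hA2 (by rw [hAA, h]; simp)
    have h3 : A' 0 1 * B' 1 0 = 0 := by
      -- Here `T` is the trace of `B` and `y = A'₀₁ B'₁₀`. The traces of `A B` and `A² B` are `e T +
      -- y` and `T + 2 e y`, so `e y` and `2 e y` both lie in `{0, 4, -4}`.
      have key : ∀ T y : ℂ, (T = 2 ∨ T = -2) → (e * T + y = 2 ∨ e * T + y = -2) →
          (T + 2 * e * y = 2 ∨ T + 2 * e * y = -2) → y = 0 := by
        intro T y hT h2 h3
        rcases mul_self_eq_one_iff.1 he with rfl | rfl <;> rcases hT with rfl | rfl <;>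
          rcases h2 with h2 | h2 <;> rcases h3 with h3 | h3 <;>
          first
          | linear_combination h2
          | linear_combination h3 / 2
          | linear_combination -h3 / 2
          | (exfalso
             have h4 : (4 : ℂ) = 0 := by
              first
              | linear_combination 2 * h2 - h3
              | linear_combination h3 - 2 * h2
              | linear_combination 2 * h2 + h3
              | linear_combination -2 * h2 - h3
             norm_num at h4)
      refine key (B' 0 0 + B' 1 1) _ t1 ?_ ?_
      · convert t2 using 2 <;> ring
      · convert t3 using 2 <;> linear_combination (-(B' 0 0) - B' 1 1) * he
    exact (mul_eq_zero.1 h3).resolve_left hx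
  have hcomm : ∀ B ∈ G, A * B = B * A := by
    intro B hB
    have h1 := hone B hB
    have t1 := htr _ hB
    rw [← trace_conj g] at t1
    have e2 : g⁻¹ * (A * B) * g = (g⁻¹ * A * g) * (g⁻¹ * B * g) := by group
    have e3 : g⁻¹ * (B * A) * g = (g⁻¹ * B * g) * (g⁻¹ * A * g) := by group
    have hd := sl_det (g⁻¹ * B * g)
    have h4 : (g⁻¹ * B * g) 0 0 = (g⁻¹ * B * g) 1 1 := by
      have : ((g⁻¹ * B * g) 0 0 - (g⁻¹ * B * g) 1 1) ^ 2 = 0 := by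
        rw [h1] at hd
        rcases t1 with t1 | t1
        · linear_combination ((g⁻¹ * B * g) 0 0 + (g⁻¹ * B * g) 1 1 + 2) * t1 - 4 * hd
        · linear_combination ((g⁻¹ * B * g) 0 0 + (g⁻¹ * B * g) 1 1 - 2) * t1 - 4 * hd
      exact sub_eq_zero.1 (pow_eq_zero_iff two_ne_zero |>.1 this)
    have : g⁻¹ * (A * B) * g = g⁻¹ * (B * A) * g := by
      rw [e2, e3]
      rw [hei] at g11
      refine sl_ext ?_ ?_ ?_ ?_ <;> simp only [sl_mul_apply, g10, g00, g11, h1, h4] <;> ring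
    exact mul_left_cancel (mul_right_cancel this)
  rcases hG.centre A hA hcomm with h | h
  · exact hA1 h
  · exact hA2 h

/-- A group of matrices with real eigenvalues, discrete and without centre, is conjugate to a group of
real matrices. -/
theorem IsRealEigenvalueGroup.exists_conj_real (hG : IsRealEigenvalueGroup G) :
    ∃ g : SL(2, ℂ), ∀ B ∈ G, ∃ B', slMap B' = g⁻¹ * B * g := by
  obtain ⟨A, hA, t, ht0, ht, htr⟩ := hG.exists_ne
  have ht1 : (t : ℂ) ≠ (t : ℂ)⁻¹ := by
    intro h
    have h' : t = t⁻¹ := by exact_mod_cast h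
    have h2 : t * t = 1 := by nth_rw 2 [h']; exact mul_inv_cancel₀ ht0
    have h3 : |t| * |t| = 1 := by rw [abs_mul_abs_self, h2]
    nlinarith [abs_nonneg t]
  obtain ⟨g, h10, h01, h00, h11⟩ := exists_conj_diagonal (Complex.ofReal_ne_zero.2 ht0) ht1 htr
  obtain ⟨k, hk⟩ := (hG.conj g).exists_conj_real_of_diagonal (A := g⁻¹ * A * g)
    ⟨A, hA, by simp⟩ ht0 ht h00 h01 h10 h11
  refine ⟨g * k, fun B hB => ?_⟩
  obtain ⟨B', h⟩ := hk (g⁻¹ * B * g) ⟨B, hB, by simp⟩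
  exact ⟨B', by rw [h]; group⟩

end

/-! ### The universal covering of the unit tangent bundle -/

namespace UnitTangent

/-- The argument of a unit tangent vector. -/
def dir (w : UnitTangent) : Circle :=
  ⟨w.vec / w.pt.im, by
    refine mem_sphere_zero_iff_norm.2 ?_
    rw [norm_div, norm_vec, Complex.norm_real,
      Real.norm_eq_abs, abs_of_pos w.pt.im_pos, div_self w.pt.im_ne_zero]⟩

theorem coe_dir (w : UnitTangent) : (w.dir : ℂ) = w.vec / w.pt.im := rfl

theorem continuous_dir : Continuous dir :=
  Continuous.subtype_mk (continuous_vec.div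
    (Complex.continuous_ofReal.comp (UpperHalfPlane.continuous_im.comp continuous_pt))
    fun w => Complex.ofReal_ne_zero.2 w.pt.im_ne_zero) _

/-- The trivialization of the unit tangent bundle by the point and the argument. -/
def trivialization : UnitTangent ≃ₜ ℍ × Circle where
  toFun w := (w.pt, w.dir)
  invFun x := ⟨(x.1, x.1.im * x.2), by
    rw [norm_mul, Circle.norm_coe, mul_one, Complex.norm_real, Real.norm_eq_abs,
      abs_of_pos x.1.im_pos]⟩
  left_inv w := UnitTangent.ext rfl (by
    change (w.pt.im : ℂ) * (w.vec / w.pt.im) = w.vec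
    exact mul_div_cancel₀ _ (Complex.ofReal_ne_zero.2 w.pt.im_ne_zero))
  right_inv x := Prod.ext rfl (Circle.ext (by
    change ((x.1.im : ℂ) * x.2) / x.1.im = x.2
    exact mul_div_cancel_left₀ _ (Complex.ofReal_ne_zero.2 x.1.im_ne_zero)))
  continuous_toFun := continuous_pt.prodMk continuous_dir
  continuous_invFun := by
    refine continuous_iff.2 ⟨continuous_fst, ?_⟩
    exact (Complex.continuous_ofReal.comp (UpperHalfPlane.continuous_im.comp continuous_fst)).mul
      (continuous_subtype_val.comp continuous_snd)

/-- The universal covering of the unit tangent bundle. -/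
def unwrap (y : ℍ × ℝ) : UnitTangent := trivialization.symm (y.1, Circle.exp y.2)

theorem isOpenQuotientMap_unwrap : IsOpenQuotientMap unwrap := by
  have h : IsOpenQuotientMap Circle.exp :=
    ⟨fun z => ⟨_, Circle.exp_arg z⟩, Circle.exp.continuous,
      Circle.isCoveringMap_exp.isLocalHomeomorph.isOpenMap⟩
  exact trivialization.symm.isOpenQuotientMap.comp (IsOpenQuotientMap.id.prodMap h)

theorem continuous_unwrap : Continuous unwrap := isOpenQuotientMap_unwrap.continuous

theorem unwrap_eq_iff {y : ℍ × ℝ} {w : UnitTangent} :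
    unwrap y = w ↔ y.1 = w.pt ∧ Circle.exp y.2 = w.dir := by
  rw [unwrap, Homeomorph.symm_apply_eq]
  exact Prod.ext_iff

theorem dir_unwrap (y : ℍ × ℝ) : (unwrap y).dir = Circle.exp y.2 := (unwrap_eq_iff.1 rfl).2.symm

theorem unwrap_add (z : ℍ) (s a : ℝ) : unwrap (z, s + a) = rot s (unwrap (z, a)) := by
  refine unwrap_eq_iff.2 ⟨rfl, Circle.ext ?_⟩
  rw [coe_dir, vec_rot, pt_rot, mul_div_assoc, ← coe_dir, dir_unwrap, Circle.exp_add,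
    Circle.coe_mul, Circle.coe_exp s]

theorem unwrap_add_two_pi (z : ℍ) (s : ℝ) : unwrap (z, s + 2 * Real.pi) = unwrap (z, s) :=
  unwrap_eq_iff.2 ⟨rfl, by rw [dir_unwrap, Circle.exp_add, Circle.exp_two_pi, mul_one]⟩

theorem exists_path_unwrap (c : C(unitInterval, UnitTangent)) (y : ℍ × ℝ) (hy : unwrap y = c 0) :
    ∃ b : C(unitInterval, ℍ × ℝ), (∀ t, unwrap (b t) = c t) ∧ b 0 = y := by
  obtain ⟨h1, h2⟩ := unwrap_eq_iff.1 hy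
  obtain ⟨a, ha, ha0⟩ := Circle.isCoveringMap_exp.exists_path_lifts
    ⟨fun t => (c t).dir, continuous_dir.comp c.continuous⟩ y.2 h2.symm
  refine ⟨⟨fun t => ((c t).pt, a t), (continuous_pt.comp c.continuous).prodMk a.continuous⟩,
    fun t => unwrap_eq_iff.2 ⟨rfl, congrFun ha t⟩, Prod.ext h1.symm ha0⟩

/-- A homography lifts to the universal covering of the unit tangent bundle, and the lift commutes
with rotations. -/
theorem exists_unwrap_smul (g : PSL(2, ℝ)) (y₀ y₁ : ℍ × ℝ) (h : unwrap y₁ = g • unwrap y₀) :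
    ∃ T : ℍ × ℝ → ℍ × ℝ, Continuous T ∧ T y₀ = y₁ ∧ (∀ y, unwrap (T y) = g • unwrap y) ∧
      ∀ z s, T (z, s + 2 * Real.pi) = ((T (z, s)).1, (T (z, s)).2 + 2 * Real.pi) := by
  obtain ⟨z₀, s₀⟩ := y₀
  obtain ⟨z₁, s₁⟩ := y₁
  have hc : Continuous fun z : ℍ => (g • unwrap (z, 0)).dir :=
    continuous_dir.comp ((continuous_const_smul g).comp
      (continuous_unwrap.comp (continuous_id.prodMk continuous_const)))
  have hg : ∀ z s, g • unwrap (z, s) = rot s (g • unwrap (z, 0)) := fun z s => by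
    rw [rot_smul, ← unwrap_add, add_zero]
  obtain ⟨h1, h2⟩ := unwrap_eq_iff.1 h
  have hdir : ∀ z s, (g • unwrap (z, s)).dir = Circle.exp s * (g • unwrap (z, 0)).dir := by
    intro z s
    apply Circle.ext
    rw [hg, coe_dir, vec_rot, pt_rot, mul_div_assoc, ← coe_dir, Circle.coe_mul, Circle.coe_exp]
  obtain ⟨a, ⟨ha0, ha⟩, -⟩ := Circle.isCoveringMap_exp.existsUnique_continuousMap_lifts
    ⟨_, hc⟩ z₀ (s₁ - s₀) (by
      change Circle.exp (s₁ - s₀) = (g • unwrap (z₀, 0)).dir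
      rw [Circle.exp_sub, h2, hdir]
      exact mul_div_cancel_left _ _)
  refine ⟨fun y => (g • y.1, y.2 + a y.1), ?_, ?_, ?_, ?_⟩
  · exact ((continuous_const_smul g).comp continuous_fst).prodMk
      (continuous_snd.add (a.continuous.comp continuous_fst))
  · refine Prod.ext ?_ ?_
    · change g • z₀ = z₁
      exact (h1.trans (pt_psl_smul _ _)).symm
    · change s₀ + a z₀ = s₁
      rw [ha0]; ring
  · rintro ⟨z, s⟩
    refine unwrap_eq_iff.2 ⟨(pt_psl_smul g (unwrap (z, s))).symm, ?_⟩
    change Circle.exp (s + a z) = _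
    rw [hdir, Circle.exp_add]
    exact congrArg _ (congrFun ha z)
  · intro z s
    refine Prod.ext rfl ?_
    change s + 2 * Real.pi + a z = s + a z + 2 * Real.pi
    ring

end UnitTangent

section

open UnitTangent

variable {Γ : Subgroup PSL(2, ℝ)}

theorem IsSurfaceGroup.eq_of_smul_unitTangent_eq (hΓ : IsSurfaceGroup Γ) {γ δ : Γ}
    {w : UnitTangent} (h : γ • w = δ • w) : γ = δ := by
  have h1 : (δ⁻¹ * γ) • w = w := by rw [mul_smul, h, inv_smul_smul]
  have h2 := hΓ.free (δ⁻¹ * γ) w.pt (by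
    have := congrArg UnitTangent.pt h1
    exact (pt_psl_smul ((δ⁻¹ * γ : Γ) : PSL(2, ℝ)) w).symm.trans this)
  exact (inv_mul_eq_one.1 h2).symm

theorem IsSurfaceGroup.isCoveringMap_unitTangent (hΓ : IsSurfaceGroup Γ) :
    IsCoveringMap (Quotient.mk (MulAction.orbitRel Γ UnitTangent)) :=
  (hΓ.isQuotientCoveringMap continuous_pt fun γ w => pt_psl_smul (γ : PSL(2, ℝ)) w).isCoveringMap

/-- A homeomorphism of `M` lifts to a local homeomorphism of `Sℍ` that intertwines the covering
transformations. -/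
theorem IsSurfaceGroup.exists_lift (hΓ : IsSurfaceGroup Γ)
    (h : SurfaceUnitTangent Γ ≃ₜ SurfaceUnitTangent Γ) :
    ∃ F : UnitTangent → UnitTangent, IsLocalHomeomorph F ∧
      (∀ w, (Quotient.mk _ (F w) : SurfaceUnitTangent Γ) = h (Quotient.mk _ w)) ∧
      ∀ ε : Γ, ∃ γ : Γ, ∀ w, F (γ • w) = ε • F w := by
  have hcov := hΓ.isCoveringMap_unitTangent
  set π : UnitTangent → SurfaceUnitTangent Γ := Quotient.mk _ with hπ
  have hπγ : ∀ (γ : Γ) w, π (γ • w) = π w := fun γ w => Quotient.sound ⟨γ, rfl⟩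
  have hsmul : ∀ γ : Γ, Continuous fun w : UnitTangent => γ • w := fun γ => continuous_const_smul γ
  let y₀ : ℍ × ℝ := (UpperHalfPlane.I, 0)
  obtain ⟨w₀, hw₀⟩ := Quotient.exists_rep (h (π (unwrap y₀)))
  -- `Sℍ` is not simply connected, so the lift is first made on `ℍ × ℝ`.
  obtain ⟨f, ⟨hf0, hf⟩, -⟩ := hcov.existsUnique_continuousMap_lifts
    ⟨fun y => h (π (unwrap y)), h.continuous.comp (hcov.continuous.comp continuous_unwrap)⟩ y₀ w₀ hw₀
  replace hf : ∀ y, π (f y) = h (π (unwrap y)) := fun y => congrFun hf y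
  have huniq : ∀ f₁ f₂ : ℍ × ℝ → UnitTangent, Continuous f₁ → Continuous f₂ →
      (∀ y, π (f₁ y) = π (f₂ y)) → ∀ y, f₁ y = f₂ y → f₁ = f₂ := fun f₁ f₂ h1 h2 h3 y hy =>
    hcov.eq_of_comp_eq h1 h2 (funext h3) y hy
  have hshift : Continuous fun y : ℍ × ℝ => (y.1, y.2 + 2 * Real.pi) := by fun_prop
  have hπs : ∀ y : ℍ × ℝ, π (f (y.1, y.2 + 2 * Real.pi)) = π (f y) := fun y => by
    rw [hf, hf, unwrap_add_two_pi]
  -- `δ` is the image in `Γ` of the class of the fibre; `f` descends to `Sℍ` exactly when it is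
  -- trivial.
  obtain ⟨δ, hδ⟩ : ∃ δ : Γ, ∀ y : ℍ × ℝ, f (y.1, y.2 + 2 * Real.pi) = δ • f y := by
    obtain ⟨δ, hδ⟩ := Quotient.exact (hπs y₀)
    refine ⟨δ, fun y => congrFun (huniq (fun y => f (y.1, y.2 + 2 * Real.pi)) (fun y => δ • f y)
      (f.continuous.comp hshift) ((hsmul δ).comp f.continuous) (fun y => ?_) y₀ hδ.symm) y⟩
    rw [hπγ, hπs]
  -- Every `ε` comes from a covering transformation `T` of `ℍ × ℝ`: a path from `f y₀` to `ε • f y₀`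
  -- is carried back by `h.symm` and lifted from `y₀`, and its end is `T y₀`. Uniqueness of lifts
  -- gives `f ∘ T = ε • f`.
  have hT : ∀ ε : Γ, ∃ (γ : Γ) (T : ℍ × ℝ → ℍ × ℝ), (∀ y, unwrap (T y) = γ • unwrap y) ∧
      (∀ y, f (T y) = ε • f y) ∧
      ∀ z s, T (z, s + 2 * Real.pi) = ((T (z, s)).1, (T (z, s)).2 + 2 * Real.pi) := by
    intro ε
    obtain ⟨x₀, hx₀⟩ := isOpenQuotientMap_unwrap.surjective (f y₀)
    obtain ⟨x₁, hx₁⟩ := isOpenQuotientMap_unwrap.surjective (ε • f y₀)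
    let p : Path x₀ x₁ := PathConnectedSpace.somePath x₀ x₁
    have hp : Continuous fun t => unwrap (p t) := continuous_unwrap.comp p.continuous
    obtain ⟨c, hc, hc0⟩ := hcov.exists_path_lifts
      ⟨fun t => h.symm (π (unwrap (p t))), h.symm.continuous.comp (hcov.continuous.comp hp)⟩
      (unwrap y₀) (by
        change h.symm (π (unwrap (p 0))) = π (unwrap y₀)
        rw [p.source, hx₀, hf, h.symm_apply_apply])
    obtain ⟨b, hb, hb0⟩ := exists_path_unwrap c y₀ hc0.symm
    have hfb : (fun t => f (b t)) = fun t => unwrap (p t) := by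
      refine hcov.eq_of_comp_eq (f.continuous.comp b.continuous) hp (funext fun t => ?_) 0 ?_
      · change π (f (b t)) = π (unwrap (p t))
        have h1 : π (c t) = h.symm (π (unwrap (p t))) := congrFun hc t
        rw [hf, hb, h1, h.apply_symm_apply]
      · rw [hb0, p.source, hx₀]
    have hy1 : f (b 1) = ε • f y₀ := by
      rw [congrFun hfb 1, p.target, hx₁]
    have h3 : π (unwrap (b 1)) = π (unwrap y₀) := by
      have := hf (b 1)
      rw [hy1, hπγ, hf] at this
      exact (h.injective this).symm
    obtain ⟨γ, hγ⟩ := Quotient.exact h3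
    obtain ⟨T, hTc, hT0, hTγ, hTs⟩ := exists_unwrap_smul γ y₀ (b 1) hγ.symm
    refine ⟨γ, T, hTγ, fun y => congrFun (huniq (fun y => f (T y)) (fun y => ε • f y)
      (f.continuous.comp hTc) ((hsmul ε).comp f.continuous) (fun y => ?_) y₀ ?_) y, hTs⟩
    · rw [hπγ, hf, hf, hTγ]
      exact congrArg h (hπγ γ _)
    · rw [hT0, hy1]
  -- `T` commutes with the shift by `2 π`, so `δ` commutes with every `ε`.
  have hδ1 : δ = 1 := by
    refine hΓ.eq_one_of_commute δ fun ε => ?_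
    obtain ⟨γ, T, -, h1, h2⟩ := hT ε
    have h3 := h1 (UpperHalfPlane.I, 0 + 2 * Real.pi)
    rw [h2, hδ (T _), h1, hδ (UpperHalfPlane.I, 0), ← mul_smul, ← mul_smul] at h3
    exact (hΓ.eq_of_smul_unitTangent_eq h3).symm
  have hinv : ∀ y y', unwrap y = unwrap y' → f y = f y' := by
    rintro ⟨z, s⟩ ⟨z', s'⟩ he
    obtain ⟨h1, h2⟩ := unwrap_eq_iff.1 he
    rw [dir_unwrap] at h2
    change z = z' at h1
    subst h1
    have hper : Function.Periodic (fun s => f (z, s)) (2 * Real.pi) := fun s => by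
      have := hδ (z, s)
      rwa [hδ1, one_smul] at this
    obtain ⟨m, hm⟩ := Circle.exp_eq_exp.1 h2
    change s = s' + _ at hm
    rw [hm]
    exact hper.int_mul m s'
  choose sec hsec using isOpenQuotientMap_unwrap.surjective
  have hF : ∀ y, f (sec (unwrap y)) = f y := fun y => hinv _ _ (hsec _)
  have hFc : Continuous fun w => f (sec w) := by
    refine isOpenQuotientMap_unwrap.isQuotientMap.continuous_iff.2 ?_
    refine f.continuous.congr fun y => (hF y).symm
  have hFπ : ∀ w, π (f (sec w)) = h (π w) := fun w => by rw [hf, hsec]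
  refine ⟨fun w => f (sec w), ?_, hFπ, fun ε => ?_⟩
  · refine IsLocalHomeomorph.of_comp (g := π) ?_ hcov.isLocalHomeomorph hFc
    have : π ∘ (fun w => f (sec w)) = h ∘ π := funext hFπ
    rw [this]
    exact h.isOpenEmbedding.isLocalHomeomorph.comp hcov.isLocalHomeomorph
  · obtain ⟨γ, T, h1, h2, -⟩ := hT ε
    refine ⟨γ, fun w => ?_⟩
    obtain ⟨y, rfl⟩ := isOpenQuotientMap_unwrap.surjective w
    change f (sec _) = ε • f (sec _)
    rw [← h1, hF, hF, h2]

end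

/-! ### Planes that contain a piece of surface -/

/-- The difference of the values at two antipodal points changes sign along a half circle, so `f`
takes equal values at some antipodal pair. -/
theorem not_injective_circle_real {f : Circle → ℝ} (hf : Continuous f) : ¬ Function.Injective f := by
  intro hinj
  have hc : Continuous fun s : ℝ => f (Circle.exp s) - f (Circle.exp (s + Real.pi)) :=
    (hf.comp Circle.exp.continuous).sub
      (hf.comp (Circle.exp.continuous.comp (continuous_add_const _)))
  have h0 : (0 : ℝ) ∈ Set.range fun s : ℝ => f (Circle.exp s) - f (Circle.exp (s + Real.pi)) := by
    have h2 : f (Circle.exp (Real.pi + Real.pi)) = f (Circle.exp 0) := by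
      rw [← two_mul, Circle.exp_two_pi, Circle.exp_zero]
    have hr := isPreconnected_range hc
    rcases le_total (f (Circle.exp 0)) (f (Circle.exp Real.pi)) with h | h
    · refine hr.Icc_subset ⟨0, rfl⟩ ⟨Real.pi, rfl⟩ ⟨?_, ?_⟩
      · simpa using h
      · change 0 ≤ f _ - f _
        rw [h2]; linarith
    · refine hr.Icc_subset ⟨Real.pi, rfl⟩ ⟨0, rfl⟩ ⟨?_, ?_⟩
      · change f _ - f _ ≤ 0
        rw [h2]; linarith
      · simpa using h
  obtain ⟨s, hs⟩ := h0
  have h1 := hinj (sub_eq_zero.1 hs)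
  have h2 : (Circle.exp Real.pi : ℂ) = -1 := by rw [Circle.coe_exp, Complex.exp_pi_mul_I]
  rw [Circle.exp_add, left_eq_mul] at h1
  rw [h1, Circle.coe_one] at h2
  norm_num at h2

theorem submodule_mk_le_iff {E : Type*} [AddCommGroup E] [Module ℝ E] {v : E} (hv : v ≠ 0)
    (W : Submodule ℝ E) : (Projectivization.mk ℝ v hv).submodule ≤ W ↔ v ∈ W := by
  rw [Projectivization.submodule_mk, Submodule.span_singleton_le_iff_mem]

theorem submodule_smul_le_iff {E : Type*} [AddCommGroup E] [Module ℝ E] (g : E ≃ₗ[ℝ] E)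
    (p : ℙ ℝ E) (W : Submodule ℝ E) :
    (g • p).submodule ≤ W ↔ p.submodule ≤ W.comap (g : E →ₗ[ℝ] E) := by
  induction p using Projectivization.ind with | h v hv =>
  rw [Projectivization.smul_mk, submodule_mk_le_iff, submodule_mk_le_iff]
  rfl

theorem finrank_comap_linearEquiv {E : Type*} [AddCommGroup E] [Module ℝ E] (g : E ≃ₗ[ℝ] E)
    (W : Submodule ℝ E) :
    Module.finrank ℝ (W.comap (g : E →ₗ[ℝ] E)) = Module.finrank ℝ W := by
  have h : W.comap (g : E →ₗ[ℝ] E) = W.map (g.symm : E →ₗ[ℝ] E) :=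
    (Submodule.map_equiv_eq_comap_symm g.symm W).symm
  rw [h]
  exact LinearEquiv.finrank_map_eq g.symm W

theorem InProjectivePlane.smul {E : Type*} [AddCommGroup E] [Module ℝ E] {s : Set (ℙ ℝ E)}
    (h : InProjectivePlane s) (g : E ≃ₗ[ℝ] E) : InProjectivePlane ((fun p => g • p) '' s) := by
  obtain ⟨W, hW, hs⟩ := h
  refine ⟨W.comap (g.symm : E →ₗ[ℝ] E), by rw [finrank_comap_linearEquiv, hW], ?_⟩
  rintro _ ⟨p, hp, rfl⟩
  rw [← submodule_smul_le_iff]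
  change (g⁻¹ • g • p).submodule ≤ W
  rw [inv_smul_smul]
  exact hs p hp

/-- An affine coordinate of the real projective space. -/
def realCoord (μ ν : C2 →ₗ[ℝ] ℝ) (p : RP3) : ℝ := μ p.rep / ν p.rep

theorem realCoord_mk (μ ν : C2 →ₗ[ℝ] ℝ) (v : C2) (hv : v ≠ 0) :
    realCoord μ ν (Projectivization.mk ℝ v hv) = μ v / ν v := by
  obtain ⟨a, ha⟩ := Projectivization.exists_smul_eq_mk_rep ℝ v hv
  rw [realCoord, ← ha, Units.smul_def, map_smul, map_smul, smul_eq_mul, smul_eq_mul,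
    mul_div_mul_left _ _ a.ne_zero]

theorem continuousAt_realCoord (μ ν : C2 →ₗ[ℝ] ℝ) {v : C2} (hv : v ≠ 0) (h : ν v ≠ 0) :
    ContinuousAt (realCoord μ ν) (Projectivization.mk ℝ v hv) := by
  rw [← (isOpenQuotientMap_mk ℝ C2).continuousAt_comp_iff (x := ⟨v, hv⟩)]
  have hμ : Continuous μ := μ.continuous_of_finiteDimensional
  have hν : Continuous ν := ν.continuous_of_finiteDimensional
  have e : realCoord μ ν ∘ (fun v : {v : C2 // v ≠ 0} => Projectivization.mk ℝ v.1 v.2) =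
      fun v => μ v.1 / ν v.1 := funext fun v => realCoord_mk _ _ _ _
  rw [e]
  exact (hμ.comp continuous_subtype_val).continuousAt.div
    (hν.comp continuous_subtype_val).continuousAt h

/-- A projective line contains no piece of surface. -/
theorem not_injOn_of_finrank_le_two {f : ℝ × ℝ → RP3} (hf : Continuous f) {y : ℝ × ℝ}
    {U : Set (ℝ × ℝ)} (hU : U ∈ 𝓝 y) (hinj : Set.InjOn f U) (L : Submodule ℝ C2)
    (hL : Module.finrank ℝ L ≤ 2) (h : ∀ x ∈ U, (f x).submodule ≤ L) : False := by
  obtain ⟨r, hr, hrU⟩ := Metric.nhds_basis_closedBall.mem_iff.1 hU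
  -- A small circle around `y` would be embedded in the line `L` minus the point `f y`, which has a
  -- real coordinate.
  let c : Circle → ℝ × ℝ := fun z => y + r • ((z : ℂ).re, (z : ℂ).im)
  have hc : Continuous c := by
    have h1 : Continuous fun z : Circle => (z : ℂ).re :=
      Complex.continuous_re.comp continuous_subtype_val
    have h2 : Continuous fun z : Circle => (z : ℂ).im :=
      Complex.continuous_im.comp continuous_subtype_val
    exact continuous_const.add ((h1.prodMk h2).const_smul r)
  have hcU : ∀ z, c z ∈ U := fun z => hrU (by
    rw [Metric.mem_closedBall, dist_eq_norm, add_sub_cancel_left, norm_smul, Real.norm_eq_abs,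
      abs_of_pos hr]
    refine mul_le_of_le_one_right hr.le ?_
    have h1 : ‖(z : ℂ)‖ = 1 := Circle.norm_coe z
    exact norm_prod_le_iff.2 ⟨h1 ▸ Complex.abs_re_le_norm _, h1 ▸ Complex.abs_im_le_norm _⟩)
  have hyU : y ∈ U := mem_of_mem_nhds hU
  have hcy : ∀ z, f (c z) ≠ f y := by
    intro z hz
    have h1 := hinj (hcU z) hyU hz
    have h2 : r • ((z : ℂ).re, (z : ℂ).im) = 0 := by simpa [c] using h1
    have h3 := (smul_eq_zero.1 h2).resolve_left hr.ne'
    exact Circle.coe_ne_zero z (Complex.ext (congrArg Prod.fst h3) (congrArg Prod.snd h3))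
  have hcinj : Function.Injective fun z => f (c z) := by
    intro z z' hz
    have h1 := hinj (hcU z) (hcU z') hz
    have h2 := smul_right_injective _ hr.ne' (add_left_cancel h1)
    exact Circle.ext (Complex.ext (congrArg Prod.fst h2) (congrArg Prod.snd h2))
  obtain ⟨v₀, hv₀, e₀⟩ : ∃ v, ∃ hv : v ≠ 0, Projectivization.mk ℝ v hv = f y :=
    ⟨_, _, Projectivization.mk_rep _⟩
  obtain ⟨v₁, hv₁, e₁⟩ : ∃ v, ∃ hv : v ≠ 0, Projectivization.mk ℝ v hv = f (c 1) :=
    ⟨_, _, Projectivization.mk_rep _⟩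
  have hm₀ : v₀ ∈ L := by rw [← submodule_mk_le_iff hv₀, e₀]; exact h _ hyU
  have hm₁ : v₁ ∈ L := by rw [← submodule_mk_le_iff hv₁, e₁]; exact h _ (hcU 1)
  have hne : ∀ a : ℝ, a • v₀ ≠ v₁ := fun a ha => hcy 1 (by
    rw [← e₀, ← e₁, Projectivization.mk_eq_mk_iff']; exact ⟨a, ha⟩)
  have hli : LinearIndependent ℝ ![v₀, v₁] := (LinearIndependent.pair_iff' hv₀).2 hne
  have hspan : Submodule.span ℝ {v₀, v₁} = L := by
    refine Submodule.eq_of_le_of_finrank_le (Submodule.span_le.2 ?_) ?_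
    · rintro _ (rfl | rfl) <;> assumption
    · have := finrank_span_eq_card hli
      rw [Matrix.range_cons, Matrix.range_cons, Matrix.range_empty, Set.union_empty,
        Set.singleton_union, Fintype.card_fin] at this
      rwa [this]
  -- `ν` vanishes on `v₀`, so that the affine coordinate `μ / ν` of the line has its pole at `f y`.
  obtain ⟨ν, hν, hν₀⟩ := Submodule.exists_le_ker_of_notMem (p := Submodule.span ℝ {v₀}) (v := v₁)
    (fun hm => by
      obtain ⟨a, ha⟩ := Submodule.mem_span_singleton.1 hm
      exact hne a ha)
  obtain ⟨μ, hμ, hμ₁⟩ := Submodule.exists_le_ker_of_notMem (p := Submodule.span ℝ {v₁}) (v := v₀)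
    (fun hm => by
      obtain ⟨a, ha⟩ := Submodule.mem_span_singleton.1 hm
      have ha0 : a ≠ 0 := fun h0 => hv₀ (by rw [← ha, h0, zero_smul])
      exact hne a⁻¹ (by rw [← ha, smul_smul, inv_mul_cancel₀ ha0, one_smul]))
  replace hν₀ : ν v₀ = 0 := hν₀ (Submodule.mem_span_singleton_self v₀)
  replace hμ₁ : μ v₁ = 0 := hμ₁ (Submodule.mem_span_singleton_self v₁)
  have hrep : ∀ z, ∃ a b : ℝ, ∃ hv : a • v₀ + b • v₁ ≠ 0, b ≠ 0 ∧
      f (c z) = Projectivization.mk ℝ (a • v₀ + b • v₁) hv := by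
    intro z
    have h1 : (f (c z)).rep ∈ Submodule.span ℝ {v₀, v₁} := by
      rw [hspan, ← submodule_mk_le_iff (Projectivization.rep_nonzero _), Projectivization.mk_rep]
      exact h _ (hcU z)
    obtain ⟨a, b, hab⟩ := Submodule.mem_span_pair.1 h1
    have hv : a • v₀ + b • v₁ ≠ 0 := by rw [hab]; exact Projectivization.rep_nonzero _
    have he : f (c z) = Projectivization.mk ℝ (a • v₀ + b • v₁) hv := by
      conv_lhs => rw [← Projectivization.mk_rep (f (c z))]
      congr 1; exact hab.symm
    refine ⟨a, b, hv, fun hb => hcy z ?_, he⟩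
    rw [he, ← e₀, Projectivization.mk_eq_mk_iff']
    exact ⟨a, by rw [hb, zero_smul, add_zero]⟩
  refine not_injective_circle_real (f := fun z => realCoord μ ν (f (c z))) ?_ ?_
  · refine continuous_iff_continuousAt.2 fun z => ?_
    obtain ⟨a, b, hv, hb, he⟩ := hrep z
    refine ContinuousAt.comp (f := fun z => f (c z)) (g := realCoord μ ν) ?_
      (hf.comp hc).continuousAt
    rw [he]
    refine continuousAt_realCoord _ _ _ ?_
    simp [hν₀, hb, hν]
  · intro z z' hz
    apply hcinj
    obtain ⟨a, b, hv, hb, he⟩ := hrep z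
    obtain ⟨a', b', hv', hb', he'⟩ := hrep z'
    simp only [he, he', realCoord_mk] at hz
    simp only [map_add, map_smul, hν₀, hμ₁, smul_eq_mul, mul_zero, add_zero, zero_add] at hz
    have hab : a * b' = a' * b := by
      rw [div_eq_div_iff (mul_ne_zero hb hν) (mul_ne_zero hb' hν)] at hz
      have : (a * b' - a' * b) * (μ v₀ * ν v₁) = 0 := by linear_combination hz
      exact sub_eq_zero.1 ((mul_eq_zero.1 this).resolve_right (mul_ne_zero hμ hν))
    change f (c z) = f (c z')
    rw [he, he', Projectivization.mk_eq_mk_iff']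
    refine ⟨b / b', ?_⟩
    rw [smul_add, smul_smul, smul_smul, div_mul_cancel₀ _ hb']
    congr 2
    field_simp; linear_combination -hab

/-- A projective plane that contains a piece of surface is determined by it. -/
theorem plane_unique {f : ℝ × ℝ → RP3} (hf : Continuous f) {y : ℝ × ℝ}
    {U : Set (ℝ × ℝ)} (hU : U ∈ 𝓝 y) (hinj : Set.InjOn f U) {W W' : Submodule ℝ C2}
    (hW : Module.finrank ℝ W = 3) (hW' : Module.finrank ℝ W' = 3)
    (h : ∀ᶠ x in 𝓝 y, (f x).submodule ≤ W) (h' : ∀ᶠ x in 𝓝 y, (f x).submodule ≤ W') :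
    W = W' := by
  by_contra hne
  have hlt : W ⊓ W' < W := by
    refine lt_of_le_of_ne inf_le_left fun he => hne ?_
    exact Submodule.eq_of_le_of_finrank_le (inf_eq_left.1 he) (by rw [hW, hW'])
  have h2 := Submodule.finrank_lt_finrank_of_lt hlt
  refine not_injOn_of_finrank_le_two (U := U ∩ {x | (f x).submodule ≤ W ∧ (f x).submodule ≤ W'}) hf
    (Filter.inter_mem hU (h.and h')) (hinj.mono Set.inter_subset_left) (W ⊓ W') (by omega) ?_
  rintro x ⟨-, h1, h2⟩
  exact le_inf h1 h2

/-- A surface that is locally contained in projective planes is contained in a projective plane. -/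
theorem exists_plane {f : ℝ × ℝ → RP3} (hf : Continuous f) (hinj : ∀ y, ∃ U ∈ 𝓝 y, Set.InjOn f U)
    (h : ∀ y, ∃ W : Submodule ℝ C2, Module.finrank ℝ W = 3 ∧ ∀ᶠ x in 𝓝 y, (f x).submodule ≤ W) :
    ∃ W : Submodule ℝ C2, Module.finrank ℝ W = 3 ∧ (∀ x, (f x).submodule ≤ W) ∧
      ∀ W' : Submodule ℝ C2, Module.finrank ℝ W' = 3 → (∀ x, (f x).submodule ≤ W') → W' = W := by
  choose W hW hfW using h
  have hloc : IsLocallyConstant W := by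
    rw [IsLocallyConstant.iff_eventually_eq]
    intro y
    filter_upwards [eventually_eventually_nhds.2 (hfW y)] with x hx
    obtain ⟨U, hU, hUi⟩ := hinj x
    exact plane_unique hf hU hUi (hW x) (hW y) (hfW x) hx
  have hmem : ∀ x, (f x).submodule ≤ W 0 := fun x => by
    rw [hloc.apply_eq_of_preconnectedSpace 0 x]
    exact (hfW x).self_of_nhds
  refine ⟨W 0, hW 0, hmem, fun W' hW' h' => ?_⟩
  obtain ⟨U, hU, hUi⟩ := hinj 0
  exact plane_unique hf hU hUi hW' (hW 0) (.of_forall h') (.of_forall hmem)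

/-! ### Parametrization of the stable leaves -/

namespace UnitTangent

/-- The stable leaf of `A • axis 0`. -/
def plaque (A : SL(2, ℝ)) (y : ℝ × ℝ) : UnitTangent := (A * uniSL y.1 * geoSL y.2) • axis 0

theorem continuous_plaque (A : SL(2, ℝ)) : Continuous (plaque A) := by
  have h : Continuous fun y : ℝ × ℝ => A * uniSL y.1 * geoSL y.2 :=
    (continuous_const.mul (continuous_uniSL.comp continuous_fst)).mul
      (continuous_geoSL.comp continuous_snd)
  exact isOpenQuotientMap_smul_axis.continuous.comp h

theorem plaque_injective (A : SL(2, ℝ)) : Function.Injective (plaque A) := by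
  rintro ⟨x, t⟩ ⟨x', t'⟩ h
  have key : ∀ e : SL(2, ℝ), (e = 1 ∨ e = -1) → uniSL x' * geoSL t' = e * (uniSL x * geoSL t) →
      (x, t) = (x', t') := by
    intro e he h1
    have h00 := congrArg (fun M : SL(2, ℝ) => (M : Matrix (Fin 2) (Fin 2) ℝ) 0 0) h1
    have h01 := congrArg (fun M : SL(2, ℝ) => (M : Matrix (Fin 2) (Fin 2) ℝ) 0 1) h1
    have hp := Real.exp_pos (t / 2)
    have hp' := Real.exp_pos (t' / 2)
    rcases he with rfl | rfl
    · simp [Matrix.SpecialLinearGroup.coe_mul, coe_uniSL, coe_geoSL, Matrix.mul_apply,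
        Fin.sum_univ_two] at h00 h01
      subst h00
      simpa using h01.symm
    · simp [Matrix.SpecialLinearGroup.coe_mul, coe_uniSL, coe_geoSL, Matrix.mul_apply,
        Fin.sum_univ_two] at h00
      linarith
  rcases smul_axis_eq_iff.1 h with h1 | h1
  · refine key 1 (Or.inl rfl) ?_
    rw [one_mul]
    exact mul_left_cancel (a := A) (by rw [← mul_assoc, ← mul_assoc]; exact h1)
  · refine key (-1) (Or.inr rfl) ?_
    refine mul_left_cancel (a := A) ?_
    rw [← mul_assoc]
    refine h1.trans ?_
    simp [mul_assoc]

/-- At the height `eᵗ` a horizontal translation by `x` has length at most `|x| e⁻ᵗ`. -/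
theorem tendsto_dist_uniSL (A : SL(2, ℝ)) (x : ℝ) :
    Tendsto (fun t => dist (gpt A t) (gpt (A * uniSL x) t)) atTop (𝓝 0) := by
  have h1 : ∀ t, dist (gpt A t) (gpt (A * uniSL x) t) ≤ |x| * Real.exp (-t) := by
    intro t
    have e : dist (gpt A t) (gpt (A * uniSL x) t) =
        dist (axis t).pt (uniSL x • (axis t).pt) := by
      rw [gpt_mul, gpt, gpt, pt_smul, dist_smul, pt_smul]
    rw [e]
    refine (UpperHalfPlane.dist_le_dist_coe_div_sqrt _ _).trans (le_of_eq ?_)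
    have him : (axis t).pt.im = Real.exp t := by
      rw [← UpperHalfPlane.coe_im, coe_pt_axis]; simp [-Complex.ofReal_exp]
    have him' : (uniSL x • (axis t).pt).im = Real.exp t := by
      rw [← UpperHalfPlane.coe_im, coe_uniSL_smul]; simp [him]
    rw [him, him', coe_uniSL_smul, dist_eq_norm, sub_add_cancel_left, norm_neg,
      Complex.norm_real, Real.sqrt_mul_self (Real.exp_pos t).le, Real.exp_neg, div_eq_mul_inv,
      Real.norm_eq_abs]
  refine squeeze_zero (fun _ => dist_nonneg) h1 ?_
  have := (Real.tendsto_exp_neg_atTop_nhds_zero).const_mul |x|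
  rwa [mul_zero] at this

theorem plaque_mem_stableLeaf (A : SL(2, ℝ)) (y y' : ℝ × ℝ) :
    plaque A y' ∈ (plaque A y).stableLeaf := by
  refine (mem_stableLeaf_iff _ _).2 ⟨y.2 - y'.2, ?_⟩
  have h := (tendsto_dist_uniSL (A * uniSL y.1) (y'.1 - y.1)).comp
    (tendsto_atTop_add_const_left atTop y.2 tendsto_id)
  refine h.congr fun t => ?_
  have h1 : A * uniSL y.1 * uniSL (y'.1 - y.1) = A * uniSL y'.1 := by
    rw [mul_assoc]; congr 1
    refine sl_ext ?_ ?_ ?_ ?_ <;> rw [sl_mul_apply] <;> simp [coe_uniSL]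
  rw [gpt_mul_geoSL, gpt_mul_geoSL, Function.comp_apply, id, h1]
  congr 2; ring

/-- A hyperbolic element preserves the stable leaf of its axis. This makes the plane of that leaf
invariant under the holonomy. -/
theorem plaque_smul (A : SL(2, ℝ)) (t : ℝ) (y : ℝ × ℝ) :
    (A * geoSL t * A⁻¹) • plaque A y = plaque A (Real.exp t * y.1, t + y.2) := by
  rw [plaque, plaque, ← mul_smul]
  congr 1
  calc A * geoSL t * A⁻¹ * (A * uniSL y.1 * geoSL y.2)
      = A * (geoSL t * uniSL y.1) * geoSL y.2 := by group
    _ = _ := by rw [geoSL_mul_uniSL, geoSL_add]; group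

end UnitTangent

/-! ### A foliated structure has a Fuchsian holonomy -/

theorem finrank_C2 : Module.finrank ℝ C2 = 4 := by
  rw [Module.finrank_pi_fintype]; simp [Complex.finrank_real_complex]

/-- An element of `SL(2, ℂ)` that preserves a real hyperplane of `ℂ²` has real eigenvalues. -/
theorem exists_trace_eq_of_comap_eq {W : Submodule ℝ C2} (hW : Module.finrank ℝ W = 3)
    (A : SL(2, ℂ)) (h : W.comap (slReal A : C2 →ₗ[ℝ] C2) = W) :
    ∃ t : ℝ, t ≠ 0 ∧ A 0 0 + A 1 1 = (t : ℂ) + (t : ℂ)⁻¹ := by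
  have hdim := finrank_C2
  have hlt : W < ⊤ := by
    rw [lt_top_iff_ne_top]
    rintro rfl
    rw [finrank_top, hdim] at hW
    omega
  obtain ⟨φ, hφ, hle⟩ := Submodule.exists_le_ker_of_lt_top W hlt
  have hker : W = LinearMap.ker φ := by
    refine Submodule.eq_of_le_of_finrank_le hle ?_
    have h1 := φ.finrank_range_add_finrank_ker
    have h2 : LinearMap.range φ = ⊤ := LinearMap.range_eq_top.2 (LinearMap.surjective hφ)
    rw [h2, finrank_top, Module.finrank_self, hdim] at h1
    omega
  have hmem : ∀ v : C2, φ (A • v) = 0 ↔ φ v = 0 := fun v => by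
    rw [← LinearMap.mem_ker, ← LinearMap.mem_ker, ← hker]
    conv_rhs => rw [← h]
    rw [Submodule.mem_comap]
    rfl
  obtain ⟨v₁, hv₁⟩ := LinearMap.surjective hφ 1
  set t := φ (A • v₁) with ht
  have ht0 : t ≠ 0 := fun h0 => by
    rw [(hmem v₁).1 h0] at hv₁
    exact zero_ne_one hv₁
  have hsmul : ∀ v : C2, φ (A • v) = t * φ v := by
    intro v
    have h1 : φ (v - φ v • v₁) = 0 := by rw [map_sub, map_smul, hv₁, smul_eq_mul, mul_one, sub_self]
    have h2 := (hmem _).2 h1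
    rw [smul_sub, smul_comm A (φ v) v₁, φ.map_sub, φ.map_smul, smul_eq_mul, ← ht] at h2
    linear_combination h2
  -- `φ` is the real part of the complex linear form `α`. As `t` is real, `φ ∘ A = t φ` gives `α ∘ A
  -- = t α`, so `t` is an eigenvalue of `A`, and the other one is `t⁻¹`.
  let α : C2 →ₗ[ℂ] ℂ := Module.Dual.extendRCLike φ
  have hα : ∀ v, α v = φ v - Complex.I * φ (Complex.I • v) := fun v => by
    simpa using Module.Dual.extendRCLike_apply (𝕜 := ℂ) φ v
  have hαA : ∀ v : C2, α (A • v) = t * α v := by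
    intro v
    rw [hα, hα, ← smul_comm A Complex.I v, hsmul, hsmul]
    push_cast; ring
  let e : Fin 2 → C2 := fun j => Pi.single j 1
  have hαe : ∀ v : C2, α v = v 0 * α (e 0) + v 1 * α (e 1) := by
    intro v
    have hv : v = v 0 • e 0 + v 1 • e 1 := by
      ext i; fin_cases i <;> simp [e]
    conv_lhs => rw [hv]
    rw [map_add, map_smul, map_smul, smul_eq_mul, smul_eq_mul]
  have hAe : ∀ i j, (A • e j) i = A i j := fun i j => by
    rw [Matrix.SpecialLinearGroup.smul_def]
    simp [e]
  have hdet : ((A : Matrix (Fin 2) (Fin 2) ℂ) - (t : ℂ) • (1 : Matrix (Fin 2) (Fin 2) ℂ)).det = 0 := by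
    refine Matrix.exists_vecMul_eq_zero_iff.1 ⟨fun j => α (e j), fun h0 => hφ ?_, ?_⟩
    · refine LinearMap.ext fun v => ?_
      have h1 : α v = 0 := by
        rw [hαe, show α (e 0) = 0 from congrFun h0 0, show α (e 1) = 0 from congrFun h0 1]; simp
      have h2 := congrArg Complex.re (hα v)
      rw [h1] at h2
      simpa using h2.symm
    · ext j
      have h1 := hαA (e j)
      rw [hαe (A • e j), hAe, hAe] at h1
      fin_cases j <;> simp [Matrix.vecMul, dotProduct, Fin.sum_univ_two] at h1 ⊢ <;>
        linear_combination h1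
  rw [Matrix.det_fin_two] at hdet
  simp at hdet
  have htc : (t : ℂ) ≠ 0 := Complex.ofReal_ne_zero.2 ht0
  have hti : (t : ℂ) * (t : ℂ)⁻¹ = 1 := mul_inv_cancel₀ htc
  refine ⟨t, ht0, mul_left_cancel₀ htc ?_⟩
  linear_combination -hdet + sl_det A - hti

theorem pslComplexify_mk (A : SL(2, ℝ)) :
    pslComplexify (QuotientGroup.mk A) = QuotientGroup.mk (slMap A) := rfl

theorem slMap_injective : Function.Injective slMap := fun A B h => by
  have h1 : ∀ i j, A i j = B i j := fun i j => by
    have := congrArg (fun M : SL(2, ℂ) => M i j) h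
    simpa [slMap_apply] using this
  exact sl_ext (h1 _ _) (h1 _ _) (h1 _ _) (h1 _ _)

theorem pslComplexify_injective : Function.Injective pslComplexify := by
  rw [injective_iff_map_eq_one]
  intro r hr
  induction r using QuotientGroup.induction_on with | H A =>
  rw [pslComplexify_mk] at hr
  rcases eq_or_eq_neg_of_psl_mk_eq (A := 1) (B := slMap A) hr.symm with h | h
  · rw [slMap_injective (h.trans (map_one slMap).symm)]; rfl
  · have h2 : slMap (-1) = -1 := by
      refine sl_ext ?_ ?_ ?_ ?_ <;> simp [slMap_apply]
    rw [slMap_injective (h.trans h2.symm), psl_mk_neg]; rfl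

theorem continuous_pslComplexify : Continuous pslComplexify := by
  refine (QuotientGroup.isOpenQuotientMap_mk).isQuotientMap.continuous_iff.2 ?_
  have h : Continuous slMap := by
    refine continuous_sl_mk fun i j => ?_
    exact Complex.continuous_ofReal.comp (UnitTangent.continuous_entry ℝ i j)
  exact (continuous_pslMk ℂ).comp h

theorem IsSurfaceGroup.exists_ne_one {Γ : Subgroup PSL(2, ℝ)} (hΓ : IsSurfaceGroup Γ) :
    ∃ γ : Γ, γ ≠ 1 := by
  by_contra! h
  obtain ⟨R, hR⟩ := hΓ.exists_radius
  have h1 : ∀ z : ℍ, dist z UpperHalfPlane.I ≤ R := fun z => by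
    obtain ⟨γ, hγ⟩ := hR z
    rwa [h γ, one_smul] at hγ
  have h2 := dist_triangle_right (gpt 1 0) (gpt 1 (2 * R + 1)) UpperHalfPlane.I
  rw [dist_gpt_gpt] at h2
  have h3 := neg_le_abs (0 - (2 * R + 1))
  linarith [h1 (gpt 1 0), h1 (gpt 1 (2 * R + 1))]

theorem psl_mk_neg_one : (QuotientGroup.mk (-1 : SL(2, ℂ)) : PSL(2, ℂ)) = 1 := by
  refine (QuotientGroup.eq_one_iff _).2 (Matrix.SpecialLinearGroup.mem_center_iff.2 ⟨-1, by simp, ?_⟩)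
  ext i j; fin_cases i <;> fin_cases j <;> simp

/-! ### From invariant planes to a Fuchsian representation -/

section

variable {Γ : Subgroup PSL(2, ℝ)} {q : Γ →* PSL(2, ℂ)}

/-- A faithful discrete representation whose elements have real eigenvalues is conjugate to a
Fuchsian one. -/
theorem IsSurfaceGroup.isConjugateToFuchsian_of_trace (hΓ : IsSurfaceGroup Γ)
    (hinj : Function.Injective q) (hdis : DiscreteTopology q.range)
    (h : ∀ γ : Γ, γ ≠ 1 → ∀ A : SL(2, ℂ), q γ = QuotientGroup.mk A →
      ∃ t : ℝ, t ≠ 0 ∧ A 0 0 + A 1 1 = (t : ℂ) + (t : ℂ)⁻¹) : IsConjugateToFuchsian q := by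
  -- `G` is the full preimage of `q(Γ)`. Its only central elements are `±1` because `q` is faithful
  -- and `Γ` has trivial centre.
  set G : Subgroup SL(2, ℂ) := q.range.comap (QuotientGroup.mk' _) with hGdef
  have hmem : ∀ A, A ∈ G ↔ ∃ γ, q γ = QuotientGroup.mk A := fun A => Iff.rfl
  have hone : ∀ A : SL(2, ℂ), (QuotientGroup.mk A : PSL(2, ℂ)) = 1 → A = 1 ∨ A = -1 := fun A hA =>
    eq_or_eq_neg_of_psl_mk_eq (A := 1) (B := A) hA.symm
  have hG : IsRealEigenvalueGroup G := by
    constructor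
    · intro A hA
      obtain ⟨γ, hγ⟩ := (hmem A).1 hA
      by_cases h1 : γ = 1
      · rw [h1, map_one] at hγ
        rcases hone A hγ.symm with rfl | rfl
        · exact ⟨1, one_ne_zero, by simp⟩
        · exact ⟨-1, by norm_num, by simp⟩
      · exact h γ h1 A hγ
    · have h1 : ({1} : Set q.range) ∈ 𝓝 1 := (isOpen_discrete _).mem_nhds rfl
      obtain ⟨U, hU, hUs⟩ := mem_nhds_subtype _ _ _ |>.1 h1
      refine ⟨_, (continuous_pslMk ℂ).continuousAt.preimage_mem_nhds (x := (1 : SL(2, ℂ))) hU, ?_⟩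
      intro A hA hAU
      have : (⟨QuotientGroup.mk A, hA⟩ : q.range) ∈ ({1} : Set q.range) := hUs hAU
      exact hone A (congrArg Subtype.val this)
    · intro A hA hcomm
      obtain ⟨γ, hγ⟩ := (hmem A).1 hA
      have : γ = 1 := by
        refine hΓ.eq_one_of_commute γ fun δ => hinj ?_
        obtain ⟨B, hB⟩ := QuotientGroup.mk_surjective (q δ)
        have := hcomm B ((hmem B).2 ⟨δ, hB.symm⟩)
        rw [map_mul, map_mul, hγ, ← hB]
        exact congrArg QuotientGroup.mk this.symm
      rw [this, map_one] at hγ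
      exact hone A hγ.symm
    · obtain ⟨γ, hγ⟩ := hΓ.exists_ne_one
      obtain ⟨A, hA⟩ := QuotientGroup.mk_surjective (q γ)
      refine ⟨A, (hmem A).2 ⟨γ, hA.symm⟩, ?_, ?_⟩
      · rintro rfl
        exact hγ (hinj (by rw [map_one, ← hA]; rfl))
      · rintro rfl
        refine hγ (hinj (by rw [map_one, ← hA]; exact psl_mk_neg_one))
  obtain ⟨g, hg⟩ := hG.exists_conj_real
  set k : PSL(2, ℂ) := QuotientGroup.mk g
  have hex : ∀ γ : Γ, ∃ r : PSL(2, ℝ), pslComplexify r = k⁻¹ * q γ * k := by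
    intro γ
    obtain ⟨A, hA⟩ := QuotientGroup.mk_surjective (q γ)
    obtain ⟨B, hB⟩ := hg A ((hmem A).2 ⟨γ, hA.symm⟩)
    exact ⟨QuotientGroup.mk B, by rw [pslComplexify_mk, hB, ← hA]; rfl⟩
  choose r hr using hex
  let ρ : Γ →* PSL(2, ℝ) := MonoidHom.mk' r fun γ δ => pslComplexify_injective (by
    rw [map_mul, hr, hr, hr, map_mul]; group)
  have hρ : ∀ γ, q γ = k * pslComplexify (ρ γ) * k⁻¹ := fun γ => by
    change q γ = k * pslComplexify (r γ) * k⁻¹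
    rw [hr]; group
  refine ⟨ρ, ⟨fun γ δ h => hinj (by rw [hρ, hρ, h]), ?_⟩, k, hρ⟩
  -- Discreteness of `ρ` is inherited through this continuous injection into a discrete space.
  let f : ρ.range → q.range := fun x => ⟨k * pslComplexify x * k⁻¹, by
    obtain ⟨_, γ, rfl⟩ := x
    exact ⟨γ, hρ γ⟩⟩
  have hf : Continuous f := Continuous.subtype_mk ((continuous_const.mul
    (continuous_pslComplexify.comp continuous_subtype_val)).mul continuous_const) _
  refine DiscreteTopology.of_continuous_injective hf fun x y hxy => ?_
  have h1 : k * pslComplexify x * k⁻¹ = k * pslComplexify y * k⁻¹ := congrArg Subtype.val hxy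
  exact Subtype.ext (pslComplexify_injective (mul_left_cancel (mul_right_cancel h1)))

/-- An equivariant local homeomorphism that maps the weakly stable leaves into planes forces the
holonomy to be Fuchsian. -/
theorem IsSurfaceGroup.isConjugateToFuchsian_of_planes (hΓ : IsSurfaceGroup Γ)
    (hinj : Function.Injective q) (hdis : DiscreteTopology q.range) {D : UnitTangent → RP3}
    (hD : IsLocalHomeomorph D)
    (hplane : ∀ w : UnitTangent, ∃ V ∈ 𝓝 w, InProjectivePlane (D '' (V ∩ w.stableLeaf)))
    (hDγ : ∀ ε : Γ, ε ≠ 1 → ∃ γ : Γ, γ ≠ 1 ∧ ∀ w, D (γ • w) = q ε • D w) :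
    IsConjugateToFuchsian q := by
  refine hΓ.isConjugateToFuchsian_of_trace hinj hdis fun ε hε E hE => ?_
  obtain ⟨γ, hγ, hγD⟩ := hDγ ε hε
  -- The stable leaf of the axis of `γ` is parametrized by the connected space `ℝ × ℝ` and preserved
  -- by `γ`.
  obtain ⟨A, t, hA⟩ := hΓ.exists_axis γ hγ
  set d : ℝ × ℝ → RP3 := fun y => D (UnitTangent.plaque A y) with hd
  have hdc : Continuous d := hD.continuous.comp (UnitTangent.continuous_plaque A)
  obtain ⟨W, hW, hdW, huniq⟩ := exists_plane hdc (fun y => by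
    obtain ⟨e, he, heD⟩ := hD (UnitTangent.plaque A y)
    refine ⟨_, (UnitTangent.continuous_plaque A).continuousAt (e.open_source.mem_nhds he), ?_⟩
    intro x hx x' hx' hxx
    refine UnitTangent.plaque_injective A (e.injOn hx hx' ?_)
    rw [← heD]; exact hxx) (fun y => by
    obtain ⟨V, hV, W, hW, h⟩ := hplane (UnitTangent.plaque A y)
    refine ⟨W, hW, ?_⟩
    filter_upwards [(UnitTangent.continuous_plaque A).continuousAt hV] with x hx
    exact h _ ⟨_, ⟨hx, UnitTangent.plaque_mem_stableLeaf A y x⟩, rfl⟩)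
  have hdE : ∀ y : ℝ × ℝ, slReal E • d y = d (Real.exp t * y.1, t + y.2) := by
    intro y
    have h1 := hγD (UnitTangent.plaque A y)
    have h2 : γ • UnitTangent.plaque A y = UnitTangent.plaque A (Real.exp t * y.1, t + y.2) := by
      rw [← UnitTangent.plaque_smul, ← UnitTangent.psl_mk_smul, ← hA]; rfl
    rw [h2, hE] at h1
    exact h1.symm
  -- `E` maps the developed leaf into itself, so the preimage of `W` by `E` also contains that leaf
  -- and is equal to `W`.
  refine exists_trace_eq_of_comap_eq hW E (huniq _ ?_ fun y => ?_)
  · rw [finrank_comap_linearEquiv, hW]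
  · rw [← submodule_smul_le_iff, hdE]
    exact hdW _

/-- Following `h` by the inverse of the bundle isomorphism `b` gives a self-homeomorphism of `M`.
With its lift `F` to `Sℍ`, the map `toRP3 ∘ B ∘ F` is a developing map of `R`, to which
`isConjugateToFuchsian_of_planes` applies. -/
theorem IsSurfaceGroup.isConjugateToFuchsian_of_isFoliated (hΓ : IsSurfaceGroup Γ)
    (hinj : Function.Injective q) (hdis : DiscreteTopology q.range) (u : EquivariantLocalHomeo q)
    (hQ : IsDevelopingPair (Quotient.mk (MulAction.orbitRel Γ (HopfPullback u)))
      (HopfPullback.toRP3 u))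
    (h : SurfaceUnitTangent Γ ≃ₜ MulAction.orbitRel.Quotient Γ (HopfPullback u))
    (R : ProjectiveStructure C2 (SurfaceUnitTangent Γ))
    (hR : IsProjectiveMap R hQ.projectiveStructure h) (hfol : IsFoliated R) :
    IsConjugateToFuchsian q := by
  obtain ⟨B, hBγ, -⟩ := hΓ.exists_equivariant_homeomorph u
  obtain ⟨b, hb⟩ := exists_quotient_homeomorph B hBγ
  obtain ⟨F, hF, hFπ, hFγ⟩ := hΓ.exists_lift (h.trans b.symm)
  have hhw : ∀ w, h (Quotient.mk _ w) = Quotient.mk _ (B (F w)) := fun w => by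
    rw [← hb, hFπ, Homeomorph.trans_apply, b.apply_symm_apply]
  have hBF : Continuous fun w => B (F w) := B.continuous.comp hF.continuous
  refine hΓ.isConjugateToFuchsian_of_planes hinj hdis
    (D := fun w => HopfPullback.toRP3 u (B (F w))) ?_ ?_ ?_
  · exact (HopfPullback.isLocalHomeomorph_toRP3).comp (B.isOpenEmbedding.isLocalHomeomorph.comp hF)
  · intro w
    obtain ⟨φ, hφ, hφw⟩ := R.covers (Quotient.mk _ w)
    obtain ⟨ψ, hψ, hψw⟩ := hQ.exists_chart (h (Quotient.mk _ w))
    obtain ⟨g, hg⟩ := hR.2 φ hφ ψ hψ (φ (Quotient.mk _ w)) ⟨_, ⟨hφw, hψw⟩, rfl⟩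
    rw [hhw] at hψw
    obtain ⟨g', hg'⟩ := hψ (B (F w)) hψw
    obtain ⟨-, V, hV, hplane⟩ := hfol φ hφ w hφw
    have hmkc : ContinuousAt (Quotient.mk (MulAction.orbitRel Γ UnitTangent)) w :=
      continuous_quotient_mk'.continuousAt
    have h1 : ∀ᶠ w' in 𝓝 w, (Quotient.mk _ w' : SurfaceUnitTangent Γ) ∈ φ.source :=
      hmkc.eventually_mem (φ.open_source.mem_nhds hφw)
    have h2 := (ContinuousAt.comp (g := φ) (f := Quotient.mk (MulAction.orbitRel Γ UnitTangent))
      (φ.continuousAt hφw) hmkc).eventually hg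
    have h3 := hBF.continuousAt.eventually hg'
    -- Near `w` the developing map differs from the chart `φ` by a projective map, which preserves
    -- planes.
    have hev : ∀ᶠ w' in 𝓝 w, HopfPullback.toRP3 u (B (F w')) =
        (g'⁻¹ * g) • φ (Quotient.mk _ w') := by
      filter_upwards [h1, h2, h3] with w' h1 h2 h3
      rw [mul_smul, eq_inv_smul_iff, ← h3, ← hhw]
      simp only [Function.comp_apply] at h2
      rw [φ.left_inv h1] at h2
      exact h2
    refine ⟨V ∩ {w' | HopfPullback.toRP3 u (B (F w')) = (g'⁻¹ * g) • φ (Quotient.mk _ w')},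
      Filter.inter_mem hV hev, ?_⟩
    obtain ⟨W, hW, hs⟩ := hplane.smul (g'⁻¹ * g)
    refine ⟨W, hW, ?_⟩
    rintro _ ⟨w', ⟨⟨hw1, hw2⟩, hw3⟩, rfl⟩
    change HopfPullback.toRP3 u (B (F w')) = _ at hw2
    change (HopfPullback.toRP3 u (B (F w'))).submodule ≤ W
    rw [hw2]
    exact hs _ ⟨_, ⟨w', ⟨hw1, hw3⟩, rfl⟩, rfl⟩
  · intro ε hε
    obtain ⟨γ, hγ⟩ := hFγ ε
    refine ⟨γ, ?_, fun w => ?_⟩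
    · rintro rfl
      refine hε ?_
      have h1 := hγ (UnitTangent.axis 0)
      rw [one_smul] at h1
      exact hΓ.eq_of_smul_unitTangent_eq (h1.symm.trans (one_smul _ _).symm)
    · rw [hγ, hBγ, HopfPullback.toRP3_smul]

end

/-! ### The upper half-plane in the complex projective line -/

theorem sl_smul_apply (A : SL(2, ℂ)) (v : C2) (i : Fin 2) :
    (A • v) i = A i 0 * v 0 + A i 1 * v 1 := by
  simp [Matrix.SpecialLinearGroup.smul_def, Matrix.mulVec, dotProduct, Fin.sum_univ_two]

/-- A hermitian form on `ℂ²` that is positive on the upper half-plane. -/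
def imForm (v : C2) : ℝ := (v 0 * conj (v 1)).im

theorem imForm_smul (a : ℂ) (v : C2) : imForm (a • v) = Complex.normSq a * imForm v := by
  have h : (a • v) 0 * conj ((a • v) 1) = Complex.normSq a * (v 0 * conj (v 1)) := by
    rw [Complex.normSq_eq_conj_mul_self, Pi.smul_apply, Pi.smul_apply, smul_eq_mul, smul_eq_mul,
      map_mul]
    ring
  rw [imForm, h, Complex.im_ofReal_mul, imForm]

theorem continuous_imForm : Continuous imForm := by
  unfold imForm; fun_prop

/-- The upper half-plane in the complex projective line. -/
def posHalf : Set CP1 := {p | 0 < imForm p.rep}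

/-- The lower half-plane in the complex projective line. -/
def negHalf : Set CP1 := {p | imForm p.rep < 0}

theorem exists_imForm_rep {v : C2} (hv : v ≠ 0) :
    ∃ r : ℝ, 0 < r ∧ imForm (Projectivization.mk ℂ v hv).rep = r * imForm v := by
  obtain ⟨a, ha⟩ := Projectivization.exists_smul_eq_mk_rep ℂ v hv
  exact ⟨_, Complex.normSq_pos.2 a.ne_zero, by rw [← ha, Units.smul_def, imForm_smul]⟩

theorem mk_mem_posHalf_iff {v : C2} (hv : v ≠ 0) :
    (Projectivization.mk ℂ v hv : CP1) ∈ posHalf ↔ 0 < imForm v := by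
  obtain ⟨r, hr, h⟩ := exists_imForm_rep hv
  change 0 < imForm _ ↔ _
  rw [h, mul_pos_iff_of_pos_left hr]

theorem mk_mem_negHalf_iff {v : C2} (hv : v ≠ 0) :
    (Projectivization.mk ℂ v hv : CP1) ∈ negHalf ↔ imForm v < 0 := by
  obtain ⟨r, hr, h⟩ := exists_imForm_rep hv
  change imForm _ < 0 ↔ _
  rw [h]
  exact ⟨fun h => lt_of_not_ge fun hn => absurd h (not_lt.2 (mul_nonneg hr.le hn)),
    mul_neg_of_pos_of_neg hr⟩

theorem isOpen_posHalf : IsOpen posHalf := by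
  rw [← (isOpenQuotientMap_mk ℂ C2).isQuotientMap.isOpen_preimage]
  have : (fun v : {v : C2 // v ≠ 0} => Projectivization.mk ℂ v.1 v.2) ⁻¹' posHalf =
      {v | 0 < imForm v.1} := Set.ext fun v => mk_mem_posHalf_iff v.2
  rw [this]
  exact isOpen_lt continuous_const (continuous_imForm.comp continuous_subtype_val)

theorem isOpen_negHalf : IsOpen negHalf := by
  rw [← (isOpenQuotientMap_mk ℂ C2).isQuotientMap.isOpen_preimage]
  have : (fun v : {v : C2 // v ≠ 0} => Projectivization.mk ℂ v.1 v.2) ⁻¹' negHalf =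
      {v | imForm v.1 < 0} := Set.ext fun v => mk_mem_negHalf_iff v.2
  rw [this]
  exact isOpen_lt (continuous_imForm.comp continuous_subtype_val) continuous_const

theorem halfVec_ne_zero (z : ℂ) : (![z, 1] : C2) ≠ 0 := fun h => one_ne_zero (congrFun h 1)

/-- The embedding of the upper half-plane in the complex projective line. -/
def ofHalf (z : ℍ) : CP1 := Projectivization.mk ℂ ![(z : ℂ), 1] (halfVec_ne_zero z)

theorem imForm_half (z : ℂ) : imForm ![z, 1] = z.im := by simp [imForm]

theorem ofHalf_mem (z : ℍ) : ofHalf z ∈ posHalf :=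
  (mk_mem_posHalf_iff _).2 (by rw [imForm_half]; exact z.im_pos)

theorem snd_ne_zero_of_imForm {v : C2} (h : 0 < imForm v) : v 1 ≠ 0 := fun h0 => by
  simp [imForm, h0] at h

theorem mk_eq_ofHalf_iff {v : C2} (hv : v ≠ 0) (z : ℍ) :
    (Projectivization.mk ℂ v hv : CP1) = ofHalf z ↔ v 1 ≠ 0 ∧ (z : ℂ) = v 0 / v 1 := by
  rw [ofHalf, mk_eq_mk_iff_det2]
  constructor
  · intro h
    simp [det2] at h
    have h1 : v 1 ≠ 0 := fun h1 => hv (by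
      rw [h1, zero_mul, sub_zero] at h
      ext i; fin_cases i <;> assumption)
    exact ⟨h1, by rw [eq_div_iff h1]; linear_combination -h⟩
  · rintro ⟨h1, h⟩
    simp [det2, h]
    field_simp; ring

theorem exists_ofHalf_eq {p : CP1} (hp : p ∈ posHalf) : ∃ z, ofHalf z = p := by
  induction p using Projectivization.ind with | h v hv =>
  rw [mk_mem_posHalf_iff] at hp
  have h1 := snd_ne_zero_of_imForm hp
  have h2 : 0 < (v 0 / v 1).im := by
    have : v = v 1 • ![v 0 / v 1, 1] := by
      ext i; fin_cases i <;> simp [mul_div_cancel₀, h1]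
    rw [this, imForm_smul, imForm_half] at hp
    exact pos_of_mul_pos_right hp (Complex.normSq_nonneg _)
  exact ⟨⟨v 0 / v 1, h2⟩, ((mk_eq_ofHalf_iff hv _).2 ⟨h1, rfl⟩).symm⟩

theorem isOpenEmbedding_ofHalf : IsOpenEmbedding ofHalf := by
  refine .of_continuous_injective_isOpenMap ?_ ?_ ?_
  · refine continuous_mk_comp (K := ℂ) (V := C2) ?_ _
    refine continuous_pi fun i => ?_
    fin_cases i
    · exact UpperHalfPlane.continuous_coe
    · exact continuous_const
  · intro z z' h
    have := ((mk_eq_ofHalf_iff (halfVec_ne_zero z) z').1 h).2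
    exact UpperHalfPlane.ext (by simpa using this.symm)
  · intro U hU
    rw [← (isOpenQuotientMap_mk ℂ C2).isQuotientMap.isOpen_preimage]
    have h1 : IsOpen ((fun z : ℍ => (z : ℂ)) '' U) :=
      UpperHalfPlane.isOpenEmbedding_coe.isOpenMap U hU
    have h2 : (fun v : {v : C2 // v ≠ 0} => Projectivization.mk ℂ v.1 v.2) ⁻¹' (ofHalf '' U) =
        {v | v.1 1 ≠ 0} ∩ (fun v => v.1 0 / v.1 1) ⁻¹' ((fun z : ℍ => (z : ℂ)) '' U) := by
      ext v
      constructor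
      · rintro ⟨z, hz, h⟩
        obtain ⟨h3, h4⟩ := (mk_eq_ofHalf_iff v.2 z).1 h.symm
        exact ⟨h3, z, hz, h4⟩
      · rintro ⟨h3, z, hz, h4⟩
        exact ⟨z, hz, ((mk_eq_ofHalf_iff v.2 z).2 ⟨h3, h4⟩).symm⟩
    rw [h2]
    have hc : ∀ i, Continuous fun v : {v : C2 // v ≠ 0} => v.1 i := fun i =>
      (continuous_apply i).comp continuous_subtype_val
    refine ContinuousOn.isOpen_inter_preimage ?_ (isOpen_ne_fun (hc 1) continuous_const) h1
    exact (hc 0).continuousOn.div (hc 1).continuousOn fun _ h => h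

theorem slMap_smul_half (A : SL(2, ℝ)) (z : ℍ) :
    slMap A • (![(z : ℂ), 1] : C2) =
      UpperHalfPlane.denom (A : GL (Fin 2) ℝ) z • ![((A • z : ℍ) : ℂ), 1] := by
  have h := UnitTangent.denom_ne_zero A z
  rw [UnitTangent.coe_smul]
  ext i
  rw [sl_smul_apply]
  fin_cases i
  · simp [slMap_apply, UpperHalfPlane.denom]
    exact (mul_div_cancel₀ _ h).symm
  · simp [slMap_apply, UpperHalfPlane.denom]

theorem ofHalf_sl_smul (A : SL(2, ℝ)) (z : ℍ) :
    ofHalf (A • z) = (QuotientGroup.mk (slMap A) : PSL(2, ℂ)) • ofHalf z := by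
  rw [ofHalf, ofHalf, psl_mk_smul_mk_CP1, eq_comm, Projectivization.mk_eq_mk_iff']
  exact ⟨_, (slMap_smul_half A z).symm⟩

theorem ofHalf_smul (r : PSL(2, ℝ)) (z : ℍ) : ofHalf (r • z) = pslComplexify r • ofHalf z := by
  induction r using QuotientGroup.induction_on with | H A => exact ofHalf_sl_smul A z

/-! ### The complex conjugation -/

/-- The complex conjugation of `ℂ²`. -/
def conjC2 : C2 ≃ₗ[ℝ] C2 := LinearEquiv.piCongrRight fun _ => Complex.conjAe.toLinearEquiv

theorem conjC2_apply (v : C2) (i : Fin 2) : conjC2 v i = conj (v i) := rfl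

theorem conjC2_conjC2 (v : C2) : conjC2 (conjC2 v) = v := by
  ext i; simp [conjC2_apply]

theorem conjC2_smul (a : ℂ) (v : C2) : conjC2 (a • v) = conj a • conjC2 v := by
  ext i; simp [conjC2_apply]

theorem conjC2_slMap (A : SL(2, ℝ)) (v : C2) : conjC2 (slMap A • v) = slMap A • conjC2 v := by
  ext i; simp [conjC2_apply, sl_smul_apply, slMap_apply]

theorem imForm_conjC2 (v : C2) : imForm (conjC2 v) = -imForm v := by
  simp [imForm, conjC2_apply]; ring

/-- The complex conjugation of the complex projective line. -/
def conjCP1 : CP1 → CP1 :=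
  Projectivization.lift (fun v => Projectivization.mk ℂ (conjC2 v.1)
    ((LinearEquiv.map_ne_zero_iff _).2 v.2)) (by
    intro a b t h
    rw [Projectivization.mk_eq_mk_iff']
    exact ⟨conj t, by rw [← conjC2_smul, h]⟩)

theorem conjCP1_mk (v : C2) (hv : v ≠ 0) : conjCP1 (Projectivization.mk ℂ v hv) =
    Projectivization.mk ℂ (conjC2 v) ((LinearEquiv.map_ne_zero_iff _).2 hv) := rfl

theorem conjCP1_conjCP1 (p : CP1) : conjCP1 (conjCP1 p) = p := by
  induction p using Projectivization.ind with | h v hv =>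
  rw [conjCP1_mk, conjCP1_mk]
  congr 1; exact conjC2_conjC2 v

theorem continuous_conjCP1 : Continuous conjCP1 := by
  refine (isOpenQuotientMap_mk ℂ C2).isQuotientMap.continuous_iff.2 ?_
  have h : Continuous conjC2 := continuous_c2_linearEquiv conjC2
  exact continuous_mk_comp (K := ℂ) (V := C2) (h.comp continuous_subtype_val) _

theorem conjCP1_mem_posHalf_iff (p : CP1) : conjCP1 p ∈ posHalf ↔ p ∈ negHalf := by
  induction p using Projectivization.ind with | h v hv =>
  rw [conjCP1_mk, mk_mem_posHalf_iff, mk_mem_negHalf_iff, imForm_conjC2, neg_pos]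

/-- A symmetry of `ℂ² = ℝ⁴` that commutes with real matrices. -/
structure IsRealSymmetry (J : C2 ≃ₗ[ℝ] C2) (σ : CP1 ≃ₜ CP1) : Prop where
  hopf_smul : ∀ p : RP3, hopf (J • p) = σ (hopf p)
  slMap_smul : ∀ (A : SL(2, ℝ)) v, J (slMap A • v) = slMap A • J v

theorem isRealSymmetry_refl : IsRealSymmetry 1 (Homeomorph.refl CP1) :=
  ⟨fun p => by rw [one_smul]; rfl, fun _ _ => rfl⟩

theorem isRealSymmetry_conj : IsRealSymmetry conjC2
    ⟨⟨conjCP1, conjCP1, conjCP1_conjCP1, conjCP1_conjCP1⟩, continuous_conjCP1,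
      continuous_conjCP1⟩ := by
  refine ⟨fun p => ?_, conjC2_slMap⟩
  induction p using Projectivization.ind with | h v hv => rfl

theorem hopf_surjective : Function.Surjective hopf := fun p => by
  induction p using Projectivization.ind with | h v hv => exact ⟨Projectivization.mk ℝ v hv, rfl⟩

theorem IsRealSymmetry.psl_smul {J : C2 ≃ₗ[ℝ] C2} {σ : CP1 ≃ₜ CP1} (h : IsRealSymmetry J σ)
    (r : PSL(2, ℝ)) (p : RP3) : J • pslComplexify r • p = pslComplexify r • J • p := by
  induction r using QuotientGroup.induction_on with | H A =>
  induction p using Projectivization.ind with | h v hv =>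
  rw [pslComplexify_mk, psl_mk_smul_mk_RP3, Projectivization.smul_mk, Projectivization.smul_mk,
    psl_mk_smul_mk_RP3]
  congr 1; exact h.slMap_smul A v

theorem IsRealSymmetry.psl_smul_CP1 {J : C2 ≃ₗ[ℝ] C2} {σ : CP1 ≃ₜ CP1} (h : IsRealSymmetry J σ)
    (r : PSL(2, ℝ)) (p : CP1) : σ (pslComplexify r • p) = pslComplexify r • σ p := by
  obtain ⟨x, rfl⟩ := hopf_surjective p
  rw [← QFProj.hopf_smul, ← h.hopf_smul, h.psl_smul, QFProj.hopf_smul, h.hopf_smul]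

/-! ### The unit tangent bundle in the real projective space -/

theorem frameVec_ne_zero (A : SL(2, ℝ)) : slMap A • (![Complex.I, 1] : C2) ≠ 0 :=
  (smul_ne_zero_iff_ne _).2 (halfVec_ne_zero _)

/-- The vector `A (i, 1)` has the columns of `A` as imaginary and real parts. If `B` is a real
multiple `t A`, the determinants give `t² = 1`. -/
theorem frame_eq_iff (A B : SL(2, ℝ)) :
    (Projectivization.mk ℝ (slMap A • (![Complex.I, 1] : C2)) (frameVec_ne_zero A) : RP3) =
      Projectivization.mk ℝ (slMap B • (![Complex.I, 1] : C2)) (frameVec_ne_zero B) ↔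
      B = A ∨ B = -A := by
  rw [eq_comm, Projectivization.mk_eq_mk_iff']
  have hv : ∀ A : SL(2, ℝ), ∀ i, (slMap A • (![Complex.I, 1] : C2)) i = A i 0 * Complex.I + A i 1 :=
    fun A i => by rw [sl_smul_apply]; simp [slMap_apply]
  constructor
  · rintro ⟨t, h⟩
    have h1 : ∀ i, t * A i 0 = B i 0 ∧ t * A i 1 = B i 1 := fun i => by
      have := congrFun h i
      rw [Pi.smul_apply, hv, hv] at this
      have h2 := congrArg Complex.re this
      have h3 := congrArg Complex.im this
      simp at h2 h3
      exact ⟨h3, h2⟩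
    have h2 : t * t = 1 := by
      have h3 := sl_det A
      have h4 := sl_det B
      rw [← (h1 0).1, ← (h1 0).2, ← (h1 1).1, ← (h1 1).2] at h4
      linear_combination h4 - t ^ 2 * h3
    rcases mul_self_eq_one_iff.1 h2 with rfl | rfl
    · left
      exact sl_ext (by linarith [(h1 0).1]) (by linarith [(h1 0).2]) (by linarith [(h1 1).1])
        (by linarith [(h1 1).2])
    · right
      refine sl_ext ?_ ?_ ?_ ?_ <;> rw [Matrix.SpecialLinearGroup.coe_neg, Matrix.neg_apply]
      · linarith [(h1 0).1]
      · linarith [(h1 0).2]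
      · linarith [(h1 1).1]
      · linarith [(h1 1).2]
  · rintro (rfl | rfl)
    · exact ⟨1, one_smul _ _⟩
    · refine ⟨-1, ?_⟩
      ext i
      rw [Pi.smul_apply, hv, hv]
      simp

/-- The embedding of the unit tangent bundle of `ℍ` in the real projective space. -/
def tangentRP3 (w : UnitTangent) : RP3 :=
  Projectivization.mk ℝ _ (frameVec_ne_zero (exists_smul_axis w).choose)

theorem tangentRP3_smul_axis (A : SL(2, ℝ)) : tangentRP3 (A • UnitTangent.axis 0) =
    Projectivization.mk ℝ (slMap A • (![Complex.I, 1] : C2)) (frameVec_ne_zero A) := by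
  rw [tangentRP3, frame_eq_iff, ← smul_axis_eq_iff]
  exact (exists_smul_axis (A • UnitTangent.axis 0)).choose_spec.symm

theorem continuous_tangentRP3 : Continuous tangentRP3 := by
  refine isOpenQuotientMap_smul_axis.isQuotientMap.continuous_iff.2 ?_
  have h : Continuous fun A : SL(2, ℝ) => slMap A • (![Complex.I, 1] : C2) := by
    refine continuous_pi fun i => ?_
    simp only [sl_smul_apply, slMap_apply]
    exact ((Complex.continuous_ofReal.comp (UnitTangent.continuous_entry ℝ i 0)).mul
      continuous_const).add ((Complex.continuous_ofReal.comp
        (UnitTangent.continuous_entry ℝ i 1)).mul continuous_const)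
  exact (continuous_mk_comp (K := ℝ) (V := C2) h frameVec_ne_zero).congr fun A =>
    (tangentRP3_smul_axis A).symm

theorem tangentRP3_injective : Function.Injective tangentRP3 := by
  intro w w' h
  obtain ⟨A, rfl⟩ := exists_smul_axis w
  obtain ⟨B, rfl⟩ := exists_smul_axis w'
  rw [tangentRP3_smul_axis, tangentRP3_smul_axis, frame_eq_iff] at h
  exact smul_axis_eq_iff.2 h

theorem tangentRP3_smul (r : PSL(2, ℝ)) (w : UnitTangent) :
    tangentRP3 (r • w) = pslComplexify r • tangentRP3 w := by
  induction r using QuotientGroup.induction_on with | H A =>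
  obtain ⟨B, rfl⟩ := exists_smul_axis w
  rw [UnitTangent.psl_mk_smul, ← mul_smul, tangentRP3_smul_axis, tangentRP3_smul_axis,
    pslComplexify_mk, psl_mk_smul_mk_RP3]
  congr 1
  rw [map_mul, mul_smul]

theorem hopf_tangentRP3 (w : UnitTangent) : hopf (tangentRP3 w) = ofHalf w.pt := by
  obtain ⟨A, rfl⟩ := exists_smul_axis w
  rw [tangentRP3_smul_axis, hopf_mk, UnitTangent.pt_smul, ofHalf_sl_smul,
    UnitTangent.pt_axis_zero]
  rfl

/-- The imaginary and real parts of `v` are the columns of a real matrix of determinant `imForm v >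
0`. Dividing by the square root of this number gives the frame. -/
theorem exists_tangentRP3_eq {p : RP3} (hp : hopf p ∈ posHalf) : ∃ w, tangentRP3 w = p := by
  induction p using Projectivization.ind with | h v hv =>
  rw [hopf_mk, mk_mem_posHalf_iff] at hp
  set d := Real.sqrt (imForm v) with hd
  have hd0 : 0 < d := Real.sqrt_pos.2 hp
  have hdd : d * d = imForm v := Real.mul_self_sqrt hp.le
  let A : SL(2, ℝ) := slMk ((v 0).im / d) ((v 0).re / d) ((v 1).im / d) ((v 1).re / d) (by
    rw [div_mul_div_comm, div_mul_div_comm, ← sub_div, div_eq_one_iff_eq (mul_pos hd0 hd0).ne', hdd]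
    simp [imForm]; ring)
  refine ⟨A • UnitTangent.axis 0, ?_⟩
  rw [tangentRP3_smul_axis, eq_comm, Projectivization.mk_eq_mk_iff']
  refine ⟨d, ?_⟩
  ext i
  rw [Pi.smul_apply, sl_smul_apply, slMap_apply, slMap_apply]
  have hd1 : (d : ℂ) ≠ 0 := Complex.ofReal_ne_zero.2 hd0.ne'
  fin_cases i
  · simp [A, coe_slMk]
    field_simp
    rw [add_comm]; exact Complex.re_add_im (v 0)
  · simp [A, coe_slMk]
    field_simp
    rw [add_comm]; exact Complex.re_add_im (v 1)

/-! ### The limit set of a Fuchsian representation -/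

theorem exists_real_of_imForm_eq_zero {v : C2} (hv : v ≠ 0) (h : imForm v = 0) :
    ∃ (μ : ℂ) (x y : ℝ), μ ≠ 0 ∧ v = μ • ![(x : ℂ), (y : ℂ)] := by
  by_cases h1 : v 1 = 0
  · have h0 : v 0 ≠ 0 := fun h0 => hv (by ext i; fin_cases i <;> assumption)
    exact ⟨v 0, 1, 0, h0, by ext i; fin_cases i <;> simp [h1]⟩
  · have h2 : v 0 / v 1 = (v 0 * conj (v 1)) / (Complex.normSq (v 1) : ℂ) := by
      rw [Complex.normSq_eq_conj_mul_self]
      have : conj (v 1) ≠ 0 := (map_ne_zero _).2 h1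
      field_simp
    have h3 : (v 0 / v 1).im = 0 := by
      rw [h2, Complex.div_ofReal_im]
      change imForm v / _ = 0
      rw [h, zero_div]
    have h4 : ((v 0 / v 1).re : ℂ) = v 0 / v 1 := Complex.ext (by simp) (by simp [h3])
    refine ⟨v 1, (v 0 / v 1).re, 1, h1, ?_⟩
    ext i; fin_cases i
    · simp only [h4]; simp [mul_div_cancel₀ _ h1]
    · simp

/-- An affine coordinate of the complex projective line. -/
def complexCoord (x y : ℝ) (p : CP1) : ℂ :=
  (x * p.rep 0 + y * p.rep 1) / det2 ![(x : ℂ), (y : ℂ)] p.rep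

theorem complexCoord_mk (x y : ℝ) {v : C2} (hv : v ≠ 0) :
    complexCoord x y (Projectivization.mk ℂ v hv) =
      (x * v 0 + y * v 1) / det2 ![(x : ℂ), (y : ℂ)] v := by
  obtain ⟨a, ha⟩ := Projectivization.exists_smul_eq_mk_rep ℂ v hv
  have h1 := a.ne_zero
  rw [complexCoord, ← ha, Units.smul_def]
  refine Eq.trans ?_ (mul_div_mul_left _ _ h1)
  congr 1
  · simp only [Pi.smul_apply, smul_eq_mul]; ring
  · simp only [det2, Pi.smul_apply, smul_eq_mul]; ring

theorem continuousAt_complexCoord {x y : ℝ} {v : C2} (hv : v ≠ 0)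
    (h : det2 ![(x : ℂ), (y : ℂ)] v ≠ 0) :
    ContinuousAt (complexCoord x y) (Projectivization.mk ℂ v hv) := by
  rw [← (isOpenQuotientMap_mk ℂ C2).continuousAt_comp_iff (x := ⟨v, hv⟩)]
  have e : complexCoord x y ∘ (fun v : {v : C2 // v ≠ 0} => Projectivization.mk ℂ v.1 v.2) =
      fun v => (x * v.1 0 + y * v.1 1) / det2 ![(x : ℂ), (y : ℂ)] v.1 :=
    funext fun v => complexCoord_mk _ _ v.2
  have hc : ∀ i, Continuous fun v : {v : C2 // v ≠ 0} => v.1 i := fun i =>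
    (continuous_apply i).comp continuous_subtype_val
  rw [e]
  refine ContinuousAt.div ?_ ?_ h
  · exact ((continuous_const.mul (hc 0)).add (continuous_const.mul (hc 1))).continuousAt
  · exact (continuous_det2.comp (continuous_const.prodMk continuous_subtype_val)).continuousAt

/-- A Jordan curve is not contained in the real projective line minus a point. -/
theorem not_injective_of_real {c : Circle → CP1} (hc : Continuous c) {p : CP1}
    (hp : p ∉ posHalf ∧ p ∉ negHalf) (hcr : ∀ θ, c θ ∉ posHalf ∧ c θ ∉ negHalf)
    (hne : ∀ θ, c θ ≠ p) : ¬ Function.Injective c := by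
  have hreal : ∀ p : CP1, p ∉ posHalf ∧ p ∉ negHalf → ∃ (x y : ℝ)
      (h : (![(x : ℂ), (y : ℂ)] : C2) ≠ 0), p = Projectivization.mk ℂ _ h := by
    intro p hp
    induction p using Projectivization.ind with | h v hv =>
    rw [mk_mem_posHalf_iff, mk_mem_negHalf_iff] at hp
    obtain ⟨μ, x, y, hμ, h⟩ := exists_real_of_imForm_eq_zero hv
      (le_antisymm (not_lt.1 hp.1) (not_lt.1 hp.2))
    refine ⟨x, y, fun h0 => hv (by rw [h, h0, smul_zero]), ?_⟩
    rw [Projectivization.mk_eq_mk_iff']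
    exact ⟨μ, h.symm⟩
  obtain ⟨x, y, h0, rfl⟩ := hreal p hp
  intro hinj
  have hxy : (x : ℂ) ^ 2 + (y : ℂ) ^ 2 ≠ 0 := by
    intro h
    have h1 : x ^ 2 + y ^ 2 = 0 := by exact_mod_cast h
    have hx : x = 0 := by nlinarith [sq_nonneg x, sq_nonneg y]
    have hy : y = 0 := by nlinarith [sq_nonneg x, sq_nonneg y]
    exact h0 (by ext i; fin_cases i <;> simp [hx, hy])
  have hdet : ∀ {v : C2} (hv : v ≠ 0), Projectivization.mk ℂ v hv ≠ Projectivization.mk ℂ _ h0 →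
      det2 ![(x : ℂ), (y : ℂ)] v ≠ 0 := fun hv hne h => hne ((mk_eq_mk_iff_det2 h0 hv).2 h).symm
  -- The coordinate has its pole at `p` and is real on the real projective line, so it embeds the
  -- curve in `ℝ`.
  have him : ∀ θ, (complexCoord x y (c θ)).im = 0 := by
    intro θ
    obtain ⟨a, b, h, e⟩ := hreal _ (hcr θ)
    rw [e, complexCoord_mk]
    have : ((x : ℂ) * (![(a : ℂ), (b : ℂ)] : C2) 0 + y * (![(a : ℂ), (b : ℂ)] : C2) 1) /
        det2 ![(x : ℂ), (y : ℂ)] ![(a : ℂ), (b : ℂ)] = ((x * a + y * b) / (x * b - y * a) : ℝ) := by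
      simp [det2]
    rw [this, Complex.ofReal_im]
  refine not_injective_circle_real (f := fun θ => (complexCoord x y (c θ)).re) ?_ ?_
  · refine Complex.continuous_re.comp (continuous_iff_continuousAt.2 fun θ => ?_)
    refine ContinuousAt.comp (f := c) (g := complexCoord x y) ?_ hc.continuousAt
    obtain ⟨a, b, h, e⟩ := hreal _ (hcr θ)
    rw [e]
    exact continuousAt_complexCoord h (hdet h (e ▸ hne θ))
  · intro θ θ' hθ
    refine hinj ?_
    have hX : complexCoord x y (c θ) = complexCoord x y (c θ') :=
      Complex.ext hθ ((him θ).trans (him θ').symm)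
    have h1 := hne θ
    have h2 := hne θ'
    revert hX h1 h2
    generalize c θ = p₁
    generalize c θ' = p₂
    induction p₁ using Projectivization.ind with | h v hv =>
    induction p₂ using Projectivization.ind with | h w hw =>
    intro hX h1 h2
    rw [complexCoord_mk, complexCoord_mk, div_eq_div_iff (hdet hv h1) (hdet hw h2)] at hX
    rw [mk_eq_mk_iff_det2]
    refine (mul_eq_zero.1 ?_).resolve_left hxy
    simp only [det2, Matrix.cons_val_zero, Matrix.cons_val_one] at hX ⊢
    linear_combination hX

section

variable {Γ : Subgroup PSL(2, ℝ)} {q : Γ →* PSL(2, ℂ)} {ρ : Γ →* PSL(2, ℝ)}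

/-- The image by `u` of a neighbourhood disjoint from its translates is open, and injectivity of `u`
keeps its translates disjoint. -/
theorem EquivariantLocalHomeo.notMem_limitSet (hΓ : IsSurfaceGroup Γ) (u : EquivariantLocalHomeo q)
    (hu : Function.Injective u.toFun) (z : ℍ) : u.toFun z ∉ limitSet q.range := by
  intro h
  refine h ?_
  obtain ⟨U, hU, hUγ⟩ := hΓ.exists_nhds_disjoint z
  refine ⟨_, u.isLocalHomeomorph.isOpenMap.image_mem_nhds hU,
    (Set.finite_singleton (1 : q.range)).subset ?_⟩
  rintro ⟨_, γ, rfl⟩ ⟨_, ⟨_, ⟨x, hx, rfl⟩, rfl⟩, y, hy, hxy⟩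
  change u.toFun y = q γ • u.toFun x at hxy
  rw [← u.equivariant] at hxy
  have := hUγ γ ⟨y, ⟨x, hx, (hu hxy).symm⟩, hy⟩
  subst this
  exact Subtype.ext (map_one q)

/-- `ρ` acts properly discontinuously on `ℍ`, and `σ` intertwines this action with that of `q`
conjugated by `g`. Taking for `σ` the identity and the conjugation, the limit set is confined to the
image by `g` of the real circle. -/
theorem notMem_limitSet_of_symmetry (hρ : IsFuchsian ρ) {g : PSL(2, ℂ)}
    (hq : ∀ γ, q γ = g * pslComplexify (ρ γ) * g⁻¹) {J : C2 ≃ₗ[ℝ] C2} {σ : CP1 ≃ₜ CP1}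
    (hσ : IsRealSymmetry J σ) {p : CP1} (hp : σ (g⁻¹ • p) ∈ posHalf) : p ∉ limitSet q.range := by
  intro h
  refine h ?_
  obtain ⟨z, hz⟩ := exists_ofHalf_eq hp
  have := hρ.discrete
  have hK := isCompact_closedBall z 1
  have hfin := finite_setOf_smul_inter ρ.range hK hK
  have hc : Continuous fun x : CP1 => σ (g⁻¹ • x) := σ.continuous.comp (continuous_const_smul _)
  have hU : (fun x : CP1 => σ (g⁻¹ • x)) ⁻¹' (ofHalf '' Metric.closedBall z 1) ∈ 𝓝 p := by
    refine hc.continuousAt.preimage_mem_nhds ?_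
    rw [← hz]
    exact isOpenEmbedding_ofHalf.isOpenMap.image_mem_nhds (Metric.closedBall_mem_nhds z one_pos)
  let F : ρ.range → q.range := fun r => ⟨g * pslComplexify r * g⁻¹, by
    obtain ⟨_, γ, rfl⟩ := r
    exact ⟨γ, hq γ⟩⟩
  refine ⟨_, hU, (hfin.image F).subset ?_⟩
  rintro ⟨_, γ, rfl⟩ ⟨_, ⟨x, ⟨k, hk, hkx⟩, rfl⟩, k', hk', hkx'⟩
  refine ⟨⟨ρ γ, γ, rfl⟩, ⟨k', ⟨k, hk, ?_⟩, hk'⟩, Subtype.ext (hq γ).symm⟩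
  refine isOpenEmbedding_ofHalf.injective ?_
  change ofHalf (ρ γ • k) = ofHalf k'
  change ofHalf k' = σ (g⁻¹ • q γ • x) at hkx'
  change ofHalf k = σ (g⁻¹ • x) at hkx
  rw [ofHalf_smul, hkx, ← hσ.psl_smul_CP1, hkx', hq, mul_smul, mul_smul, inv_smul_smul]

/-- The developing map of an injective structure has values in a half-plane. -/
theorem IsQuasiFuchsian.exists_symmetry (hqF : IsQuasiFuchsian q) (hΓ : IsSurfaceGroup Γ)
    (hρ : IsFuchsian ρ) {g : PSL(2, ℂ)} (hq : ∀ γ, q γ = g * pslComplexify (ρ γ) * g⁻¹)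
    (u : EquivariantLocalHomeo q) (hu : Function.Injective u.toFun) :
    ∃ (J : C2 ≃ₗ[ℝ] C2) (σ : CP1 ≃ₜ CP1), IsRealSymmetry J σ ∧
      ∀ z, σ (g⁻¹ • u.toFun z) ∈ posHalf := by
  have hpos : ∀ p : CP1, p ∈ limitSet q.range → g⁻¹ • p ∉ posHalf ∧ g⁻¹ • p ∉ negHalf := fun p hp =>
    ⟨fun h => notMem_limitSet_of_symmetry hρ hq isRealSymmetry_refl h hp,
      fun h => notMem_limitSet_of_symmetry hρ hq isRealSymmetry_conj
        ((conjCP1_mem_posHalf_iff _).2 h) hp⟩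
  have hor : ∀ z, g⁻¹ • u.toFun z ∈ posHalf ∨ g⁻¹ • u.toFun z ∈ negHalf := by
    intro z
    -- If `u z` were on the circle, the limit set, which avoids `u z`, would be a Jordan curve in
    -- the circle minus a point.
    by_contra! hz
    obtain ⟨c, hc, hcinj, hcr⟩ := hqF.jordan
    have hcl : ∀ θ, c θ ∈ limitSet q.range := fun θ => hcr ▸ ⟨θ, rfl⟩
    refine not_injective_of_real (c := fun θ => g⁻¹ • c θ) ((continuous_const_smul _).comp hc) hz
      (fun θ => hpos _ (hcl θ)) (fun θ h => ?_) fun θ θ' h => hcinj (smul_left_cancel _ h)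
    exact u.notMem_limitSet hΓ hu z (smul_left_cancel _ h ▸ hcl θ)
  have hcont : Continuous fun z => g⁻¹ • u.toFun z :=
    (continuous_const_smul _).comp u.isLocalHomeomorph.continuous
  -- By connectedness of `ℍ` the image is in one half-plane; the conjugation is used if this is the
  -- lower one.
  have hclopen : IsClopen {z | g⁻¹ • u.toFun z ∈ posHalf} := by
    refine ⟨⟨?_⟩, isOpen_posHalf.preimage hcont⟩
    have : {z | g⁻¹ • u.toFun z ∈ posHalf}ᶜ = {z | g⁻¹ • u.toFun z ∈ negHalf} := by
      ext z
      refine ⟨fun h => (hor z).resolve_left h, fun h h' => ?_⟩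
      exact lt_asymm (a := imForm (g⁻¹ • u.toFun z).rep) h h'
    rw [this]
    exact isOpen_negHalf.preimage hcont
  rcases isClopen_iff.1 hclopen with h | h
  · refine ⟨_, _, isRealSymmetry_conj, fun z => (conjCP1_mem_posHalf_iff _).2 ?_⟩
    exact (hor z).resolve_left fun hz => (h ▸ (show z ∈ {z | g⁻¹ • u.toFun z ∈ posHalf} from hz) :)
  · exact ⟨_, _, isRealSymmetry_refl, fun z => (h ▸ Set.mem_univ z :
      z ∈ {z | g⁻¹ • u.toFun z ∈ posHalf})⟩

/-! ### Equivariant homeomorphisms of the hyperbolic plane -/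

/-- The range is open. It is also closed: it is the union of the `ρ`-translates of the compact image
of a ball, of which finitely many meet a given compact ball. Connectedness of `ℍ` then gives
surjectivity. -/
theorem IsSurfaceGroup.exists_homeomorph (hΓ : IsSurfaceGroup Γ) (hρ : IsFuchsian ρ) {f : ℍ → ℍ}
    (hf : Continuous f) (hfi : Function.Injective f) (hfo : IsOpenMap f)
    (hfγ : ∀ (γ : Γ) z, f (γ • z) = ρ γ • f z) : ∃ F : ℍ ≃ₜ ℍ, ∀ z, F z = f z := by
  obtain ⟨R, hR⟩ := hΓ.exists_radius
  have := hρ.discrete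
  have hK := (isCompact_closedBall UpperHalfPlane.I R).image hf
  have hcl : IsClosed (Set.range f) := by
    refine isClosed_of_closure_subset fun w hw => ?_
    have hfin := finite_setOf_smul_inter ρ.range hK (isCompact_closedBall w 1)
    have hcl : IsClosed (⋃ r ∈ {r : ρ.range | (((r • ·) ''
        (f '' Metric.closedBall UpperHalfPlane.I R)) ∩ Metric.closedBall w 1).Nonempty},
        (r • ·) '' (f '' Metric.closedBall UpperHalfPlane.I R)) :=
      hfin.isClosed_biUnion fun r _ =>
        (hK.image (continuous_const_smul (r : PSL(2, ℝ)))).isClosed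
    have hmem : w ∈ closure (Set.range f ∩ Metric.closedBall w 1) := by
      refine mem_closure_iff_nhds.2 fun t ht => ?_
      obtain ⟨y, ⟨h1, h2⟩, h3⟩ := mem_closure_iff_nhds.1 hw _
        (Filter.inter_mem ht (Metric.closedBall_mem_nhds w one_pos))
      exact ⟨y, h1, h3, h2⟩
    have hsub : Set.range f ∩ Metric.closedBall w 1 ⊆ ⋃ r ∈ {r : ρ.range | (((r • ·) ''
        (f '' Metric.closedBall UpperHalfPlane.I R)) ∩ Metric.closedBall w 1).Nonempty},
        (r • ·) '' (f '' Metric.closedBall UpperHalfPlane.I R) := by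
      rintro _ ⟨⟨z, rfl⟩, hz⟩
      obtain ⟨γ, hγ⟩ := hR z
      have h1 : f z ∈ (((⟨ρ γ⁻¹, γ⁻¹, rfl⟩ : ρ.range) • ·) ''
          (f '' Metric.closedBall UpperHalfPlane.I R)) := by
        refine ⟨f (γ • z), ⟨_, hγ, rfl⟩, ?_⟩
        change ρ γ⁻¹ • f (γ • z) = f z
        rw [← hfγ, inv_smul_smul]
      exact Set.mem_biUnion ⟨_, h1, hz⟩ h1
    obtain ⟨⟨_, γ, rfl⟩, -, _, ⟨z, -, rfl⟩, hz⟩ := Set.mem_iUnion₂.1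
      (closure_minimal hsub hcl hmem)
    exact ⟨γ • z, (hfγ γ z).trans hz⟩
  have hsurj : Function.Surjective f := by
    rw [← Set.range_eq_univ]
    refine (isClopen_iff.1 ⟨hcl, hfo.isOpen_range⟩).resolve_left ?_
    exact (Set.range_nonempty f).ne_empty
  exact ⟨(Equiv.ofBijective f ⟨hfi, hsurj⟩).toHomeomorphOfContinuousOpen hf hfo, fun _ => rfl⟩

/-- By equivariance and compactness, points at distance at most `1` have images at distance at most
`C`. The geodesic between two points is then cut into pieces of length at most `1`. -/
theorem exists_coarseLip {f : ℍ → ℍ} (hf : Continuous f) {K : Set ℍ} (hK : IsCompact K)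
    (h : ∀ z, ∃ δ ε : PSL(2, ℝ), δ • z ∈ K ∧ ∀ x, f (δ • x) = ε • f x) :
    ∃ L, 1 ≤ L ∧ ∀ L', L ≤ L' → CoarseLip L' f := by
  have hK1 : IsCompact (Metric.cthickening 1 K) := hK.cthickening
  obtain ⟨C, hC⟩ := Metric.isBounded_iff.1 (hK1.image hf).isBounded
  have hloc : ∀ z w, dist z w ≤ 1 → dist (f z) (f w) ≤ C := by
    intro z w hzw
    obtain ⟨δ, ε, hδ, hε⟩ := h z
    rw [← dist_smul ε, ← hε, ← hε]
    refine hC ⟨_, Metric.self_subset_cthickening K hδ, rfl⟩ ⟨_, ?_, rfl⟩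
    exact Metric.mem_cthickening_of_dist_le _ (δ • z) 1 K hδ (by rwa [dist_smul, dist_comm])
  have hC0 : 0 ≤ C := dist_nonneg.trans (hloc UpperHalfPlane.I UpperHalfPlane.I (by simp))
  have hchain : ∀ (n : ℕ) (A : SL(2, ℝ)) (s t : ℝ), |s - t| ≤ (n : ℝ) → dist (f (gpt A s)) (f (gpt A t)) ≤ n * C := by
    intro n A
    induction n with
    | zero =>
      intro s t hst
      have : s = t := sub_eq_zero.1 (abs_nonpos_iff.1 (by simpa using hst))
      simp [this]
    | succ n ih =>
      intro s t hst
      push_cast at hst ⊢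
      have hn : (0 : ℝ) < n + 1 := by positivity
      have h1 : |s - (s + (t - s) * (n / (n + 1)))| ≤ n := by
        have e : s - (s + (t - s) * (n / (n + 1))) = (s - t) * (n / (n + 1)) := by ring
        rw [e, abs_mul, abs_of_nonneg (by positivity : (0 : ℝ) ≤ n / (n + 1)), ← mul_div_assoc,
          div_le_iff₀ hn, mul_comm (n : ℝ)]
        exact mul_le_mul_of_nonneg_right hst (Nat.cast_nonneg n)
      have h2 : |(s + (t - s) * (n / (n + 1))) - t| ≤ 1 := by
        have e : (s + (t - s) * (n / (n + 1))) - t = (s - t) / (n + 1) := by field_simp; ring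
        rw [e, abs_div, abs_of_pos hn, div_le_one hn]
        exact hst
      have h3 := dist_triangle (f (gpt A s)) (f (gpt A (s + (t - s) * (n / (n + 1))))) (f (gpt A t))
      have h4 := hloc (gpt A (s + (t - s) * (n / (n + 1)))) (gpt A t) (by rwa [dist_gpt_gpt])
      linarith [ih _ _ h1]
  refine ⟨max 1 C, le_max_left _ _, fun L hL z w => ?_⟩
  obtain ⟨A, s, t, rfl, rfl⟩ := exists_gpt_eq z w
  have h1 := hchain ⌈|s - t|⌉₊ A s t (Nat.le_ceil _)
  have h2 := (Nat.ceil_lt_add_one (abs_nonneg (s - t))).le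
  rw [dist_gpt_gpt]
  calc _ ≤ _ := h1
    _ ≤ (|s - t| + 1) * L :=
      mul_le_mul h2 ((le_max_right _ _).trans hL) hC0 (by positivity)
    _ = _ := by ring

/-- An equivariant homeomorphism of cocompact actions is a quasi-isometry. -/
theorem IsSurfaceGroup.exists_coarseHomeo (hΓ : IsSurfaceGroup Γ) (f : ℍ ≃ₜ ℍ)
    (hfγ : ∀ (γ : Γ) z, f (γ • z) = ρ γ • f z) : ∃ L, CoarseHomeo L f := by
  obtain ⟨R, hR⟩ := hΓ.exists_radius
  have hK := isCompact_closedBall UpperHalfPlane.I R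
  obtain ⟨L₁, h1, hL₁⟩ := exists_coarseLip f.continuous hK fun z => by
    obtain ⟨γ, hγ⟩ := hR z
    exact ⟨γ, ρ γ, hγ, fun x => hfγ γ x⟩
  obtain ⟨L₂, -, hL₂⟩ := exists_coarseLip f.symm.continuous (hK.image f.continuous) fun z => by
    obtain ⟨γ, hγ⟩ := hR (f.symm z)
    refine ⟨ρ γ, γ, ⟨_, hγ, ?_⟩, fun x => ?_⟩
    · exact (hfγ γ _).trans (by rw [f.apply_symm_apply])
    · rw [f.symm_apply_eq]
      exact ((hfγ γ _).trans (by rw [f.apply_symm_apply])).symm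
  exact ⟨max L₁ L₂, h1.trans (le_max_left _ _), hL₁ _ (le_max_left _ _), hL₂ _ (le_max_right _ _)⟩

end

/-! ### The foliated structure of a Fuchsian representation -/

/-- Proportionality of `v` and `w` over `ℝ` is the closed condition `|v|² w = Re ⟨v, w⟩ v`. -/
instance : T2Space RP3 := by
  rw [t2_iff_isClosed_diagonal, ← ((isOpenQuotientMap_mk ℝ C2).prodMap
    (isOpenQuotientMap_mk ℝ C2)).isQuotientMap.isClosed_preimage]
  have hN : ∀ v : C2, ∀ a : ℝ, (herm v (a • v)).re =
      a * (Complex.normSq (v 0) + Complex.normSq (v 1)) := fun v a => by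
    have h := herm_smul_smul 1 a v v
    rw [one_smul, map_one, one_mul, herm_self, ← Complex.ofReal_mul] at h
    rw [ofReal_smul_C2, h, Complex.ofReal_re]
  have : Prod.map (fun v : {v : C2 // v ≠ 0} => Projectivization.mk ℝ v.1 v.2)
      (fun v : {v : C2 // v ≠ 0} => Projectivization.mk ℝ v.1 v.2) ⁻¹' Set.diagonal RP3 =
      {x | (Complex.normSq (x.1.1 0) + Complex.normSq (x.1.1 1)) • x.2.1 =
        (herm x.1.1 x.2.1).re • x.1.1} := by
    ext ⟨⟨v, hv⟩, ⟨w, hw⟩⟩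
    change (Projectivization.mk ℝ v hv : RP3) = Projectivization.mk ℝ w hw ↔
      (Complex.normSq (v 0) + Complex.normSq (v 1)) • w = (herm v w).re • v
    rw [eq_comm, Projectivization.mk_eq_mk_iff']
    constructor
    · rintro ⟨a, rfl⟩
      rw [hN, smul_smul, mul_comm]
    · intro h
      have h0 := (normSq_add_pos hv).ne'
      exact ⟨(Complex.normSq (v 0) + Complex.normSq (v 1))⁻¹ * (herm v w).re, by
        rw [mul_smul, ← h, smul_smul, inv_mul_cancel₀ h0, one_smul]⟩
  rw [this]
  have h1 : Continuous fun x : {v : C2 // v ≠ 0} × {v : C2 // v ≠ 0} => x.1.1 :=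
    continuous_subtype_val.comp continuous_fst
  have h2 : Continuous fun x : {v : C2 // v ≠ 0} × {v : C2 // v ≠ 0} => x.2.1 :=
    continuous_subtype_val.comp continuous_snd
  have h3 : Continuous fun x : {v : C2 // v ≠ 0} × {v : C2 // v ≠ 0} => herm x.1.1 x.2.1 := by
    have h : Continuous fun x : C2 × C2 => herm x.1 x.2 := by unfold herm; fun_prop
    exact h.comp (h1.prodMk h2)
  have h4 : ∀ i, Continuous fun x : {v : C2 // v ≠ 0} × {v : C2 // v ≠ 0} =>
      Complex.normSq (x.1.1 i) := fun i =>
    Complex.continuous_normSq.comp ((continuous_apply i).comp h1)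
  exact isClosed_eq (((h4 0).add (h4 1)).smul h2) ((Complex.continuous_re.comp h3).smul h1)

theorem InProjectiveLine.smul {E : Type*} [AddCommGroup E] [Module ℝ E] {s : Set (ℙ ℝ E)}
    (h : InProjectiveLine s) (g : E ≃ₗ[ℝ] E) : InProjectiveLine ((fun p => g • p) '' s) := by
  obtain ⟨W, hW, hs⟩ := h
  refine ⟨W.comap (g.symm : E →ₗ[ℝ] E), by rw [finrank_comap_linearEquiv, hW], ?_⟩
  rintro _ ⟨p, hp, rfl⟩
  rw [← submodule_smul_le_iff]
  change (g⁻¹ • g • p).submodule ≤ W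
  rw [inv_smul_smul]
  exact hs p hp

theorem InProjectiveLine.mono {E : Type*} [AddCommGroup E] [Module ℝ E] {s t : Set (ℙ ℝ E)}
    (h : InProjectiveLine t) (hst : s ⊆ t) : InProjectiveLine s := by
  obtain ⟨W, hW, hs⟩ := h
  exact ⟨W, hW, fun p hp => hs p (hst hp)⟩

theorem InProjectivePlane.mono {E : Type*} [AddCommGroup E] [Module ℝ E] {s t : Set (ℙ ℝ E)}
    (h : InProjectivePlane t) (hst : s ⊆ t) : InProjectivePlane s := by
  obtain ⟨W, hW, hs⟩ := h
  exact ⟨W, hW, fun p hp => hs p (hst hp)⟩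

/-! ### The lines and planes of the developed leaves -/

theorem finrank_ker_add {V : Type*} [AddCommGroup V] [Module ℝ V] (φ : C2 →ₗ[ℝ] V)
    (h : Function.Surjective φ) : Module.finrank ℝ V + Module.finrank ℝ (LinearMap.ker φ) = 4 := by
  rw [← finrank_C2, ← φ.finrank_range_add_finrank_ker, LinearMap.range_eq_top.2 h, finrank_top]

/-- The real hyperplane `ℂ × ℝ` of `ℂ²`. -/
def stablePlane : Submodule ℝ C2 :=
  LinearMap.ker (Complex.imLm ∘ₗ LinearMap.proj (R := ℝ) (φ := fun _ : Fin 2 => ℂ) 1)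

theorem mem_stablePlane_iff (v : C2) : v ∈ stablePlane ↔ (v 1).im = 0 := Iff.rfl

theorem finrank_stablePlane : Module.finrank ℝ stablePlane = 3 := by
  have h := finrank_ker_add
    (Complex.imLm ∘ₗ LinearMap.proj (R := ℝ) (φ := fun _ : Fin 2 => ℂ) 1)
    (fun x => ⟨![0, x * Complex.I], by simp⟩)
  rw [Module.finrank_self] at h
  exact Nat.add_left_cancel (n := 1) h

/-- The real plane `iℝ × ℝ` of `ℂ²`. -/
def geodesicLine : Submodule ℝ C2 :=
  LinearMap.ker ((Complex.reLm ∘ₗ LinearMap.proj (R := ℝ) (φ := fun _ : Fin 2 => ℂ) 0).prod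
    (Complex.imLm ∘ₗ LinearMap.proj (R := ℝ) (φ := fun _ : Fin 2 => ℂ) 1))

theorem mem_geodesicLine_iff (v : C2) : v ∈ geodesicLine ↔ (v 0).re = 0 ∧ (v 1).im = 0 :=
  Prod.ext_iff

theorem finrank_geodesicLine : Module.finrank ℝ geodesicLine = 2 := by
  have h := finrank_ker_add
    ((Complex.reLm ∘ₗ LinearMap.proj (R := ℝ) (φ := fun _ : Fin 2 => ℂ) 0).prod
      (Complex.imLm ∘ₗ LinearMap.proj (R := ℝ) (φ := fun _ : Fin 2 => ℂ) 1))
    (fun x => ⟨![x.1, x.2 * Complex.I], by simp⟩)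
  rw [Module.finrank_prod, Module.finrank_self] at h
  exact Nat.add_left_cancel (n := 2) h

theorem tangentRP3_mul (A B : SL(2, ℝ)) : tangentRP3 ((A * B) • UnitTangent.axis 0) =
    slReal (slMap A) • tangentRP3 (B • UnitTangent.axis 0) := by
  rw [tangentRP3_smul_axis, tangentRP3_smul_axis, Projectivization.smul_mk]
  congr 1
  change _ = slMap A • slMap B • (![Complex.I, 1] : C2)
  rw [map_mul, mul_smul]

/-- `D` maps the geodesic of `A` to that of its shadow `B`, and diagonal matrices send `(i, 1)` into
`iℝ × ℝ`. -/
theorem CoarseHomeo.inProjectiveLine {L : ℝ} {f : ℍ ≃ₜ ℍ} (hf : CoarseHomeo L f)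
    {D : UnitTangent → UnitTangent} (hD : ∀ w w', ShadowRel L f w w' ↔ D w = w')
    (w : UnitTangent) : InProjectiveLine ((fun w' => tangentRP3 (D w')) '' w.geodesicLeaf) := by
  obtain ⟨A, rfl⟩ := exists_smul_axis w
  obtain ⟨B, hB⟩ := hf.exists_shadow A
  have h0 : InProjectiveLine {p : RP3 | p.submodule ≤ geodesicLine} :=
    ⟨_, finrank_geodesicLine, fun _ h => h⟩
  refine (h0.smul (slReal (slMap B))).mono ?_
  rintro _ ⟨w', hw', rfl⟩
  obtain ⟨t, rfl⟩ := (UnitTangent.mem_geodesicLeaf_iff A w').1 hw'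
  obtain ⟨s, hs⟩ := hB.exists_axis hf t
  refine ⟨tangentRP3 (geoSL s • UnitTangent.axis 0), ?_, ?_⟩
  · change Projectivization.submodule _ ≤ _
    rw [tangentRP3_smul_axis, submodule_mk_le_iff, mem_geodesicLine_iff, sl_smul_apply,
      sl_smul_apply]
    simp [slMap_apply, coe_geoSL, -Complex.ofReal_exp]
  · change _ = tangentRP3 (D _)
    rw [(hD _ _).1 hs, UnitTangent.smul_axis_eq B s, tangentRP3_mul]

/-- Asymptotic geodesics have asymptotic shadows, so `B⁻¹ B'` is upper triangular and sends `(i, 1)`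
to a vector with real second coordinate. -/
theorem CoarseHomeo.inProjectivePlane {L : ℝ} {f : ℍ ≃ₜ ℍ} (hf : CoarseHomeo L f)
    {D : UnitTangent → UnitTangent} (hD : ∀ w w', ShadowRel L f w w' ↔ D w = w')
    (w : UnitTangent) : InProjectivePlane ((fun w' => tangentRP3 (D w')) '' w.stableLeaf) := by
  obtain ⟨A, rfl⟩ := exists_smul_axis w
  obtain ⟨B, hB⟩ := hf.exists_shadow A
  have h0 : InProjectivePlane {p : RP3 | p.submodule ≤ stablePlane} :=
    ⟨_, finrank_stablePlane, fun _ h => h⟩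
  refine (h0.smul (slReal (slMap B))).mono ?_
  rintro _ ⟨w', hw', rfl⟩
  obtain ⟨A', rfl⟩ := exists_smul_axis w'
  obtain ⟨B', hB'⟩ := exists_smul_axis (D (A' • UnitTangent.axis 0))
  have hS := ((shadowRel_iff A' B').1 ((hD _ _).2 hB')).1
  have hc := hB.lower_left_eq_zero hf hS (UnitTangent.asymp_of_mem_stableLeaf hw')
  refine ⟨tangentRP3 ((B⁻¹ * B') • UnitTangent.axis 0), ?_, ?_⟩
  · change Projectivization.submodule _ ≤ _
    rw [tangentRP3_smul_axis, submodule_mk_le_iff, mem_stablePlane_iff, sl_smul_apply, slMap_apply,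
      slMap_apply, hc]
    simp
  · change _ = tangentRP3 (D _)
    rw [hB']
    refine (tangentRP3_mul B (B⁻¹ * B')).symm.trans ?_
    rw [mul_inv_cancel_left]

section

variable {Γ : Subgroup PSL(2, ℝ)} {q : Γ →* PSL(2, ℂ)} {ρ : Γ →* PSL(2, ℝ)}

theorem CoarseHomeo.equivariant {L : ℝ} {f : ℍ ≃ₜ ℍ}
    {D : UnitTangent → UnitTangent} (hD : ∀ w w', ShadowRel L f w w' ↔ D w = w')
    (hfγ : ∀ (γ : Γ) z, f (γ • z) = ρ γ • f z) (γ : Γ) (w : UnitTangent) :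
    D (γ • w) = ρ γ • D w := by
  obtain ⟨⟨γ', hγ'⟩, rfl⟩ : ∃ δ : Γ, δ = γ := ⟨γ, rfl⟩
  obtain ⟨A, rfl⟩ := QuotientGroup.mk_surjective γ'
  obtain ⟨B, hB⟩ := QuotientGroup.mk_surjective (ρ ⟨QuotientGroup.mk A, hγ'⟩)
  have h := ((hD w _).2 rfl).smul A B fun z => by
    have := hfγ ⟨QuotientGroup.mk A, hγ'⟩ z
    rw [← hB] at this
    exact this
  rw [← hB, UnitTangent.psl_mk_smul]
  exact (hD _ _).1 h

/-- The equivariant identification of the unit tangent bundle with the pullback, for a coarse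
equivalence of `ℍ` with the half-plane that contains the developed image. -/
theorem exists_developed_homeomorph {u : EquivariantLocalHomeo q} {g : PSL(2, ℂ)}
    (hq : ∀ γ, q γ = g * pslComplexify (ρ γ) * g⁻¹) {J : C2 ≃ₗ[ℝ] C2} {σ : CP1 ≃ₜ CP1}
    (hσ : IsRealSymmetry J σ) {f : ℍ ≃ₜ ℍ} (hf : ∀ z, ofHalf (f z) = σ (g⁻¹ • u.toFun z))
    (hfγ : ∀ (γ : Γ) z, f (γ • z) = ρ γ • f z) (D : UnitTangent ≃ₜ UnitTangent)
    (hDγ : ∀ (γ : Γ) w, D (γ • w) = ρ γ • D w) :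
    ∃ H : UnitTangent ≃ₜ HopfPullback u, (∀ (γ : Γ) w, H (γ • w) = γ • H w) ∧
      ∀ w, HopfPullback.toRP3 u (H w) = g • J⁻¹ • tangentRP3 (D w) := by
  have hJinv : ∀ p : RP3, σ (hopf (J⁻¹ • p)) = hopf p := fun p => by
    rw [← hσ.hopf_smul, smul_inv_smul]
  have hu : ∀ w, u.toFun (f.symm (D w).pt) = hopf (g • J⁻¹ • tangentRP3 (D w)) := by
    intro w
    have h1 := hf (f.symm (D w).pt)
    rw [f.apply_symm_apply, ← hopf_tangentRP3, ← hJinv] at h1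
    rw [QFProj.hopf_smul, σ.injective h1, smul_inv_smul]
  -- The point of `ℙ³(ℝ)` is prescribed by `D`; the foot point is then the only one whose image by
  -- `u` is the right complex line.
  set F : UnitTangent → HopfPullback u := fun w => HopfPullback.ofPair u _ _ (hu w) with hF
  have hbase : ∀ w, (F w).base = f.symm (D w).pt := fun w => rfl
  have hdev : ∀ w, HopfPullback.toRP3 u (F w) = g • J⁻¹ • tangentRP3 (D w) := fun w => rfl
  have hFc : Continuous F := HopfPullback.continuous_iff.2
    ⟨f.symm.continuous.comp (UnitTangent.continuous_pt.comp D.continuous),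
      (continuous_const_smul g).comp ((continuous_const_smul J⁻¹).comp
        (continuous_tangentRP3.comp D.continuous))⟩
  have hFi : Function.Injective F := by
    intro w w' h
    have h1 := congrArg (HopfPullback.toRP3 u) h
    rw [hdev, hdev] at h1
    exact D.injective (tangentRP3_injective (smul_left_cancel _ (smul_left_cancel _ h1)))
  have hFs : Function.Surjective F := by
    intro x
    have h1 : hopf (J • g⁻¹ • HopfPullback.toRP3 u x) = ofHalf (f x.base) := by
      rw [hσ.hopf_smul, QFProj.hopf_smul, HopfPullback.hopf_toRP3, hf]
    obtain ⟨w', hw'⟩ := exists_tangentRP3_eq (h1 ▸ ofHalf_mem _)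
    refine ⟨D.symm w', HopfPullback.ext' ?_ ?_⟩
    · rw [hbase, D.apply_symm_apply, f.symm_apply_eq]
      apply isOpenEmbedding_ofHalf.injective
      rw [← hopf_tangentRP3, hw', h1]
    · rw [hdev, D.apply_symm_apply, hw', inv_smul_smul, smul_inv_smul]
  let e := Equiv.ofBijective F ⟨hFi, hFs⟩
  have he : ∀ w, e w = F w := fun _ => rfl
  -- The inverse has a closed graph, and it is locally bounded because `D` of its value has foot
  -- point `f y.base`.
  have hec : Continuous e.symm := by
    refine continuous_of_isClosed_graph ?_ fun x => ?_
    · have : {p : HopfPullback u × UnitTangent | e.symm p.1 = p.2} =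
          {p | p.1.base = (F p.2).base ∧
            HopfPullback.toRP3 u p.1 = HopfPullback.toRP3 u (F p.2)} := by
        ext ⟨x, w⟩
        change e.symm x = w ↔ x.base = (F w).base ∧
          HopfPullback.toRP3 u x = HopfPullback.toRP3 u (F w)
        rw [Equiv.symm_apply_eq, he]
        exact ⟨fun h => by rw [h]; exact ⟨rfl, rfl⟩, fun h => HopfPullback.ext' h.1 h.2⟩
      rw [this]
      exact (isClosed_eq (HopfPullback.continuous_base.comp continuous_fst)
        (HopfPullback.continuous_base.comp (hFc.comp continuous_snd))).inter
        (isClosed_eq (HopfPullback.continuous_toRP3.comp continuous_fst)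
        (HopfPullback.continuous_toRP3.comp (hFc.comp continuous_snd)))
    · have hK := isCompact_pt_preimage (isCompact_closedBall (f x.base) 1)
      refine ⟨D ⁻¹' (UnitTangent.pt ⁻¹' Metric.closedBall (f x.base) 1),
        D.isCompact_preimage.2 hK, ?_⟩
      have hc : Continuous fun y : HopfPullback u => f y.base :=
        f.continuous.comp HopfPullback.continuous_base
      filter_upwards [hc.continuousAt (Metric.closedBall_mem_nhds (f x.base) one_pos)] with y hy
      have h1 : (D (e.symm y)).pt = f y.base := by
        have h2 := hbase (e.symm y)
        rw [← he, e.apply_symm_apply] at h2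
        rw [h2, f.apply_symm_apply]
      change (D (e.symm y)).pt ∈ Metric.closedBall (f x.base) 1
      rw [h1]
      exact hy
  refine ⟨⟨e, hFc, hec⟩, fun γ w => ?_, hdev⟩
  refine HopfPullback.ext' ?_ ?_
  · change f.symm (D (γ • w)).pt = γ • f.symm (D w).pt
    rw [f.symm_apply_eq, hfγ, f.apply_symm_apply, hDγ, UnitTangent.pt_psl_smul]
  · change g • J⁻¹ • tangentRP3 (D (γ • w)) = q γ • g • J⁻¹ • tangentRP3 (D w)
    have h1 : J⁻¹ • pslComplexify (ρ γ) • tangentRP3 (D w) =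
        pslComplexify (ρ γ) • J⁻¹ • tangentRP3 (D w) := by
      rw [inv_smul_eq_iff, hσ.psl_smul, smul_inv_smul]
    rw [hDγ, tangentRP3_smul, h1, hq, ← mul_smul, ← mul_smul, inv_mul_cancel_right]

/-- The structure of an injective Fuchsian developing map is foliated. -/
theorem IsQuasiFuchsian.exists_isFoliated (hqF : IsQuasiFuchsian q) (hΓ : IsSurfaceGroup Γ)
    (u : EquivariantLocalHomeo q) (hu : Function.Injective u.toFun)
    (hconj : IsConjugateToFuchsian q)
    (hQ : IsDevelopingPair (Quotient.mk (MulAction.orbitRel Γ (HopfPullback u)))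
      (HopfPullback.toRP3 u)) :
    ∃ H : UnitTangent ≃ₜ HopfPullback u, (∀ (γ : Γ) w, H (γ • w) = γ • H w) ∧
      ∃ (h : SurfaceUnitTangent Γ ≃ₜ MulAction.orbitRel.Quotient Γ (HopfPullback u))
        (R : ProjectiveStructure C2 (SurfaceUnitTangent Γ)),
        (∀ w : UnitTangent, h (Quotient.mk _ w) = Quotient.mk _ (H w)) ∧
        IsProjectiveMap R hQ.projectiveStructure h ∧ IsFoliated R := by
  obtain ⟨ρ, hρ, g, hq⟩ := hconj
  obtain ⟨J, σ, hσ, hpos⟩ := hqF.exists_symmetry hΓ hρ hq u hu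
  choose f₀ hf₀ using fun z => exists_ofHalf_eq (hpos z)
  have hf₀γ : ∀ (γ : Γ) z, f₀ (γ • z) = ρ γ • f₀ z := by
    intro γ z
    apply isOpenEmbedding_ofHalf.injective
    rw [hf₀, ofHalf_smul, hf₀, u.equivariant, ← hσ.psl_smul_CP1, hq, mul_smul, mul_smul,
      inv_smul_smul]
  have hf₀c : Continuous f₀ := by
    rw [isOpenEmbedding_ofHalf.isEmbedding.continuous_iff]
    exact (σ.continuous.comp ((continuous_const_smul g⁻¹).comp
      u.isLocalHomeomorph.continuous)).congr fun z => (hf₀ z).symm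
  have hf₀i : Function.Injective f₀ := fun z z' h => hu (by
    have h1 := congrArg ofHalf h
    rw [hf₀, hf₀] at h1
    exact smul_left_cancel _ (σ.injective h1))
  have hf₀o : IsOpenMap f₀ := by
    intro U hU
    have h1 : IsOpen ((fun z => σ (g⁻¹ • u.toFun z)) '' U) := by
      have h2 : IsOpenMap fun z => σ (g⁻¹ • u.toFun z) :=
        σ.isOpenMap.comp ((isOpenMap_smul g⁻¹).comp u.isLocalHomeomorph.isOpenMap)
      exact h2 U hU
    have h3 : f₀ '' U = ofHalf ⁻¹' ((fun z => σ (g⁻¹ • u.toFun z)) '' U) := by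
      ext w
      constructor
      · rintro ⟨z, hz, rfl⟩
        exact ⟨z, hz, (hf₀ z).symm⟩
      · rintro ⟨z, hz, h⟩
        exact ⟨z, hz, isOpenEmbedding_ofHalf.injective ((hf₀ z).trans h)⟩
    rw [h3]
    exact h1.preimage isOpenEmbedding_ofHalf.continuous
  obtain ⟨f, hf⟩ := hΓ.exists_homeomorph hρ hf₀c hf₀i hf₀o hf₀γ
  have hfγ : ∀ (γ : Γ) z, f (γ • z) = ρ γ • f z := fun γ z => by rw [hf, hf, hf₀γ]
  obtain ⟨L, hL⟩ := hΓ.exists_coarseHomeo f hfγ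
  obtain ⟨D, hD⟩ := hL.exists_homeomorph
  obtain ⟨H, hHγ, hH⟩ := exists_developed_homeomorph (u := u) hq hσ
    (fun z => by rw [hf, hf₀]) hfγ D (CoarseHomeo.equivariant hD hfγ)
  obtain ⟨h, hh⟩ := exists_quotient_homeomorph H hHγ
  have hcov := hΓ.isQuotientCoveringMap UnitTangent.continuous_pt
    fun γ w => UnitTangent.pt_psl_smul (γ : PSL(2, ℝ)) w
  have hdev : IsLocalHomeomorph fun w => HopfPullback.toRP3 u (H w) :=
    (HopfPullback.isLocalHomeomorph_toRP3).comp H.isOpenEmbedding.isLocalHomeomorph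
  have hR : IsDevelopingPair (Quotient.mk (MulAction.orbitRel Γ UnitTangent))
      fun w => HopfPullback.toRP3 u (H w) :=
    isDevelopingPair_quotient hcov hdev (fun γ => pslLift (q γ)) fun γ w => by
      rw [hHγ, HopfPullback.toRP3_smul, pslLift_smul]
  refine ⟨H, hHγ, h, hR.projectiveStructure, hh, hR.isProjectiveMap hQ H.continuous h.continuous hh
    fun w => ⟨1, .of_forall fun _ => (one_smul _ _).symm⟩, ?_⟩
  intro φ hφ w hw
  obtain ⟨k, hk⟩ := hφ w hw
  -- Near `w` the chart is a fixed projective map after `tangentRP3 ∘ D`, which maps entire leaves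
  -- into lines and planes.
  have hk' : ∀ᶠ w' in 𝓝 w, φ (Quotient.mk _ w') =
      (k * pslLift g * J⁻¹) • tangentRP3 (D w') := by
    filter_upwards [hk] with w' hw'
    rw [hw', hH, mul_smul, mul_smul, pslLift_smul]
  refine ⟨⟨_, hk', ?_⟩, ⟨_, hk', ?_⟩⟩
  · refine ((hL.inProjectiveLine hD w).smul (k * pslLift g * J⁻¹)).mono ?_
    rintro _ ⟨w', ⟨h1, h2⟩, rfl⟩
    exact ⟨_, ⟨w', h2, rfl⟩, Eq.symm h1⟩
  · refine ((hL.inProjectivePlane hD w).smul (k * pslLift g * J⁻¹)).mono ?_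
    rintro _ ⟨w', ⟨h1, h2⟩, rfl⟩
    exact ⟨_, ⟨w', h2, rfl⟩, Eq.symm h1⟩

end

end QFProj

end

/-! ### The theorem -/

theorem mainTheorem11 (Γ : Subgroup (Matrix.ProjectiveSpecialLinearGroup (Fin 2) ℝ))
    (hΓ : QFProj.IsSurfaceGroup Γ)
    (q : Γ →* Matrix.ProjectiveSpecialLinearGroup (Fin 2) ℂ) (hq : QFProj.IsQuasiFuchsian q)
    (u : QFProj.EquivariantLocalHomeo q) :
    ∃ P : QFProj.ProjectiveStructure QFProj.C2 (QFProj.HopfPullback u),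
      QFProj.IsDevelopingMap P (QFProj.HopfPullback.toRP3 u) ∧
      (∀ γ : Γ, QFProj.IsProjectiveMap P P (fun x => γ • x)) ∧
      Nonempty (MulAction.orbitRel.Quotient Γ (QFProj.HopfPullback u) ≃ₜ
        QFProj.SurfaceUnitTangent Γ) ∧
      ∃ Q : QFProj.ProjectiveStructure QFProj.C2
          (MulAction.orbitRel.Quotient Γ (QFProj.HopfPullback u)),
        QFProj.IsProjectiveMap P Q (fun x => Quotient.mk _ x) ∧
        (∀ (h : QFProj.SurfaceUnitTangent Γ ≃ₜ
              MulAction.orbitRel.Quotient Γ (QFProj.HopfPullback u))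
            (R : QFProj.ProjectiveStructure QFProj.C2 (QFProj.SurfaceUnitTangent Γ)),
          QFProj.IsProjectiveMap R Q h → QFProj.IsFoliated R →
            QFProj.IsConjugateToFuchsian q) ∧
        (Function.Injective u.toFun → QFProj.IsConjugateToFuchsian q →
          ∃ H : QFProj.UnitTangent ≃ₜ QFProj.HopfPullback u,
            (∀ (γ : Γ) (w : QFProj.UnitTangent), H (γ • w) = γ • H w) ∧
            ∃ (h : QFProj.SurfaceUnitTangent Γ ≃ₜ
                MulAction.orbitRel.Quotient Γ (QFProj.HopfPullback u))
              (R : QFProj.ProjectiveStructure QFProj.C2 (QFProj.SurfaceUnitTangent Γ)),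
              (∀ w : QFProj.UnitTangent, h (Quotient.mk _ w) = Quotient.mk _ (H w)) ∧
              QFProj.IsProjectiveMap R Q h ∧ QFProj.IsFoliated R) := by
  have hcovN := hΓ.isQuotientCoveringMap (X := QFProj.HopfPullback u)
    QFProj.HopfPullback.continuous_base QFProj.HopfPullback.base_smul
  have hloc := QFProj.HopfPullback.isLocalHomeomorph_toRP3 (u := u)
  have hlift : ∀ (γ : Γ) (x : QFProj.HopfPullback u), QFProj.HopfPullback.toRP3 u (γ • x) =
      QFProj.pslLift (q γ) • QFProj.HopfPullback.toRP3 u x := fun γ x => by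
    rw [QFProj.HopfPullback.toRP3_smul, QFProj.pslLift_smul]
  -- Both structures have the developing map `toRP3`, for the identity covering and for the quotient
  -- by `Γ`.
  have hP := QFProj.isDevelopingPair_id hloc
  have hQ := QFProj.isDevelopingPair_quotient hcovN hloc (fun γ => QFProj.pslLift (q γ)) hlift
  obtain ⟨B, hB, -⟩ := hΓ.exists_equivariant_homeomorph u
  obtain ⟨b, -⟩ := QFProj.exists_quotient_homeomorph B hB
  refine ⟨hP.projectiveStructure, QFProj.isDevelopingMap_id hloc, fun γ => ?_, ⟨b.symm⟩,
    hQ.projectiveStructure, ?_, fun h R hR hfol => ?_, fun hu hconj => ?_⟩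
  · exact hP.isProjectiveMap hP (continuous_const_smul γ) (continuous_const_smul γ) (fun _ => rfl)
      fun _ => ⟨_, .of_forall fun x => hlift γ x⟩
  · exact hP.isProjectiveMap hQ continuous_id hcovN.continuous (fun _ => rfl)
      fun _ => ⟨1, .of_forall fun _ => (one_smul _ _).symm⟩
  · exact hΓ.isConjugateToFuchsian_of_isFoliated hq.faithful hq.discrete u hQ h R hR hfol
  · exact hq.exists_isFoliated hΓ u hu hconj hQ
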